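/- **Setting.** A program consists of finitely many threads, each executing deterministic code with the instructions $\textsf{store}\ x\ r$, $\textsf{load}\ r\ x$, $\textsf{fence}$ and instructions that do not access memory. It is run under the usual store-buffer semantics of TSO (one FIFO buffer per thread) or PSO (one FIFO buffer per thread and memory location): a store is enqueued in a buffer, a load of $x$ takes the newest pending store to $x$ of its own thread if there is one and reads memory otherwise, a fence requires that the buffers of its thread are empty, and for each buffer an auxiliary thread performs *updates*, which move the oldest entry of the buffer to memory. An *execution* $\tau$ is a sequence of steps of threads and auxiliary threads from the initial configuration; its events are triples $(p,i,j)$: the $j$-th event of the (auxiliary) thread $p$, executing $i$. It is *maximal* if no step is enabled after it, and *completed* if every store has its update in $\tau$. The executions of the program are assumed to have bounded length. The *chronological trace* of $\tau$ is the directed graph on all events of $\tau$ with the edges: between consecutive events of the same (auxiliary) thread; from a store to its update; between consecutive updates to the same location; from an update to each load of another thread that reads its value; from a load to the update that overwrites the value read; and, for each buffer of a thread $p$, from the latest update from that buffer preceding a fence of $p$ to this fence. The *happens-before relation* of $\tau$ is the transitive closure of these edges. The *Shasha-Snir trace* of a completed $\tau$ is the directed graph on the non-update events with the edges: between consecutive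 events of the same thread; between stores whose updates are consecutive updates to the same location; from a store to each load that reads its value (via memory or buffer forwarding); and from a load to the store that overwrites the value read. **Theorem (Correctness of DPOR algorithms).** Let Source-DPOR and Optimal-DPOR be the algorithms of Abdulla, Aronis, Jonsson and Sagonas (POPL 2014), run on a program as above under TSO or under PSO with the happens-before relation induced by chronological traces. Whatever choices the algorithms make, they terminate, every execution they explore to the end (that is, every maximal execution sequence $E$ for which $\mathit{Explore}(E,\dots)$ is called) is a maximal, hence completed, execution of the program, and 1. Source-DPOR explores at least one execution from each equivalence class of maximal executions, where two executions are equivalent if they have the same Shasha-Snir trace; 2. Optimal-DPOR explores exactly one execution (counted with multiplicity) from each of these classes. -/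

import Mathlib

namespace RelaxedDPOR

/-! ### Generic notation for sequences of threads and events `⟨p, i⟩` -/

/-- Number of occurrences of `p` in the sequence `E`. -/
noncomputable def occ {P : Type*} (E : List P) (p : P) : ℕ := by
  classical exact E.count p

/-- `f[a ↩ b]`. -/
noncomputable def assign {α β : Type*} (f : α → β) (a : α) (b : β) : α → β := by
  classical exact Function.update f a b

/-! ### Programs and their semantics under TSO and PSO -/

/-- Instructions of the assembly-like language.  `other o` stands for the instructions that do
not access memory. -/
inductive Instr (Loc Reg Op : Type*)
  | store (x : Loc) (r : Reg)
  | load (r : Reg) (x : Loc)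
  | fence
  | other (o : Op)

/-- A parallel program: each thread has a deterministic code, given by the instruction at each
value of its program counter (`none` means that the thread has terminated).  `sem o` is the effect
of the local instruction `o` on the program counter and the registers. -/
structure Program (T Loc Reg Val Op : Type*) where
  code : T → ℕ → Option (Instr Loc Reg Op)
  sem : Op → ℕ × (Reg → Val) → ℕ × (Reg → Val)
  initReg : T → Reg → Val
  initMem : Loc → Val

inductive MemModel
  | tso
  | pso

/-- The store buffer of a thread in which a store to `x` is enqueued.  Under TSO a thread has one
FIFO buffer for all locations (named `none`), under PSO one FIFO buffer per location. -/
def MemModel.buf {Loc : Type*} : MemModel → Loc → Option Loc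
  | .tso, _ => none
  | .pso, x => some x

/-- Regular threads, and for each store buffer `b` of a thread `p` an auxiliary thread `upd p b`
which performs the memory updates from that buffer. -/
inductive Thread (T Loc : Type*)
  | reg (p : T)
  | upd (p : T) (b : Option Loc)

/-- What an event executes: an instruction, or the pseudo-instruction that updates `x`. -/
inductive Act (Loc Reg Op : Type*)
  | instr (i : Instr Loc Reg Op)
  | upd (x : Loc)

structure LocalConf (Loc Reg Val : Type*) where
  pc : ℕ
  regs : Reg → Val
  buf : Option Loc → List (Loc × Val)

structure Conf (T Loc Reg Val : Type*) where
  loc : T → LocalConf Loc Reg Val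
  mem : Loc → Val

/-- The value of the rightmost entry for `x` in the buffer `B`, if there is one. -/
noncomputable def latest {Loc Val : Type*} (B : List (Loc × Val)) (x : Loc) : Option Val := by
  classical exact ((B.filter (fun e => e.1 = x)).getLast?).map Prod.snd

section Semantics

variable {T Loc Reg Val Op : Type*} (P : Program T Loc Reg Val Op) (M : MemModel)

def initConf : Conf T Loc Reg Val where
  loc p := { pc := 0, regs := P.initReg p, buf := fun _ => [] }
  mem := P.initMem

noncomputable def Conf.setLocal (c : Conf T Loc Reg Val) (p : T) (l : LocalConf Loc Reg Val) :
    Conf T Loc Reg Val :=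
  { c with loc := assign c.loc p l }

/-- The next (pseudo-)instruction of a regular or auxiliary thread. -/
def nextAct (c : Conf T Loc Reg Val) : Thread T Loc → Option (Act Loc Reg Op)
  | .reg p => (P.code p (c.loc p).pc).map Act.instr
  | .upd p b => ((c.loc p).buf b).head?.map (fun e => Act.upd e.1)

open Classical in
/-- The transition of a thread from a configuration; `none` if the thread is not enabled. -/
noncomputable def step (c : Conf T Loc Reg Val) : Thread T Loc → Option (Conf T Loc Reg Val)
  | .reg p =>
    match P.code p (c.loc p).pc with
    | none => none
    | some (.store x r) => some (c.setLocal p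
        { pc := (c.loc p).pc + 1
          regs := (c.loc p).regs
          buf := assign (c.loc p).buf (M.buf x)
            ((c.loc p).buf (M.buf x) ++ [(x, (c.loc p).regs r)]) })
    | some (.load r x) => some (c.setLocal p
        { pc := (c.loc p).pc + 1
          regs := assign (c.loc p).regs r
            ((latest ((c.loc p).buf (M.buf x)) x).getD (c.mem x))
          buf := (c.loc p).buf })
    | some .fence =>
        if ∀ b, (c.loc p).buf b = [] then
          some (c.setLocal p { c.loc p with pc := (c.loc p).pc + 1 })
        else none
    | some (.other o) => some (c.setLocal p
        { pc := (P.sem o ((c.loc p).pc, (c.loc p).regs)).1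
          regs := (P.sem o ((c.loc p).pc, (c.loc p).regs)).2
          buf := (c.loc p).buf })
  | .upd p b =>
    match (c.loc p).buf b with
    | [] => none
    | (x, v) :: B => some
        { loc := assign c.loc p { c.loc p with buf := assign (c.loc p).buf b B }
          mem := assign c.mem x v }

/-- The configuration reached by a sequence of threads.  Since threads are deterministic, an
execution is determined by its sequence of threads, and is represented by it. -/
noncomputable def run (τ : List (Thread T Loc)) : Option (Conf T Loc Reg Val) :=
  τ.foldlM (step P M) (initConf P)

def IsExec (τ : List (Thread T Loc)) : Prop := (run P M τ).isSome

/-- An execution in which no thread can take a further step. -/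
def IsMaximal (τ : List (Thread T Loc)) : Prop :=
  IsExec P M τ ∧ ∀ p, ¬ IsExec P M (τ ++ [p])

/-! ### Events and the relations between them.  Events of `τ` are first referred to by their
position `k` in `τ` (counted from `0`). -/

/-- The (pseudo-)instruction executed at position `k`. -/
noncomputable def actAt (τ : List (Thread T Loc)) (k : ℕ) : Option (Act Loc Reg Op) :=
  (run P M (τ.take k)).bind fun c => (τ[k]?).bind fun p => nextAct P c p

def IsStore (τ : List (Thread T Loc)) (k : ℕ) (p : T) (x : Loc) : Prop :=
  τ[k]? = some (.reg p) ∧ ∃ r, actAt P M τ k = some (.instr (.store x r))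

def IsLoad (τ : List (Thread T Loc)) (k : ℕ) (p : T) (x : Loc) : Prop :=
  τ[k]? = some (.reg p) ∧ ∃ r, actAt P M τ k = some (.instr (.load r x))

def IsFence (τ : List (Thread T Loc)) (k : ℕ) (p : T) : Prop :=
  τ[k]? = some (.reg p) ∧ actAt P M τ k = some (.instr .fence)

/-- Position `k` is an update to `x` from a store buffer of `p`. -/
def IsUpd (τ : List (Thread T Loc)) (k : ℕ) (p : T) (x : Loc) : Prop :=
  τ[k]? = some (.upd p (M.buf x)) ∧ actAt P M τ k = some (.upd x)

/-- `u` is the update event corresponding to the store `s`: as buffers are FIFO, the `n`-th store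
into a buffer is the one that is dequeued by the `n`-th update from it. -/
def StoreUpd (τ : List (Thread T Loc)) (s u : ℕ) : Prop :=
  ∃ p x, IsStore P M τ s p x ∧ IsUpd P M τ u p x ∧
    {k | k < s ∧ ∃ y, M.buf y = M.buf x ∧ IsStore P M τ k p y}.ncard =
      occ (τ.take u) (.upd p (M.buf x))

/-- All stores have reached memory. -/
def IsCompleted (τ : List (Thread T Loc)) : Prop :=
  IsExec P M τ ∧ ∀ s p x, IsStore P M τ s p x → ∃ u, StoreUpd P M τ s u

/-- `u` and `u'` are consecutive updates to the same location. -/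
def NextUpd (τ : List (Thread T Loc)) (u u' : ℕ) : Prop :=
  ∃ x, (∃ p, IsUpd P M τ u p x) ∧ (∃ p, IsUpd P M τ u' p x) ∧ u < u' ∧
    ∀ k p, u < k → k < u' → ¬ IsUpd P M τ k p x

/-- The load `k` is not served by buffer forwarding: the thread has no pending store to the
location `x` of the load. -/
def FromMemory (τ : List (Thread T Loc)) (k : ℕ) (p : T) (x : Loc) : Prop :=
  IsLoad P M τ k p x ∧
    ∃ c, run P M (τ.take k) = some c ∧ latest ((c.loc p).buf (M.buf x)) x = none

/-- The load `k` is served by buffer forwarding. -/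
def FromBuffer (τ : List (Thread T Loc)) (k : ℕ) (p : T) (x : Loc) : Prop :=
  IsLoad P M τ k p x ∧
    ∃ c, run P M (τ.take k) = some c ∧ latest ((c.loc p).buf (M.buf x)) x ≠ none

/-- The load `k` reads its value from the store `s`, via memory or by buffer forwarding. -/
def ReadsFrom (τ : List (Thread T Loc)) (k s : ℕ) : Prop :=
  ∃ p x,
    (FromBuffer P M τ k p x ∧ IsStore P M τ s p x ∧ s < k ∧
      ∀ s', s < s' → s' < k → ¬ IsStore P M τ s' p x) ∨
    (FromMemory P M τ k p x ∧ ∃ u q, IsUpd P M τ u q x ∧ u < k ∧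
      (∀ u' q', u < u' → u' < k → ¬ IsUpd P M τ u' q' x) ∧ StoreUpd P M τ s u)

/-- `u` is the update that overwrites the value read by the load `k`: the next update to the
location after the update of the store that `k` reads from, or the first update to the location if
`k` reads the initial value. -/
def Overwrites (τ : List (Thread T Loc)) (k u : ℕ) : Prop :=
  (∃ s u', ReadsFrom P M τ k s ∧ StoreUpd P M τ s u' ∧ NextUpd P M τ u' u) ∨
  (∃ p x, FromMemory P M τ k p x ∧ (∀ u' q, u' < k → ¬ IsUpd P M τ u' q x) ∧
    (∃ q, IsUpd P M τ u q x) ∧ ∀ u' q, u' < u → ¬ IsUpd P M τ u' q x)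

/-- Program order (also between consecutive events of an auxiliary thread). -/
def PO (τ : List (Thread T Loc)) (k k' : ℕ) : Prop :=
  ∃ p, τ[k]? = some p ∧ τ[k']? = some p ∧ occ (τ.take k') p = occ (τ.take k) p + 1

/-- The load `k` reads the value of the update `u`, which originates in another thread. -/
def SrcCT (τ : List (Thread T Loc)) (u k : ℕ) : Prop :=
  ∃ s p q x, ReadsFrom P M τ k s ∧ StoreUpd P M τ s u ∧ IsLoad P M τ k p x ∧
    IsUpd P M τ u q x ∧ q ≠ p

/-- `f` is a fence of a thread and `u` the latest update before `f` from a buffer of that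
thread. -/
def UpdFence (τ : List (Thread T Loc)) (u f : ℕ) : Prop :=
  ∃ p b, IsFence P M τ f p ∧ τ[u]? = some (.upd p b) ∧ u < f ∧
    ∀ k, u < k → k < f → τ[k]? ≠ some (.upd p b)

def ChronEdge (τ : List (Thread T Loc)) (k k' : ℕ) : Prop :=
  PO τ k k' ∨ StoreUpd P M τ k k' ∨ NextUpd P M τ k k' ∨ SrcCT P M τ k k' ∨
    Overwrites P M τ k k' ∨ UpdFence P M τ k k'

/-- Store order: the corresponding updates are consecutive updates to the same location. -/
def StoreOrder (τ : List (Thread T Loc)) (s s' : ℕ) : Prop :=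
  ∃ u u', StoreUpd P M τ s u ∧ StoreUpd P M τ s' u' ∧ NextUpd P M τ u u'

def SSEdge (τ : List (Thread T Loc)) (k k' : ℕ) : Prop :=
  PO τ k k' ∨ StoreOrder P M τ k k' ∨ ReadsFrom P M τ k' k ∨
    ∃ u, Overwrites P M τ k u ∧ StoreUpd P M τ k' u

/-! ### Chronological traces and Shasha-Snir traces -/

/-- An event `(p, i, j)`: the `j`-th event (counted from `1`) of the thread `p`, executing `i`. -/
structure Event (T Loc Reg Op : Type*) where
  thread : Thread T Loc
  act : Act Loc Reg Op
  idx : ℕ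

/-- A directed graph with vertices in `V`. -/
@[ext]
structure TraceGraph (V : Type*) where
  verts : Set V
  edges : Set (V × V)

/-- `e` is the event of `τ` at position `k`. -/
def IsEventAt (τ : List (Thread T Loc)) (k : ℕ) (e : Event T Loc Reg Op) : Prop :=
  τ[k]? = some e.thread ∧ actAt P M τ k = some e.act ∧ e.idx = occ (τ.take k) e.thread + 1

/-- The chronological trace of `τ`. -/
def chronTrace (τ : List (Thread T Loc)) : TraceGraph (Event T Loc Reg Op) where
  verts := {e | ∃ k, IsEventAt P M τ k e}
  edges := {d | ∃ k k', IsEventAt P M τ k d.1 ∧ IsEventAt P M τ k' d.2 ∧ ChronEdge P M τ k k'}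

/-- The Shasha-Snir trace of a (completed) execution `τ`; its vertices are the non-update events. -/
def ssTrace (τ : List (Thread T Loc)) : TraceGraph (Event T Loc Reg Op) where
  verts := {e | (∃ k, IsEventAt P M τ k e) ∧ ∀ x, e.act ≠ .upd x}
  edges := {d | (∀ x, d.1.act ≠ .upd x) ∧ (∀ x, d.2.act ≠ .upd x) ∧
    ∃ k k', IsEventAt P M τ k d.1 ∧ IsEventAt P M τ k' d.2 ∧ SSEdge P M τ k k'}

/-- The happens-before relation induced by chronological traces: the transitive closure of the
edges.  Events are named `⟨p, j⟩`. -/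
def chronHB (τ : List (Thread T Loc)) (a b : Thread T Loc × ℕ) : Prop :=
  ∃ e e' : Event T Loc Reg Op, (e.thread, e.idx) = a ∧ (e'.thread, e'.idx) = b ∧
    Relation.TransGen (fun d d' => (d, d') ∈ (chronTrace P M τ).edges) e e'

end Semantics

/-! ### Notions used by the DPOR algorithms -/

/-- What a DPOR algorithm is run on: the execution sequences of a concurrent system, and a relation
on the events of each of them. -/
structure HBSystem (P : Type*) where
  isExec : List P → Prop
  hb : List P → P × ℕ → P × ℕ → Prop

/-- The executions of a program under a memory model, with the happens-before relation induced by
chronological traces. -/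
def chronSystem {T Loc Reg Val Op : Type*} (P : Program T Loc Reg Val Op) (M : MemModel) :
    HBSystem (Thread T Loc) where
  isExec := IsExec P M
  hb := chronHB P M

section Dpor

variable {P : Type*}

/-- `next_[E](p)`. -/
noncomputable def nextEv (E : List P) (p : P) : P × ℕ := (p, occ E p + 1)

/-- `dom(E)`. -/
def dom (E : List P) : Set (P × ℕ) := {e | 1 ≤ e.2 ∧ e.2 ≤ occ E e.1}

/-- `dom_[E](w)`: the events of `E.w` that belong to `w`. -/
def domAfter (E w : List P) : Set (P × ℕ) := dom (E ++ w) \ dom E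

/-- The event at position `k` of `E`. -/
noncomputable def eventAt (E : List P) (k : Fin E.length) : P × ℕ :=
  (E.get k, occ (E.take k) (E.get k) + 1)

/-- The position of the event `e` in `E`. -/
noncomputable def position (E : List P) (e : P × ℕ) : ℕ :=
  sInf {k | ∃ h : k < E.length, eventAt E ⟨k, h⟩ = e}

/-- `pre(E, e)`: the prefix of `E` up to, but not including, `e`. -/
noncomputable def pre (E : List P) (e : P × ℕ) : List P := E.take (position E e)

namespace HBSystem

variable (S : HBSystem P)

/-- The threads that are enabled after `E`. -/
def enabled (E : List P) : Set P := {p | S.isExec (E ++ [p])}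

/-- `E ≃ E'`: the two execution sequences have the same happens-before relation. -/
def Equiv (E E' : List P) : Prop :=
  S.isExec E ∧ S.isExec E' ∧ dom E = dom E' ∧ ∀ a b, S.hb E a b ↔ S.hb E' a b

/-- `E ⊨ p ♦ w`: `E.p.w` is an execution sequence in which the next event of `p` after `E` does
not happen before any event of `w`. -/
def Indep (E : List P) (p : P) (w : List P) : Prop :=
  S.isExec (E ++ p :: w) ∧
    ∀ e ∈ domAfter (E ++ [p]) w, ¬ S.hb (E ++ p :: w) (nextEv E p) e

/-- `I_[E](w)`: the initials. -/
def initials (E w : List P) : Set P :=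
  {p | p ∈ w ∧ ∀ e ∈ domAfter E w, e ≠ nextEv E p → ¬ S.hb (E ++ w) e (nextEv E p)}

/-- `WI_[E](w)`: the weak initials. -/
def weakInitials (E w : List P) : Set P := S.initials E w ∪ {p | S.Indep E p w}

/-- `e ⋖_E e'`: the events are in a race. -/
def Race (E : List P) (e e' : P × ℕ) : Prop :=
  e ∈ dom E ∧ e' ∈ dom E ∧ e.1 ≠ e'.1 ∧ S.hb E e e' ∧
    ¬ ∃ d ∈ dom E, d ≠ e ∧ d ≠ e' ∧ S.hb E e d ∧ S.hb E d e'

/-- `e ≾_E e'`: the race can be reversed, i.e. whenever `E' ≃ E` and `e` occurs immediately before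
`e'` in `E'`, the thread of `e'` was enabled before the occurrence of `e`. -/
def RevRace (E : List P) (e e' : P × ℕ) : Prop :=
  S.Race E e e' ∧ ∀ E₁ E₂ : List P, S.Equiv (E₁ ++ e.1 :: e'.1 :: E₂) E →
    nextEv E₁ e.1 = e → nextEv E₁ e'.1 = e' → e'.1 ∈ S.enabled E₁

open Classical in
/-- `notdep(e, E)`: the sub-sequence of `E` of the events that occur after `e` but do not happen
after `e`. -/
noncomputable def notdep (E : List P) (e : P × ℕ) : List P :=
  ((List.finRange E.length).filter
    (fun k => position E e < k.val ∧ ¬ S.hb E e (eventAt E k))).map E.get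

/-- `v ⊑_[E] w`. -/
def HBPrefix (E v w : List P) : Prop := ∃ v', S.Equiv (E ++ v ++ v') (E ++ w)

/-- `v ~_[E] w`. -/
def Consistent (E v w : List P) : Prop := ∃ v' w', S.Equiv (E ++ v ++ v') (E ++ w ++ w')

end HBSystem

/-- Control points of the recursive procedure `Explore(E, …)`: at its start, at the head of its
`while` loop, and at its end. -/
inductive Ctl
  | enter
  | loop
  | ret

/-! ### Source-DPOR -/

/-- State of Source-DPOR.  `seq` is the `E` of the innermost active call `Explore(E, Sleep)`;
`sleep E` is the variable `Sleep` of the call for `E`, and `backtrack` is the global variable of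
that name.  `log` lists the explored (maximal) executions in the order of exploration. -/
structure SourceState (P : Type*) where
  seq : List P
  ctl : Ctl
  sleep : List P → Set P
  backtrack : List P → Set P
  log : List (List P)

/-- The call `Explore(⟨⟩, ∅)`. -/
def SourceState.init : SourceState P where
  seq := []
  ctl := .enter
  sleep := fun _ => ∅
  backtrack := fun _ => ∅
  log := []

/-- The race detection of Source-DPOR when `E.p` is about to be explored, for a list of events `e`
in a reversible race with the last event of `E.p`: with `E' = pre(E, e)` and `v = notdep(e, E).p`,
if `I_[E'](v) ∩ backtrack(E') = ∅` then some `q ∈ I_[E'](v)` is added to `backtrack(E')`. -/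
inductive SourceRaces (S : HBSystem P) (E : List P) (p : P) :
    List (P × ℕ) → (List P → Set P) → (List P → Set P) → Prop
  | nil (bt : List P → Set P) : SourceRaces S E p [] bt bt
  | skip (e : P × ℕ) (l : List (P × ℕ)) (bt bt' : List P → Set P)
      (h : (S.initials (pre E e) (S.notdep E e ++ [p]) ∩
        bt (pre E e)).Nonempty)
      (hl : SourceRaces S E p l bt bt') : SourceRaces S E p (e :: l) bt bt'
  | add (e : P × ℕ) (l : List (P × ℕ)) (bt bt' : List P → Set P) (q : P)
      (h : S.initials (pre E e) (S.notdep E e ++ [p]) ∩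
        bt (pre E e) = ∅)
      (hq : q ∈ S.initials (pre E e) (S.notdep E e ++ [p]))
      (hl : SourceRaces S E p l
        (assign bt (pre E e) (insert q (bt (pre E e)))) bt') :
      SourceRaces S E p (e :: l) bt bt'

/-- The steps of Source-DPOR:
```
Explore(E, Sleep)
  if ∃ p ∈ enabled(E) \ Sleep then
    backtrack(E) := {p}
    while ∃ p ∈ backtrack(E) \ Sleep do
      foreach e ∈ dom(E) with e ≾_{E.p} next_[E](p) do
        E' := pre(E, e);  v := notdep(e, E).p
        if I_[E'](v) ∩ backtrack(E') = ∅ then add some q ∈ I_[E'](v) to backtrack(E')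
      Explore(E.p, {q ∈ Sleep | E ⊨ p ♦ q})
      add p to Sleep
```
The choices of the algorithm are left open. -/
inductive SourceStep (S : HBSystem P) : SourceState P → SourceState P → Prop
  /-- `E` is a maximal execution sequence. -/
  | maximal (s : SourceState P) (hc : s.ctl = .enter) (h : S.enabled s.seq = ∅) :
      SourceStep S s { s with ctl := .ret, log := s.log ++ [s.seq] }
  /-- The exploration is blocked by the sleep set. -/
  | blocked (s : SourceState P) (hc : s.ctl = .enter) (h : (S.enabled s.seq).Nonempty)
      (hs : S.enabled s.seq ⊆ s.sleep s.seq) :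
      SourceStep S s { s with ctl := .ret }
  | start (s : SourceState P) (hc : s.ctl = .enter) (p : P)
      (hp : p ∈ S.enabled s.seq \ s.sleep s.seq) :
      SourceStep S s { s with ctl := .loop, backtrack := assign s.backtrack s.seq {p} }
  | call (s : SourceState P) (hc : s.ctl = .loop) (p : P)
      (hp : p ∈ s.backtrack s.seq \ s.sleep s.seq) (l : List (P × ℕ)) (hn : l.Nodup)
      (hl : ∀ e, e ∈ l ↔ e ∈ dom s.seq ∧ S.RevRace (s.seq ++ [p]) e (nextEv s.seq p))
      (bt : List P → Set P) (hbt : SourceRaces S s.seq p l s.backtrack bt) :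
      SourceStep S s
        { s with
          seq := s.seq ++ [p]
          ctl := .enter
          sleep := assign s.sleep (s.seq ++ [p]) {q ∈ s.sleep s.seq | S.Indep s.seq p [q]}
          backtrack := bt }
  | exit (s : SourceState P) (hc : s.ctl = .loop) (h : s.backtrack s.seq ⊆ s.sleep s.seq) :
      SourceStep S s { s with ctl := .ret }
  | back (s : SourceState P) (hc : s.ctl = .ret) (E : List P) (p : P) (h : s.seq = E ++ [p]) :
      SourceStep S s
        { s with
          seq := E
          ctl := .loop
          sleep := assign s.sleep E (insert p (s.sleep E)) }

/-- The call `Explore(⟨⟩, ∅)` has returned. -/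
def SourceState.Finished (s : SourceState P) : Prop := s.seq = [] ∧ s.ctl = .ret

/-! ### Wakeup trees.  An ordered tree `⟨B, ≺⟩` is represented by the list of the nodes of the
prefix-closed set `B` of sequences, in increasing (post-)order `≺`; `[[]]` is the tree that
consists of its root only. -/

def IsLeaf (B : List (List P)) (v : List P) : Prop := ∀ p, v ++ [p] ∉ B

open Classical in
/-- `subtree(⟨B, ≺⟩, p)`. -/
noncomputable def subtree (B : List (List P)) (p : P) : List (List P) :=
  B.filterMap fun w =>
    match w with
    | [] => none
    | q :: w' => if q = p then some w' else none

open Classical in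
/-- Removal of all sequences of form `p.w`. -/
noncomputable def removeBranch (B : List (List P)) (p : P) : List (List P) :=
  B.filter fun w => w.head? ≠ some p

/-- The nodes `v.w'` for the nonempty prefixes `w'` of `w`, in increasing order `≺`. -/
def newNodes (v w : List P) : List (List P) := (w.inits.tail.map (fun w' => v ++ w')).reverse

/-- `InsertWut S E w B B'`: `B'` is a possible value of `insert_[E](w, B)`.  Let `v` be the smallest
node with `v ~_[E] w`.  If `v` is a leaf, the tree is unchanged; otherwise, for a shortest `w'` with
`w ⊑_[E] v.w'`, the leaf `v.w'` is added, ordered after all nodes of form `v.w''`. -/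
inductive InsertWut (S : HBSystem P) (E w : List P) : List (List P) → List (List P) → Prop
  | leaf (l₁ l₂ : List (List P)) (v : List P) (hv : S.Consistent E v w)
      (hmin : ∀ u ∈ l₁, ¬ S.Consistent E u w) (h : IsLeaf (l₁ ++ v :: l₂) v) :
      InsertWut S E w (l₁ ++ v :: l₂) (l₁ ++ v :: l₂)
  | extend (l₁ l₂ : List (List P)) (v w' : List P) (hv : S.Consistent E v w)
      (hmin : ∀ u ∈ l₁, ¬ S.Consistent E u w) (h : ¬ IsLeaf (l₁ ++ v :: l₂) v)
      (hw : S.HBPrefix E w (v ++ w'))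
      (hshort : ∀ w'', S.HBPrefix E w (v ++ w'') → w'.length ≤ w''.length) :
      InsertWut S E w (l₁ ++ v :: l₂) (l₁ ++ newNodes v w' ++ v :: l₂)

/-! ### Optimal-DPOR -/

/-- State of Optimal-DPOR.  `seq` is the `E` of the innermost active call `Explore(E, Sleep, WuT)`.
At the start of that call, `sleep E` and `wut E` hold the arguments `Sleep` and `WuT`. -/
structure OptimalState (P : Type*) where
  seq : List P
  ctl : Ctl
  sleep : List P → Set P
  wut : List P → List (List P)
  log : List (List P)

/-- The call `Explore(⟨⟩, ∅, ⟨{⟨⟩}, ∅⟩)`. -/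
def OptimalState.init : OptimalState P where
  seq := []
  ctl := .enter
  sleep := fun _ => ∅
  wut := fun _ => [[]]
  log := []

/-- The race detection of Optimal-DPOR on a maximal `E`, for a list of reversible races `(e, e')`:
with `E' = pre(E, e)` and `v = notdep(e, E).proc(e')`, if `sleep(E') ∩ WI_[E'](v) = ∅` then
`wut(E') := insert_[E'](v, wut(E'))`. -/
inductive OptimalRaces (S : HBSystem P) (E : List P) (sleep : List P → Set P) :
    List ((P × ℕ) × (P × ℕ)) → (List P → List (List P)) → (List P → List (List P)) → Prop
  | nil (wt : List P → List (List P)) : OptimalRaces S E sleep [] wt wt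
  | skip (e e' : P × ℕ) (l : List ((P × ℕ) × (P × ℕ))) (wt wt' : List P → List (List P))
      (h : (sleep (pre E e) ∩
        S.weakInitials (pre E e) (S.notdep E e ++ [e'.1])).Nonempty)
      (hl : OptimalRaces S E sleep l wt wt') : OptimalRaces S E sleep ((e, e') :: l) wt wt'
  | insert (e e' : P × ℕ) (l : List ((P × ℕ) × (P × ℕ))) (wt wt' : List P → List (List P))
      (B : List (List P))
      (h : sleep (pre E e) ∩ S.weakInitials (pre E e) (S.notdep E e ++ [e'.1]) = ∅)
      (hB : InsertWut S (pre E e) (S.notdep E e ++ [e'.1]) (wt (pre E e)) B)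
      (hl : OptimalRaces S E sleep l (assign wt (pre E e) B) wt') :
      OptimalRaces S E sleep ((e, e') :: l) wt wt'

/-- The steps of Optimal-DPOR:
```
Explore(E, Sleep, WuT)
  if enabled(E) = ∅ then
    foreach e, e' ∈ dom(E) with e ≾_E e' do
      E' := pre(E, e);  v := notdep(e, E).proc(e')
      if sleep(E') ∩ WI_[E'](v) = ∅ then wut(E') := insert_[E'](v, wut(E'))
  else
    if WuT ≠ ⟨{⟨⟩}, ∅⟩ then wut(E) := WuT
    else choose p ∈ enabled(E);  wut(E) := ⟨{p}, ∅⟩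
    sleep(E) := Sleep
    while ∃ p ∈ wut(E) do
      p := min_≺ {p ∈ wut(E)}
      Explore(E.p, {q ∈ sleep(E) | E ⊨ p ♦ q}, subtree(wut(E), p))
      add p to sleep(E)
      remove all sequences of form p.w from wut(E)
```
The choices of the algorithm are left open. -/
inductive OptimalStep (S : HBSystem P) : OptimalState P → OptimalState P → Prop
  | maximal (s : OptimalState P) (hc : s.ctl = .enter) (h : S.enabled s.seq = ∅)
      (l : List ((P × ℕ) × (P × ℕ))) (hn : l.Nodup)
      (hl : ∀ r, r ∈ l ↔ S.RevRace s.seq r.1 r.2)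
      (wt : List P → List (List P)) (hwt : OptimalRaces S s.seq s.sleep l s.wut wt) :
      OptimalStep S s { s with ctl := .ret, wut := wt, log := s.log ++ [s.seq] }
  | useTree (s : OptimalState P) (hc : s.ctl = .enter) (h : (S.enabled s.seq).Nonempty)
      (hw : s.wut s.seq ≠ [[]]) :
      OptimalStep S s { s with ctl := .loop }
  | choose (s : OptimalState P) (hc : s.ctl = .enter) (p : P) (hp : p ∈ S.enabled s.seq)
      (hw : s.wut s.seq = [[]]) :
      OptimalStep S s { s with ctl := .loop, wut := assign s.wut s.seq [[p], []] }
  | call (s : OptimalState P) (hc : s.ctl = .loop) (p : P) (l₁ l₂ : List (List P))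
      (hp : s.wut s.seq = l₁ ++ [p] :: l₂) (hmin : ∀ u ∈ l₁, u.length ≠ 1) :
      OptimalStep S s
        { s with
          seq := s.seq ++ [p]
          ctl := .enter
          sleep := assign s.sleep (s.seq ++ [p]) {q ∈ s.sleep s.seq | S.Indep s.seq p [q]}
          wut := assign s.wut (s.seq ++ [p]) (subtree (s.wut s.seq) p) }
  | exit (s : OptimalState P) (hc : s.ctl = .loop) (h : ∀ p, [p] ∉ s.wut s.seq) :
      OptimalStep S s { s with ctl := .ret }
  | back (s : OptimalState P) (hc : s.ctl = .ret) (E : List P) (p : P) (h : s.seq = E ++ [p]) :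
      OptimalStep S s
        { s with
          seq := E
          ctl := .loop
          sleep := assign s.sleep E (insert p (s.sleep E))
          wut := assign s.wut E (removeBranch (s.wut E) p) }

/-- The call `Explore(⟨⟩, ∅, ⟨{⟨⟩}, ∅⟩)` has returned. -/
def OptimalState.Finished (s : OptimalState P) : Prop := s.seq = [] ∧ s.ctl = .ret

end Dpor

/-- There is no infinite run from `s`, whatever choices are made. -/
def Terminates {σ : Type*} (next : σ → σ → Prop) (s : σ) : Prop := Acc (fun b a => next a b) s

/-- `s'` is a state in which a run from `s` ends. -/
def Outcome {σ : Type*} (next : σ → σ → Prop) (s s' : σ) : Prop :=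
  Relation.ReflTransGen next s s' ∧ ∀ s'', ¬ next s' s''

end RelaxedDPOR

namespace RelaxedDPOR

/-! ### Events of a sequence in the order of their occurrence -/

section Events

variable {P : Type*}

/-! The proof separates the algorithms from the memory models. `HBSystem.Valid` lists what the DPOR
algorithms need of a happens-before relation: it is a strict order that contains program order and
is determined by prefixes; adjacent unrelated events can be exchanged (`swap`); no thread disables
another one; a thread that enables another one is needed for that (`enable`); and independence of
`p.r` implies independence of `r` when `r` is already enabled (`remove`). Under these axioms every
linearization is reached by exchanges (`linearize`). Hence equivalence is a congruence, and
independence, initials and weak initials become statements about which thread can be moved to the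
front of an equivalent sequence (`indep_iff`, `mem_initials_iff`, `mem_weakInitials_iff`).

Both algorithms are complete for the same reason. Suppose that a call for `E` is about to return,
that `D` is the set of threads dealt with after `E`, and that no thread of `D` is a weak initial of
a continuation `w`. Choose `p` in `D` that is independent of the longest possible prefix `u` of `w`,
and let `r` follow `u` in `w`. In `p.u.r` the events of `p` and `r` are in a race, this race is
reversible (`revRace_of_race`), and an execution with this race has been explored already. The
sequence by which the algorithm reverses the race is compatible with `u.r` (`equiv_notdep`), so
whatever the algorithm has scheduled for the race can be started before `u.r`. As it has been dealt
with by now, this contradicts the choice of `w` or of `p`. The argument is carried out in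
`SourceInv.exists_of_exit` for backtrack sets and in `OptimalInv.exists_of_exit` for wakeup trees,
where the explored execution may have branched off further up the current path. Optimal-DPOR
explores no class twice because a sleeping thread is never an initial of the rest of the current
path (`notMem_initials`). Its leaves are guarded against sleeping threads, so its exploration is
never blocked. Termination is a lexicographic descent along the stack of active calls.

For programs, the essential point is that adjacent events without a chronological edge commute as
steps (`independent_of_not_chronEdge`, `step_comm`) and that the exchange preserves all relations
between events (`similar_exchange`). In particular, an update commutes with a load of its own
thread, since the load obtains the same value from the buffer and from memory. One thread enables
another only by filling an empty buffer or by emptying a buffer before a fence, and both give edges.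
This leads to `chronSystem_valid`.

Finally, `ssTrace_eq_iff_equiv` identifies the two notions of equivalence on completed executions.
Exchanges preserve Shasha-Snir traces; conversely, the Shasha-Snir trace determines the
instructions, the order of updates and the sources of loads, although its edges carry no labels, and
these data determine every chronological edge. -/

theorem occ_eq_count [DecidableEq P] (E : List P) (p : P) : occ E p = E.count p := by
  unfold occ; congr!

@[simp] theorem occ_nil (p : P) : occ ([] : List P) p = 0 := by simp [occ]

@[simp] theorem occ_append (E w : List P) (p : P) : occ (E ++ w) p = occ E p + occ w p := by
  simp [occ]

@[simp] theorem occ_singleton_self (p : P) : occ [p] p = 1 := by simp [occ]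

theorem occ_singleton_ne {p q : P} (h : p ≠ q) : occ [q] p = 0 := by
  classical
  rw [occ_eq_count, List.count_singleton]; simp [h.symm]

theorem occ_eq_zero {w : List P} {p : P} : occ w p = 0 ↔ p ∉ w := by
  classical
  rw [occ_eq_count, List.count_eq_zero]

theorem occ_pos {w : List P} {p : P} : 0 < occ w p ↔ p ∈ w := by
  classical
  rw [occ_eq_count, List.count_pos_iff]

theorem perm_iff_occ {E E' : List P} : E.Perm E' ↔ ∀ p, occ E p = occ E' p := by
  classical
  simp only [occ_eq_count, List.perm_iff_count]

/-- The largest index of `p` in `dom E` is `occ E p`, so a set of event names determines all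
multiplicities. -/
theorem dom_eq_iff {E E' : List P} : dom E = dom E' ↔ E.Perm E' := by
  rw [perm_iff_occ]
  constructor
  · intro h p
    by_contra hne
    rcases Nat.lt_or_gt_of_ne hne with h1 | h1
    · have : (p, occ E' p) ∈ dom E' := ⟨by simp only; omega, le_refl _⟩
      rw [← h] at this
      have := this.2
      simp only at this; omega
    · have : (p, occ E p) ∈ dom E := ⟨by simp only; omega, le_refl _⟩
      rw [h] at this
      have := this.2
      simp only at this; omega
  · intro h
    ext e
    simp [dom, h]

theorem nextEv_congr {E E' : List P} (h : E.Perm E') (p : P) : nextEv E p = nextEv E' p := by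
  simp [nextEv, perm_iff_occ.1 h p]

theorem nextEv_append_of_notMem {E w : List P} {p : P} (h : p ∉ w) :
    nextEv (E ++ w) p = nextEv E p := by
  simp [nextEv, occ_eq_zero.2 h]

theorem nextEv_append_singleton_of_ne {E : List P} {p q : P} (h : p ≠ q) :
    nextEv (E ++ [q]) p = nextEv E p :=
  nextEv_append_of_notMem (by simpa using h)

@[simp] theorem nextEv_fst (E : List P) (p : P) : (nextEv E p).1 = p := rfl

/-- The events of `w` in `E.w`, in the order of their occurrence. -/
noncomputable def eventsFrom : List P → List P → List (P × ℕ)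
  | _, [] => []
  | E, p :: w => nextEv E p :: eventsFrom (E ++ [p]) w

/-- The events of `E`, in the order of their occurrence. -/
noncomputable def events (E : List P) : List (P × ℕ) := eventsFrom [] E

@[simp] theorem eventsFrom_nil (E : List P) : eventsFrom E [] = [] := rfl

@[simp] theorem eventsFrom_cons (E : List P) (p : P) (w : List P) :
    eventsFrom E (p :: w) = nextEv E p :: eventsFrom (E ++ [p]) w := rfl

theorem eventsFrom_append (E w w' : List P) :
    eventsFrom E (w ++ w') = eventsFrom E w ++ eventsFrom (E ++ w) w' := by
  induction w generalizing E with
  | nil => simp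
  | cons p w ih => simp [ih]

theorem events_append (E w : List P) : events (E ++ w) = events E ++ eventsFrom E w := by
  simp [events, eventsFrom_append]

@[simp] theorem events_nil : events ([] : List P) = [] := rfl

theorem events_concat (E : List P) (p : P) : events (E ++ [p]) = events E ++ [nextEv E p] := by
  simp [events_append]

theorem eventsFrom_congr {E E' : List P} (h : E.Perm E') (w : List P) :
    eventsFrom E w = eventsFrom E' w := by
  induction w generalizing E E' with
  | nil => rfl
  | cons p w ih => simp [nextEv_congr h, ih (h.append_right [p])]

@[simp] theorem map_fst_eventsFrom (E w : List P) : (eventsFrom E w).map Prod.fst = w := by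
  induction w generalizing E with
  | nil => rfl
  | cons p w ih => simp [ih]

@[simp] theorem map_fst_events (E : List P) : (events E).map Prod.fst = E :=
  map_fst_eventsFrom _ _

@[simp] theorem length_events (E : List P) : (events E).length = E.length := by
  conv_rhs => rw [← map_fst_events E, List.length_map]

theorem mem_eventsFrom {E w : List P} {e : P × ℕ} :
    e ∈ eventsFrom E w ↔ occ E e.1 < e.2 ∧ e.2 ≤ occ (E ++ w) e.1 := by
  induction w generalizing E with
  | nil => simp
  | cons q w ih =>
    obtain ⟨p, i⟩ := e
    simp only [eventsFrom_cons, List.mem_cons, ih, nextEv, Prod.mk.injEq]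
    rw [show E ++ q :: w = (E ++ [q]) ++ w by simp]
    simp only [occ_append]
    by_cases h : p = q
    · subst h
      simp only [occ_singleton_self, true_and]
      omega
    · simp only [occ_singleton_ne h, h, false_and, false_or]
      omega

theorem mem_events {E : List P} {e : P × ℕ} : e ∈ events E ↔ e ∈ dom E := by
  simp [events, mem_eventsFrom, dom, Nat.lt_iff_add_one_le]

theorem mem_domAfter {E w : List P} {e : P × ℕ} : e ∈ domAfter E w ↔ e ∈ eventsFrom E w := by
  simp only [domAfter, dom, Set.mem_sdiff, Set.mem_ofPred_eq, mem_eventsFrom]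
  constructor
  · rintro ⟨⟨h1, h2⟩, h3⟩
    exact ⟨by by_contra h; exact h3 ⟨h1, by omega⟩, h2⟩
  · rintro ⟨h1, h2⟩
    exact ⟨⟨by omega, h2⟩, fun h => by omega⟩

theorem fst_mem_of_mem_eventsFrom {E w : List P} {e : P × ℕ} (h : e ∈ eventsFrom E w) :
    e.1 ∈ w := by
  rw [← map_fst_eventsFrom E w]
  exact List.mem_map_of_mem h

theorem nextEv_mem_eventsFrom {E w : List P} {p : P} (h : p ∈ w) :
    nextEv E p ∈ eventsFrom E w := by
  rw [mem_eventsFrom]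
  have := occ_pos.2 h
  simp only [nextEv, occ_append]
  omega

theorem nextEv_notMem_events (E : List P) (p : P) : nextEv E p ∉ events E := by
  rw [mem_events]
  rintro ⟨_, h⟩
  simp [nextEv] at h

theorem notMem_events_of_mem_eventsFrom {E w : List P} {e : P × ℕ} (h : e ∈ eventsFrom E w) :
    e ∉ events E := by
  rw [mem_events]
  rw [mem_eventsFrom] at h
  rintro ⟨_, h'⟩
  omega

theorem nodup_events (E : List P) : (events E).Nodup := by
  induction E using List.reverseRecOn with
  | nil => simp
  | append_singleton E p ih =>
    rw [events_concat, List.nodup_append]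
    refine ⟨ih, by simp, ?_⟩
    rintro a ha b hb rfl
    simp only [List.mem_singleton] at hb
    exact nextEv_notMem_events E p (hb ▸ ha)

theorem nodup_eventsFrom (E w : List P) : (eventsFrom E w).Nodup := by
  have := nodup_events (E ++ w)
  rw [events_append] at this
  exact this.of_append_right

theorem events_perm {E E' : List P} (h : E.Perm E') : (events E).Perm (events E') := by
  rw [List.perm_ext_iff_of_nodup (nodup_events _) (nodup_events _)]
  intro a
  rw [mem_events, mem_events, dom_eq_iff.2 h]

theorem perm_of_events_perm {E E' : List P} (h : (events E).Perm (events E')) : E.Perm E' := by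
  simpa using h.map Prod.fst

theorem events_perm_iff {E E' : List P} : (events E).Perm (events E') ↔ E.Perm E' :=
  ⟨perm_of_events_perm, events_perm⟩

/-- An event splits the sequence at its position. -/
theorem exists_split_of_mem_events {E : List P} {e : P × ℕ} (h : e ∈ events E) :
    ∃ A B, E = A ++ e.1 :: B ∧ e = nextEv A e.1 := by
  induction E using List.reverseRecOn with
  | nil => simp at h
  | append_singleton E p ih =>
    rw [events_concat, List.mem_append, List.mem_singleton] at h
    rcases h with h | h
    · obtain ⟨A, B, h1, h2⟩ := ih h
      exact ⟨A, B ++ [p], by conv_lhs => rw [h1]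
                             simp, h2⟩
    · exact ⟨E, [], by simp [h], by rw [h]; rfl⟩

/-- An event is named by its thread and its index within the thread, so its name does not change
when only other threads run before it. -/
theorem eventsFrom_append_of_notMem {A B w : List P} (h : ∀ p ∈ w, p ∉ B) :
    eventsFrom (A ++ w) B = eventsFrom A B := by
  induction B generalizing A with
  | nil => rfl
  | cons b B ih =>
    have hb : b ∉ w := fun hb => h b hb (by simp)
    rw [eventsFrom_cons, eventsFrom_cons, nextEv_append_of_notMem hb]
    rw [← ih (A := A ++ [b]) (fun p hp hB => h p hp (by simp [hB]))]
    congr 1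
    apply eventsFrom_congr
    simpa using (List.perm_append_comm (l₁ := w) (l₂ := [b])).append_left A

theorem getElem_events (E : List P) (k : ℕ) (hk : k < E.length) :
    (events E)[k]'(by simpa using hk) = eventAt E ⟨k, hk⟩ := by
  have h : E = E.take k ++ E[k] :: E.drop (k + 1) := by simp
  have h2 : events E = events (E.take k) ++ nextEv (E.take k) E[k] ::
      eventsFrom (E.take k ++ [E[k]]) (E.drop (k + 1)) := by
    rw [← eventsFrom_cons, ← events_append, ← h]
  simp only [h2]
  rw [List.getElem_append_right (by simp)]
  simp [eventAt, nextEv, Nat.min_eq_left hk.le]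

/-- Event names do not repeat, so the set whose infimum defines the position is a singleton. -/
theorem position_nextEv (A B : List P) (p : P) :
    position (A ++ p :: B) (nextEv A p) = A.length := by
  have hk : A.length < (A ++ p :: B).length := by simp
  have h0 : eventAt (A ++ p :: B) ⟨A.length, hk⟩ = nextEv A p := by
    simp [eventAt, nextEv]
  have : {k | ∃ h : k < (A ++ p :: B).length, eventAt (A ++ p :: B) ⟨k, h⟩ = nextEv A p}
      = {A.length} := by
    ext k
    simp only [Set.mem_ofPred_eq, Set.mem_singleton_iff]
    constructor
    · rintro ⟨h, h'⟩
      rw [← h0, ← getElem_events, ← getElem_events] at h'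
      exact (nodup_events _).getElem_inj_iff.1 h'
    · rintro rfl
      exact ⟨hk, h0⟩
  rw [position, this, csInf_singleton]

theorem pre_nextEv (A B : List P) (p : P) : pre (A ++ p :: B) (nextEv A p) = A := by
  rw [pre, position_nextEv]
  simp

open Classical in
-- Replaces the filter over positions by a filter over the list of events behind the chosen one,
-- which is the form that `split` produces.
theorem notdep_nextEv (S : HBSystem P) (A B : List P) (p : P) :
    S.notdep (A ++ p :: B) (nextEv A p) =
      ((eventsFrom (A ++ [p]) B).filter
        (fun e => ¬ S.hb (A ++ p :: B) (nextEv A p) e)).map Prod.fst := by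
  have key : ∀ L : List P, ∀ Q : P × ℕ → Prop, ∀ n,
      ((List.finRange L.length).filter (fun k => n < k.val ∧ Q (eventAt L k))).map L.get =
      (((events L).drop (n + 1)).filter (fun e => Q e)).map Prod.fst := by
    intro L Q n
    have h1 : (List.finRange L.length).map (eventAt L) = events L := by
      apply List.ext_getElem
      · simp
      · intro i h h'
        simp only [List.getElem_map, List.getElem_finRange]
        rw [getElem_events _ _ (by simpa using h')]
        rfl
    have h2 : L.get = Prod.fst ∘ eventAt L := by
      funext k; rfl
    -- Both lists are sorted and have the same members without repetition, hence they are equal.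
    have h3 : ((List.finRange L.length).filter (fun k => n < k.val)) =
        (List.finRange L.length).drop (n + 1) := by
      apply List.Perm.eq_of_pairwise (le := fun a b => a ≤ b)
      · intro a b _ _ h h'
        exact le_antisymm h h'
      · exact ((List.pairwise_lt_finRange _).imp (fun h => le_of_lt h)).filter _
      · exact ((List.pairwise_lt_finRange _).imp (fun h => le_of_lt h)).sublist
          (List.drop_sublist _ _)
      · rw [List.perm_ext_iff_of_nodup ((List.nodup_finRange _).filter _)
          ((List.nodup_finRange _).sublist (List.drop_sublist _ _))]
        intro a
        simp only [List.mem_filter, List.mem_finRange, true_and, decide_eq_true_eq]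
        rw [List.mem_drop_iff_getElem]
        constructor
        · intro h
          refine ⟨a.val - (n + 1), by simp; omega, ?_⟩
          ext
          simp
          omega
        · rintro ⟨j, hj, rfl⟩
          simp
          omega
    rw [h2, ← List.map_map, ← h1, ← List.map_drop, ← h3, List.filter_map, List.filter_filter]
    congr 2
    apply List.filter_congr
    intro x _
    simp [Bool.and_comm]
  rw [HBSystem.notdep, position_nextEv]
  have h := key (A ++ p :: B) (fun e => ¬ S.hb (A ++ p :: B) (nextEv A p) e) A.length
  have h' : (events (A ++ p :: B)).drop (A.length + 1) = eventsFrom (A ++ [p]) B := by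
    rw [events_append, eventsFrom_cons, List.drop_append, List.drop_of_length_le (by simp)]
    simp
  rw [h'] at h
  convert h using 3 <;> exact funext fun x => decide_eq_decide.2 Iff.rfl

end Events

end RelaxedDPOR

namespace RelaxedDPOR

/-! ### Valid happens-before relations -/

section Valid

variable {P : Type*}

/-- The properties of a happens-before relation on which the correctness of the DPOR algorithms
rests. -/
structure HBSystem.Valid (S : HBSystem P) : Prop where
  exec_nil : S.isExec []
  exec_prefix : ∀ E w, S.isExec (E ++ w) → S.isExec E
  hb_mem : ∀ E a b, S.isExec E → S.hb E a b → a ∈ events E ∧ b ∈ events E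
  hb_trans : ∀ E a b c, S.hb E a b → S.hb E b c → S.hb E a c
  hb_irrefl : ∀ E a, S.isExec E → ¬ S.hb E a a
  hb_order : ∀ E, S.isExec E → (events E).Pairwise (fun a b => ¬ S.hb E b a)
  hb_thread : ∀ E p i j, S.isExec E → (p, i) ∈ events E → (p, j) ∈ events E → i < j →
    S.hb E (p, i) (p, j)
  hb_prefix : ∀ E w a b, S.isExec (E ++ w) → a ∈ events E → b ∈ events E →
    (S.hb (E ++ w) a b ↔ S.hb E a b)
  swap : ∀ A p q B, S.isExec (A ++ p :: q :: B) → p ≠ q →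
    ¬ S.hb (A ++ [p, q]) (nextEv A p) (nextEv A q) →
    S.isExec (A ++ q :: p :: B) ∧ ∀ a b, S.hb (A ++ p :: q :: B) a b ↔ S.hb (A ++ q :: p :: B) a b
  /-- A thread does not disable another one. -/
  not_disable : ∀ E p q, p ≠ q → S.isExec (E ++ [p]) → S.isExec (E ++ [q]) → S.isExec (E ++ [p, q])
  /-- A thread that enables another one is needed to do so. -/
  enable : ∀ E q r X, q ≠ r → ¬ S.isExec (E ++ [r]) → S.isExec (E ++ [q, r]) → q ∉ X → r ∉ X →
    ¬ S.isExec (E ++ X ++ [r])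
  /-- A dependency cannot be destroyed by inserting an event that is independent of its source. -/
  remove : ∀ E x p r, p ≠ r → S.Indep E x [p, r] → S.isExec (E ++ [r]) → S.Indep E x [r]
  finite_enabled : ∀ E, (S.enabled E).Finite

/-- Exchange of two consecutive independent events. -/
def HBSystem.Swap (S : HBSystem P) (L L' : List P) : Prop :=
  ∃ A p q B, L = A ++ p :: q :: B ∧ L' = A ++ q :: p :: B ∧ p ≠ q ∧ S.isExec L ∧
    ¬ S.hb (A ++ [p, q]) (nextEv A p) (nextEv A q)

variable {S : HBSystem P} (hS : S.Valid)

namespace HBSystem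

theorem Equiv.perm {E E' : List P} (h : S.Equiv E E') : E.Perm E' := dom_eq_iff.1 h.2.2.1

theorem Equiv.symm {E E' : List P} (h : S.Equiv E E') : S.Equiv E' E :=
  ⟨h.2.1, h.1, h.2.2.1.symm, fun a b => (h.2.2.2 a b).symm⟩

theorem Equiv.trans {E E' E'' : List P} (h : S.Equiv E E') (h' : S.Equiv E' E'') :
    S.Equiv E E'' :=
  ⟨h.1, h'.2.1, h.2.2.1.trans h'.2.2.1, fun a b => (h.2.2.2 a b).trans (h'.2.2.2 a b)⟩

theorem Equiv.refl {E : List P} (h : S.isExec E) : S.Equiv E E :=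
  ⟨h, h, rfl, fun _ _ => Iff.rfl⟩

end HBSystem

open HBSystem

namespace HBSystem.Valid

include hS

theorem equiv_of_swap {L L' : List P} (h : S.Swap L L') : S.Equiv L L' := by
  obtain ⟨A, p, q, B, rfl, rfl, hpq, he, hn⟩ := h
  obtain ⟨h1, h2⟩ := hS.swap A p q B he hpq hn
  exact ⟨he, h1, dom_eq_iff.2 ((List.Perm.swap q p B).append_left A), h2⟩

theorem equiv_of_swaps {L L' : List P} (hL : S.isExec L)
    (h : Relation.ReflTransGen S.Swap L L') : S.Equiv L L' := by
  induction h with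
  | refl => exact .refl hL
  | tail _ h ih => exact ih.trans (hS.equiv_of_swap h)

/-- The event is moved past `B` one neighbour at a time; the hypothesis on the remaining events
survives because an exchange preserves happens-before. The suffix `w` is carried along so that the
same exchanges apply to continuations. -/
theorem swaps_move_right (B A w : List P) (p : P) (he : S.isExec (A ++ p :: B ++ w)) (hp : p ∉ B)
    (hn : ∀ b ∈ eventsFrom (A ++ [p]) B, ¬ S.hb (A ++ p :: B) (nextEv A p) b) :
    Relation.ReflTransGen S.Swap (A ++ p :: B ++ w) (A ++ B ++ p :: w) := by
  induction B generalizing A with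
  | nil => simp only [List.append_nil, List.append_assoc, List.cons_append, List.nil_append]
           exact .refl
  | cons b B ih =>
    simp only [List.mem_cons, not_or] at hp
    have hmem : nextEv A p ∈ events (A ++ [p, b]) := by
      simp [events_append]
    have hnb : nextEv (A ++ [p]) b = nextEv A b := nextEv_append_singleton_of_ne (Ne.symm hp.1)
    have hpb : nextEv (A ++ [b]) p = nextEv A p := nextEv_append_singleton_of_ne hp.1
    have hmem' : nextEv A b ∈ events (A ++ [p, b]) := by
      simp [events_append, hnb]
    have he0 : S.isExec (A ++ p :: b :: B) := hS.exec_prefix _ w (by simpa using he)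
    have h0 : ¬ S.hb (A ++ [p, b]) (nextEv A p) (nextEv A b) := by
      rw [← hS.hb_prefix (A ++ [p, b]) B _ _ (by simpa using he0) hmem hmem']
      have := hn (nextEv A b) (by simp [hnb])
      simpa using this
    have hsw : S.Swap (A ++ p :: b :: B ++ w) (A ++ b :: p :: B ++ w) :=
      ⟨A, p, b, B ++ w, by simp, by simp, hp.1, he, h0⟩
    have hsw' := hS.swap A p b B he0 hp.1 h0
    refine Relation.ReflTransGen.head hsw ?_
    have := ih (A ++ [b]) (by simpa using (hS.equiv_of_swap hsw).2.1) hp.2 ?_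
    · simpa using this
    · intro c hc
      have hc' : c ∈ eventsFrom (A ++ [p]) (b :: B) := by
        simp only [eventsFrom_cons, List.mem_cons]
        right
        rwa [eventsFrom_congr (E' := A ++ [b] ++ [p])]
        simpa using (List.Perm.swap b p []).append_left A
      have := hn c hc'
      rw [hsw'.2] at this
      rw [hpb]
      simpa using this

/-- Every linearization of the happens-before relation can be reached by exchanging independent
events. -/
theorem linearize (n : ℕ) (L : List P) (l : List (P × ℕ)) (hn : L.length = n) (he : S.isExec L)
    (hl : l.Perm (events L)) (hp : l.Pairwise (fun a b => ¬ S.hb L b a)) :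
    events (l.map Prod.fst) = l ∧ ∀ w, S.isExec (L ++ w) →
      Relation.ReflTransGen S.Swap (L ++ w) (l.map Prod.fst ++ w) := by
  induction n generalizing L l with
  | zero =>
    obtain rfl := List.length_eq_zero_iff.1 hn
    obtain rfl : l = [] := by simpa using hl
    exact ⟨rfl, fun w _ => .refl⟩
  | succ n ih =>
    rcases List.eq_nil_or_concat l with rfl | ⟨l', b, rfl⟩
    · have := hl.length_eq
      simp [hn] at this
    have hb : b ∈ events L := hl.subset (by simp)
    obtain ⟨A, B, hL, hbA⟩ := exists_split_of_mem_events hb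
    obtain ⟨p, i⟩ := b
    simp only at hL hbA
    have hev : events L = events A ++ (p, i) :: eventsFrom (A ++ [p]) B := by
      rw [hL, events_append, eventsFrom_cons, ← hbA]
    have hl' : l'.Perm (events A ++ eventsFrom (A ++ [p]) B) := by
      rw [hev, List.concat_eq_append] at hl
      have h1 : ((p, i) :: l').Perm ((p, i) :: (events A ++ eventsFrom (A ++ [p]) B)) :=
        (List.perm_append_comm (l₁ := [(p, i)])).trans (hl.trans List.perm_middle)
      exact h1.cons_inv
    rw [List.concat_eq_append, List.pairwise_append] at hp
    -- The last event of `l` happens before no other event, since `l` respects happens-before. It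
    -- therefore has no successor in `B` and can be moved behind `B`, which leaves a shorter
    -- sequence for the induction.
    have hB : ∀ c ∈ eventsFrom (A ++ [p]) B, ¬ S.hb L (p, i) c := fun c hc =>
      hp.2.2 c (hl'.symm.subset (by simp [hc])) (p, i) (by simp)
    have hpB : p ∉ B := by
      intro hpB
      have hc := nextEv_mem_eventsFrom (E := A ++ [p]) hpB
      refine hB _ hc ?_
      refine hS.hb_thread L p i _ he hb (by rw [hev]; exact List.mem_append_right _ (List.mem_cons_of_mem _ hc)) ?_
      rw [nextEv, Prod.mk.injEq] at hbA
      simp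
      omega
    have hBe : eventsFrom (A ++ [p]) B = eventsFrom A B :=
      eventsFrom_append_of_notMem (by simpa using hpB)
    have hmove : ∀ w, S.isExec (L ++ w) →
        Relation.ReflTransGen S.Swap (L ++ w) (A ++ B ++ p :: w) := by
      intro w hw
      rw [hL] at hw hB ⊢
      exact hS.swaps_move_right B A w p hw hpB (by rwa [← hbA])
    have heq := hS.equiv_of_swaps (by simpa using he) (hmove [] (by simpa using he))
    simp only [List.append_nil] at heq
    have heAB : S.isExec (A ++ B) := hS.exec_prefix _ [p] heq.2.1
    have hl'' : l'.Perm (events (A ++ B)) := by rwa [events_append, ← hBe]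
    have hlen : (A ++ B).length = n := by
      rw [hL] at hn
      simp at hn ⊢
      omega
    obtain ⟨ih1, ih2⟩ := ih (A ++ B) l' hlen heAB hl'' (hp.1.imp_of_mem (by
      intro a b ha hb hab
      rw [heq.2.2.2] at hab
      rwa [hS.hb_prefix (A ++ B) [p] b a heq.2.1 (hl''.subset hb) (hl''.subset ha)] at hab))
    have hperm : (l'.map Prod.fst).Perm (A ++ B) := by
      simpa using hl''.map Prod.fst
    constructor
    · rw [List.concat_eq_append, List.map_append, List.map_singleton, events_concat, ih1,
        nextEv_congr hperm, nextEv_append_of_notMem hpB, hbA]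
    · intro w hw
      have h1 := hmove w hw
      have h2 := ih2 (p :: w) (hS.equiv_of_swaps hw h1).2.1
      simpa using h1.trans h2

theorem linearize_equiv {L : List P} {l : List (P × ℕ)} (he : S.isExec L)
    (hl : l.Perm (events L)) (hp : l.Pairwise (fun a b => ¬ S.hb L b a)) :
    S.Equiv L (l.map Prod.fst) ∧ events (l.map Prod.fst) = l := by
  obtain ⟨h1, h2⟩ := hS.linearize _ L l rfl he hl hp
  exact ⟨by simpa using hS.equiv_of_swaps (by simpa using he) (h2 [] (by simpa using he)), h1⟩

/-- `events E'` respects the happens-before relation of `E'`, which is that of `E`; so it is one of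
the linearizations of `E`. -/
theorem swaps_of_equiv {E E' w : List P} (h : S.Equiv E E') (he : S.isExec (E ++ w)) :
    Relation.ReflTransGen S.Swap (E ++ w) (E' ++ w) := by
  have := (hS.linearize _ E (events E') rfl h.1 (events_perm h.perm.symm)
    ((hS.hb_order E' h.2.1).imp (by intro a b hab; rwa [h.2.2.2]))).2 w he
  simpa using this

/-- An equivalence is realised by exchanges inside `E`, and these can be performed in front of any
continuation. -/
theorem equiv_append {E E' w : List P} (h : S.Equiv E E') (he : S.isExec (E ++ w)) :
    S.Equiv (E ++ w) (E' ++ w) :=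
  hS.equiv_of_swaps he (hS.swaps_of_equiv h he)

/-- By `hb_prefix` the relation among events of a prefix is decided by the prefix, so different
continuations can be cancelled as soon as the prefixes have the same events. -/
theorem equiv_cancel {E E' w w' : List P} (h : S.Equiv (E ++ w) (E' ++ w')) (hp : E.Perm E') :
    S.Equiv E E' := by
  refine ⟨hS.exec_prefix _ _ h.1, hS.exec_prefix _ _ h.2.1, dom_eq_iff.2 hp, fun a b => ?_⟩
  have hmem := fun c => (events_perm hp).mem_iff (a := c)
  by_cases hab : a ∈ events E ∧ b ∈ events E
  · rw [← hS.hb_prefix E w a b h.1 hab.1 hab.2, h.2.2.2,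
      hS.hb_prefix E' w' a b h.2.1 ((hmem a).1 hab.1) ((hmem b).1 hab.2)]
  · constructor
    · intro h'
      exact absurd (hS.hb_mem _ _ _ (hS.exec_prefix _ _ h.1) h') hab
    · intro h'
      have := hS.hb_mem _ _ _ (hS.exec_prefix _ _ h.2.1) h'
      rw [← hmem, ← hmem] at this
      exact absurd this hab

/-- Happens-before respects the order of occurrence, so all predecessors of an event of `E` lie in
`E`. -/
theorem hb_concat_right {E w : List P} {a b : P × ℕ} (he : S.isExec (E ++ w))
    (h : S.hb (E ++ w) a b) (hb : b ∈ events E) : S.hb E a b := by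
  have ha := (hS.hb_mem _ _ _ he h).1
  rw [events_append, List.mem_append] at ha
  rcases ha with ha | ha
  · rwa [← hS.hb_prefix E w a b he ha hb]
  · have := hS.hb_order _ he
    rw [events_append, List.pairwise_append] at this
    exact absurd h (this.2.2 b hb a ha)

theorem not_hb_of_later {E w : List P} {a b : P × ℕ} (he : S.isExec (E ++ w))
    (hb : b ∈ events E) (ha : a ∈ eventsFrom E w) : ¬ S.hb (E ++ w) a b := by
  have := hS.hb_order _ he
  rw [events_append, List.pairwise_append] at this
  exact this.2.2 b hb a ha

open Classical in
/-- A set of events that is closed under predecessors can be executed first. -/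
theorem split {L : List P} (he : S.isExec L) (D : P × ℕ → Prop)
    (hD : ∀ a b, S.hb L a b → D b → D a) :
    S.Equiv L (((events L).filter D).map Prod.fst ++
        ((events L).filter (fun e => ¬ D e)).map Prod.fst) ∧
      events (((events L).filter D).map Prod.fst) = (events L).filter D ∧
      eventsFrom (((events L).filter D).map Prod.fst)
        (((events L).filter (fun e => ¬ D e)).map Prod.fst) =
          (events L).filter (fun e => ¬ D e) := by
  have hperm : ((events L).filter D ++ (events L).filter (fun e => ¬ D e)).Perm (events L) := by
    simpa using List.filter_append_perm (fun e => decide (D e)) (events L)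
  obtain ⟨h1, h2⟩ := hS.linearize_equiv he hperm (by
    rw [List.pairwise_append]
    refine ⟨(hS.hb_order L he).filter _, (hS.hb_order L he).filter _, ?_⟩
    intro a ha b hb hab
    simp only [List.mem_filter, decide_eq_true_eq] at ha hb
    exact hb.2 (hD b a hab ha.2))
  rw [List.map_append] at h1 h2
  rw [events_append] at h2
  exact ⟨h1, List.append_inj h2 (by simp)⟩

end HBSystem.Valid

end Valid

end RelaxedDPOR

namespace RelaxedDPOR

/-! ### Independence, initials and races -/

section Races

variable {P : Type*} {S : HBSystem P} (hS : S.Valid)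

open HBSystem

theorem mem_eventsFrom_of_perm {E E' w w' : List P} (h : E.Perm E') (hw : (E ++ w).Perm (E' ++ w'))
    {e : P × ℕ} : e ∈ eventsFrom E w ↔ e ∈ eventsFrom E' w' := by
  rw [mem_eventsFrom, mem_eventsFrom, perm_iff_occ.1 h, perm_iff_occ.1 hw]

theorem mem_eventsFrom_append_left {E w w' : List P} {e : P × ℕ} (h : e ∈ eventsFrom E w) :
    e ∈ eventsFrom E (w ++ w') := by
  rw [eventsFrom_append]
  exact List.mem_append_left _ h

theorem mem_events_append_left {E w : List P} {e : P × ℕ} (h : e ∈ events E) :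
    e ∈ events (E ++ w) := by
  rw [events_append]
  exact List.mem_append_left _ h

theorem mem_events_append_right {E w : List P} {e : P × ℕ} (h : e ∈ eventsFrom E w) :
    e ∈ events (E ++ w) := by
  rw [events_append]
  exact List.mem_append_right _ h

theorem HBSystem.Equiv.perm_right {E w w' : List P} (h : S.Equiv (E ++ w) (E ++ w')) :
    w.Perm w' := (List.perm_append_left_iff E).1 h.perm

theorem HBSystem.Indep.exec {E w : List P} {p : P} (h : S.Indep E p w) : S.isExec (E ++ p :: w) :=
  h.1

theorem HBSystem.indep_nil {E : List P} {p : P} (h : S.isExec (E ++ [p])) : S.Indep E p [] :=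
  ⟨h, fun e he => by simp [mem_domAfter] at he⟩

namespace HBSystem.Valid

include hS

theorem exec_left {E w : List P} (h : S.isExec (E ++ w)) : S.isExec E := hS.exec_prefix E w h

theorem hb_congr {L L' A : List P} {w : List P} {a b : P × ℕ} (h : S.Equiv L L') (hL : L' = A ++ w)
    (ha : a ∈ events A) (hb : b ∈ events A) : S.hb L a b ↔ S.hb A a b := by
  subst hL
  rw [h.2.2.2, hS.hb_prefix A w a b h.2.1 ha hb]

open Classical in
-- Version of `split` for a predecessor-closed set containing all of `E`: the prefix `E` stays in
-- place, and only the events of `w` are separated, each part keeping its order.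
theorem split_prefix {E w : List P} (he : S.isExec (E ++ w)) (D : P × ℕ → Prop)
    (hE : ∀ e ∈ events E, D e) (hD : ∀ a b, S.hb (E ++ w) a b → D b → D a) :
    ∃ x y, S.Equiv (E ++ w) (E ++ x ++ y) ∧ eventsFrom E x = (eventsFrom E w).filter D ∧
      eventsFrom (E ++ x) y = (eventsFrom E w).filter (fun e => ¬ D e) := by
  obtain ⟨h1, h2, h3⟩ := hS.split he D hD
  have hE1 : (events E).filter D = events E := by
    rw [List.filter_eq_self]
    intro e he
    simpa using hE e he
  have hE2 : (events E).filter (fun e => ¬ D e) = [] := by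
    rw [List.filter_eq_nil_iff]
    intro e he
    simpa using hE e he
  rw [events_append, List.filter_append, List.filter_append, hE1, hE2, List.nil_append,
    List.map_append, map_fst_events] at h1 h3
  rw [events_append, List.filter_append, hE1, List.map_append, map_fst_events] at h2
  rw [events_append] at h2
  exact ⟨_, _, h1, List.append_cancel_left h2, h3⟩

/-- Program order puts every further event of `p` after its next one. -/
theorem indep_notMem {E w : List P} {p : P} (h : S.Indep E p w) : p ∉ w := by
  intro hp
  refine h.2 (nextEv (E ++ [p]) p) (mem_domAfter.2 (nextEv_mem_eventsFrom hp)) ?_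
  have he : E ++ p :: w = E ++ [p] ++ w := by simp
  refine hS.hb_thread _ p _ _ h.1 ?_ ?_ (by simp)
  · rw [he]
    refine mem_events_append_left ?_
    rw [events_concat]
    exact List.mem_append_right _ (List.mem_singleton_self _)
  · rw [he]
    exact mem_events_append_right (nextEv_mem_eventsFrom hp)

/-- Independence as commutation. In one direction `p` is moved to the end by `swaps_move_right`; in
the other, events that precede `p` in an equivalent execution cannot happen after it. From here on
independence can be handled by composing equivalences. -/
theorem indep_iff {E w : List P} {p : P} :
    S.Indep E p w ↔ p ∉ w ∧ S.Equiv (E ++ p :: w) (E ++ w ++ [p]) := by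
  constructor
  · intro h
    have hp := hS.indep_notMem h
    refine ⟨hp, ?_⟩
    have := hS.swaps_move_right w E [] p (by simpa using h.1) hp
      (fun b hb => h.2 b (mem_domAfter.2 hb))
    rw [List.append_nil] at this
    exact hS.equiv_of_swaps h.1 this
  · rintro ⟨hp, h⟩
    refine ⟨h.1, fun e he => ?_⟩
    rw [mem_domAfter, eventsFrom_append_of_notMem (by simpa using hp)] at he
    rw [h.2.2.2]
    apply hS.not_hb_of_later h.2.1 (mem_events_append_right he)
    simp [nextEv_append_of_notMem hp]

theorem indep_equiv {E w : List P} {p : P} (h : S.Indep E p w) :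
    S.Equiv (E ++ p :: w) (E ++ w ++ [p]) := (hS.indep_iff.1 h).2

theorem indep_append {E a b : List P} {p : P} :
    S.Indep E p (a ++ b) ↔ S.Indep E p a ∧ S.Indep (E ++ a) p b := by
  constructor
  · intro h
    have h1 : S.Indep E p a := by
      refine ⟨hS.exec_left (w := b) (by simpa using h.1), fun e he => ?_⟩
      rw [mem_domAfter] at he
      have := h.2 e (mem_domAfter.2 (mem_eventsFrom_append_left he))
      rwa [show E ++ p :: (a ++ b) = E ++ p :: a ++ b by simp,
        hS.hb_prefix _ _ _ _ (by simpa using h.1)] at this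
      · simp [events_append]
      · have := mem_events_append_right he
        simpa using this
    refine ⟨h1, hS.indep_iff.2 ?_⟩
    have hp := hS.indep_notMem h
    refine ⟨fun hb => hp (by simp [hb]), ?_⟩
    have e1 := hS.indep_equiv h
    have e2 := hS.equiv_append (w := b) (hS.indep_equiv h1) (by simpa using h.1)
    simp only [List.append_assoc, List.cons_append, List.nil_append] at e1 e2 ⊢
    exact e2.symm.trans e1
  · rintro ⟨h1, h2⟩
    refine hS.indep_iff.2 ⟨?_, ?_⟩
    · have := hS.indep_notMem h1
      have := hS.indep_notMem h2
      simp [*]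
    · have e2 := hS.indep_equiv h2
      have e1 := hS.equiv_append (w := b) (hS.indep_equiv h1).symm (by simpa using h2.1)
      simp only [List.append_assoc, List.cons_append, List.nil_append] at e1 e2 ⊢
      exact e1.symm.trans e2

theorem indep_ne {E : List P} {p q : P} (h : S.Indep E p [q]) : p ≠ q := by
  simpa using hS.indep_notMem h

theorem indep_singleton_symm {E : List P} {p q : P} (h : S.Indep E p [q]) : S.Indep E q [p] :=
  hS.indep_iff.2 ⟨by simpa using (hS.indep_ne h).symm, by simpa using (hS.indep_equiv h).symm⟩

theorem mem_initials_of_equiv {E w w' : List P} {q : P} (h : S.Equiv (E ++ w) (E ++ q :: w')) :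
    q ∈ S.initials E w := by
  refine ⟨h.perm_right.symm.subset (by simp), fun e he hne => ?_⟩
  rw [mem_domAfter, mem_eventsFrom_of_perm (List.Perm.refl E) h.perm] at he
  simp only [eventsFrom_cons, List.mem_cons, hne, false_or] at he
  rw [h.2.2.2]
  have hex := h.2.1
  rw [show E ++ q :: w' = E ++ [q] ++ w' by simp] at hex ⊢
  exact hS.not_hb_of_later hex (by simp [events_append]) he

open Classical in
-- By the definition of initials, `E` together with the next event of `q` is closed under
-- predecessors; `split_prefix` brings this event to the front and leaves the others in their order.
theorem exists_equiv_of_mem_initials {E w : List P} {q : P} (he : S.isExec (E ++ w))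
    (h : q ∈ S.initials E w) :
    ∃ w', S.Equiv (E ++ w) (E ++ q :: w') ∧
      eventsFrom (E ++ [q]) w' = (eventsFrom E w).filter (fun e => e ≠ nextEv E q) := by
  classical
  obtain ⟨x, y, h1, h2, h3⟩ := hS.split_prefix he (fun e => e ∈ events E ∨ e = nextEv E q)
    (fun e he => .inl he) (by
      intro a b hab hb
      rcases hb with hb | rfl
      · exact .inl (hS.hb_mem _ _ _ (hS.exec_left he)
          (hS.hb_concat_right he hab hb)).1
      · by_contra hn
        simp only [not_or] at hn
        have ha := (hS.hb_mem _ _ _ he hab).1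
        rw [events_append, List.mem_append] at ha
        exact h.2 a (mem_domAfter.2 (ha.resolve_left hn.1)) hn.2 hab)
  have hx : eventsFrom E x = [nextEv E q] := by
    rw [h2]
    trans (eventsFrom E w).filter (fun e => e = nextEv E q)
    · apply List.filter_congr
      intro e he
      simp [notMem_events_of_mem_eventsFrom he]
    · rw [List.filter_eq, List.count_eq_one_of_mem (nodup_eventsFrom E w)
        (nextEv_mem_eventsFrom h.1)]
      rfl
  have hy : eventsFrom (E ++ x) y = (eventsFrom E w).filter (fun e => e ≠ nextEv E q) := by
    rw [h3]
    apply List.filter_congr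
    intro e he
    simp [notMem_events_of_mem_eventsFrom he]
  have hxq : x = [q] := by
    have := congrArg (List.map Prod.fst) hx
    simpa using this
  subst hxq
  exact ⟨y, by simpa using h1, hy⟩

theorem mem_initials_iff {E w : List P} {q : P} (he : S.isExec (E ++ w)) :
    q ∈ S.initials E w ↔ ∃ w', S.Equiv (E ++ w) (E ++ q :: w') :=
  ⟨fun h => let ⟨w', h', _⟩ := hS.exists_equiv_of_mem_initials he h; ⟨w', h'⟩,
    fun ⟨_, h⟩ => hS.mem_initials_of_equiv h⟩

theorem initials_congr {E w w' : List P} (h : S.Equiv (E ++ w) (E ++ w')) :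
    S.initials E w = S.initials E w' := by
  ext q
  rw [hS.mem_initials_iff h.1, hS.mem_initials_iff h.2.1]
  exact ⟨fun ⟨v, hv⟩ => ⟨v, h.symm.trans hv⟩, fun ⟨v, hv⟩ => ⟨v, h.trans hv⟩⟩

theorem initials_append {E a b : List P} {q : P} (he : S.isExec (E ++ a ++ b))
    (h : q ∈ S.initials E a) : q ∈ S.initials E (a ++ b) := by
  obtain ⟨w, hw⟩ := (hS.mem_initials_iff (hS.exec_left he)).1 h
  refine hS.mem_initials_of_equiv (w' := w ++ b) ?_
  simpa using hS.equiv_append hw he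

theorem initials_of_append {E a b : List P} {q : P} (he : S.isExec (E ++ a ++ b)) (hq : q ∈ a)
    (h : q ∈ S.initials E (a ++ b)) : q ∈ S.initials E a := by
  refine ⟨hq, fun e hea hne => ?_⟩
  rw [mem_domAfter] at hea
  have := h.2 e (mem_domAfter.2 (mem_eventsFrom_append_left hea)) hne
  rwa [← List.append_assoc, hS.hb_prefix _ _ _ _ he (mem_events_append_right hea)
    (mem_events_append_right (nextEv_mem_eventsFrom hq))] at this

/-- Moving the last event to the front leaves exactly `w` behind it, so it commutes with all of `w`.
-/
theorem indep_of_mem_initials_concat {E w : List P} {q : P} (he : S.isExec (E ++ w ++ [q]))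
    (hq : q ∉ w) (h : q ∈ S.initials E (w ++ [q])) : S.Indep E q w := by
  classical
  obtain ⟨w', h1, h2⟩ := hS.exists_equiv_of_mem_initials (by simpa using he) h
  have hw : w' = w := by
    have := congrArg (List.map Prod.fst) h2
    rw [map_fst_eventsFrom, eventsFrom_append, List.filter_append, List.filter_eq_self.2,
      List.filter_eq_nil_iff.2] at this
    · simpa using this
    · intro e he
      simp only [eventsFrom_cons, eventsFrom_nil, List.mem_singleton] at he
      simp [he, nextEv_append_of_notMem hq]
    · intro e he
      have := fst_mem_of_mem_eventsFrom he
      simp only [decide_eq_true_eq]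
      rintro rfl
      exact hq this
  subst hw
  exact hS.indep_iff.2 ⟨hq, by simpa using h1.symm⟩

/-- If `q` occurs in `w`, it is an initial there. Otherwise its first occurrence is in `w'`; as it
can be moved to the front, it commutes with everything before this occurrence, in particular with
`w`. This is how information on an extension is brought back to a prefix. -/
theorem mem_initials_or_indep {E w v w' : List P} {q : P}
    (h : S.Equiv (E ++ q :: v) (E ++ w ++ w')) : q ∈ S.initials E w ∨ S.Indep E q w := by
  have hq : q ∈ S.initials E (w ++ w') := hS.mem_initials_of_equiv (by simpa using h.symm)
  by_cases hqw : q ∈ w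
  · exact .inl (hS.initials_of_append h.2.1 hqw hq)
  · right
    obtain ⟨a, b, rfl, ha⟩ := List.eq_append_cons_of_mem
      ((List.mem_append.1 hq.1).resolve_left hqw)
    have he : S.isExec (E ++ (w ++ a ++ [q]) ++ b) := by simpa using h.2.1
    have := hS.initials_of_append (E := E) (a := w ++ a ++ [q]) (b := b) (q := q) he (by simp)
      (by simpa using hq)
    have h2 := hS.indep_of_mem_initials_concat (w := w ++ a) (by simpa using hS.exec_left he)
      (by simp [hqw, ha]) this
    exact (hS.indep_append.1 h2).1

/-- The weak initials are the threads that can start some extension of `w`; in this form they are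
visibly invariant under equivalence. -/
theorem mem_weakInitials_iff {E w : List P} {q : P} (he : S.isExec (E ++ w)) :
    q ∈ S.weakInitials E w ↔ S.Consistent E [q] w := by
  constructor
  · rintro (h | h)
    · obtain ⟨w', hw⟩ := (hS.mem_initials_iff he).1 h
      exact ⟨w', [], by simpa using hw.symm⟩
    · exact ⟨w, [q], by simpa using hS.indep_equiv h⟩
  · rintro ⟨v, w', h⟩
    exact hS.mem_initials_or_indep (v := v) (w' := w') (by simpa using h)

theorem indep_congr {E a b : List P} {q : P} (h : S.Equiv (E ++ a) (E ++ b))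
    (hq : S.Indep E q a) : S.Indep E q b := by
  have hqa := hS.indep_notMem hq
  have hqb : q ∉ b := fun h' => hqa (h.perm_right.symm.subset h')
  have h1 := hS.indep_equiv hq
  have h2 := hS.equiv_append (w := [q]) h h1.2.1
  refine hS.indep_of_mem_initials_concat h2.2.1 hqb
    (hS.mem_initials_of_equiv (w' := a) ?_)
  simpa using h2.symm.trans h1.symm

/-- Iterates `not_disable`: once enabled, `r` stays enabled until it runs. -/
theorem exec_concat_of_notMem {E a : List P} {r : P} (hr : r ∉ a) (ha : S.isExec (E ++ a))
    (h : S.isExec (E ++ [r])) : S.isExec (E ++ a ++ [r]) := by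
  induction a using List.reverseRecOn with
  | nil => simpa using h
  | append_singleton a b ih =>
    simp only [List.mem_append, List.mem_singleton, not_or] at hr
    rw [← List.append_assoc] at ha
    have := hS.not_disable _ b r (Ne.symm hr.2) ha (ih hr.1 (hS.exec_left ha))
    simpa using this

theorem exec_of_indep {E u : List P} {p r : P} (hpu : S.Indep E p u)
    (hur : S.isExec (E ++ u ++ [r])) (hpr : p ≠ r) : S.isExec (E ++ p :: u ++ [r]) ∧
      S.Equiv (E ++ p :: u ++ [r]) (E ++ u ++ [p, r]) := by
  have h1 := hS.indep_equiv hpu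
  have h2 := hS.not_disable _ p r hpr h1.2.1 hur
  have h3 := hS.equiv_append (w := [r]) h1.symm (by simpa using h2)
  exact ⟨h3.2.1, by simpa using h3.symm⟩

/-- If `p` does not race with `u` but with `r` after `u`, then what can be started before
`p.u.r` can be started before `u.r`. -/
theorem mem_initials_or_indep_of_race {E u : List P} {p q r : P} (hpu : S.Indep E p u)
    (hur : S.isExec (E ++ u ++ [r])) (hpr : p ≠ r) (hn : ¬ S.Indep E p (u ++ [r])) (hqp : q ≠ p)
    (hq : S.Consistent E [q] (p :: u ++ [r])) :
    q ∈ S.initials E u ∨ S.Indep E q (u ++ [r]) := by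
  obtain ⟨hex, heq⟩ := hS.exec_of_indep hpu hur hpr
  have hpe := hS.indep_equiv hpu
  rcases (hS.mem_weakInitials_iff (by simpa using hex)).2 hq with h | h
  · left
    by_cases hqu : q ∈ u
    · have h1 := hS.initials_of_append (by simpa using hex) (by simp [hqu]) h
      rw [hS.initials_congr (w' := u ++ [p]) (by simpa using hpe)] at h1
      exact hS.initials_of_append (by simpa using hpe.2.1) hqu h1
    · have hqr : q = r := by
        have := h.1
        simpa [hqp, hqu] using this
      subst hqr
      -- If `r` itself could be started first, it would commute with `p` after `u`, and `p` would be
      -- independent of `u.r`.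
      exfalso
      apply hn
      rw [hS.initials_congr (w' := (u ++ [p]) ++ [q]) (by simpa using heq)] at h
      have h2 := hS.indep_of_mem_initials_concat (by simpa using heq.2.1) (by simp [hqu, hqp]) h
      exact hS.indep_append.2 ⟨hpu, hS.indep_singleton_symm (hS.indep_append.1 h2).2⟩
  · right
    have h1 := hS.indep_congr (b := u ++ [p, r]) (by simpa using heq) h
    obtain ⟨h2, h3⟩ := hS.indep_append.1 h1
    -- After `u`, the thread `q` is independent of `p.r`; by `remove` it is still independent of `r`
    -- when `p` is left out.
    exact hS.indep_append.2 ⟨h2, hS.remove _ _ _ _ hpr h3 hur⟩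

/-- If the events of `b` happen before neither `p` nor `r`, then `r` can be executed before `b` if
`p` is removed. -/
theorem equiv_move_left_of_remove {E b : List P} {p r : P} (hpr : p ≠ r)
    (he : S.isExec (E ++ b ++ [p, r])) (hr : S.isExec (E ++ b ++ [r]))
    (hb : ∀ c ∈ eventsFrom E b, ¬ S.hb (E ++ b ++ [p, r]) c (nextEv (E ++ b) p) ∧
      ¬ S.hb (E ++ b ++ [p, r]) c (nextEv (E ++ b) r)) :
    S.Equiv (E ++ b ++ [r]) (E ++ r :: b) := by
  induction b using List.reverseRecOn with
  | nil => simpa using Equiv.refl (by simpa using hr)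
  | append_singleton b x ih =>
    have hx := hb (nextEv (E ++ b) x) (by simp [eventsFrom_append])
    have hev : events (E ++ (b ++ [x]) ++ [p, r]) = events (E ++ b) ++ [nextEv (E ++ b) x,
        nextEv (E ++ (b ++ [x])) p, nextEv (E ++ (b ++ [x])) r] := by
      rw [show E ++ (b ++ [x]) ++ [p, r] = (E ++ b) ++ [x, p, r] by simp, events_append]
      simp only [eventsFrom_cons, eventsFrom_nil]
      rw [nextEv_append_singleton_of_ne hpr.symm]
      simp
    have hxp : x ≠ p := by
      rintro rfl
      refine hx.1 (hS.hb_thread _ x _ _ he ?_ ?_ (by simp))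
      · rw [hev]; simp [nextEv]
      · rw [hev]; simp [nextEv]
    have hxr : x ≠ r := by
      rintro rfl
      refine hx.2 (hS.hb_thread _ x _ _ he ?_ ?_ (by simp))
      · rw [hev]; simp [nextEv]
      · rw [hev]; simp [nextEv]
    have hind : S.Indep (E ++ b) x [p, r] := by
      refine ⟨by simpa using he, fun e hee => ?_⟩
      rw [mem_domAfter] at hee
      simp only [eventsFrom_cons, eventsFrom_nil, List.mem_cons, List.not_mem_nil, or_false] at hee
      rw [nextEv_append_singleton_of_ne hpr.symm] at hee
      rcases hee with rfl | rfl
      · simpa using hx.1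
      · simpa using hx.2
    have heq := hS.indep_equiv hind
    have hpr' : S.isExec (E ++ b ++ [p, r]) := hS.exec_left heq.2.1
    -- `x` does not enable `r`: otherwise `enable` would make `x` indispensable for `r`, whereas `r`
    -- runs after `p` without it.
    have hr' : S.isExec (E ++ b ++ [r]) := by
      by_contra hc
      have := hS.enable (E ++ b) x r [p] hxr hc (by simpa using hr) (by simpa using hxp)
        (by simpa using hpr.symm)
      exact this (by simpa using hpr')
    have hxr' := hS.indep_equiv (hS.remove _ _ _ _ hpr hind hr')
    have := ih hpr' hr' (by
      intro c hc
      have hcx := hb c (mem_eventsFrom_append_left hc)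
      have hc' : c ∈ events (E ++ b ++ [p, r]) :=
        mem_events_append_left (mem_events_append_right hc)
      have e1 : nextEv (E ++ (b ++ [x])) p = nextEv (E ++ b) p := by
        rw [← List.append_assoc]
        exact nextEv_append_singleton_of_ne hxp.symm
      have e2 : nextEv (E ++ (b ++ [x])) r = nextEv (E ++ b) r := by
        rw [← List.append_assoc]
        exact nextEv_append_singleton_of_ne hxr.symm
      rw [e1, e2] at hcx
      have heq' : S.Equiv (E ++ (b ++ [x]) ++ [p, r]) (E ++ b ++ [p, r] ++ [x]) := by
        simpa using heq
      rw [hS.hb_congr heq' rfl hc' (mem_events_append_right (nextEv_mem_eventsFrom (by simp))),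
        hS.hb_congr heq' rfl hc'] at hcx
      · exact hcx
      · refine mem_events_append_right ?_
        exact nextEv_mem_eventsFrom (by simp))
    have h4 := hS.equiv_append (w := [x]) this (by simpa using hxr'.2.1)
    simp only [List.append_assoc, List.cons_append, List.nil_append] at hxr' h4 ⊢
    exact hxr'.trans h4

end HBSystem.Valid

end Races

end RelaxedDPOR

namespace RelaxedDPOR

/-! ### Reversible races and the sequences that reverse them -/

section RaceReversal

variable {P : Type*} {S : HBSystem P} (hS : S.Valid)

open HBSystem

namespace HBSystem.Valid

include hS

open Classical in
-- The complement of an event and its successors is closed under predecessors, so it can be executed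
-- first. This is `notdep`; it is followed by `p` and the events `R` that depend on `p`.
theorem split_notdep {E x : List P} {p : P} (he : S.isExec (E ++ p :: x)) :
    ∃ R, S.Equiv (E ++ p :: x) (E ++ S.notdep (E ++ p :: x) (nextEv E p) ++ p :: R) ∧
      eventsFrom E (S.notdep (E ++ p :: x) (nextEv E p)) = (eventsFrom (E ++ [p]) x).filter
        (fun c => ¬ S.hb (E ++ p :: x) (nextEv E p) c) ∧
      eventsFrom (E ++ S.notdep (E ++ p :: x) (nextEv E p) ++ [p]) R =
        (eventsFrom (E ++ [p]) x).filter (fun c => S.hb (E ++ p :: x) (nextEv E p) c) := by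
  have he' : S.isExec (E ++ [p] ++ x) := by simpa using he
  have hirr := hS.hb_irrefl _ (nextEv E p) he
  obtain ⟨y, z, h1, h2, h3⟩ := hS.split_prefix he
    (fun c => c ≠ nextEv E p ∧ ¬ S.hb (E ++ p :: x) (nextEv E p) c) (by
      intro e hee
      refine ⟨?_, ?_⟩
      · rintro rfl
        exact nextEv_notMem_events E p hee
      · exact hS.not_hb_of_later he hee (by simp)) (by
      intro a b hab ⟨hb1, hb2⟩
      refine ⟨?_, fun ha => hb2 (hS.hb_trans _ _ _ _ ha hab)⟩
      rintro rfl
      exact hb2 hab)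
  have hne : ∀ c ∈ eventsFrom (E ++ [p]) x, c ≠ nextEv E p := by
    rintro c hc rfl
    exact notMem_events_of_mem_eventsFrom hc (by simp [events_append])
  have hy : eventsFrom E y = (eventsFrom (E ++ [p]) x).filter
        (fun c => ¬ S.hb (E ++ p :: x) (nextEv E p) c) := by
    rw [h2, eventsFrom_cons, List.filter_cons_of_neg (by simp)]
    apply List.filter_congr
    intro c hc
    simp [hne c hc]
  have hz : eventsFrom (E ++ y) z = nextEv E p :: (eventsFrom (E ++ [p]) x).filter
        (fun c => S.hb (E ++ p :: x) (nextEv E p) c) := by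
    rw [h3, eventsFrom_cons, List.filter_cons_of_pos (by simp)]
    congr 1
    apply List.filter_congr
    intro c hc
    simp [hne c hc]
  have hyN : y = S.notdep (E ++ p :: x) (nextEv E p) := by
    rw [notdep_nextEv, ← map_fst_eventsFrom E y, hy]
  rw [← hyN]
  cases z with
  | nil => simp at hz
  | cons q R =>
    simp only [eventsFrom_cons, List.cons.injEq] at hz
    obtain rfl : q = p := by simpa using congrArg Prod.fst hz.1
    exact ⟨R, h1, hy, hz.2⟩

theorem notMem_notdep {E x : List P} {p : P} (he : S.isExec (E ++ p :: x)) :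
    p ∉ S.notdep (E ++ p :: x) (nextEv E p) := by
  classical
  rw [notdep_nextEv]
  intro h
  rw [List.mem_map] at h
  obtain ⟨c, hc, hcp⟩ := h
  obtain ⟨q, i⟩ := c
  simp only at hcp
  subst hcp
  rw [List.mem_filter, decide_eq_true_eq] at hc
  refine hc.2 (hS.hb_thread _ q _ _ he ?_ ?_ ?_)
  · exact mem_events_append_right (by simp [nextEv])
  · exact mem_events_append_right (by simp [hc.1])
  · have := (mem_eventsFrom.1 hc.1).1
    simpa using this

theorem indep_notdep {E x : List P} {p : P} (he : S.isExec (E ++ p :: x)) :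
    S.Indep E p (S.notdep (E ++ p :: x) (nextEv E p)) := by
  obtain ⟨R, h1, -, -⟩ := hS.split_notdep he
  have h2 := hS.mem_initials_of_equiv (q := p) (w' := x)
    (w := S.notdep (E ++ p :: x) (nextEv E p) ++ [p] ++ R) (by simpa using h1.symm)
  have h3 : S.isExec (E ++ (S.notdep (E ++ p :: x) (nextEv E p) ++ [p]) ++ R) := by
    simpa using h1.2.1
  have h4 := hS.initials_of_append h3 (by simp) h2
  exact hS.indep_of_mem_initials_concat (by simpa using hS.exec_left h3)
    (hS.notMem_notdep he) h4

/-- `p` is independent of `u`, so `r` is the only event of `u.r` that can be responsible for the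
dependence. -/
theorem hb_of_not_indep {E u : List P} {p r : P} (hpu : S.Indep E p u)
    (hur : S.isExec (E ++ u ++ [r])) (hpr : p ≠ r) (hn : ¬ S.Indep E p (u ++ [r])) :
    S.hb (E ++ p :: u ++ [r]) (nextEv E p) (nextEv (E ++ u) r) := by
  by_contra hc
  obtain ⟨hex, heq⟩ := hS.exec_of_indep hpu hur hpr
  refine hn ⟨by simpa using hex, fun e he => ?_⟩
  rw [mem_domAfter, eventsFrom_append, List.mem_append] at he
  rcases he with he | he
  · have := hpu.2 e (mem_domAfter.2 he)
    rwa [← List.cons_append, ← List.append_assoc, hS.hb_prefix _ _ _ _ hex]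
    · exact mem_events_append_right (by simp)
    · exact mem_events_append_right (by simp [he])
  · simp only [eventsFrom_cons, eventsFrom_nil, List.mem_singleton] at he
    rw [he, nextEv_congr (E := E ++ [p] ++ u) (E' := E ++ u ++ [p])
      (by simpa using (hS.indep_equiv hpu).perm),
      nextEv_append_singleton_of_ne hpr.symm]
    simpa using hc

/-- The race is direct because an event between `p` and `r` would lie in `u`, of which `p` is
independent. For reversibility, let `p` and `r` be adjacent after `E₁` in an equivalent execution
and suppose that `r` is disabled after `E₁`. Then `p` enables `r`. On the other hand `r` is enabled
after `E.u`, where `p` has not run; passing to a common extension of `E₁` and `E.u` without `p` and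
`r` contradicts `enable`. -/
theorem revRace_of_race {E u z L : List P} {p r : P} (hpu : S.Indep E p u)
    (hur : S.isExec (E ++ u ++ [r])) (hpr : p ≠ r) (hn : ¬ S.Indep E p (u ++ [r]))
    (hL : S.Equiv L (E ++ p :: u ++ r :: z)) :
    S.RevRace L (nextEv E p) (nextEv (E ++ u) r) := by
  classical
  have hb := hS.hb_of_not_indep hpu hur hpr hn
  obtain ⟨hex, heq⟩ := hS.exec_of_indep hpu hur hpr
  have hp := hS.indep_notMem hpu
  have hL' : S.Equiv L ((E ++ p :: u ++ [r]) ++ z) := by simpa using hL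
  have hme : nextEv E p ∈ events (E ++ p :: u ++ [r]) := by simp [events_append, eventsFrom_append]
  have hnr : nextEv (E ++ p :: u) r = nextEv (E ++ u) r := by
    rw [nextEv_congr (E' := E ++ u ++ [p]) (by simpa using (hS.indep_equiv hpu).perm),
      nextEv_append_singleton_of_ne hpr.symm]
  have hme' : nextEv (E ++ u) r ∈ events (E ++ p :: u ++ [r]) := by
    rw [← hnr]
    exact mem_events_append_right (by simp)
  have hbL : S.hb L (nextEv E p) (nextEv (E ++ u) r) := by
    rwa [hS.hb_congr hL' rfl hme hme']
  have hLu : S.Equiv L (E ++ u ++ (p :: r :: z)) := by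
    have := hS.equiv_append (w := z) heq hL'.2.1
    exact hL'.trans (by simpa using this)
  refine ⟨⟨?_, ?_, hpr, hbL, ?_⟩, ?_⟩
  · exact mem_events.1 (hS.hb_mem _ _ _ hL.1 hbL).1
  · exact mem_events.1 (hS.hb_mem _ _ _ hL.1 hbL).2
  · rintro ⟨d, hd, hde, hde', hed, hde2⟩
    have hd1 : d ∈ events (E ++ p :: u ++ [r]) := by
      rw [hL'.2.2.2] at hde2
      exact (hS.hb_mem _ _ _ hex (hS.hb_concat_right hL'.2.1 hde2 hme')).1
    have hed' := (hS.hb_congr hL' rfl hme hd1).1 hed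
    rw [show E ++ p :: u ++ [r] = E ++ [p] ++ u ++ [r] by simp] at hd1
    rw [events_append, List.mem_append, events_append, List.mem_append, events_concat,
      List.mem_append, List.mem_singleton] at hd1
    rcases hd1 with ((hd1 | hd1) | hd1) | hd1
    · refine hS.not_hb_of_later (E := E) (w := p :: u ++ [r]) (by simpa using hex) hd1
        (by simp : nextEv E p ∈ _) (by simpa using hed')
    · exact hde hd1
    · refine hpu.2 d (mem_domAfter.2 hd1) ?_
      rwa [hS.hb_prefix _ _ _ _ hex] at hed'
      · exact mem_events_append_right (by simp)
      · exact mem_events_append_right (by simp [hd1])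
    · simp only [eventsFrom_cons, eventsFrom_nil, List.mem_singleton] at hd1
      apply hde'
      rw [hd1, ← hnr]
      congr 1
      simp
  · intro E₁ E₂ heq₁ h₁ h₂
    simp only [nextEv_fst] at heq₁ h₁ h₂ ⊢
    by_contra hdis
    have hocc₁ : occ E₁ p = occ E p := by simpa [nextEv] using h₁
    have hocc₂ : occ E₁ r = occ (E ++ u) r := by simpa [nextEv] using h₂
    have hoccu : occ (E ++ u) p = occ E p := by simp [occ_eq_zero.2 hp]
    have hexE₁ := hS.exec_left heq₁.1
    have hexEu := hS.exec_left hur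
    -- The union of two predecessor-closed sets is predecessor-closed; it is linearized once
    -- starting with `E₁` and once starting with `E ++ u`.
    obtain ⟨D, hDd⟩ : ∃ D : P × ℕ → Prop, ∀ c, D c ↔ c ∈ events E₁ ∨ c ∈ events (E ++ u) :=
      ⟨_, fun _ => Iff.rfl⟩
    have hDclosed : ∀ a b, S.hb L a b → D b → D a := by
      intro a b hab hb
      rw [hDd] at hb ⊢
      rcases hb with hb | hb
      · rw [← heq₁.2.2.2] at hab
        exact .inl (hS.hb_mem _ _ _ hexE₁ (hS.hb_concat_right heq₁.1 hab hb)).1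
      · rw [hLu.2.2.2] at hab
        exact .inr (hS.hb_mem _ _ _ hexEu (hS.hb_concat_right hLu.2.1 hab hb)).1
    obtain ⟨X, X', hX1, hX2, -⟩ := hS.split_prefix heq₁.1 D (fun e he => (hDd e).2 (.inl he))
      (fun a b hab => hDclosed a b ((heq₁.2.2.2 a b).1 hab))
    obtain ⟨Y, Y', hY1, hY2, -⟩ := hS.split_prefix hLu.2.1 D (fun e he => (hDd e).2 (.inr he))
      (fun a b hab => hDclosed a b ((hLu.2.2.2 a b).2 hab))
    have hDX : ∀ c ∈ eventsFrom E₁ X, c ∈ events (E ++ u) := by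
      intro c hc
      have hc' := hc
      rw [hX2, List.mem_filter, decide_eq_true_eq, hDd] at hc'
      exact hc'.2.resolve_left (notMem_events_of_mem_eventsFrom hc)
    have hDY : ∀ c ∈ eventsFrom (E ++ u) Y, c ∈ events E₁ := by
      intro c hc
      have hc' := hc
      rw [hY2, List.mem_filter, decide_eq_true_eq, hDd] at hc'
      exact hc'.2.resolve_right (notMem_events_of_mem_eventsFrom hc)
    have hpX : p ∉ X := by
      intro h
      have := (mem_events.1 (hDX _ (nextEv_mem_eventsFrom (E := E₁) h))).2
      simp only [nextEv] at this
      omega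
    have hrX : r ∉ X := by
      intro h
      have := (mem_events.1 (hDX _ (nextEv_mem_eventsFrom (E := E₁) h))).2
      simp only [nextEv] at this
      omega
    have hrY : r ∉ Y := by
      intro h
      have := (mem_events.1 (hDY _ (nextEv_mem_eventsFrom (E := E ++ u) h))).2
      simp only [nextEv] at this
      omega
    have hperm : (E₁ ++ X).Perm (E ++ u ++ Y) := by
      rw [← events_perm_iff, List.perm_ext_iff_of_nodup (nodup_events _) (nodup_events _)]
      have hall := fun c => (events_perm (heq₁.trans hLu).perm).mem_iff (a := c)
      intro c
      rw [events_append, events_append (E ++ u), List.mem_append, List.mem_append]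
      constructor
      · rintro (h | h)
        · by_cases h' : c ∈ events (E ++ u)
          · exact .inl h'
          · right
            rw [hY2, List.mem_filter, decide_eq_true_eq, hDd]
            refine ⟨?_, .inl h⟩
            have := (hall c).1 (mem_events_append_left h)
            rw [events_append, List.mem_append] at this
            exact this.resolve_left h'
        · exact .inl (hDX c h)
      · rintro (h | h)
        · by_cases h' : c ∈ events E₁
          · exact .inl h'
          · right
            rw [hX2, List.mem_filter, decide_eq_true_eq, hDd]
            refine ⟨?_, .inr h⟩
            have := (hall c).2 (mem_events_append_left h)
            rw [events_append, List.mem_append] at this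
            exact this.resolve_left h'
        · exact .inl (hDY c h)
    have heqXY := hS.equiv_cancel (hX1.symm.trans ((heq₁.trans hLu).trans hY1)) hperm
    -- `r` remains enabled along `Y`, hence is enabled after the equivalent sequence `E₁ ++ X`, in
    -- which `X` contains neither `p` nor `r`.
    have h5 := hS.exec_concat_of_notMem hrY heqXY.2.1 hur
    have h6 := (hS.equiv_append heqXY.symm h5).2.1
    refine hS.enable E₁ p r X hpr hdis ?_ hpX hrX h6
    exact hS.exec_left (w := E₂) (by simpa using heq₁.1)

/-- Up to equivalence `notdep` is the same for both executions, and for the second one it is `u.y`,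
where `y` consists of events of `z` that do not depend on `p`. Since `y` comes after `p` and `r`
there, none of its events happens before either of them. So when `p` is dropped, `r` can be moved in
front of `y` by `equiv_move_left_of_remove`. -/
theorem equiv_notdep {E u z x : List P} {p r : P} (hpu : S.Indep E p u)
    (hur : S.isExec (E ++ u ++ [r])) (hpr : p ≠ r) (hn : ¬ S.Indep E p (u ++ [r]))
    (hL : S.Equiv (E ++ p :: x) (E ++ p :: u ++ r :: z)) :
    ∃ y, S.Equiv (E ++ S.notdep (E ++ p :: x) (nextEv E p) ++ [r]) (E ++ u ++ r :: y) := by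
  classical
  have hb := hS.hb_of_not_indep hpu hur hpr hn
  obtain ⟨hex, heq⟩ := hS.exec_of_indep hpu hur hpr
  have hL2 : S.Equiv (E ++ p :: x) (E ++ p :: (u ++ r :: z)) := by simpa using hL
  have hL3 : S.Equiv (E ++ p :: x) ((E ++ p :: u ++ [r]) ++ z) := by simpa using hL
  have hL4 : S.Equiv (E ++ p :: x) ((E ++ p :: u) ++ r :: z) := by simpa using hL
  have hnr : nextEv (E ++ p :: u) r = nextEv (E ++ u) r := by
    rw [nextEv_congr (E' := E ++ u ++ [p]) (by simpa using (hS.indep_equiv hpu).perm),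
      nextEv_append_singleton_of_ne hpr.symm]
  have hme : nextEv E p ∈ events (E ++ p :: u ++ [r]) := by simp [events_append, eventsFrom_append]
  have hme' : nextEv (E ++ u) r ∈ events (E ++ p :: u ++ [r]) := by
    rw [← hnr]
    exact mem_events_append_right (by simp)
  have hbL : S.hb (E ++ p :: (u ++ r :: z)) (nextEv E p) (nextEv (E ++ u) r) := by
    rwa [← hL2.2.2.2, hS.hb_congr hL3 rfl hme hme']
  obtain ⟨R, h1, h2, h3⟩ := hS.split_notdep hL.1
  obtain ⟨R', h1', h2', h3'⟩ := hS.split_notdep hL2.2.1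
  set N := S.notdep (E ++ p :: x) (nextEv E p)
  set N' := S.notdep (E ++ p :: (u ++ r :: z)) (nextEv E p)
  have hNN : S.Equiv (E ++ N) (E ++ N') := by
    refine hS.equiv_cancel (h1.symm.trans (hL2.trans h1')) ?_
    refine List.Perm.append_left E ?_
    have : (eventsFrom E N).Perm (eventsFrom E N') := by
      rw [List.perm_ext_iff_of_nodup (nodup_eventsFrom _ _) (nodup_eventsFrom _ _)]
      intro c
      rw [h2, h2', List.mem_filter, List.mem_filter]
      simp only [decide_eq_true_eq]
      rw [hL2.2.2.2, mem_eventsFrom_of_perm (List.Perm.refl _) (by simpa using hL2.perm)]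
    simpa using this.map Prod.fst
  -- `N'` is `u` followed by events of `z`
  have hufil : (eventsFrom (E ++ [p]) u).filter
      (fun c => ¬ S.hb (E ++ p :: (u ++ r :: z)) (nextEv E p) c) = eventsFrom E u := by
    rw [eventsFrom_append_of_notMem (by simpa using hS.indep_notMem hpu), List.filter_eq_self]
    intro c hc
    rw [← eventsFrom_append_of_notMem (w := [p]) (by simpa using hS.indep_notMem hpu)] at hc
    have := hpu.2 c (mem_domAfter.2 hc)
    rw [decide_eq_true_eq]
    rwa [← hL2.2.2.2, hS.hb_congr hL4 rfl]
    · exact mem_events_append_right (by simp)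
    · exact mem_events_append_right (by simp [hc])
  obtain ⟨y, hy⟩ : ∃ y, N' = u ++ y := by
    have hmap := congrArg (List.map Prod.fst) h2'
    rw [map_fst_eventsFrom, eventsFrom_append, List.filter_append, hufil, List.map_append,
      map_fst_eventsFrom] at hmap
    exact ⟨_, hmap⟩
  have hyev : eventsFrom (E ++ u) y = (eventsFrom (E ++ p :: u) (r :: z)).filter
      (fun c => ¬ S.hb (E ++ p :: (u ++ r :: z)) (nextEv E p) c) := by
    rw [hy, eventsFrom_append, eventsFrom_append, List.filter_append, hufil] at h2'
    simpa using List.append_cancel_left h2'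
  have hry : r ∉ y := by
    intro h
    have hmem := nextEv_mem_eventsFrom (E := E ++ u) h
    rw [hyev, List.mem_filter, decide_eq_true_eq] at hmem
    exact hmem.2 hbL
  have hyz : ∀ c ∈ eventsFrom (E ++ u) y, c ∈ eventsFrom (E ++ p :: u ++ [r]) z := by
    intro c hc
    rw [hyev, List.mem_filter, decide_eq_true_eq, eventsFrom_cons, List.mem_cons, hnr] at hc
    refine hc.1.resolve_left ?_
    rintro rfl
    exact hc.2 hbL
  obtain ⟨R'', hR⟩ : ∃ R'', R' = r :: R'' := by
    have hmap := congrArg (List.map Prod.fst) h3'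
    rw [map_fst_eventsFrom, eventsFrom_append, List.filter_append] at hmap
    have : (eventsFrom (E ++ [p]) u).filter
        (fun c => S.hb (E ++ p :: (u ++ r :: z)) (nextEv E p) c) = [] := by
      rw [List.filter_eq_nil_iff]
      intro c hc
      rw [eventsFrom_append_of_notMem (by simpa using hS.indep_notMem hpu), ← hufil,
        List.mem_filter, decide_eq_true_eq] at hc
      simpa using hc.2
    rw [this, List.nil_append, eventsFrom_cons, List.filter_cons_of_pos] at hmap
    · exact ⟨_, hmap⟩
    · rw [decide_eq_true_eq, show E ++ [p] ++ u = E ++ p :: u by simp, hnr]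
      exact hbL
  rw [hy] at h1' hNN
  rw [hR] at h1'
  have hyr : S.isExec (E ++ u ++ y ++ [r]) :=
    hS.exec_concat_of_notMem hry (by simpa using hNN.2.1) hur
  have hpy : p ∉ u ++ y := by
    rw [← hy]
    exact hS.notMem_notdep hL2.2.1
  have hypr : S.isExec (E ++ u ++ y ++ [p, r]) :=
    hS.exec_left (w := R'') (by simpa using h1'.2.1)
  have h1'' : S.Equiv (E ++ p :: (u ++ r :: z)) (E ++ u ++ y ++ [p, r] ++ R'') := by
    simpa using h1'
  have key := hS.equiv_move_left_of_remove (E := E ++ u) (b := y) hpr hypr hyr (by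
    intro c hc
    have hcz := hyz c hc
    rw [nextEv_append_of_notMem hry]
    rw [show E ++ u ++ y = E ++ (u ++ y) by simp, nextEv_append_of_notMem hpy,
      show E ++ (u ++ y) ++ [p, r] = E ++ u ++ y ++ [p, r] by simp]
    have hcm : c ∈ events (E ++ u ++ y ++ [p, r]) :=
      mem_events_append_left (mem_events_append_right hc)
    have hm1 : nextEv E p ∈ events (E ++ u ++ y ++ [p, r]) := by
      refine mem_events_append_right ?_
      have := nextEv_mem_eventsFrom (E := E ++ (u ++ y)) (w := [p, r]) (p := p) (by simp)
      rwa [nextEv_append_of_notMem hpy, ← List.append_assoc] at this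
    have hm2 : nextEv (E ++ u) r ∈ events (E ++ u ++ y ++ [p, r]) := by
      refine mem_events_append_right ?_
      have := nextEv_mem_eventsFrom (E := E ++ u ++ y) (w := [p, r]) (p := r) (by simp)
      rwa [nextEv_append_of_notMem hry] at this
    rw [← hS.hb_congr h1'' rfl hcm hm1, ← hS.hb_congr h1'' rfl hcm hm2]
    have hL5 : E ++ p :: (u ++ r :: z) = E ++ p :: u ++ [r] ++ z := by simp
    rw [hL5]
    exact ⟨hS.not_hb_of_later hL3.2.1 hme hcz, hS.not_hb_of_later hL3.2.1 hme' hcz⟩)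
  refine ⟨y, ?_⟩
  have h7 := hS.equiv_append (w := [r]) hNN.symm (by simpa using hyr)
  exact h7.symm.trans (by simpa using key)

/-- A rearrangement of `A` extends by `w` to a rearrangement of `A ++ w`, so reversibility is
inherited by the prefix. -/
theorem revRace_prefix {A w : List P} {e e' : P × ℕ} (he : S.isExec (A ++ w))
    (h : S.RevRace (A ++ w) e e') (hm : e ∈ events A) (hm' : e' ∈ events A) :
    S.RevRace A e e' := by
  obtain ⟨⟨h1, h2, h3, h4, h5⟩, h6⟩ := h
  refine ⟨⟨mem_events.1 hm, mem_events.1 hm', h3, (hS.hb_prefix A w _ _ he hm hm').1 h4, ?_⟩, ?_⟩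
  · rintro ⟨d, hd, hde, hde', h7, h8⟩
    rw [← mem_events] at hd
    exact h5 ⟨d, mem_events.1 (mem_events_append_left hd), hde, hde',
      (hS.hb_prefix A w _ _ he hm hd).2 h7, (hS.hb_prefix A w _ _ he hd hm').2 h8⟩
  · intro E₁ E₂ heq
    have := hS.equiv_append heq.symm he
    exact h6 E₁ (E₂ ++ w) (by simpa using this.symm)

/-- Nothing lies between the two events in happens-before, so `e'` commutes with all that precedes
it among the events depending on `p`, and it can be executed directly after `p` behind `N`.
Reversibility, applied to this arrangement, says that its thread is enabled after `E.N` without `p`.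
-/
theorem equiv_of_revRace {E x : List P} {p : P} {e' : P × ℕ} (he : S.isExec (E ++ p :: x))
    (h : S.RevRace (E ++ p :: x) (nextEv E p) e') :
    let N := S.notdep (E ++ p :: x) (nextEv E p)
    (∃ R, S.Equiv (E ++ p :: x) (E ++ N ++ p :: e'.1 :: R)) ∧ S.isExec (E ++ N ++ [e'.1]) ∧
      e' = nextEv (E ++ N) e'.1 ∧ p ≠ e'.1 ∧ ¬ S.Indep E p (N ++ [e'.1]) := by
  classical
  intro N
  obtain ⟨r, i⟩ := e'
  obtain ⟨R, h1, h2, h3⟩ := hS.split_notdep he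
  have hind := hS.indep_notdep he
  change S.Equiv _ (E ++ N ++ p :: R) at h1
  change eventsFrom (E ++ N ++ [p]) R = _ at h3
  change S.Indep E p N at hind
  obtain ⟨⟨-, hm', hpr, hb, hdir⟩, hrev⟩ := h
  simp only [nextEv_fst] at hpr
  have hm : (r, i) ∈ eventsFrom (E ++ [p]) x := by
    rw [← mem_events, show E ++ p :: x = E ++ [p] ++ x by simp, events_append,
      List.mem_append] at hm'
    refine hm'.resolve_left (fun hm => ?_)
    rw [events_concat, List.mem_append, List.mem_singleton] at hm
    rcases hm with hm | hm
    · exact hS.not_hb_of_later he hm (by simp) hb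
    · exact hpr (by rw [nextEv, Prod.mk.injEq] at hm; exact hm.1.symm)
  have hmR : (r, i) ∈ eventsFrom (E ++ N ++ [p]) R := by
    rw [h3, List.mem_filter, decide_eq_true_eq]
    exact ⟨hm, hb⟩
  obtain ⟨l₁, l₂, hl⟩ := List.append_of_mem hmR
  have hRmap := congrArg (List.map Prod.fst) hl
  rw [map_fst_eventsFrom, List.map_append, List.map_cons] at hRmap
  set a := l₁.map Prod.fst
  set b := l₂.map Prod.fst
  have hla : eventsFrom (E ++ N ++ [p]) a = l₁ ∧ nextEv (E ++ N ++ [p] ++ a) r = (r, i) := by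
    rw [hRmap, eventsFrom_append] at hl
    have := List.append_inj hl (by
      have := congrArg List.length (map_fst_eventsFrom (E ++ N ++ [p]) a)
      rw [List.length_map] at this
      rw [this, List.length_map])
    refine ⟨this.1, ?_⟩
    have h' := this.2
    rw [eventsFrom_cons, List.cons.injEq] at h'
    exact h'.1
  have hla1 : ∀ c ∈ l₁, c ≠ (r, i) := by
    rintro c hc rfl
    have := nodup_eventsFrom (E ++ N ++ [p]) R
    rw [hl, List.nodup_append] at this
    exact this.2.2 _ hc _ (by simp) rfl
  -- An event of `l₁` depends on `p`; if it happened before `e'`, the race would not be direct.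
  have hnohb : ∀ c ∈ l₁, ¬ S.hb (E ++ p :: x) c (r, i) := by
    intro c hc hcb
    have hcR : c ∈ eventsFrom (E ++ N ++ [p]) R := by rw [hl]; simp [hc]
    rw [h3, List.mem_filter, decide_eq_true_eq] at hcR
    refine hdir ⟨c, mem_events.1 (hS.hb_mem _ _ _ he hcR.2).2, ?_, hla1 c hc, hcR.2, hcb⟩
    rintro rfl
    exact hS.hb_irrefl _ _ he hcR.2
  have hra : r ∉ a := by
    intro hra
    have hc := nextEv_mem_eventsFrom (E := E ++ N ++ [p]) hra
    have hlt : nextEv (E ++ N ++ [p]) r ∈ l₁ := by rw [← hla.1]; exact hc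
    refine hnohb _ hlt (hS.hb_thread _ r _ _ he ?_ ?_ ?_)
    · have hcR : nextEv (E ++ N ++ [p]) r ∈ eventsFrom (E ++ N ++ [p]) R := by
        rw [hl]
        exact List.mem_append_left _ hlt
      rw [h3, List.mem_filter, decide_eq_true_eq] at hcR
      exact (hS.hb_mem _ _ _ he hcR.2).2
    · exact (hS.hb_mem _ _ _ he hb).2
    · have := (mem_eventsFrom.1 hc).2
      have h4 := hla.2
      simp only [nextEv, Prod.mk.injEq] at this h4
      omega
  have hex : S.isExec (E ++ N ++ [p] ++ (a ++ [r]) ++ b) := by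
    have := h1.2.1
    rw [hRmap] at this
    simpa using this
  have h1' : S.Equiv (E ++ p :: x) ((E ++ N ++ [p] ++ (a ++ [r])) ++ b) := by
    rw [hRmap] at h1
    simpa using h1
  have hini : r ∈ S.initials (E ++ N ++ [p]) (a ++ [r]) := by
    refine ⟨by simp, fun c hc hne => ?_⟩
    rw [mem_domAfter, eventsFrom_append, List.mem_append] at hc
    rw [← nextEv_append_of_notMem hra, hla.2] at hne ⊢
    have hc1 : c ∈ l₁ := by
      rw [hla.1] at hc
      refine hc.resolve_right ?_
      rw [eventsFrom_cons, hla.2]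
      simpa using hne
    have := hnohb c hc1
    rwa [hS.hb_congr h1' rfl] at this
    · exact mem_events_append_right (mem_eventsFrom_append_left (by rwa [hla.1]))
    · refine mem_events_append_right ?_
      rw [eventsFrom_append, eventsFrom_cons, hla.2]
      simp
  have hind2 := hS.indep_of_mem_initials_concat (by simpa using hS.exec_left hex) hra hini
  have heq2 := hS.indep_equiv hind2
  have hfin : S.Equiv (E ++ p :: x) (E ++ N ++ p :: r :: (a ++ b)) := by
    have := hS.equiv_append (w := b) heq2.symm (by simpa using hex)
    exact h1'.trans (by simpa using this)
  have hNr : (r, i) = nextEv (E ++ N) r := by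
    rw [← hla.2, nextEv_append_of_notMem hra, nextEv_append_singleton_of_ne hpr.symm]
  have hpN := hS.indep_notMem hind
  have hexr : S.isExec (E ++ N ++ [r]) :=
    hrev (E ++ N) (a ++ b) hfin.symm (nextEv_append_of_notMem hpN) hNr.symm
  refine ⟨⟨_, hfin⟩, hexr, hNr, hpr, fun hc => ?_⟩
  have e1 := hS.equiv_append (w := r :: (a ++ b)) (hS.indep_equiv hind).symm
    (by simpa using hfin.2.1)
  have e2 : S.Equiv (E ++ p :: x) (E ++ p :: (N ++ [r]) ++ (a ++ b)) :=
    hfin.trans (by simpa using e1)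
  have hrm : (r, i) ∈ eventsFrom (E ++ [p]) (N ++ [r]) := by
    rw [eventsFrom_append, hNr, ← nextEv_append_singleton_of_ne hpr.symm,
      nextEv_congr (E' := E ++ [p] ++ N) (by
        simpa using (List.perm_append_comm (l₁ := N) (l₂ := [p])).append_left E)]
    simp
  refine hc.2 _ (mem_domAfter.2 hrm) ?_
  rwa [hS.hb_congr e2 rfl] at hb
  · exact mem_events_append_right (by simp)
  · exact mem_events_append_right (by simp [hrm])

/-- Source-DPOR computes `notdep` before the racing step is appended. As that step happens after the
event of `p`, it would be filtered out anyway. -/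
theorem notdep_concat {E x : List P} {p r : P} (he : S.isExec (E ++ p :: x ++ [r]))
    (h : S.hb (E ++ p :: x ++ [r]) (nextEv E p) (nextEv (E ++ p :: x) r)) :
    S.notdep (E ++ p :: x ++ [r]) (nextEv E p) = S.notdep (E ++ p :: x) (nextEv E p) := by
  classical
  rw [show E ++ p :: x ++ [r] = E ++ p :: (x ++ [r]) by simp] at he h ⊢
  rw [notdep_nextEv, notdep_nextEv, eventsFrom_append, List.filter_append]
  have h0 : (eventsFrom (E ++ [p] ++ x) [r]).filter
      (fun c => ¬ S.hb (E ++ p :: (x ++ [r])) (nextEv E p) c) = [] := by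
    rw [List.filter_eq_nil_iff]
    intro c hc
    simp only [eventsFrom_cons, eventsFrom_nil, List.mem_singleton] at hc
    subst hc
    simpa using h
  rw [h0, List.append_nil]
  congr 1
  apply List.filter_congr
  intro c hc
  rw [decide_eq_decide, show E ++ p :: (x ++ [r]) = E ++ p :: x ++ [r] by simp,
    hS.hb_prefix _ _ _ _ (by simpa using he)]
  · exact mem_events_append_right (by simp)
  · exact mem_events_append_right (by simp [hc])

/-- The sequence used by Source-DPOR for reversing a race is compatible with every sequence in
which the race is reversed. -/
theorem equiv_notdep_of_prefix {E u z x x' : List P} {p r : P} (hpu : S.Indep E p u)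
    (hur : S.isExec (E ++ u ++ [r])) (hpr : p ≠ r) (hn : ¬ S.Indep E p (u ++ [r]))
    (hL : S.Equiv (E ++ p :: x ++ r :: x') (E ++ p :: u ++ r :: z))
    (hr : nextEv (E ++ p :: x) r = nextEv (E ++ u) r) :
    S.RevRace (E ++ p :: x ++ [r]) (nextEv E p) (nextEv (E ++ p :: x) r) ∧
    ∃ y y', S.Equiv (E ++ S.notdep (E ++ p :: x) (nextEv E p) ++ r :: y') (E ++ u ++ r :: y) := by
  have hrev := hS.revRace_of_race hpu hur hpr hn hL
  have hL1 : S.isExec (E ++ p :: x ++ [r] ++ x') := by simpa using hL.1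
  rw [← hr] at hrev
  have hrev' := hS.revRace_prefix (A := E ++ p :: x ++ [r]) (w := x') hL1 (by simpa using hrev)
    (mem_events_append_left (mem_events_append_right (by simp)))
    (mem_events_append_right (by simp))
  refine ⟨hrev', ?_⟩
  have hN := hS.notdep_concat (hS.exec_left hL1) hrev'.1.2.2.2.1
  have heA : S.isExec (E ++ p :: (x ++ [r])) := by simpa using hS.exec_left hL1
  obtain ⟨⟨R, h1⟩, h2, h3, h4, h5⟩ := hS.equiv_of_revRace heA (e' := nextEv (E ++ p :: x) r)
    (by simpa using hrev')
  have hind := hS.indep_notdep heA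
  rw [show E ++ p :: (x ++ [r]) = E ++ p :: x ++ [r] by simp, hN] at h1 h2 h3 h5 hind
  simp only [nextEv_fst] at h1 h2 h3 h4 h5
  set N := S.notdep (E ++ p :: x) (nextEv E p)
  have e1 := hS.equiv_append (w := r :: R) (hS.indep_equiv hind).symm (by simpa using h1.2.1)
  have e2 : S.Equiv (E ++ p :: x ++ [r]) (E ++ p :: N ++ r :: R) :=
    h1.trans (by simpa using e1)
  have e3 := hS.equiv_append (w := x') e2 hL1
  -- Both `notdep` of the prefix and `u` satisfy the assumptions of `equiv_notdep` for the same full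
  -- execution; the two descriptions of the reversal of that execution are compared.
  obtain ⟨y', h6⟩ := hS.equiv_notdep (x := x ++ r :: x') (z := R ++ x') hind h2 h4 h5
    (by simpa using e3)
  obtain ⟨y, h7⟩ := hS.equiv_notdep (x := x ++ r :: x') (z := z) hpu hur hpr hn
    (by simpa using hL)
  exact ⟨y, y', h6.symm.trans h7⟩

end HBSystem.Valid

end RaceReversal

end RelaxedDPOR

namespace RelaxedDPOR

/-! ### Termination of the explorations -/

section Termination

variable {P : Type*}

theorem assign_self {α β : Type*} (f : α → β) (a : α) (b : β) : assign f a b a = b := by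
  simp [assign]

theorem assign_ne {α β : Type*} (f : α → β) {a c : α} (b : β) (h : c ≠ a) :
    assign f a b c = f c := by
  simp [assign, h]

/-- The rank 2 of the loop head equals the constant of a suspended call in `frameMeasure`, so a
recursive call does not change the component of the caller. -/
def Ctl.rank : Ctl → ℕ
  | .enter => 3
  | .loop => 2
  | .ret => 1

/-- The progress of the call of `Explore` for the prefix of length `i` of `E`. -/
noncomputable def frameMeasure (S : HBSystem P) (E : List P) (c : Ctl) (sleep : List P → Set P)
    (i : ℕ) : WithTop ℕ :=
  if i < E.length then ((4 * (S.enabled (E.take i) \ sleep (E.take i)).ncard + 2 : ℕ) : WithTop ℕ)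
  else if i = E.length then ((4 * (S.enabled E \ sleep E).ncard + c.rank : ℕ) : WithTop ℕ)
  else ⊤

/-- Lexicographic decrease of the progress of the active calls. -/
def Advances (S : HBSystem P) (N : ℕ) (E' : List P) (c' : Ctl) (sleep' : List P → Set P)
    (E : List P) (c : Ctl) (sleep : List P → Set P) : Prop :=
  Pi.Lex (ι := Fin (N + 2)) (β := fun _ => WithTop ℕ) (· < ·) (fun {_} a b => a < b)
    (fun i => frameMeasure S E' c' sleep' i) (fun i => frameMeasure S E c sleep i)

theorem advances_ctl (S : HBSystem P) {N : ℕ} {E : List P} {c c' : Ctl}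
    {sleep : List P → Set P} (hE : E.length ≤ N) (h : c'.rank < c.rank) :
    Advances S N E c' sleep E c sleep := by
  refine ⟨⟨E.length, by omega⟩, fun j hj => ?_, ?_⟩
  · have : (j : ℕ) < E.length := hj
    simp [frameMeasure, this]
  · simp only [frameMeasure, lt_irrefl, if_false, if_true]
    exact_mod_cast by omega

/-- The components up to the caller are unchanged; the component of the new call drops from `⊤` to a
finite value. -/
theorem advances_call (S : HBSystem P) {N : ℕ} {E : List P} {p : P}
    {sleep sleep' : List P → Set P} (hE : E.length ≤ N)
    (h : ∀ A, A ≠ E ++ [p] → sleep' A = sleep A) :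
    Advances S N (E ++ [p]) .enter sleep' E .loop sleep := by
  refine ⟨⟨E.length + 1, by omega⟩, fun j hj => ?_, ?_⟩
  · have hj' : (j : ℕ) < E.length + 1 := hj
    have hlen : (j : ℕ) < (E ++ [p]).length := by simpa using hj'
    simp only [frameMeasure, hlen, if_true]
    rcases Nat.lt_or_eq_of_le (Nat.lt_succ_iff.1 hj') with h1 | h1
    · rw [if_pos h1, List.take_append_of_le_length h1.le, h]
      intro h2
      have := congrArg List.length h2
      simp at this
      omega
    · rw [if_neg (by omega), if_pos h1, h1]
      simp only [List.take_left']
      rw [h _ (by simp)]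
      rfl
  · simp only [frameMeasure, List.length_append, List.length_singleton]
    rw [if_neg (by omega), if_pos trivial, if_neg (by omega), if_neg (by omega)]
    exact WithTop.coe_lt_top _

/-- Putting `p` to sleep decreases the number of enabled threads that are awake, and this outweighs
the reset of all later components to `⊤`. -/
theorem advances_back (S : HBSystem P) {N : ℕ} {E : List P} {p : P} {c : Ctl}
    {sleep sleep' : List P → Set P} (hE : E.length ≤ N)
    (h : ∀ A, A ≠ E → sleep' A = sleep A) (h' : sleep' E = insert p (sleep E))
    (hfin : (S.enabled E).Finite) (hp : p ∈ S.enabled E) (hp' : p ∉ sleep E) :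
    Advances S N E .loop sleep' (E ++ [p]) c sleep := by
  refine ⟨⟨E.length, by omega⟩, fun j hj => ?_, ?_⟩
  · have hj' : (j : ℕ) < E.length := hj
    have hlen : (j : ℕ) < (E ++ [p]).length := by simp; omega
    simp only [frameMeasure, hlen, hj', if_true]
    rw [List.take_append_of_le_length hj'.le, h]
    intro h2
    have := congrArg List.length h2
    simp at this
    omega
  · simp only [frameMeasure, lt_irrefl, if_false, if_true]
    rw [if_pos (by simp), List.take_left', h']
    · have : (S.enabled E \ insert p (sleep E)).ncard < (S.enabled E \ sleep E).ncard := by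
        apply Set.ncard_lt_ncard
        · refine ⟨Set.sdiff_subset_sdiff_right (Set.subset_insert _ _), fun hsub => ?_⟩
          exact (hsub ⟨hp, hp'⟩).2 (Set.mem_insert _ _)
        · exact hfin.subset Set.sdiff_subset
      simp only [Ctl.rank]
      exact_mod_cast by omega
    · rfl

/-- The lexicographic order on finitely many copies of `WithTop ℕ` is well founded. There are `N +
2` components because a call from a sequence of length `N` concerns the component `N + 1`. -/
theorem terminates_of_advances {σ : Type*} {next : σ → σ → Prop} (S : HBSystem P) (N : ℕ)
    (seq : σ → List P) (ctl : σ → Ctl) (sleep : σ → List P → Set P) (Inv : σ → Prop)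
    (hstep : ∀ s s', Inv s → next s s' → Inv s' ∧
      Advances S N (seq s') (ctl s') (sleep s') (seq s) (ctl s) (sleep s))
    (s : σ) (hs : Inv s) : Terminates next s := by
  have hwf : WellFounded (fun s' s : σ =>
      Advances S N (seq s') (ctl s') (sleep s') (seq s) (ctl s) (sleep s)) :=
    InvImage.wf (fun s => fun i : Fin (N + 2) => frameMeasure S (seq s) (ctl s) (sleep s) i)
      (Pi.Lex.wellFounded (· < ·) (fun _ => wellFounded_lt))
  induction s using hwf.induction with
  | _ s ih =>
    exact Acc.intro _ fun s' h => ih s' (hstep s s' hs h).2 (hstep s s' hs h).1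

theorem invariant_of_reflTransGen {σ : Type*} {next : σ → σ → Prop} {Inv : σ → Prop}
    (hstep : ∀ s s', Inv s → next s s' → Inv s') {s s' : σ} (hs : Inv s)
    (h : Relation.ReflTransGen next s s') : Inv s' := by
  induction h with
  | refl => exact hs
  | tail _ h ih => exact hstep _ _ ih h

end Termination

/-! ### Sleep sets -/

section Sleep

variable {P : Type*} {S : HBSystem P}

open HBSystem

/-- The sleep set with which `Explore(E, …)` is called. -/
def inherited (S : HBSystem P) (sleep : List P → Set P) (E : List P) : Set P :=
  {q | ∃ E' p, E = E' ++ [p] ∧ q ∈ sleep E' ∧ S.Indep E' p [q]}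

@[simp] theorem inherited_nil (sleep : List P → Set P) : inherited S sleep [] = ∅ := by
  ext q
  simp [inherited]

theorem mem_inherited_concat {sleep : List P → Set P} {E : List P} {p q : P} :
    q ∈ inherited S sleep (E ++ [p]) ↔ q ∈ sleep E ∧ S.Indep E p [q] := by
  constructor
  · rintro ⟨E', p', h, h1, h2⟩
    obtain ⟨rfl, h3⟩ := List.append_inj' h rfl
    obtain rfl : p = p' := by simpa using h3
    exact ⟨h1, h2⟩
  · rintro ⟨h1, h2⟩
    exact ⟨E, p, rfl, h1, h2⟩

theorem inherited_congr {sleep sleep' : List P → Set P} {E : List P}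
    (h : ∀ A, A <+: E → A ≠ E → sleep' A = sleep A) :
    inherited S sleep' E = inherited S sleep E := by
  rcases List.eq_nil_or_concat E with rfl | ⟨E, p, rfl⟩
  · simp
  · rw [List.concat_eq_append] at h ⊢
    ext q
    rw [mem_inherited_concat, mem_inherited_concat, h E (List.prefix_append _ _) (by simp)]

/-- A sleeping thread is handed down from call to call as long as it is independent of the thread
that is executed. -/
theorem mem_sleep_append (hS : S.Valid) {sleep : List P → Set P} {E x : List P} {q : P}
    (hinh : ∀ A, A <+: E ++ x → inherited S sleep A ⊆ sleep A) (hq : q ∈ sleep E)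
    (hind : S.Indep E q x) : q ∈ sleep (E ++ x) := by
  induction x using List.reverseRecOn with
  | nil => simpa using hq
  | append_singleton x b ih =>
    obtain ⟨h1, h2⟩ := hS.indep_append.1 hind
    have := ih (fun A hA => hinh A (hA.trans (by simp))) h1
    rw [← List.append_assoc]
    exact hinh (E ++ x ++ [b]) (by simp) (mem_inherited_concat.2
      ⟨this, hS.indep_singleton_symm h2⟩)

theorem prefix_concat_iff' {A E : List P} {p : P} : A <+: E ++ [p] ↔ A <+: E ∨ A = E ++ [p] := by
  rw [List.prefix_concat_iff]
  exact or_comm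

theorem prefix_ne_concat {A E : List P} {p : P} (h : A <+: E) : A ≠ E ++ [p] := by
  rintro rfl
  have := h.length_le
  simp at this

theorem concat_prefix_concat {A E : List P} {p q : P} (h : A ++ [q] <+: E ++ [p]) :
    A ++ [q] <+: E ∨ (A = E ∧ q = p) := by
  rcases prefix_concat_iff'.1 h with h | h
  · exact .inl h
  · obtain ⟨h1, h2⟩ := List.append_inj' h rfl
    exact .inr ⟨h1, by simpa using h2⟩

theorem exists_split_of_mem_eventsFrom {E w : List P} {e : P × ℕ} (h : e ∈ eventsFrom E w) :
    ∃ a b, w = a ++ e.1 :: b ∧ e = nextEv (E ++ a) e.1 := by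
  induction w generalizing E with
  | nil => simp at h
  | cons p w ih =>
    rw [eventsFrom_cons, List.mem_cons] at h
    rcases h with rfl | h
    · exact ⟨[], w, by simp, by simp⟩
    · obtain ⟨a, b, h1, h2⟩ := ih h
      exact ⟨p :: a, b, by conv_lhs => rw [h1]
                           simp, by simpa using h2⟩

theorem exists_first_split {l : List P} {Q : P → Prop} (h : ∃ p ∈ l, Q p) :
    ∃ l₁ p l₂, l = l₁ ++ p :: l₂ ∧ Q p ∧ ∀ q ∈ l₁, ¬ Q q := by
  induction l with
  | nil => simp at h
  | cons a l ih =>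
    by_cases ha : Q a
    · exact ⟨[], a, l, rfl, ha, by simp⟩
    · obtain ⟨l₁, p, l₂, rfl, h1, h2⟩ := ih (by simpa [ha] using h)
      exact ⟨a :: l₁, p, l₂, rfl, h1, by simpa [ha] using h2⟩

/-- Among the threads in `D`, one that stays independent for longest. -/
theorem exists_longest {D : Set P} {Q : P → List P → Prop} {w : List P}
    (h0 : ∃ p ∈ D, Q p []) (h : ∀ p ∈ D, ¬ Q p w) :
    ∃ p ∈ D, ∃ u r w', w = u ++ r :: w' ∧ Q p u ∧ ∀ q ∈ D, ¬ Q q (u ++ [r]) := by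
  induction w using List.reverseRecOn with
  | nil => obtain ⟨p, hp, hq⟩ := h0; exact absurd hq (h p hp)
  | append_singleton w r ih =>
    by_cases h1 : ∃ p ∈ D, Q p w
    · obtain ⟨p, hp, hq⟩ := h1
      exact ⟨p, hp, w, r, [], rfl, hq, h⟩
    · push Not at h1
      obtain ⟨p, hp, u, r', w', rfl, h2, h3⟩ := ih h1
      exact ⟨p, hp, u, r', w' ++ [r], by simp, h2, h3⟩

end Sleep

end RelaxedDPOR

namespace RelaxedDPOR

/-! ### Correctness of Source-DPOR -/

section Source

variable {P : Type*} {S : HBSystem P} (hS : S.Valid)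

open HBSystem

/-- Invariant of Source-DPOR, for the set `V` of the sequences for which `Explore` has been called
and the lists `done E` of the threads from which the active call for `E` has returned. -/
structure SourceInv (S : HBSystem P) (s : SourceState P) (V : Set (List P))
    (done : List P → List P) : Prop where
  visited_exec : ∀ L ∈ V, S.isExec L
  visited_prefix : ∀ L w, L ++ w ∈ V → L ∈ V
  seq_visited : s.seq ∈ V
  sleep_iff : ∀ E, E <+: s.seq → ∀ q, q ∈ s.sleep E ↔ q ∈ inherited S s.sleep E ∨ q ∈ done E
  path : ∀ E p, E ++ [p] <+: s.seq → p ∉ s.sleep E ∧ p ∈ s.backtrack E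
  visited : ∀ E p, E <+: s.seq → E ++ [p] ∈ V → p ∈ done E ∨ E ++ [p] <+: s.seq
  fresh : s.ctl = .enter → done s.seq = []
  cover : ∀ E, E <+: s.seq → ∀ l₁ p l₂, done E = l₁ ++ p :: l₂ → S.isExec (E ++ [p]) ∧
    ∀ w, S.isExec (E ++ p :: w) → (∀ q, (q ∈ inherited S s.sleep E ∨ q ∈ l₁) →
      S.Indep E p [q] → q ∉ S.initials (E ++ [p]) w) →
      ∃ L z, E ++ p :: L ∈ V ∧ S.Equiv (E ++ p :: L) (E ++ p :: w ++ z)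
  asleep : ∀ E, E <+: s.seq → ∀ x, E ++ x ∈ V → ∀ q ∈ inherited S s.sleep E, q ∉ S.initials E x
  races : ∀ E, E <+: s.seq → ∀ p x r, E ++ p :: x ++ [r] ∈ V →
    S.RevRace (E ++ p :: x ++ [r]) (nextEv E p) (nextEv (E ++ p :: x) r) →
    (S.initials E (S.notdep (E ++ p :: x) (nextEv E p) ++ [r]) ∩ s.backtrack E).Nonempty
  backtrack_enabled : ∀ E, E <+: s.seq → (E ≠ s.seq ∨ s.ctl = .loop) →
    s.backtrack E ⊆ S.enabled E ∧ ∃ p ∈ s.backtrack E, p ∉ inherited S s.sleep E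
  ret : s.ctl = .ret → ∀ w, S.isExec (s.seq ++ w) →
    (∀ q ∈ inherited S s.sleep s.seq, q ∉ S.initials s.seq w) →
    ∃ L z, s.seq ++ L ∈ V ∧ S.Equiv (s.seq ++ L) (s.seq ++ w ++ z)
  logged : ∀ L ∈ V, S.enabled L = ∅ → L ∈ s.log ∨ (L = s.seq ∧ s.ctl = .enter)
  log_maximal : ∀ L ∈ s.log, S.isExec L ∧ S.enabled L = ∅

theorem sourceInv_init (hS : S.Valid) : SourceInv S SourceState.init {[]} (fun _ => []) where
  visited_exec := by
    rintro L rfl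
    exact hS.exec_nil
  visited_prefix := by
    intro L w h
    simp only [Set.mem_singleton_iff, List.append_eq_nil_iff] at h ⊢
    exact h.1
  seq_visited := rfl
  sleep_iff := by
    intro E hE q
    have : E = [] := by simpa [SourceState.init] using hE
    subst this
    simp [SourceState.init]
  path := by
    intro E p h
    simp [SourceState.init] at h
  visited := by
    intro E p _ h
    simp at h
  fresh := fun _ => rfl
  cover := by
    intro E _ l₁ p l₂ h
    simp at h
  asleep := by
    intro E hE x _ q hq
    have : E = [] := by simpa [SourceState.init] using hE
    subst this
    simp at hq
  races := by
    intro E _ p x r h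
    simp at h
  backtrack_enabled := by
    intro E hE h
    have : E = [] := by simpa [SourceState.init] using hE
    subst this
    simp [SourceState.init] at h
  ret := by
    intro h
    simp [SourceState.init] at h
  logged := by
    rintro L rfl _
    exact .inr ⟨rfl, rfl⟩
  log_maximal := by simp [SourceState.init]

/-- What the invariant needs of race detection, whatever choices are made: backtrack sets grow, each
listed race is answered, and additions are initials of a reversal, hence enabled. -/
theorem sourceRaces_spec {E : List P} {p : P} {l : List (P × ℕ)} {bt bt' : List P → Set P}
    (h : SourceRaces S E p l bt bt') :
    (∀ A, bt A ⊆ bt' A) ∧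
    (∀ e ∈ l, (S.initials (pre E e) (S.notdep E e ++ [p]) ∩ bt' (pre E e)).Nonempty) ∧
    ∀ A, ∀ q ∈ bt' A, q ∈ bt A ∨
      ∃ e ∈ l, A = pre E e ∧ q ∈ S.initials A (S.notdep E e ++ [p]) := by
  induction h with
  | nil bt => simp
  | skip e l bt bt' h hl ih =>
    obtain ⟨h1, h2, h3⟩ := ih
    refine ⟨h1, ?_, ?_⟩
    · intro e' he'
      rcases List.mem_cons.1 he' with rfl | he'
      · obtain ⟨q, hq1, hq2⟩ := h
        exact ⟨q, hq1, h1 _ hq2⟩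
      · exact h2 e' he'
    · intro A q hq
      rcases h3 A q hq with h | ⟨e', he', h⟩
      · exact .inl h
      · exact .inr ⟨e', List.mem_cons_of_mem _ he', h⟩
  | add e l bt bt' q h hq hl ih =>
    obtain ⟨h1, h2, h3⟩ := ih
    have hsub : ∀ A, bt A ⊆ assign bt (pre E e) (insert q (bt (pre E e))) A := by
      intro A
      by_cases hA : A = pre E e
      · subst hA
        rw [assign_self]
        exact Set.subset_insert _ _
      · rw [assign_ne _ _ hA]
    refine ⟨fun A => (hsub A).trans (h1 A), ?_, ?_⟩
    · intro e' he'
      rcases List.mem_cons.1 he' with rfl | he'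
      · refine ⟨q, hq, h1 _ ?_⟩
        rw [assign_self]
        exact Set.mem_insert _ _
      · exact h2 e' he'
    · intro A q' hq'
      rcases h3 A q' hq' with h4 | ⟨e', he', h4⟩
      · by_cases hA : A = pre E e
        · subst hA
          rw [assign_self] at h4
          rcases h4 with rfl | h4
          · exact .inr ⟨e, by simp, rfl, hq⟩
          · exact .inl h4
        · rw [assign_ne _ _ hA] at h4
          exact .inl h4
      · exact .inr ⟨e', List.mem_cons_of_mem _ he', h4⟩

theorem exists_sourceRaces {E : List P} {p : P} {l : List (P × ℕ)} (bt : List P → Set P)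
    (h : ∀ e ∈ l, (S.initials (pre E e) (S.notdep E e ++ [p])).Nonempty) :
    ∃ bt', SourceRaces S E p l bt bt' := by
  induction l generalizing bt with
  | nil => exact ⟨bt, .nil bt⟩
  | cons e l ih =>
    have ih' := fun bt => ih bt (fun e he => h e (by simp [he]))
    by_cases hne : (S.initials (pre E e) (S.notdep E e ++ [p]) ∩ bt (pre E e)).Nonempty
    · obtain ⟨bt', h'⟩ := ih' bt
      exact ⟨bt', .skip e l bt bt' hne h'⟩
    · obtain ⟨q, hq⟩ := h e (by simp)
      obtain ⟨bt', h'⟩ := ih' (assign bt (pre E e) (insert q (bt (pre E e))))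
      exact ⟨bt', .add e l bt bt' q (Set.not_nonempty_iff_eq_empty.1 hne) hq h'⟩

include hS

/-- The sequence that reverses a race with the last event is an execution sequence. -/
theorem exec_notdep_concat {E : List P} {p : P} (he : S.isExec (E ++ [p])) {e : P × ℕ}
    (hd : e ∈ dom E) (hr : S.RevRace (E ++ [p]) e (nextEv E p)) :
    ∃ A B, E = A ++ e.1 :: B ∧ e = nextEv A e.1 ∧ pre E e = A ∧
      S.isExec (A ++ (S.notdep E e ++ [p])) := by
  obtain ⟨A, B, hE, he'⟩ := exists_split_of_mem_events (mem_events.2 hd)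
  refine ⟨A, B, hE, he', ?_, ?_⟩
  · have := pre_nextEv A B e.1
    rwa [← he', ← hE] at this
  · subst hE
    rw [he'] at hr
    simp only [nextEv_fst] at hr
    have h1 := hS.notdep_concat he hr.1.2.2.2.1
    have h2 := (hS.equiv_of_revRace (E := A) (x := B ++ [p]) (by simpa using he)
      (by simpa using hr)).2.1
    rw [show A ++ e.1 :: (B ++ [p]) = A ++ e.1 :: B ++ [p] by simp, h1, ← he'] at h2
    simpa using h2

theorem mem_enabled_of_mem_initials {E w : List P} {q : P} (he : S.isExec (E ++ w))
    (h : q ∈ S.initials E w) : q ∈ S.enabled E := by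
  obtain ⟨w', h'⟩ := (hS.mem_initials_iff he).1 h
  exact hS.exec_left (w := w') (by simpa using h'.2.1)

theorem head_mem_initials {E w : List P} {q : P} (he : S.isExec (E ++ q :: w)) :
    q ∈ S.initials E (q :: w) := hS.mem_initials_of_equiv (.refl he)

/-- If some thread from which the call has returned is a weak initial of `w`, the first such thread
covers `w`. Otherwise take the one that is independent of the longest prefix `u` of `w`, with `r`
behind `u`. The exploration below `p` has met `p.u.r`, detected the race of `p` with `r`, and
ensured that an initial `q` of its reversal is in the backtrack set. At exit `q` is asleep, so it is
inherited or done; either possibility contradicts the assumptions on `w` or the choice of `p`. -/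
theorem SourceInv.exists_of_exit {s : SourceState P} {V : Set (List P)} {done : List P → List P}
    (I : SourceInv S s V done) (hc : s.ctl = .loop) (h : s.backtrack s.seq ⊆ s.sleep s.seq)
    {w : List P} (hw : S.isExec (s.seq ++ w))
    (hsl : ∀ q ∈ inherited S s.sleep s.seq, q ∉ S.initials s.seq w) :
    ∃ L z, s.seq ++ L ∈ V ∧ S.Equiv (s.seq ++ L) (s.seq ++ w ++ z) := by
  have hseq : s.seq <+: s.seq := List.prefix_refl _
  have hini : ∀ {u r w'}, w = u ++ r :: w' → ∀ q, q ∈ S.initials s.seq (u ++ [r]) →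
      q ∈ S.initials s.seq w := by
    rintro u r w' rfl q hq
    have := hS.initials_append (b := w') (by simpa using hw) hq
    simpa using this
  by_cases hA : ∃ p ∈ done s.seq, p ∈ S.weakInitials s.seq w
  · obtain ⟨l₁, p, l₂, hl, hp, hfirst⟩ := exists_first_split hA
    -- If `p` is only independent of `w`, it is appended to `w`; thus `b` is empty or `[p]`.
    obtain ⟨w₂, b, hb, hbp⟩ : ∃ w₂ b, S.Equiv (s.seq ++ p :: w₂) (s.seq ++ (w ++ b)) ∧
        ∀ q ∈ b, q = p := by
      rcases hp with hp | hp
      · obtain ⟨w₂, h2⟩ := (hS.mem_initials_iff hw).1 hp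
        exact ⟨w₂, [], by simpa using h2.symm, by simp⟩
      · exact ⟨w, [p], by simpa using hS.indep_equiv hp, by simp⟩
    obtain ⟨L, z, h1, h2⟩ := (I.cover _ hseq l₁ p l₂ hl).2 w₂ hb.1 (by
      intro q hq hpq hqi
      have hne := hS.indep_ne hpq
      obtain ⟨w₃, h3⟩ := (hS.mem_initials_iff (by simpa using hb.1)).1 hqi
      have h4 := hS.equiv_append (w := w₃) (hS.indep_equiv hpq) (by simpa using h3.2.1)
      have h5 : q ∈ S.initials s.seq (w ++ b) := by
        refine hS.mem_initials_of_equiv (w' := p :: w₃) (hb.symm.trans ?_)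
        have h3' : S.Equiv (s.seq ++ p :: w₂) (s.seq ++ [p, q] ++ w₃) := by simpa using h3
        exact h3'.trans (by simpa using h4)
      have hqw : q ∈ w := by
        refine (List.mem_append.1 h5.1).resolve_right (fun h6 => hne (hbp q h6).symm)
      have h6 := hS.initials_of_append (by simpa using hb.2.1) hqw h5
      rcases hq with hq | hq
      · exact hsl q hq h6
      · exact hfirst q hq (.inl h6))
    refine ⟨p :: L, b ++ z, h1, h2.trans ?_⟩
    have := hS.equiv_append (w := z) hb h2.2.1
    simpa using this
  · push Not at hA
    obtain ⟨hbt, p₀, hp₀, hp₀'⟩ := I.backtrack_enabled _ hseq (.inr hc)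
    have hp₀d : p₀ ∈ done s.seq :=
      ((I.sleep_iff _ hseq p₀).1 (h hp₀)).resolve_left hp₀'
    have hdone_exec : ∀ p ∈ done s.seq, S.isExec (s.seq ++ [p]) := by
      intro p hp
      obtain ⟨l₁, l₂, hl⟩ := List.append_of_mem hp
      exact (I.cover _ hseq l₁ p l₂ hl).1
    obtain ⟨p, hp, u, r, w', rfl, hpu, hlong⟩ := exists_longest
      (D := {p | p ∈ done s.seq}) (Q := S.Indep s.seq) (w := w)
      ⟨p₀, hp₀d, indep_nil (hdone_exec p₀ hp₀d)⟩ (fun p hp h => hA p hp (.inr h))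
    simp only [Set.mem_ofPred_eq] at hp hlong
    have hur : S.isExec (s.seq ++ u ++ [r]) := hS.exec_left (w := w') (by simpa using hw)
    have hdI : ∀ q ∈ done s.seq, q ∉ S.initials s.seq (u ++ [r]) :=
      fun q hq h => hA q hq (.inl (hini rfl q h))
    have hpr : p ≠ r := by
      rintro rfl
      refine hdI p hp (hS.mem_initials_of_equiv (w' := u) ?_)
      simpa using (hS.indep_equiv hpu).symm
    obtain ⟨hex, heq⟩ := hS.exec_of_indep hpu hur hpr
    have hn := hlong p hp
    obtain ⟨l₁, l₂, hl⟩ := List.append_of_mem hp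
    -- The cover of `p` requires that no earlier thread that is asleep below `p` can start `u.r`; by
    -- `mem_initials_or_indep_of_race` such a thread would be an initial of `u` or independent of
    -- `u.r`.
    obtain ⟨L, z, h1, h2⟩ := (I.cover _ hseq l₁ p l₂ hl).2 (u ++ [r]) (by simpa using hex) (by
      intro q hq hpq hqi
      have hne := hS.indep_ne hpq
      obtain ⟨w₃, h3⟩ := (hS.mem_initials_iff (by simpa using hex)).1 hqi
      have h4 := hS.equiv_append (w := w₃) (hS.indep_equiv hpq) (by simpa using h3.2.1)
      rcases hS.mem_initials_or_indep_of_race hpu hur hpr hn hne.symm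
        ⟨p :: w₃, [], by
          have h3' : S.Equiv (s.seq ++ (p :: u ++ [r])) (s.seq ++ [p, q] ++ w₃) := by
            simpa using h3
          have := (h3'.trans h4).symm
          simpa using this⟩ with h5 | h5
      · have h6 := hS.initials_append hur h5
        rcases hq with hq | hq
        · exact hsl q hq (hini rfl q h6)
        · exact hdI q (by simp [hl, hq]) h6
      · exact hS.indep_notMem h5 hqi.1)
    have hnr : nextEv (s.seq ++ p :: u) r = nextEv (s.seq ++ u) r := by
      rw [nextEv_congr (E' := s.seq ++ u ++ [p]) (by simpa using (hS.indep_equiv hpu).perm),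
        nextEv_append_singleton_of_ne hpr.symm]
    have hmem : nextEv (s.seq ++ u) r ∈ eventsFrom (s.seq ++ [p]) L := by
      rw [mem_eventsFrom_of_perm (List.Perm.refl _) (w' := u ++ [r] ++ z)
        (by simpa using h2.perm), ← hnr, eventsFrom_append, eventsFrom_append]
      simp
    obtain ⟨x, x', rfl, hx⟩ := exists_split_of_mem_eventsFrom hmem
    simp only [nextEv_fst] at hx h1 h2 hmem
    obtain ⟨hrev, y, y', h3⟩ := hS.equiv_notdep_of_prefix (E := s.seq) (u := u) (z := z) (x := x)
      (x' := x') hpu hur hpr hn (by simpa using h2) (by rw [hx]; simp)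
    have hxV : s.seq ++ p :: x ++ [r] ∈ V := I.visited_prefix _ x' (by simpa using h1)
    obtain ⟨q, hq, hqb⟩ := I.races _ hseq p x r hxV hrev
    have hqs := (I.sleep_iff _ hseq q).1 (h hqb)
    set N := S.notdep (s.seq ++ p :: x) (nextEv s.seq p)
    have h4 : q ∈ S.initials s.seq (u ++ r :: y) := by
      rw [hS.initials_congr (w' := N ++ [r] ++ y') (by simpa using h3.symm)]
      exact hS.initials_append (by simpa using h3.1) hq
    obtain ⟨w₃, h5⟩ := (hS.mem_initials_iff (by simpa using h3.2.1)).1 h4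
    exfalso
    rcases hS.mem_initials_or_indep (E := s.seq) (w := u ++ [r]) (w' := y) (v := w₃) (q := q)
      (by simpa using h5.symm) with h6 | h6
    · rcases hqs with hqs | hqs
      · exact hsl q hqs (hini rfl q h6)
      · exact hdI q hqs h6
    · rcases hqs with hqs | hqs
      -- Here `q` does not occur in `u.r`, so it lies in `notdep` and is an initial of it. As
      -- `notdep` can be executed first in `p.x`, the inherited thread `q` is an initial of a
      -- visited sequence, contrary to `asleep`.
      · have hqr : q ∉ u ++ [r] := hS.indep_notMem h6
        have hexN : S.isExec (s.seq ++ N ++ [r]) := hS.exec_left (w := y') (by simpa using h3.1)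
        have hqN : q ∈ S.initials s.seq N := by
          refine hS.initials_of_append hexN ?_ hq
          have := hq.1
          simp only [List.mem_append, List.mem_singleton] at this hqr
          tauto
        obtain ⟨R, h7, -, -⟩ := hS.split_notdep (E := s.seq) (x := x) (p := p)
          (I.visited_exec _ (I.visited_prefix _ [r] hxV))
        have h8 : q ∈ S.initials s.seq (N ++ p :: R) := hS.initials_append (by simpa using h7.2.1) hqN
        rw [← hS.initials_congr (w := p :: x) (by simpa using h7)] at h8
        exact I.asleep _ hseq _ (I.visited_prefix _ [r] hxV) q hqs h8
      · exact hlong q hqs h6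

omit hS in
theorem SourceInv.inherited_subset {s : SourceState P} {V : Set (List P)}
    {done : List P → List P} (I : SourceInv S s V done) {A : List P} (hA : A <+: s.seq) :
    inherited S s.sleep A ⊆ s.sleep A := fun q hq => (I.sleep_iff A hA q).2 (.inl hq)

/-- The points that need work are that `asleep` and `races` hold for the newly visited sequence, and
that the threads added to the backtrack sets are enabled. -/
theorem SourceInv.call {s : SourceState P} {V : Set (List P)} {done : List P → List P}
    (I : SourceInv S s V done) (hc : s.ctl = .loop) {p : P}
    (hp : p ∈ s.backtrack s.seq \ s.sleep s.seq) {l : List (P × ℕ)}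
    (hl : ∀ e, e ∈ l ↔ e ∈ dom s.seq ∧ S.RevRace (s.seq ++ [p]) e (nextEv s.seq p))
    {bt : List P → Set P} (hbt : SourceRaces S s.seq p l s.backtrack bt) :
    SourceInv S
        { s with
          seq := s.seq ++ [p]
          ctl := .enter
          sleep := assign s.sleep (s.seq ++ [p]) {q ∈ s.sleep s.seq | S.Indep s.seq p [q]}
          backtrack := bt } (insert (s.seq ++ [p]) V) (assign done (s.seq ++ [p]) []) := by
  obtain ⟨hmono, hraces, hnew⟩ := sourceRaces_spec hbt
  have hseq : s.seq <+: s.seq := List.prefix_refl _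
  have hexp : S.isExec (s.seq ++ [p]) := (I.backtrack_enabled _ hseq (.inr hc)).1 hp.1
  set sleep' := assign s.sleep (s.seq ++ [p]) {q ∈ s.sleep s.seq | S.Indep s.seq p [q]}
  have hsl : ∀ A, A <+: s.seq → sleep' A = s.sleep A := fun A hA =>
    assign_ne _ _ (prefix_ne_concat hA)
  have hinh : ∀ A, A <+: s.seq → inherited S sleep' A = inherited S s.sleep A := fun A hA =>
    inherited_congr (fun B hB _ => hsl B (hB.trans hA))
  have hinh' : ∀ q, q ∈ inherited S sleep' (s.seq ++ [p]) ↔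
      q ∈ s.sleep s.seq ∧ S.Indep s.seq p [q] := by
    intro q
    rw [mem_inherited_concat, hsl _ hseq]
  -- `E.p` is visited for the first time: an earlier visit would have put `p` to sleep.
  have hnotV : s.seq ++ [p] ∉ V := by
    intro hV
    rcases I.visited _ p hseq hV with h | h
    · exact hp.2 ((I.sleep_iff _ hseq p).2 (.inr h))
    · exact prefix_ne_concat h rfl
  refine ⟨?_, ?_, .inl rfl, ?_, ?_, ?_, ?_, ?_, ?_, ?_, ?_, ?_, ?_, I.log_maximal⟩
  · rintro L (rfl | hL)
    · exact hexp
    · exact I.visited_exec L hL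
  · rintro L w (h | h)
    · have : L <+: s.seq ++ [p] := ⟨w, h⟩
      rcases prefix_concat_iff'.1 this with ⟨v, hv⟩ | h'
      · exact .inr (I.visited_prefix L v (hv ▸ I.seq_visited))
      · exact .inl h'
    · exact .inr (I.visited_prefix L w h)
  · intro E hE q
    rcases prefix_concat_iff'.1 hE with hE | rfl
    · simp only [hinh E hE, hsl E hE]
      rw [assign_ne _ _ (prefix_ne_concat hE)]
      exact I.sleep_iff E hE q
    · simp only [hinh']
      rw [assign_self]
      simp [sleep', assign_self]
  · intro E q hE
    rcases concat_prefix_concat hE with hE | ⟨rfl, rfl⟩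
    · obtain ⟨h1, h2⟩ := I.path E q hE
      exact ⟨by simpa only [hsl E ((List.prefix_append _ _).trans hE)], hmono E h2⟩
    · exact ⟨by simpa only [hsl _ hseq] using hp.2, hmono _ hp.1⟩
  · rintro E q hE (h | h)
    · exact .inr (by simp only [h, List.prefix_refl])
    · rcases prefix_concat_iff'.1 hE with hE | rfl
      · rw [assign_ne _ _ (prefix_ne_concat hE)]
        exact (I.visited E q hE h).imp id (fun h' => h'.trans (List.prefix_append _ _))
      · exact absurd (I.visited_prefix _ [q] h) hnotV
  · intro _
    exact assign_self _ _ _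
  · intro E hE l₁ q l₂ hd
    rcases prefix_concat_iff'.1 hE with hE | rfl
    · rw [assign_ne _ _ (prefix_ne_concat hE)] at hd
      obtain ⟨h1, h2⟩ := I.cover E hE l₁ q l₂ hd
      refine ⟨h1, fun w hw hq => ?_⟩
      simp only [hinh E hE] at hq
      obtain ⟨L, z, h3, h4⟩ := h2 w hw hq
      exact ⟨L, z, .inr h3, h4⟩
    · rw [assign_self] at hd
      simp at hd
  · rintro E hE x hx q hq hqx
    rcases prefix_concat_iff'.1 hE with hE | rfl
    · simp only [hinh E hE] at hq
      rcases hx with hx | hx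
      · obtain ⟨x₀, hx₀⟩ := hE
        obtain rfl : x = x₀ ++ [p] := by
          rw [← hx₀, List.append_assoc] at hx
          exact List.append_cancel_left hx
        have hES : E <+: s.seq := ⟨x₀, hx₀⟩
        have hexx : S.isExec (E ++ x₀ ++ [p]) := by rw [hx₀]; exact hexp
        by_cases hqx₀ : q ∈ x₀
        · exact I.asleep E hES x₀ (hx₀ ▸ I.seq_visited) q hq
            (hS.initials_of_append hexx hqx₀ hqx)
        · obtain rfl : q = p := by
            have := hqx.1
            simpa [hqx₀] using this
          have hind := hS.indep_of_mem_initials_concat hexx hqx₀ hqx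
          -- A sleeping thread that is independent of `x₀` is still asleep when `p` is chosen, so it
          -- is not `p`.
          refine hp.2 ?_
          have := mem_sleep_append hS (sleep := s.sleep) (E := E) (x := x₀)
            (fun A hA => I.inherited_subset (hx₀ ▸ hA)) (I.inherited_subset hES hq) hind
          rwa [hx₀] at this
      · exact I.asleep E hE x hx q hq hqx
    · rcases hx with hx | hx
      · have : x = [] := by simpa using hx
        subst this
        simpa using hqx.1
      · exact hnotV (I.visited_prefix _ x hx)
  · rintro E hE p₁ x r hx hrev
    have hE : E <+: s.seq := by
      rcases prefix_concat_iff'.1 hE with hE | rfl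
      · exact hE
      · exfalso
        rcases hx with hx | hx
        · have := congrArg List.length hx
          simp at this
        · exact hnotV (I.visited_prefix _ (p₁ :: x ++ [r]) (by simpa using hx))
    rcases hx with hx | hx
    · obtain ⟨hx1, hx2⟩ := List.append_inj' hx rfl
      obtain rfl : r = p := by simpa using hx2
      have he : nextEv E p₁ ∈ l := by
        rw [hl]
        rw [← hx1]
        exact ⟨mem_events.1 (mem_events_append_right (by simp)), hrev⟩
      have := hraces _ he
      rw [← hx1, pre_nextEv] at this
      exact this
    · obtain ⟨q, hq1, hq2⟩ := I.races E hE p₁ x r hx hrev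
      exact ⟨q, hq1, hmono E hq2⟩
  · intro E hE hne
    rcases prefix_concat_iff'.1 hE with hE | rfl
    · obtain ⟨h1, q, h2, h3⟩ := I.backtrack_enabled E hE (.inr hc)
      refine ⟨?_, q, hmono E h2, by simpa only [hinh E hE]⟩
      intro q' hq'
      rcases hnew E q' hq' with h | ⟨e, he, rfl, h⟩
      · exact h1 h
      · obtain ⟨hd, hr⟩ := (hl e).1 he
        obtain ⟨A, B, -, -, h4, h5⟩ := exec_notdep_concat hS hexp hd hr
        rw [h4] at h ⊢
        exact mem_enabled_of_mem_initials hS h5 h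
    · simp at hne
  · intro h
    simp at h
  · rintro L (rfl | hL) hen
    · exact .inr ⟨rfl, rfl⟩
    · rcases I.logged L hL hen with h | ⟨_, h⟩
      · exact .inl h
      · rw [hc] at h
        simp at h

omit hS in
-- What the returned call guarantees in `ret` becomes the entry of `cover` for `p`; the sleep set of
-- the call consists of the threads inherited by `E` or done before `p` that are independent of `p`.
theorem SourceInv.back {s : SourceState P} {V : Set (List P)} {done : List P → List P}
    (I : SourceInv S s V done) (hc : s.ctl = .ret) {E : List P} {p : P} (h : s.seq = E ++ [p]) :
    SourceInv S
        { s with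
          seq := E
          ctl := .loop
          sleep := assign s.sleep E (insert p (s.sleep E)) } V (assign done E (done E ++ [p])) := by
  have hE : E <+: s.seq := by rw [h]; exact List.prefix_append _ _
  have hpre : ∀ A, A <+: E → A <+: s.seq := fun A hA => hA.trans hE
  have hinh : ∀ A, A <+: E →
      inherited S (assign s.sleep E (insert p (s.sleep E))) A = inherited S s.sleep A := fun A hA =>
    inherited_congr (fun B hB hne => assign_ne _ _ (by
      rintro rfl
      exact hne (hB.eq_of_length_le hA.length_le)))
  have hbt : ∀ A, A <+: E → A ≠ s.seq := by
    intro A hA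
    rw [h]
    exact prefix_ne_concat hA
  have hexE : S.isExec (E ++ [p]) := h ▸ I.visited_exec _ I.seq_visited
  refine ⟨I.visited_exec, I.visited_prefix, ?_, ?_, ?_, ?_, ?_, ?_, ?_, ?_, ?_, ?_, ?_,
    I.log_maximal⟩
  · exact I.visited_prefix E [p] (h ▸ I.seq_visited)
  · intro A hA q
    simp only [hinh A hA]
    by_cases hAE : A = E
    · subst hAE
      rw [assign_self, assign_self]
      have := I.sleep_iff A (hpre A hA) q
      simp only [Set.mem_insert_iff, this, List.mem_append, List.mem_singleton]
      tauto
    · rw [assign_ne _ _ hAE, assign_ne _ _ hAE]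
      exact I.sleep_iff A (hpre A hA) q
  · intro A q hA
    have hAE : A ≠ E := by
      rintro rfl
      exact prefix_ne_concat hA rfl
    simp only
    rw [assign_ne _ _ hAE]
    exact I.path A q (hA.trans hE)
  · intro A q hA hV
    rcases I.visited A q (hpre A hA) hV with h1 | h1
    · left
      by_cases hAE : A = E
      · subst hAE
        rw [assign_self]
        simp [h1]
      · rwa [assign_ne _ _ hAE]
    · rw [h] at h1
      rcases concat_prefix_concat h1 with h1 | ⟨rfl, rfl⟩
      · exact .inr h1
      · left
        rw [assign_self]
        simp
  · intro h
    simp at h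
  · intro A hA l₁ q l₂ hd
    simp only [hinh A hA]
    by_cases hAE : A = E
    · subst hAE
      rw [assign_self] at hd
      rcases List.eq_nil_or_concat l₂ with rfl | ⟨l₂, a, rfl⟩
      · obtain ⟨h1, h2⟩ := List.append_inj' hd rfl
        obtain rfl : p = q := by simpa using h2
        refine ⟨hexE, fun w hw hq => ?_⟩
        obtain ⟨L, z, h3, h4⟩ := I.ret hc w (by rw [h]; simpa using hw) (by
          intro q hqi
          rw [h, mem_inherited_concat, I.sleep_iff A (hpre A hA), h1] at hqi
          rw [h]
          exact hq q hqi.1 hqi.2)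
        rw [h] at h3 h4
        exact ⟨L, z, by simpa using h3, by simpa using h4⟩
      · refine I.cover A (hpre A hA) l₁ q l₂ ?_
        rw [List.concat_eq_append, ← List.cons_append, ← List.append_assoc] at hd
        exact (List.append_inj' hd rfl).1
    · rw [assign_ne _ _ hAE] at hd
      exact I.cover A (hpre A hA) l₁ q l₂ hd
  · intro A hA x hx q hq
    simp only [hinh A hA] at hq
    exact I.asleep A (hpre A hA) x hx q hq
  · intro A hA
    exact I.races A (hpre A hA)
  · intro A hA _
    simp only [hinh A hA]
    exact I.backtrack_enabled A (hpre A hA) (.inl (hbt A hA))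
  · intro h
    simp at h
  · intro L hL hen
    rcases I.logged L hL hen with h1 | ⟨_, h1⟩
    · exact .inl h1
    · rw [hc] at h1
      simp at h1

theorem SourceInv.step {s s' : SourceState P} (h : SourceStep S s s')
    (I : ∃ V done, SourceInv S s V done) : ∃ V done, SourceInv S s' V done := by
  obtain ⟨V, done, I⟩ := I
  have hseq : s.seq <+: s.seq := List.prefix_refl _
  have hexs := I.visited_exec _ I.seq_visited
  cases h with
  | maximal hc h =>
    refine ⟨V, done, I.visited_exec, I.visited_prefix, I.seq_visited, I.sleep_iff, I.path,
      I.visited, by simp, I.cover, I.asleep, I.races, ?_, ?_, ?_, ?_⟩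
    · rintro E hE (hne | hne)
      · exact I.backtrack_enabled E hE (.inl hne)
      · simp at hne
    · intro _ w hw _
      obtain rfl : w = [] := by
        cases w with
        | nil => rfl
        | cons q w =>
          have : q ∈ S.enabled s.seq := hS.exec_left (w := w) (by simpa using hw)
          rw [h] at this
          simp at this
      exact ⟨[], [], by simpa using I.seq_visited, by simpa using HBSystem.Equiv.refl hexs⟩
    · intro L hL hen
      rcases I.logged L hL hen with h1 | ⟨h1, _⟩
      · exact .inl (by simp [h1])
      · exact .inl (by simp [h1])
    · intro L hL
      simp only [List.mem_append, List.mem_singleton] at hL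
      rcases hL with hL | rfl
      · exact I.log_maximal L hL
      · exact ⟨hexs, h⟩
  | blocked hc hne hs =>
    refine ⟨V, done, I.visited_exec, I.visited_prefix, I.seq_visited, I.sleep_iff, I.path,
      I.visited, by simp, I.cover, I.asleep, I.races, ?_, ?_, ?_, I.log_maximal⟩
    · rintro E hE (hne | hne)
      · exact I.backtrack_enabled E hE (.inl hne)
      · simp at hne
    · intro _ w hw hin
      cases w with
      | nil => exact ⟨[], [], by simpa using I.seq_visited, by simpa using HBSystem.Equiv.refl hexs⟩
      | cons q w =>
        -- A nonempty `w` starts with an enabled, hence sleeping thread. Nothing is done yet, so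
        -- this thread is inherited, and such `w` are excluded.
        exfalso
        have hq : q ∈ S.enabled s.seq := hS.exec_left (w := w) (by simpa using hw)
        have hq' := (I.sleep_iff _ hseq q).1 (hs hq)
        rw [I.fresh hc] at hq'
        exact hin q (by simpa using hq') (head_mem_initials hS hw)
    · intro L hL hen
      rcases I.logged L hL hen with h1 | ⟨rfl, _⟩
      · exact .inl h1
      · rw [hen] at hne
        simp at hne
  | start hc p hp =>
    have hbt : ∀ A, A ≠ s.seq → assign s.backtrack s.seq {p} A = s.backtrack A := fun A hA =>
      assign_ne _ _ hA
    -- Nothing beyond the current sequence has been visited, so overwriting its backtrack set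
    -- affects no recorded race.
    have hnoV : ∀ q x, s.seq ++ q :: x ∉ V := by
      intro q x hx
      have := I.visited _ q hseq (I.visited_prefix _ x (by simpa using hx))
      rw [I.fresh hc] at this
      rcases this with h | h
      · simp at h
      · exact prefix_ne_concat h rfl
    refine ⟨V, done, I.visited_exec, I.visited_prefix, I.seq_visited, I.sleep_iff, ?_,
      I.visited, by simp, I.cover, I.asleep, ?_, ?_, by simp, ?_, I.log_maximal⟩
    · intro E q hE
      have hEs : E ≠ s.seq := by
        rintro rfl
        exact prefix_ne_concat hE rfl
      obtain ⟨h1, h2⟩ := I.path E q hE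
      refine ⟨h1, ?_⟩
      simp only
      rwa [hbt E hEs]
    · intro E hE p₁ x r hx
      have hEs : E ≠ s.seq := by
        rintro rfl
        exact hnoV p₁ (x ++ [r]) (by simpa using hx)
      simp only
      rw [hbt E hEs]
      exact I.races E hE p₁ x r hx
    · intro E hE _
      simp only
      by_cases hEs : E = s.seq
      · subst hEs
        rw [assign_self]
        refine ⟨by simpa using hp.1, p, rfl, fun h => hp.2 ((I.sleep_iff _ hseq p).2 (.inl h))⟩
      · rw [hbt E hEs]
        exact I.backtrack_enabled E hE (.inl hEs)
    · intro L hL hen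
      rcases I.logged L hL hen with h1 | ⟨rfl, _⟩
      · exact .inl h1
      · have := hp.1
        rw [hen] at this
        simp at this
  | call hc p hp l hn hl bt hbt => exact ⟨_, _, I.call hS hc hp hl hbt⟩
  | exit hc h =>
    refine ⟨V, done, I.visited_exec, I.visited_prefix, I.seq_visited, I.sleep_iff, I.path,
      I.visited, by simp, I.cover, I.asleep, I.races, ?_, ?_, ?_, I.log_maximal⟩
    · intro E hE _
      exact I.backtrack_enabled E hE (.inr hc)
    · intro _ w hw hsl
      exact I.exists_of_exit hS hc h hw hsl
    · intro L hL hen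
      rcases I.logged L hL hen with h1 | ⟨_, h1⟩
      · exact .inl h1
      · rw [hc] at h1
        simp at h1
  | back hc E p h => exact ⟨V, _, I.back hc h⟩

/-- No step blocks: race detection can always be carried out, because the reversal of a detected
race is an execution and its first thread is an initial. -/
theorem SourceInv.finished {s : SourceState P} {V : Set (List P)} {done : List P → List P}
    (I : SourceInv S s V done) (h : ∀ s', ¬ SourceStep S s s') : s.Finished := by
  classical
  have hseq : s.seq <+: s.seq := List.prefix_refl _
  obtain ⟨c, hc⟩ : ∃ c, s.ctl = c := ⟨_, rfl⟩
  cases c with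
  | enter =>
    exfalso
    by_cases hen : S.enabled s.seq = ∅
    · exact h _ (.maximal s hc hen)
    · by_cases hs : S.enabled s.seq ⊆ s.sleep s.seq
      · exact h _ (.blocked s hc (Set.nonempty_iff_ne_empty.2 hen) hs)
      · obtain ⟨p, hp⟩ := Set.not_subset.1 hs
        exact h _ (.start s hc p hp)
  | loop =>
    exfalso
    by_cases hs : s.backtrack s.seq ⊆ s.sleep s.seq
    · exact h _ (.exit s hc hs)
    · obtain ⟨p, hp⟩ := Set.not_subset.1 hs
      have hexp : S.isExec (s.seq ++ [p]) := (I.backtrack_enabled _ hseq (.inr hc)).1 hp.1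
      let l := (events s.seq).filter (fun e => S.RevRace (s.seq ++ [p]) e (nextEv s.seq p))
      have hl : ∀ e, e ∈ l ↔ e ∈ dom s.seq ∧ S.RevRace (s.seq ++ [p]) e (nextEv s.seq p) := by
        intro e
        simp [l, mem_events]
      obtain ⟨bt, hbt⟩ := exists_sourceRaces (S := S) (E := s.seq) (p := p) (l := l) s.backtrack (by
        intro e he
        obtain ⟨hd, hr⟩ := (hl e).1 he
        obtain ⟨A, B, -, -, h4, h5⟩ := exec_notdep_concat hS hexp hd hr
        rw [h4]
        generalize S.notdep s.seq e = N at h5 ⊢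
        cases N with
        | nil => exact ⟨p, head_mem_initials hS h5⟩
        | cons q N => exact ⟨q, head_mem_initials hS h5⟩)
      exact h _ (.call s hc p hp l ((nodup_events _).filter _) hl bt hbt)
  | ret =>
    refine ⟨?_, hc⟩
    by_contra hne
    rcases List.eq_nil_or_concat s.seq with h1 | ⟨E, p, h1⟩
    · exact hne h1
    · exact h _ (.back s hc E p (by rw [h1, List.concat_eq_append]))

theorem source_terminates (N : ℕ) (hN : ∀ L, S.isExec L → L.length ≤ N) :
    Terminates (SourceStep S) SourceState.init := by
  refine terminates_of_advances S N SourceState.seq SourceState.ctl SourceState.sleep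
    (fun s => ∃ V done, SourceInv S s V done) ?_ _ ⟨_, _, sourceInv_init hS⟩
  intro s s' hI h
  refine ⟨SourceInv.step hS h hI, ?_⟩
  obtain ⟨V, done, I⟩ := hI
  have hlen := hN _ (I.visited_exec _ I.seq_visited)
  have hctl : ∀ c' : Ctl, c'.rank < s.ctl.rank → Advances S N s.seq c' s.sleep s.seq s.ctl s.sleep :=
    fun c' h => advances_ctl S hlen h
  cases h with
  | maximal hc h => exact hctl _ (by simp [hc, Ctl.rank])
  | blocked hc hne hs => exact hctl _ (by simp [hc, Ctl.rank])
  | start hc p hp => exact hctl _ (by simp [hc, Ctl.rank])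
  | call hc p hp l hn hl bt hbt =>
    rw [hc]
    exact advances_call S hlen (fun A hA => assign_ne _ _ hA)
  | exit hc h => exact hctl _ (by simp [hc, Ctl.rank])
  | back hc E p h =>
    have hE : E ++ [p] <+: s.seq := by rw [h]
    rw [h] at hlen ⊢
    refine advances_back S (show E.length ≤ N by simp at hlen; omega) (fun A hA => assign_ne _ _ hA)
      (assign_self _ _ _) (hS.finite_enabled E) ?_ (I.path E p hE).1
    have := I.visited_exec _ I.seq_visited
    rw [h] at this
    exact this

theorem source_outcome {s : SourceState P} (h : Outcome (SourceStep S) SourceState.init s) :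
    s.Finished ∧ (∀ L ∈ s.log, S.isExec L ∧ S.enabled L = ∅) ∧
      ∀ L, S.isExec L → S.enabled L = ∅ → ∃ L' ∈ s.log, S.Equiv L' L := by
  obtain ⟨V, done, I⟩ := invariant_of_reflTransGen (Inv := fun s => ∃ V done, SourceInv S s V done)
    (fun s s' hI h => SourceInv.step hS h hI) ⟨_, _, sourceInv_init hS⟩ h.1
  have hf := I.finished hS h.2
  refine ⟨hf, I.log_maximal, fun L hL hen => ?_⟩
  obtain ⟨L', z, h1, h2⟩ := I.ret hf.2 L (by rw [hf.1]; simpa using hL) (by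
    rw [hf.1]
    simp)
  rw [hf.1] at h1 h2
  simp only [List.nil_append] at h1 h2
  -- The invariant yields an exploration of some extension; a maximal execution has only the trivial
  -- one.
  obtain rfl : z = [] := by
    cases z with
    | nil => rfl
    | cons q z =>
      have : q ∈ S.enabled L := hS.exec_left (w := z) (by simpa using h2.2.1)
      rw [hen] at this
      simp at this
  rw [List.append_nil] at h2
  have hen' : S.enabled L' = ∅ := by
    ext q
    simp only [Set.mem_empty_iff_false, iff_false]
    intro hq
    have : q ∈ S.enabled L := (hS.equiv_append h2 hq).2.1
    rw [hen] at this
    simp at this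
  rcases I.logged L' h1 hen' with h3 | ⟨_, h3⟩
  · exact ⟨L', h3, h2⟩
  · rw [hf.2] at h3
    simp at h3

end Source

end RelaxedDPOR

namespace RelaxedDPOR

/-! ### Wakeup trees -/

section Trees

variable {P : Type*} {S : HBSystem P}

open HBSystem

/-- `a` comes before `b` in the list `B`. -/
def Before {α : Type*} (B : List α) (a b : α) : Prop := [a, b].Sublist B

theorem before_append {α : Type*} {l₁ l₂ : List α} {a b : α} :
    Before (l₁ ++ l₂) a b ↔ Before l₁ a b ∨ (a ∈ l₁ ∧ b ∈ l₂) ∨ Before l₂ a b := by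
  unfold Before
  rw [List.sublist_append_iff]
  constructor
  · rintro ⟨k₁, k₂, h, h1, h2⟩
    match k₁, k₂ with
    | [], k₂ => simp only [List.nil_append] at h; subst h; exact .inr (.inr h2)
    | [x], k₂ =>
      simp only [List.cons_append, List.nil_append, List.cons.injEq] at h
      obtain ⟨rfl, rfl⟩ := h
      exact .inr (.inl ⟨by simpa using h1, by simpa using h2⟩)
    | x :: y :: k₁, k₂ =>
      simp only [List.cons_append, List.cons.injEq, List.nil_eq, List.append_eq_nil_iff] at h
      obtain ⟨rfl, rfl, rfl, rfl⟩ := h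
      exact .inl h1
  · rintro (h | ⟨h1, h2⟩ | h)
    · exact ⟨[a, b], [], by simp, h, by simp⟩
    · exact ⟨[a], [b], by simp, by simpa using h1, by simpa using h2⟩
    · exact ⟨[], [a, b], by simp, by simp, h⟩

theorem before_cons {α : Type*} {l : List α} {x a b : α} :
    Before (x :: l) a b ↔ (a = x ∧ b ∈ l) ∨ Before l a b := by
  rw [show x :: l = [x] ++ l from rfl, before_append]
  have : ¬ Before [x] a b := fun h => by simpa using List.Sublist.length_le h
  simp [this]

theorem not_before_nil {α : Type*} {a b : α} : ¬ Before [] a b := by simp [Before]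

theorem Before.mem_left {α : Type*} {B : List α} {a b : α} (h : Before B a b) : a ∈ B :=
  h.subset (by simp)

theorem Before.mem_right {α : Type*} {B : List α} {a b : α} (h : Before B a b) : b ∈ B :=
  h.subset (by simp)

theorem before_total {α : Type*} {B : List α} {a b : α} (ha : a ∈ B) (hb : b ∈ B) (h : a ≠ b) :
    Before B a b ∨ Before B b a := by
  obtain ⟨l₁, l₂, rfl⟩ := List.append_of_mem ha
  simp only [List.mem_append, List.mem_cons, h.symm, false_or] at hb
  rcases hb with hb | hb
  · right
    exact before_append.2 (.inr (.inl ⟨hb, by simp⟩))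
  · left
    exact before_append.2 (.inr (.inr (before_cons.2 (.inl ⟨rfl, hb⟩))))

theorem mem_of_before_of_nodup {α : Type*} {l₁ l₂ : List α} {a x : α}
    (hn : (l₁ ++ x :: l₂).Nodup) (h : Before (l₁ ++ x :: l₂) a x) : a ∈ l₁ := by
  rw [List.nodup_append] at hn
  obtain ⟨-, h2, h3⟩ := hn
  rw [List.nodup_cons] at h2
  rcases before_append.1 h with h | ⟨h, -⟩ | h
  · exact h.mem_left
  · exact h
  · rcases before_cons.1 h with ⟨-, h⟩ | h
    · exact absurd h h2.1
    · exact absurd h.mem_right h2.1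

/-- A wakeup tree after `E`, apart from its relation with the sleep set. -/
structure WakeupTree (S : HBSystem P) (E : List P) (B : List (List P)) : Prop where
  root : [] ∈ B
  closed : ∀ u p, u ++ [p] ∈ B → u ∈ B
  post : ∀ a b, Before B a b → ¬ a <+: b
  contiguous : ∀ u p q y, p ≠ q → Before B (u ++ q :: y) (u ++ [p]) →
    Before B (u ++ [q]) (u ++ [p])
  exec : ∀ u ∈ B, S.isExec (E ++ u)
  weakInitials : ∀ u p c, Before B (u ++ [p]) (u ++ c) → IsLeaf B (u ++ c) →
    p ∉ S.weakInitials (E ++ u) c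

/-- No sleeping thread can be started before a leaf. -/
def Guarded (S : HBSystem P) (E : List P) (sl : Set P) (B : List (List P)) : Prop :=
  ∀ w ∈ B, IsLeaf B w → w ≠ [] → ∀ q ∈ sl, q ∉ S.weakInitials E w

/-- `q` is the first child of the root. -/
def FirstChild (B : List (List P)) (q : P) : Prop := [q] ∈ B ∧ ∀ p, ¬ Before B [p] [q]

namespace WakeupTree

variable {E : List P} {B : List (List P)}

/-- A repeated node would come before itself, against `post`, since a sequence is a prefix of
itself. -/
theorem nodup (T : WakeupTree S E B) : B.Nodup := by
  rw [List.Nodup, List.pairwise_iff_forall_sublist]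
  rintro a b h rfl
  exact T.post a a h (List.prefix_refl _)

theorem mem_of_prefix (T : WakeupTree S E B) {u v : List P} (h : u ++ v ∈ B) : u ∈ B := by
  induction v using List.reverseRecOn with
  | nil => simpa using h
  | append_singleton v p ih => exact ih (T.closed _ p (by simpa using h))

theorem exists_leaf {u : List P} (hu : u ∈ B) :
    ∃ y, u ++ y ∈ B ∧ IsLeaf B (u ++ y) := by
  by_contra hc
  push Not at hc
  have : ∀ n, ∃ y, u ++ y ∈ B ∧ y.length = n := by
    intro n
    induction n with
    | zero => exact ⟨[], by simpa using hu, rfl⟩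
    | succ n ih =>
      obtain ⟨y, hy, hn⟩ := ih
      have := hc y hy
      simp only [IsLeaf, not_forall, not_not] at this
      obtain ⟨p, hp⟩ := this
      exact ⟨y ++ [p], by simpa using hp, by simp [hn]⟩
  obtain ⟨y, hy, hn⟩ := this ((B.map List.length).sum + 1)
  have h1 : (u ++ y).length ≤ (B.map List.length).sum :=
    List.single_le_sum (by simp) _ (List.mem_map_of_mem hy)
  simp at h1
  omega

theorem not_isLeaf_nil {q : P} (h : [q] ∈ B) : ¬ IsLeaf B [] := fun hl => hl q (by simpa using h)

theorem eq_root (T : WakeupTree S E B) (h : ∀ p, [p] ∉ B) : B = [[]] := by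
  have hall : ∀ u ∈ B, u = [] := by
    intro u hu
    cases u with
    | nil => rfl
    | cons p u => exact absurd (T.mem_of_prefix (u := [p]) (v := u) hu) (h p)
  have hn := T.nodup
  have hr := T.root
  match B with
  | [] => simp at hr
  | [u] => rw [hall u (by simp)]
  | u :: v :: B =>
    rw [hall u (by simp), hall v (by simp)] at hn
    simp at hn

/-- If a node of another branch came before the first child, `contiguous` would put the root of that
branch before it. -/
theorem before_of_firstChild (T : WakeupTree S E B) {q a : P} {y : List P} (hq : FirstChild B q)
    (ha : a :: y ∈ B) (hne : a ≠ q) : Before B [q] (a :: y) := by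
  rcases before_total hq.1 ha (by simp [hne.symm]) with h | h
  · exact h
  · exact absurd (T.contiguous [] q a y hne.symm (by simpa using h)) (by simpa using hq.2 a)

end WakeupTree

theorem wakeupTree_singleton {E : List P} (h : S.isExec E) : WakeupTree S E [[]] where
  root := by simp
  closed := by intro u p h; simp at h
  post := by
    intro a b h
    rcases before_cons.1 h with ⟨_, h⟩ | h
    · simp at h
    · exact absurd h not_before_nil
  contiguous := by
    intro u p q y _ h
    simpa using h.mem_left
  exec := by simpa using h
  weakInitials := by
    intro u p c h
    simpa using h.mem_left

theorem before_pair {α : Type*} {x y a b : α} (h : Before [x, y] a b) : a = x ∧ b = y := by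
  rcases before_cons.1 h with ⟨h1, h2⟩ | h
  · exact ⟨h1, by simpa using h2⟩
  · rcases before_cons.1 h with ⟨_, h⟩ | h
    · simp at h
    · exact absurd h not_before_nil

theorem wakeupTree_pair {E : List P} {p : P} (hS : S.Valid) (h : S.isExec (E ++ [p])) :
    WakeupTree S E [[p], []] where
  root := by simp
  closed := by
    intro u q h
    have : u = [] ∧ q = p := by
      cases u with
      | nil => simpa using h
      | cons a u => simp at h
    simp [this.1]
  post := by
    intro a b h
    obtain ⟨rfl, rfl⟩ := before_pair h
    simp
  contiguous := by
    intro u p q y _ h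
    have := (before_pair h).2
    simp at this
  exec := by
    simp only [List.mem_cons, List.not_mem_nil, or_false, forall_eq_or_imp, forall_eq,
      List.append_nil]
    exact ⟨h, hS.exec_left h⟩
  weakInitials := by
    intro u q c h hl
    have := (before_pair h).2
    rw [this] at hl
    exact absurd hl (WakeupTree.not_isLeaf_nil (q := p) (by simp))

theorem mem_subtree {B : List (List P)} {p : P} {w : List P} :
    w ∈ subtree B p ↔ p :: w ∈ B := by
  classical
  simp only [subtree, List.mem_filterMap]
  constructor
  · rintro ⟨v, hv, h⟩
    cases v with
    | nil => simp at h
    | cons q v =>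
      simp only [Option.ite_none_right_eq_some, Option.some.injEq] at h
      obtain ⟨rfl, rfl⟩ := h
      exact hv
  · intro h
    exact ⟨_, h, by simp⟩

theorem map_cons_subtree {B : List (List P)} {p : P} :
    ((subtree B p).map (fun w => p :: w)).Sublist B := by
  classical
  unfold subtree
  induction B with
  | nil => simp
  | cons v B ih =>
    cases v with
    | nil => exact ih.trans (List.sublist_cons_self _ _)
    | cons q v =>
      by_cases hq : q = p
      · subst hq
        simpa using ih
      · simpa [hq] using ih.trans (List.sublist_cons_self _ _)

theorem before_subtree {B : List (List P)} {p : P} {a b : List P}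
    (h : Before (subtree B p) a b) : Before B (p :: a) (p :: b) :=
  (List.Sublist.map (fun w => p :: w) h).trans map_cons_subtree

theorem before_subtree_of {B : List (List P)} {p : P} {a b : List P}
    (h : Before B (p :: a) (p :: b)) : Before (subtree B p) a b := by
  classical
  have : (subtree [p :: a, p :: b] p).Sublist (subtree B p) := List.Sublist.filterMap _ h
  simpa [subtree, Before] using this

theorem isLeaf_subtree {B : List (List P)} {p : P} {w : List P} :
    IsLeaf (subtree B p) w ↔ IsLeaf B (p :: w) := by
  simp [IsLeaf, mem_subtree]

theorem WakeupTree.subtree {E : List P} {B : List (List P)} (T : WakeupTree S E B) {p : P}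
    (hp : [p] ∈ B) : WakeupTree S (E ++ [p]) (subtree B p) where
  root := mem_subtree.2 hp
  closed := fun u q h => mem_subtree.2 (T.closed (p :: u) q (by simpa using mem_subtree.1 h))
  post := fun a b h hab => T.post _ _ (before_subtree h) (by simpa using hab)
  contiguous := fun u q q' y hq h => before_subtree_of (by
    simpa using T.contiguous (p :: u) q q' y hq (by simpa using before_subtree h))
  exec := fun u hu => by simpa using T.exec _ (mem_subtree.1 hu)
  weakInitials := fun u q c h hl => by
    simpa using T.weakInitials (p :: u) q c (by simpa using before_subtree h)
      (by simpa using isLeaf_subtree.1 hl)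

theorem mem_removeBranch {B : List (List P)} {p : P} {w : List P} :
    w ∈ removeBranch B p ↔ w ∈ B ∧ w.head? ≠ some p := by
  classical
  simp [removeBranch]

theorem isLeaf_of_isLeaf_removeBranch {B : List (List P)} {p : P} {w : List P} (hw : w ≠ [])
    (hm : w ∈ removeBranch B p) (h : IsLeaf (removeBranch B p) w) : IsLeaf B w := by
  intro q hq
  refine h q (mem_removeBranch.2 ⟨hq, ?_⟩)
  cases w with
  | nil => exact absurd rfl hw
  | cons a w => simpa using (mem_removeBranch.1 hm).2

theorem isLeaf_removeBranch {B : List (List P)} {p : P} {w : List P} (h : IsLeaf B w) :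
    IsLeaf (removeBranch B p) w := fun q hq => h q (mem_removeBranch.1 hq).1

theorem before_removeBranch {B : List (List P)} {p : P} {a b : List P}
    (h : Before (removeBranch B p) a b) : Before B a b := by
  classical
  exact List.Sublist.trans h List.filter_sublist

theorem WakeupTree.removeBranch {E : List P} {B : List (List P)} (T : WakeupTree S E B) (p : P) :
    WakeupTree S E (removeBranch B p) where
  root := mem_removeBranch.2 ⟨T.root, by simp⟩
  closed := by
    intro u q h
    rw [mem_removeBranch] at h ⊢
    refine ⟨T.closed u q h.1, ?_⟩
    cases u with
    | nil => simp
    | cons a u => simpa using h.2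
  post := fun a b h => T.post a b (before_removeBranch h)
  contiguous := by
    intro u q q' y hq h
    have h1 := T.contiguous u q q' y hq (before_removeBranch h)
    have h2 := (mem_removeBranch.1 h.mem_left).2
    have h3 := (mem_removeBranch.1 h.mem_right).2
    classical
    have := h1.filter (fun w : List P => w.head? ≠ some p)
    rw [List.filter_eq_self.2] at this
    · exact this
    · intro a ha
      simp only [List.mem_cons, List.not_mem_nil, or_false] at ha
      rcases ha with rfl | rfl
      · cases u with
        | nil => simpa using h2
        | cons b u => simpa using h2
      · simpa using h3
  exec := fun u hu => T.exec u (mem_removeBranch.1 hu).1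
  weakInitials := by
    intro u q c h hl
    -- Removing a branch creates a new leaf at most at the root, and the root is no leaf as long as
    -- the child in question is left.
    by_cases hc : u ++ c = []
    · exfalso
      rw [List.append_eq_nil_iff] at hc
      rw [hc.1, hc.2] at hl
      rw [hc.1] at h
      exact hl q h.mem_left
    · exact T.weakInitials u q c (before_removeBranch h)
        (isLeaf_of_isLeaf_removeBranch hc h.mem_right hl)

/-- All leaves of other branches come after the first child, so the ordering condition of wakeup
trees says that it is no weak initial of them. This is the guard required when it moves from the
tree to the sleep set. -/
theorem Guarded.removeBranch {E : List P} {B : List (List P)} {sl : Set P}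
    (T : WakeupTree S E B) (h : Guarded S E sl B) {p : P} (hp : FirstChild B p) :
    Guarded S E (insert p sl) (removeBranch B p) := by
  intro w hw hl hne q hq
  have hlB := isLeaf_of_isLeaf_removeBranch hne hw hl
  rcases hq with rfl | hq
  · cases w with
    | nil => exact absurd rfl hne
    | cons a w =>
      have ha : a ≠ q := by simpa using (mem_removeBranch.1 hw).2
      have := T.before_of_firstChild hp (mem_removeBranch.1 hw).1 ha
      simpa using T.weakInitials [] q (a :: w) (by simpa using this) hlB
  · exact h w (mem_removeBranch.1 hw).1 hlB hne q hq

theorem mem_newNodes {v w u : List P} : u ∈ newNodes v w ↔ ∃ x, x <+: w ∧ x ≠ [] ∧ u = v ++ x := by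
  have : ∀ x : List P, x ∈ w.inits.tail ↔ x <+: w ∧ x ≠ [] := by
    intro x
    cases w with
    | nil => simp
    | cons a w =>
      simp only [List.inits_cons, List.tail_cons, List.mem_map, List.mem_inits]
      constructor
      · rintro ⟨y, hy, rfl⟩
        simp [hy]
      · rintro ⟨hx, hne⟩
        cases x with
        | nil => exact absurd rfl hne
        | cons b x =>
          rw [List.cons_prefix_cons] at hx
          exact ⟨x, hx.2, by rw [hx.1]⟩
  simp only [newNodes, List.mem_reverse, List.mem_map, this]
  constructor
  · rintro ⟨x, ⟨h1, h2⟩, rfl⟩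
    exact ⟨x, h1, h2, rfl⟩
  · rintro ⟨x, h1, h2, rfl⟩
    exact ⟨x, ⟨h1, h2⟩, rfl⟩

/-- The longest prefix comes first, in accordance with the post-order. -/
theorem before_newNodes {v w a b : List P} (h : Before (newNodes v w) a b) :
    b.length < a.length := by
  have h1 : ∀ w : List P, w.inits.Pairwise (fun a b => a.length < b.length) := by
    intro w
    induction w with
    | nil => simp
    | cons a w ih =>
      rw [List.inits_cons, List.pairwise_cons, List.pairwise_map]
      refine ⟨?_, by simpa using ih⟩
      intro x hx
      obtain ⟨y, -, rfl⟩ := List.mem_map.1 hx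
      simp
  have h2 : (newNodes v w).Pairwise (fun a b => b.length < a.length) := by
    rw [newNodes, List.pairwise_reverse, List.pairwise_map]
    refine ((h1 w).sublist (List.tail_sublist _)).imp ?_
    intro a b hab
    simpa using hab
  exact (List.pairwise_iff_forall_sublist.1 h2) h

end Trees

end RelaxedDPOR

namespace RelaxedDPOR

/-! ### Insertion into wakeup trees -/

section Insert

variable {P : Type*} {S : HBSystem P}

open HBSystem

theorem before_insert {α : Type*} {l₁ l₂ N : List α} {x a b : α}
    (h : Before (l₁ ++ N ++ x :: l₂) a b) :
    Before (l₁ ++ x :: l₂) a b ∨ (a ∈ l₁ ∧ b ∈ N) ∨ Before N a b ∨ (a ∈ N ∧ b ∈ x :: l₂) := by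
  rw [List.append_assoc] at h
  rcases before_append.1 h with h | ⟨h1, h2⟩ | h
  · exact .inl (before_append.2 (.inl h))
  · rcases List.mem_append.1 h2 with h2 | h2
    · exact .inr (.inl ⟨h1, h2⟩)
    · exact .inl (before_append.2 (.inr (.inl ⟨h1, h2⟩)))
  · rcases before_append.1 h with h | h | h
    · exact .inr (.inr (.inl h))
    · exact .inr (.inr (.inr h))
    · exact .inl (before_append.2 (.inr (.inr h)))

theorem Before.insert {α : Type*} {l₁ l₂ N : List α} {x a b : α}
    (h : Before (l₁ ++ x :: l₂) a b) : Before (l₁ ++ N ++ x :: l₂) a b :=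
  List.Sublist.trans h (by
    rw [List.append_assoc]
    exact (List.sublist_append_right _ _).append_left _)

theorem consistent_of_append {E a b w : List P} (h : S.Consistent E (a ++ b) w) :
    S.Consistent E a w := by
  obtain ⟨s, t, h⟩ := h
  exact ⟨b ++ s, t, by simpa using h⟩

/-- What is maintained about a node of the exploration tree below which the exploration takes
place. -/
structure Frame (S : HBSystem P) (E : List P) (sl : Set P) (B : List (List P)) (q : P) : Prop where
  tree : WakeupTree S E B
  guarded : Guarded S E sl B
  first : FirstChild B q

variable (hS : S.Valid)

include hS

/-- An extension of `y` is, up to equivalence, an extension of `w`. -/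
theorem Consistent.of_hbPrefix {E a w y : List P} (hw : S.HBPrefix E w y)
    (h : S.Consistent E a y) : S.Consistent E a w := by
  obtain ⟨r, hr⟩ := hw
  obtain ⟨s, t, h⟩ := h
  refine ⟨s, r ++ t, ?_⟩
  have := h.trans (hS.equiv_append (w := t) hr.symm h.2.1)
  simpa using this

/-- The result of an insertion into a wakeup tree. -/
theorem insert_spec {E w : List P} {B B' : List (List P)} {sl : Set P} {q : P}
    (F : Frame S E sl B q) (hI : InsertWut S E w B B') (hex : S.isExec (E ++ w))
    (hsl : sl ∩ S.weakInitials E w = ∅) (hq : q ∉ S.weakInitials E w) :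
    Frame S E sl B' q ∧ (∀ u ∈ B, u ∈ B' ∧ (IsLeaf B u → IsLeaf B' u)) ∧
      (∀ y, q :: y ∈ B' → IsLeaf B' (q :: y) → q :: y ∈ B ∧ IsLeaf B (q :: y)) ∧
      ∃ y ∈ B', IsLeaf B' y ∧ y ≠ [] ∧ S.Consistent E y w := by
  obtain ⟨T, G, hF⟩ := F
  have hroot : ¬ IsLeaf B [] := WakeupTree.not_isLeaf_nil hF.1
  have hWI : ∀ p, S.Consistent E [p] w → p ∈ S.weakInitials E w := fun p h =>
    (hS.mem_weakInitials_iff hex).2 h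
  cases hI with
  | leaf l₁ l₂ v hv hmin h =>
    refine ⟨⟨T, G, hF⟩, fun u hu => ⟨hu, id⟩, fun y h1 h2 => ⟨h1, h2⟩, v, by simp, h, ?_, hv⟩
    rintro rfl
    exact hroot h
  | extend l₁ l₂ v w' hv hmin h hw hshort =>
    set B := l₁ ++ v :: l₂ with hB
    set N := newNodes v w' with hN
    have hvB : v ∈ B := by simp [hB]
    have hexv : S.isExec (E ++ (v ++ w')) := by
      obtain ⟨r, hr⟩ := hw
      exact hr.2.1
    -- Every node on the new branch is consistent with `w`, since `w` is contained in `v ++ w'`.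
    -- This is played off against the minimality of `v` below.
    have hcons : ∀ a, a <+: v ++ w' → S.Consistent E a w := by
      rintro a ⟨b, hb⟩
      exact Consistent.of_hbPrefix hS hw ⟨b, [], by
        rw [List.append_assoc, hb, List.append_nil]
        exact HBSystem.Equiv.refl hexv⟩
    have hNpre : ∀ a ∈ N, a <+: v ++ w' ∧ v <+: a ∧ v.length < a.length := by
      intro a ha
      obtain ⟨x, hx, hne, rfl⟩ := mem_newNodes.1 ha
      refine ⟨by simpa using hx, List.prefix_append _ _, ?_⟩
      have := List.length_pos_of_ne_nil hne
      simp only [List.length_append]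
      omega
    have hlater : ∀ b ∈ l₂, ¬ v <+: b := fun b hb =>
      T.post v b (before_append.2 (.inr (.inr (before_cons.2 (.inl ⟨rfl, hb⟩)))))
    have hlater' : ∀ b ∈ v :: l₂, v <+: b → b = v := by
      intro b hb hvb
      rcases List.mem_cons.1 hb with hb | hb
      · exact hb
      · exact absurd hvb (hlater b hb)
    -- A new node is not among the nodes before `v`, none of which is consistent with `w`, and not
    -- among the later ones, which do not extend `v` by post-order.
    have hNB : ∀ a ∈ N, a ∉ B := by
      intro a ha haB
      obtain ⟨h1, h2, h3⟩ := hNpre a ha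
      rcases List.mem_append.1 haB with h4 | h4
      · exact hmin a h4 (hcons a h1)
      · have := hlater' a h4 h2
        rw [this] at h3
        exact lt_irrefl _ h3
    have hmem : ∀ u, u ∈ l₁ ++ N ++ v :: l₂ ↔ u ∈ B ∨ u ∈ N := by
      intro u
      simp only [hB, List.mem_append, List.mem_cons]
      tauto
    have hconcat : ∀ u p, u ++ [p] ∈ N → v <+: u ∧ (u = v ∨ u ∈ N) := by
      intro u p hup
      obtain ⟨x, hx, hne, hup⟩ := mem_newNodes.1 hup
      rcases List.eq_nil_or_concat x with rfl | ⟨x, r, rfl⟩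
      · exact absurd rfl hne
      · rw [List.concat_eq_append] at hx hup
        rw [← List.append_assoc] at hup
        obtain ⟨rfl, -⟩ := List.append_inj' hup rfl
        refine ⟨List.prefix_append _ _, ?_⟩
        by_cases hx0 : x = []
        · subst hx0
          simp
        · exact .inr (mem_newNodes.2 ⟨x, (List.prefix_append _ _).trans hx, hx0, rfl⟩)
    have hleafB : ∀ u, IsLeaf (l₁ ++ N ++ v :: l₂) u → IsLeaf B u := fun u hu p hp =>
      hu p ((hmem _).2 (.inl hp))
    have hleafN : ∀ u ∈ N, IsLeaf (l₁ ++ N ++ v :: l₂) u → u = v ++ w' := by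
      intro u hu hl
      obtain ⟨x, ⟨y, rfl⟩, hne, rfl⟩ := mem_newNodes.1 hu
      cases y with
      | nil => simp
      | cons a y =>
        refine absurd ((hmem _).2 (.inr (mem_newNodes.2 ⟨x ++ [a], ?_, by simp, ?_⟩))) (hl a)
        · exact ⟨y, by simp⟩
        · simp
    have T' : WakeupTree S E (l₁ ++ N ++ v :: l₂) := by
      constructor
      · exact (hmem _).2 (.inl T.root)
      · intro u p hup
        rcases (hmem _).1 hup with hup | hup
        · exact (hmem _).2 (.inl (T.closed u p hup))
        · rcases (hconcat u p hup).2 with rfl | h1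
          · exact (hmem _).2 (.inl hvB)
          · exact (hmem _).2 (.inr h1)
      · intro a b hab hpre
        rcases before_insert hab with h1 | ⟨h1, h2⟩ | h1 | ⟨h1, h2⟩
        · exact T.post a b h1 hpre
        · exact hmin a h1 (hcons a (hpre.trans (hNpre b h2).1))
        · have := before_newNodes h1
          have := hpre.length_le
          omega
        · have h3 := hlater' b h2 ((hNpre a h1).2.1.trans hpre)
          have := hpre.length_le
          have := (hNpre a h1).2.2
          rw [h3] at *
          omega
      · intro u p r y hpr hab
        rcases before_insert hab with h1 | ⟨h1, h2⟩ | h1 | ⟨h1, h2⟩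
        · exact (T.contiguous u p r y hpr h1).insert
        · have h3 := (hconcat u p h2).1
          have h4 : u ++ [r] ∈ B := T.mem_of_prefix (v := y) (by simpa [hB] using Or.inl h1)
          have h5 : u ++ [r] ∈ l₁ := by
            rcases List.mem_append.1 h4 with h5 | h5
            · exact h5
            · have h6 := hlater' _ h5 (h3.trans (List.prefix_append _ _))
              have := h3.length_le
              rw [← h6] at this
              simp at this
          rw [List.append_assoc]
          exact before_append.2 (.inr (.inl ⟨h5, List.mem_append_left _ h2⟩))
        · have h3 : u ++ [p] <+: v ++ w' := (hNpre _ h1.mem_right).1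
          have h4 : u ++ [r] <+: v ++ w' :=
            List.IsPrefix.trans ⟨y, by simp⟩ (hNpre _ h1.mem_left).1
          have := (List.prefix_of_prefix_length_le h3 h4 (by simp)).eq_of_length (by simp)
          exact absurd (by simpa using this) hpr
        · have h3 : u ++ [r] <+: u ++ r :: y := ⟨y, by simp⟩
          have h4 := (hNpre _ h1).2.1
          have h5 : u ++ [r] <+: v := by
            rcases List.prefix_or_prefix_of_prefix h4 h3 with h5 | h5
            · rcases prefix_concat_iff'.1 h5 with h5 | h5
              · exfalso
                have h6 := hlater' _ h2 (h5.trans (List.prefix_append _ _))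
                have := h5.length_le
                rw [← h6] at this
                simp at this
              · rw [h5]
            · exact h5
          obtain ⟨z, hz⟩ := h5
          have h6 : u ++ [p] ∈ l₂ := by
            rcases List.mem_cons.1 h2 with h6 | h6
            · rw [← h6] at hz
              simp at hz
              exact absurd hz.1.symm hpr
            · exact h6
          refine (T.contiguous u p r z hpr ?_).insert
          rw [show u ++ r :: z = v by simpa using hz]
          exact before_append.2 (.inr (.inr (before_cons.2 (.inl ⟨rfl, h6⟩))))
      · intro u hu
        rcases (hmem _).1 hu with hu | hu
        · exact T.exec u hu
        · obtain ⟨z, hz⟩ := (hNpre u hu).1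
          rw [← hz, ← List.append_assoc] at hexv
          exact hS.exec_prefix _ _ hexv
      · intro u p c hab hl hp
        rcases before_insert hab with h1 | ⟨h1, h2⟩ | h1 | ⟨h1, h2⟩
        · exact T.weakInitials u p c h1 (hleafB _ hl) hp
        · have h3 := hleafN _ h2 hl
          rw [← h3] at hw hexv
          have h4 := (hS.mem_weakInitials_iff (by simpa using hexv)).1 hp
          -- If `p` were a weak initial of the rest of the new leaf, the earlier node `u.p` would be
          -- consistent with `w`, against the minimality of `v`.
          refine hmin _ h1 (Consistent.of_hbPrefix hS hw ?_)
          obtain ⟨s, t, h5⟩ := h4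
          exact ⟨s, t, by simpa using h5⟩
        · have h3 := hleafN _ h1.mem_right hl
          have h4 := before_newNodes h1
          have h5 := (hNpre _ h1.mem_left).1.length_le
          rw [h3] at h4
          omega
        · have h3 := (hconcat u p h1).1
          -- A new node precedes a leaf in the same subtree only if this leaf is `v`, but `v` is not
          -- a leaf.
          have h4 := hlater' _ h2 (h3.trans (List.prefix_append _ _))
          rw [h4] at hl
          exact h (hleafB _ hl)
    have hroot' : ¬ IsLeaf (l₁ ++ N ++ v :: l₂) [] := fun hl => hroot (hleafB _ hl)
    refine ⟨⟨T', ?_, (hmem _).2 (.inl hF.1), ?_⟩, ?_, ?_, ?_⟩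
    · intro u hu hl hne r hr hrw
      rcases (hmem _).1 hu with hu | hu
      · exact G u hu (hleafB _ hl) hne r hr hrw
      · have h3 := hleafN _ hu hl
        rw [← h3] at hw hexv
        have h4 := (hS.mem_weakInitials_iff hexv).1 hrw
        have h5 := hWI r (Consistent.of_hbPrefix hS hw h4)
        have : r ∈ sl ∩ S.weakInitials E w := ⟨hr, h5⟩
        rw [hsl] at this
        exact this
    · intro p hp
      rcases before_insert hp with h1 | ⟨h1, h2⟩ | h1 | ⟨h1, h2⟩
      · exact hF.2 p h1
      · exact hNB _ h2 hF.1
      · exact hNB _ h1.mem_right hF.1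
      · have h3 := (hNpre _ h1).2.2
        have : v = [] := by
          cases v with
          | nil => rfl
          | cons _ _ => simp at h3
        subst this
        have := hlater' _ h2 (List.nil_prefix)
        simp at this
    · intro u hu
      refine ⟨(hmem _).2 (.inl hu), fun hl p hp => ?_⟩
      rcases (hmem _).1 hp with hp | hp
      · exact hl p hp
      · rcases (hconcat u p hp).2 with rfl | h1
        · exact h hl
        · exact hNB _ h1 hu
    · intro y hy hl
      rcases (hmem _).1 hy with hy | hy
      · exact ⟨hy, hleafB _ hl⟩
      · exfalso
        -- A new node below `q` would make `q` a weak initial of `w`. So the branch that is being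
        -- explored never changes.
        exact hq (hWI q (consistent_of_append (b := y) (by simpa using hcons _ (hNpre _ hy).1)))
    · have hvw : v ++ w' ∈ l₁ ++ N ++ v :: l₂ := by
        by_cases hw0 : w' = []
        · subst hw0
          rw [List.append_nil]
          exact (hmem _).2 (.inl hvB)
        · exact (hmem _).2 (.inr (mem_newNodes.2 ⟨w', List.prefix_refl _, hw0, rfl⟩))
      obtain ⟨y, hy, hl⟩ := WakeupTree.exists_leaf hvw
      refine ⟨_, hy, hl, ?_, ?_⟩
      · intro h0
        rw [h0] at hl
        exact hroot' hl
      · refine Consistent.of_hbPrefix hS hw ⟨[], y, ?_⟩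
        have := T'.exec _ hy
        simpa using HBSystem.Equiv.refl this

end Insert

end RelaxedDPOR

namespace RelaxedDPOR

/-! ### Correctness of Optimal-DPOR -/

section Optimal

variable {P : Type*} {S : HBSystem P}

open HBSystem

/-- The race detection of Optimal-DPOR has taken account of the reversal `v` of a race. -/
def Handled (S : HBSystem P) (E : List P) (sl : Set P) (B : List (List P)) (v : List P) : Prop :=
  (∃ q ∈ sl, q ∈ S.weakInitials E v) ∨ ∃ y ∈ B, IsLeaf B y ∧ y ≠ [] ∧ S.Consistent E y v

theorem insertWut_subset {E w : List P} {B B' : List (List P)} (h : InsertWut S E w B B') :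
    B ⊆ B' := by
  cases h with
  | leaf => exact fun _ h => h
  | extend l₁ l₂ v w' =>
    intro u hu
    simp only [List.mem_append, List.mem_cons] at hu ⊢
    tauto

/-- The root is consistent with every execution, so a smallest consistent node exists, and by
consistency it has some extension containing `w`. -/
theorem exists_insertWut {E w : List P} {B : List (List P)} (h : [] ∈ B) (he : S.isExec (E ++ w)) :
    ∃ B', InsertWut S E w B B' := by
  classical
  obtain ⟨l₁, v, l₂, rfl, h1, h2⟩ := exists_first_split (Q := fun u => S.Consistent E u w)
    ⟨_, h, w, [], by simpa using HBSystem.Equiv.refl he⟩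
  by_cases hl : IsLeaf (l₁ ++ v :: l₂) v
  · exact ⟨_, .leaf l₁ l₂ v h1 h2 hl⟩
  · have hex : ∃ n, ∃ w', S.HBPrefix E w (v ++ w') ∧ w'.length = n := by
      obtain ⟨s, t, h3⟩ := h1
      exact ⟨_, s, ⟨t, by simpa using h3.symm⟩, rfl⟩
    obtain ⟨w', h3, h4⟩ := Nat.find_spec hex
    exact ⟨_, .extend l₁ l₂ v w' h1 h2 hl h3 fun w'' h5 => h4 ▸ Nat.find_min' hex ⟨w'', h5, rfl⟩⟩

theorem exists_optimalRaces {L : List P} {sleep : List P → Set P}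
    (l : List ((P × ℕ) × (P × ℕ))) (wt : List P → List (List P))
    (h : ∀ r ∈ l, [] ∈ wt (pre L r.1) ∧ S.isExec (pre L r.1 ++ (S.notdep L r.1 ++ [r.2.1]))) :
    ∃ wt', OptimalRaces S L sleep l wt wt' := by
  induction l generalizing wt with
  | nil => exact ⟨wt, .nil wt⟩
  | cons r l ih =>
    obtain ⟨e, e'⟩ := r
    by_cases hs : sleep (pre L e) ∩ S.weakInitials (pre L e) (S.notdep L e ++ [e'.1]) = ∅
    · obtain ⟨h1, h2⟩ := h (e, e') (by simp)
      obtain ⟨B, hB⟩ := exists_insertWut h1 h2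
      obtain ⟨wt', h3⟩ := ih (assign wt (pre L e) B) (by
        intro r hr
        refine ⟨?_, (h r (by simp [hr])).2⟩
        by_cases hre : pre L r.1 = pre L e
        · rw [hre, assign_self]
          exact insertWut_subset hB h1
        · rw [assign_ne _ _ hre]
          exact (h r (by simp [hr])).1)
      exact ⟨wt', .insert e e' l wt wt' B hs hB h3⟩
    · obtain ⟨wt', h3⟩ := ih wt (fun r hr => h r (by simp [hr]))
      exact ⟨wt', .skip e e' l wt wt' (Set.nonempty_iff_ne_empty.2 hs) h3⟩

variable (hS : S.Valid)

include hS

/-- The last clause matters for insertion: the thread of the first event is not a weak initial of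
the reversal, so nothing is inserted below the child through which the current path runs. -/
theorem revRace_split {L : List P} {e e' : P × ℕ} (hL : S.isExec L) (h : S.RevRace L e e') :
    ∃ x, L = pre L e ++ e.1 :: x ∧ e = nextEv (pre L e) e.1 ∧
      S.isExec (pre L e ++ (S.notdep L e ++ [e'.1])) ∧
      e.1 ∉ S.weakInitials (pre L e) (S.notdep L e ++ [e'.1]) := by
  obtain ⟨A, x, h1, h2⟩ := exists_split_of_mem_events (mem_events.2 h.1.1)
  have hpre : pre L e = A := by
    rw [h1, h2]
    exact pre_nextEv _ _ _
  rw [hpre]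
  obtain ⟨p, i⟩ := e
  simp only at h1 h2
  rw [h2] at h ⊢
  subst h1
  obtain ⟨-, h3, -, h4, h5⟩ := hS.equiv_of_revRace hL h
  refine ⟨x, rfl, rfl, by simpa using h3, ?_⟩
  rintro (h6 | h6)
  · have := h6.1
    simp only [List.mem_append, List.mem_singleton] at this
    rcases this with h7 | h7
    · exact hS.notMem_notdep hL h7
    · exact h4 h7
  · exact h5 h6

/-- Each race changes the tree at a single prefix of `L`, whose child on the path is the thread of
the first event; so the hypotheses of `insert_spec` are met at each insertion and its conclusions
accumulate. -/
theorem optimalRaces_spec {L : List P} {sleep : List P → Set P}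
    {l : List ((P × ℕ) × (P × ℕ))} {wt wt' : List P → List (List P)}
    (h : OptimalRaces S L sleep l wt wt') (hL : S.isExec L)
    (hl : ∀ r ∈ l, S.RevRace L r.1 r.2)
    (hF : ∀ E q, E ++ [q] <+: L → Frame S E (sleep E) (wt E) q) :
    (∀ E q, E ++ [q] <+: L → Frame S E (sleep E) (wt' E) q) ∧
    (∀ A, (∀ q, ¬ A ++ [q] <+: L) → wt' A = wt A) ∧
    (∀ E q, E ++ [q] <+: L → (∀ u ∈ wt E, u ∈ wt' E ∧ (IsLeaf (wt E) u → IsLeaf (wt' E) u)) ∧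
      ∀ y, q :: y ∈ wt' E → IsLeaf (wt' E) (q :: y) → q :: y ∈ wt E ∧ IsLeaf (wt E) (q :: y)) ∧
    ∀ r ∈ l, Handled S (pre L r.1) (sleep (pre L r.1)) (wt' (pre L r.1))
      (S.notdep L r.1 ++ [r.2.1]) := by
  induction h with
  | nil wt => exact ⟨hF, fun _ _ => rfl, fun E q _ => ⟨fun u h => ⟨h, id⟩, fun y h h' => ⟨h, h'⟩⟩,
      by simp⟩
  | skip e e' l wt wt' h hs ih =>
    obtain ⟨h1, h2, h3, h4⟩ := ih (fun r hr => hl r (by simp [hr])) hF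
    refine ⟨h1, h2, h3, ?_⟩
    intro r hr
    rcases List.mem_cons.1 hr with rfl | hr
    · obtain ⟨q, hq⟩ := h
      exact .inl ⟨q, hq⟩
    · exact h4 r hr
  | insert e e' l wt wt' B h hB hs ih =>
    obtain ⟨x, h5, h6, h7, h8⟩ := revRace_split hS hL (hl _ List.mem_cons_self)
    simp only at h5 h6 h7 h8
    set A := pre L e with hA
    have hAL : A ++ [e.1] <+: L := ⟨x, by rw [List.append_assoc]; exact h5.symm⟩
    have huniq : ∀ q, A ++ [q] <+: L → q = e.1 := by
      intro q hq
      have := (List.prefix_of_prefix_length_le hq hAL (by simp)).eq_of_length (by simp)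
      simpa using this
    obtain ⟨i1, i2, i3, i4⟩ := insert_spec hS (hF _ _ hAL) hB h7 h h8
    obtain ⟨h1, h2, h3, h4⟩ := ih (fun r hr => hl r (by simp [hr])) (by
      intro E q hE
      by_cases hEA : E = A
      · subst hEA
        rw [assign_self, huniq q hE]
        exact i1
      · rw [assign_ne _ _ hEA]
        exact hF E q hE)
    refine ⟨h1, ?_, ?_, ?_⟩
    · intro E hE
      rw [h2 E hE, assign_ne]
      rintro rfl
      exact hE _ hAL
    · intro E q hE
      obtain ⟨h9, h10⟩ := h3 E q hE
      by_cases hEA : E = A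
      · subst hEA
        rw [assign_self] at h9 h10
        obtain rfl := huniq q hE
        refine ⟨fun u hu => ⟨(h9 u (i2 u hu).1).1, fun hul => (h9 u (i2 u hu).1).2
          ((i2 u hu).2 hul)⟩, fun y hy hyl => ?_⟩
        obtain ⟨h11, h12⟩ := h10 y hy hyl
        exact i3 y h11 h12
      · rw [assign_ne _ _ hEA] at h9 h10
        exact ⟨h9, h10⟩
    · intro r hr
      rcases List.mem_cons.1 hr with rfl | hr
      · right
        obtain ⟨y, j1, j2, j3, j4⟩ := i4
        have := (h3 A _ hAL).1 y (by rw [assign_self]; exact j1)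
        rw [assign_self] at this
        exact ⟨y, this.1, this.2 j2, j3, j4⟩
      · exact h4 r hr

end Optimal

/-! #### The invariant -/

section Invariant

variable {P : Type*} {S : HBSystem P} (hS : S.Valid)

open HBSystem

/-- `cover` and `races` record what has been achieved at the calls on the path. `logged_path`
locates logged executions: they leave the path through sleeping threads only. During a recursive
call the caller keeps an old copy of the branch handed over, while the callee works on its own tree;
`down` relates the two, a leaf of the copy being still present or starting with a thread that is now
asleep. The second part of `enter` and `loop` ensure that a call which has exhausted its tree has a
nonempty sleep set. -/
structure OptimalInv (S : HBSystem P) (s : OptimalState P) : Prop where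
  exec : S.isExec s.seq
  sleep_enabled : ∀ E, E <+: s.seq → s.sleep E ⊆ S.enabled E
  inherited_subset : ∀ E, E <+: s.seq → inherited S s.sleep E ⊆ s.sleep E
  path : ∀ E p, E ++ [p] <+: s.seq → p ∉ s.sleep E ∧ FirstChild (s.wut E) p
  tree : ∀ E, E <+: s.seq → WakeupTree S E (s.wut E)
  guarded : ∀ E, E <+: s.seq → Guarded S E (s.sleep E) (s.wut E)
  enter : s.ctl = .enter → (∀ L ∈ s.log, ¬ s.seq <+: L) ∧
    (s.wut s.seq = [[]] → s.sleep s.seq = ∅)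
  loop : s.ctl = .loop → (∃ p, [p] ∈ s.wut s.seq) ∨ (s.sleep s.seq).Nonempty
  logged_path : ∀ L ∈ s.log, ∀ E p, E <+: s.seq → E ++ [p] <+: L →
    p ∈ s.sleep E ∨ E ++ [p] <+: s.seq
  cover : ∀ E, E <+: s.seq → ∀ p ∈ s.sleep E, ∀ w, S.isExec (E ++ p :: w) →
    S.enabled (E ++ p :: w) = ∅ → ∃ L ∈ s.log, S.Equiv L (E ++ p :: w)
  races : ∀ E, E <+: s.seq → ∀ p x, E ++ p :: x ∈ s.log → ∀ e',
    S.RevRace (E ++ p :: x) (nextEv E p) e' →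
    Handled S E (s.sleep E) (s.wut E) (S.notdep (E ++ p :: x) (nextEv E p) ++ [e'.1])
  down : ∀ E q, E ++ [q] <+: s.seq → ∀ y, q :: y ∈ s.wut E → IsLeaf (s.wut E) (q :: y) → y ≠ [] →
    (y ∈ s.wut (E ++ [q]) ∧ IsLeaf (s.wut (E ++ [q])) y) ∨
      ∃ r z, y = r :: z ∧ r ∈ s.sleep (E ++ [q])
  ret : s.ctl = .ret → ∀ w, S.isExec (s.seq ++ w) → S.enabled (s.seq ++ w) = ∅ →
    ∃ L ∈ s.log, S.Equiv L (s.seq ++ w)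
  log_maximal : ∀ L ∈ s.log, S.isExec L ∧ S.enabled L = ∅
  log_pairwise : s.log.Pairwise (fun L L' => ¬ S.Equiv L L')

theorem eq_nil_of_maximal (hS : S.Valid) {L w : List P} (h : S.enabled L = ∅) (he : S.isExec (L ++ w)) :
    w = [] := by
  cases w with
  | nil => rfl
  | cons q w =>
    have : q ∈ S.enabled L := hS.exec_left (w := w) (by simpa using he)
    rw [h] at this
    simp at this

/-- Without a maximal extension there would be executions of every length. -/
theorem exists_maximal_extension {N : ℕ} (hN : ∀ L, S.isExec L → L.length ≤ N) {L : List P}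
    (h : S.isExec L) : ∃ w, S.isExec (L ++ w) ∧ S.enabled (L ++ w) = ∅ := by
  by_contra hc
  push Not at hc
  have : ∀ n, ∃ w, S.isExec (L ++ w) ∧ w.length = n := by
    intro n
    induction n with
    | zero => exact ⟨[], by simpa using h, rfl⟩
    | succ n ih =>
      obtain ⟨w, h1, h2⟩ := ih
      obtain ⟨q, hq⟩ := hc w h1
      exact ⟨w ++ [q], by simpa [HBSystem.enabled] using hq, by simp [h2]⟩
  obtain ⟨w, h1, h2⟩ := this (N + 1)
  have := hN _ h1
  simp at this
  omega

theorem enabled_eq_empty_of_equiv (hS : S.Valid) {L L' : List P} (h : S.Equiv L L')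
    (h' : S.enabled L = ∅) : S.enabled L' = ∅ := by
  ext q
  simp only [Set.mem_empty_iff_false, iff_false]
  intro hq
  have : q ∈ S.enabled L := (hS.equiv_append h.symm hq).2.1
  rw [h'] at this
  simp at this

theorem exists_divergence (E L : List P) (h : ¬ L <+: E) :
    ∃ A w p x, E = A ++ w ∧ L = A ++ p :: x ∧ ¬ A ++ [p] <+: E := by
  induction E generalizing L with
  | nil =>
    cases L with
    | nil => simp at h
    | cons p x => exact ⟨[], [], p, x, rfl, rfl, by simp⟩
  | cons a E ih =>
    cases L with
    | nil => simp at h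
    | cons p x =>
      by_cases hap : a = p
      · subst hap
        obtain ⟨A, w, q, y, h1, h2, h3⟩ := ih x (by simpa using h)
        exact ⟨a :: A, w, q, y, by simp [h1], by simp [h2], by simpa using h3⟩
      · exact ⟨[], a :: E, p, x, rfl, rfl, by
          intro h
          obtain ⟨z, hz⟩ := h
          simp at hz
          exact hap hz.1.symm⟩

/-- If `q` does not occur in `w`, then an initial of `w.s` is an initial of `s`. -/
theorem consistent_tail (hS : S.Valid) {A w s v : List P} {q : P} (hq : q ∉ w)
    (h : S.Equiv (A ++ q :: v) (A ++ w ++ s)) : ∃ v', S.Equiv (A ++ w ++ q :: v') (A ++ w ++ s) := by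
  have h1 : q ∈ S.initials A (w ++ s) := hS.mem_initials_of_equiv (by simpa using h.symm)
  have h2 : q ∈ S.initials (A ++ w) s := by
    refine ⟨by simpa [hq] using h1.1, fun e he hne hb => ?_⟩
    rw [nextEv_append_of_notMem hq] at hne hb
    refine h1.2 e ?_ hne (by simpa using hb)
    rw [mem_domAfter] at he ⊢
    rw [eventsFrom_append]
    exact List.mem_append_right _ he
  obtain ⟨v', h3⟩ := (hS.mem_initials_iff h.2.1).1 h2
  exact ⟨v', h3.symm⟩

namespace OptimalInv

include hS

/-- Consider the first step by which a thread sleeping at `A` would become an initial. This step is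
by the thread itself, which is independent of what precedes it and hence still asleep, but the path
never takes a sleeping thread. -/
theorem notMem_initials {s : OptimalState P} (I : OptimalInv S s) {A w : List P}
    (hw : A ++ w <+: s.seq) {q : P} (hq : q ∈ s.sleep A) : q ∉ S.initials A w := by
  induction w using List.reverseRecOn with
  | nil => exact fun h => by simpa using h.1
  | append_singleton w b ih =>
    intro h
    have hw' : A ++ w ++ [b] <+: s.seq := by simpa using hw
    have hex : S.isExec (A ++ w ++ [b]) := by
      obtain ⟨z, hz⟩ := hw'
      exact hS.exec_left (w := z) (hz ▸ I.exec)
    have hpre : A ++ w <+: s.seq := (List.prefix_append _ _).trans hw'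
    by_cases hqw : q ∈ w
    · exact ih hpre (hS.initials_of_append hex hqw h)
    · obtain rfl : q = b := by
        have := h.1
        simpa [hqw] using this
      have hind := hS.indep_of_mem_initials_concat hex hqw h
      exact (I.path _ q hw').1 (mem_sleep_append hS (fun B hB => I.inherited_subset B
        (hB.trans hpre)) hq hind)

/-- The first alternative of `mem_initials_or_indep` is excluded by `notMem_initials`. So a thread
sleeping at `A` that can start a continuation of the current sequence is asleep at the current
sequence and can start what follows it. -/
theorem indep_of_equiv {s : OptimalState P} (I : OptimalInv S s) {A w v s' : List P} {q : P}
    (hE : s.seq = A ++ w) (hq : q ∈ s.sleep A) (h : S.Equiv (A ++ q :: v) (A ++ w ++ s')) :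
    S.Indep A q w ∧ q ∈ s.sleep s.seq ∧ ∃ v', S.Equiv (s.seq ++ q :: v') (s.seq ++ s') := by
  have hind : S.Indep A q w := by
    rcases hS.mem_initials_or_indep h with h1 | h1
    · exact absurd h1 (I.notMem_initials hS (by rw [hE]) hq)
    · exact h1
  refine ⟨hind, ?_, ?_⟩
  · rw [hE]
    exact mem_sleep_append hS (fun B hB => I.inherited_subset B (by rwa [hE])) hq hind
  · rw [hE]
    exact consistent_tail hS (hS.indep_notMem hind) h

/-- No leaf of a wakeup tree on the current path leads to a sequence whose start has been
explored. -/
theorem not_consistent_of_leaf {s : OptimalState P} (I : OptimalInv S s)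
    (hroot : s.wut s.seq = [[]]) {g : List P} {p : P}
    (hg : ∀ A w q, s.seq = A ++ w → q ∈ s.sleep A → ¬ S.Consistent A [q] (w ++ g))
    (w A y : List P) (hE : s.seq = A ++ w) (hp : p ∈ s.sleep A) (hpw : S.Indep A p w)
    (hy : y ∈ s.wut A) (hl : IsLeaf (s.wut A) y) (hne : y ≠ []) :
    ¬ S.Consistent A y (w ++ g) := by
  induction w generalizing A y with
  | nil =>
    rw [List.append_nil] at hE
    rw [← hE, hroot] at hy
    exact absurd (by simpa using hy) hne
  | cons b w ih =>
    intro hc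
    have hpre : A ++ [b] <+: s.seq := ⟨w, by simp [hE]⟩
    have hpreA : A <+: s.seq := ⟨b :: w, hE.symm⟩
    obtain ⟨-, hfirst⟩ := I.path A b hpre
    cases y with
    | nil => exact hne rfl
    | cons a y =>
      have hexy := (I.tree A hpreA).exec _ hy
      by_cases hab : a = b
      · subst hab
        have hind : S.Indep A p [a] ∧ S.Indep (A ++ [a]) p w :=
          hS.indep_append.1 (by simpa using hpw)
        by_cases hy0 : y = []
        · subst hy0
          -- The leaf consists of `a` alone, and `p` is asleep and independent of `a`, hence a weak
          -- initial of the leaf.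
          exact I.guarded A hpreA _ hy hl hne p hp (.inr hind.1)
        · have hc' : S.Consistent (A ++ [a]) y (w ++ g) := by
            obtain ⟨u, t, h⟩ := hc
            exact ⟨u, t, by simpa using h⟩
          -- The leaf is followed into the tree of the next call on the path, or it starts with a
          -- thread that is already asleep there.
          rcases I.down A a hpre y hy hl hy0 with ⟨h1, h2⟩ | ⟨r, z, rfl, h1⟩
          · refine ih (A ++ [a]) y (by simp [hE]) ?_ hind.2 h1 h2 hy0 hc'
            exact mem_sleep_append hS (fun B hB => I.inherited_subset B (hB.trans hpre)) hp hind.1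
          · exact hg (A ++ [a]) w r (by simp [hE]) h1 (consistent_of_append (b := z) hc')
      -- The leaf lies in a later branch than the path. Consistency would make `b` a weak initial of
      -- it, against the order of the tree.
      · have hbef := (I.tree A hpreA).before_of_firstChild hfirst hy hab
        refine (I.tree A hpreA).weakInitials [] b (a :: y) hbef hl ?_
        rw [List.append_nil]
        refine (hS.mem_weakInitials_iff hexy).2 ?_
        obtain ⟨u, t, h⟩ := hc
        exact ⟨w ++ g ++ t, u, by simpa using h.symm⟩

/-- The argument is that of Source-DPOR, with sleep sets in place of lists of done threads. As only
maximal executions are recorded, `p.u.r` is first extended to a maximal one. The logged execution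
equivalent to it may have left the path at an ancestor `A`, so the race was handled in the tree at
`A`; there it left a sleeping weak initial or a leaf, and both are ruled out. -/
theorem exists_of_exit {N : ℕ} (hN : ∀ L, S.isExec L → L.length ≤ N) {s : OptimalState P}
    (I : OptimalInv S s) (hc : s.ctl = .loop) (h : ∀ p, [p] ∉ s.wut s.seq) {w : List P}
    (hw : S.isExec (s.seq ++ w)) (hen : S.enabled (s.seq ++ w) = ∅) :
    ∃ L ∈ s.log, S.Equiv L (s.seq ++ w) := by
  have hseq : s.seq <+: s.seq := List.prefix_refl _
  have hroot : s.wut s.seq = [[]] := (I.tree _ hseq).eq_root h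
  have hne : (s.sleep s.seq).Nonempty := by
    rcases I.loop hc with ⟨p, hp⟩ | h1
    · exact absurd hp (h p)
    · exact h1
  by_cases hWI : ∃ p ∈ s.sleep s.seq, p ∈ S.weakInitials s.seq w
  · obtain ⟨p, hp, hpw⟩ := hWI
    obtain ⟨u, t, h1⟩ := (hS.mem_weakInitials_iff hw).1 hpw
    obtain rfl := eq_nil_of_maximal hS hen h1.2.1
    rw [List.append_nil] at h1
    obtain ⟨L, hL, h2⟩ := I.cover _ hseq p hp u (by simpa using h1.1)
      (by simpa using enabled_eq_empty_of_equiv hS h1.symm hen)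
    exact ⟨L, hL, h2.trans (by simpa using h1)⟩
  exfalso
  push Not at hWI
  obtain ⟨p, hp, u, r, w', rfl, hpu, hlong⟩ := exists_longest (D := s.sleep s.seq)
    (Q := fun p u => S.Indep s.seq p u) (w := w)
    (by obtain ⟨p, hp⟩ := hne
        exact ⟨p, hp, HBSystem.indep_nil (I.sleep_enabled _ hseq hp)⟩)
    (fun p hp h => hWI p hp (.inr h))
  have hexr : S.isExec (s.seq ++ u ++ [r] ++ w') := by simpa using hw
  have hur : S.isExec (s.seq ++ u ++ [r]) := hS.exec_left hexr
  have hnotI : ∀ q ∈ s.sleep s.seq, q ∉ S.initials s.seq (u ++ [r]) := by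
    intro q hq hqi
    have := hS.initials_append (b := w') (by simpa using hexr) hqi
    exact hWI q hq (.inl (by simpa using this))
  have hnotI' : ∀ q ∈ s.sleep s.seq, q ∉ S.initials s.seq u := fun q hq hqi =>
    hnotI q hq (hS.initials_append hur hqi)
  have hpr : p ≠ r := by
    rintro rfl
    exact hnotI p hp (hS.mem_initials_of_equiv (by simpa using (hS.indep_equiv hpu).symm))
  have hnp := hlong p hp
  obtain ⟨hexp, -⟩ := hS.exec_of_indep hpu hur hpr
  obtain ⟨z, hz, hzen⟩ := exists_maximal_extension hN hexp
  have hz' : s.seq ++ p :: u ++ [r] ++ z = s.seq ++ p :: (u ++ r :: z) := by simp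
  rw [hz'] at hz hzen
  obtain ⟨L, hL, hLe⟩ := I.cover _ hseq p hp _ hz hzen
  obtain ⟨A, x', p', x, hA, rfl, hdiv⟩ := exists_divergence s.seq L (by
    intro hpre
    have := hLe.perm.length_eq
    have := hpre.length_le
    simp at *
    omega)
  have hAs : A <+: s.seq := ⟨x', hA.symm⟩
  have hp' : p' ∈ s.sleep A := by
    rcases I.logged_path _ hL A p' hAs ⟨x, by simp⟩ with h1 | h1
    · exact h1
    · exact absurd h1 hdiv
  have hLe' : S.Equiv (A ++ p' :: x) (A ++ x' ++ (p :: u ++ r :: z)) := by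
    rw [← hA]
    simpa using hLe
  obtain ⟨hind, hp's, v', hv'⟩ := I.indep_of_equiv hS hA hp' hLe'
  -- The logged execution leaves the path through a thread that is asleep at the current sequence
  -- too. A thread other than `p` would be an initial of `u` or independent of `u.r`, and neither is
  -- possible for a sleeping thread.
  obtain rfl : p' = p := by
    by_contra hne'
    rcases hS.mem_initials_or_indep_of_race hpu hur hpr hnp hne'
      ⟨v', z, by simpa using hv'⟩ with h1 | h1
    · exact hnotI' _ hp's h1
    · exact hlong _ hp's h1
  have hindu : S.Indep A p' (x' ++ u) := hS.indep_append.2 ⟨hind, hA ▸ hpu⟩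
  have hnindu : ¬ S.Indep A p' (x' ++ u ++ [r]) := by
    rw [List.append_assoc]
    intro h1
    have := (hS.indep_append.1 h1).2
    rw [← hA] at this
    exact hnp this
  have hexu : S.isExec (A ++ (x' ++ u) ++ [r]) := by
    rw [← List.append_assoc, ← hA]
    exact hur
  have hLu : S.Equiv (A ++ p' :: x) (A ++ p' :: (x' ++ u) ++ r :: z) := by
    have h1 := hS.equiv_append (w := u ++ r :: z) (hS.indep_equiv hind).symm
      (by simpa [hA] using hLe.2.1)
    refine hLe'.trans ?_
    simpa using h1
  have hrace := hS.revRace_of_race hindu hexu hpr hnindu hLu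
  obtain ⟨y, hy⟩ := hS.equiv_notdep hindu hexu hpr hnindu hLu
  -- No thread sleeping anywhere on the path can start the remaining path followed by an extension
  -- of `u.r`: it would be asleep at the end of the path and be a weak initial of `u.r`.
  have hF : ∀ B w q, s.seq = B ++ w → q ∈ s.sleep B →
      ¬ S.Consistent B [q] (w ++ (u ++ r :: y)) := by
    rintro B w q hB hq ⟨v, t, h1⟩
    obtain ⟨-, h2, v', h3⟩ := I.indep_of_equiv hS (v := v) (s' := u ++ r :: y ++ t) hB hq
      (by simpa using h1)
    rcases hS.mem_initials_or_indep (E := s.seq) (w := u ++ [r]) (w' := y ++ t) (q := q) (v := v')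
      (by simpa using h3) with h4 | h4
    · exact hnotI q h2 h4
    · exact hlong q h2 h4
  -- The reversal of the race at `A` has the rest of the path, then `u.r`, as a part, by
  -- `equiv_notdep`; consistency transfers.
  have hcons : ∀ a, S.Consistent A a (S.notdep (A ++ p' :: x) (nextEv A p') ++ [r]) →
      S.Consistent A a (x' ++ (u ++ r :: y)) := by
    rintro a ⟨v, t, h1⟩
    refine ⟨v, t, ?_⟩
    have h2 : S.Equiv (A ++ (S.notdep (A ++ p' :: x) (nextEv A p') ++ [r]) ++ t)
        (A ++ (x' ++ u) ++ r :: y ++ t) := hS.equiv_append (by simpa using hy) h1.2.1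
    simpa using h1.trans h2
  rcases I.races A hAs p' x hL _ hrace with ⟨q, hq, hqv⟩ | ⟨b, hb, hbl, hb0, hbc⟩
  · refine hF A x' q hA hq (hcons [q] ((hS.mem_weakInitials_iff ?_).1 hqv))
    simpa using hy.1
  · exact I.not_consistent_of_leaf hS hroot hF x' A b hA hp' hind hb hbl hb0 (hcons b hbc)

end OptimalInv

end Invariant

end RelaxedDPOR

namespace RelaxedDPOR

/-! ### Preservation of the invariant by the steps of Optimal-DPOR -/

section OptimalSteps

variable {P : Type*} {S : HBSystem P} (hS : S.Valid)

open HBSystem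

theorem optimalInv_init (hS : S.Valid) : OptimalInv S OptimalState.init := by
  have hpre : ∀ E : List P, E <+: (OptimalState.init (P := P)).seq → E = [] := by
    intro E hE
    simpa [OptimalState.init] using hE
  have hpre' : ∀ (E : List P) q, ¬ E ++ [q] <+: (OptimalState.init (P := P)).seq := by
    intro E q hE
    simpa using hpre _ hE
  refine ⟨hS.exec_nil, ?_, ?_, ?_, ?_, ?_, ?_, ?_, ?_, ?_, ?_, ?_, ?_, ?_, ?_⟩
  · intro E _ q hq
    simp [OptimalState.init] at hq
  · intro E hE
    rw [hpre E hE]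
    simp
  · exact fun E p h => absurd h (hpre' E p)
  · intro E hE
    rw [hpre E hE]
    exact wakeupTree_singleton hS.exec_nil
  · intro E _ w _ _ _ q hq
    simp [OptimalState.init] at hq
  · simp [OptimalState.init]
  · simp [OptimalState.init]
  · simp [OptimalState.init]
  · simp [OptimalState.init]
  · simp [OptimalState.init]
  · exact fun E q h => absurd h (hpre' E q)
  · simp [OptimalState.init]
  · simp [OptimalState.init]
  · simp [OptimalState.init]

theorem prefix_eq_or_concat {E L : List P} (h : E <+: L) : E = L ∨ ∃ q, E ++ [q] <+: L := by
  obtain ⟨w, rfl⟩ := h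
  cases w with
  | nil => exact .inl (by simp)
  | cons q w => exact .inr ⟨q, w, by simp⟩

/-- If the recorded leaf disappears with its branch, the root of the branch is a weak initial of
`v`, and it is asleep now. -/
theorem Handled.removeBranch {E v : List P} {sl : Set P} {B : List (List P)} {p : P}
    (hS : S.Valid) (hv : S.isExec (E ++ v)) (h : Handled S E sl B v) :
    Handled S E (insert p sl) (removeBranch B p) v := by
  rcases h with ⟨q, hq, h⟩ | ⟨y, hy, hl, hne, h⟩
  · exact .inl ⟨q, .inr hq, h⟩
  · cases y with
    | nil => exact absurd rfl hne
    | cons a y =>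
      by_cases hap : a = p
      · subst hap
        exact .inl ⟨a, .inl rfl, (hS.mem_weakInitials_iff hv).2
          (consistent_of_append (b := y) (by simpa using h))⟩
      · exact .inr ⟨a :: y, mem_removeBranch.2 ⟨hy, by simpa using hap⟩,
          isLeaf_removeBranch hl, hne, h⟩

/-- A handed-down thread commutes with `p`, so if it could start a leaf of the subtree, it could
start the corresponding leaf of the whole tree. -/
theorem guarded_subtree (hS : S.Valid) {E : List P} {sl : Set P} {B : List (List P)} {p : P}
    (T : WakeupTree S E B) (G : Guarded S E sl B) :
    Guarded S (E ++ [p]) {q ∈ sl | S.Indep E p [q]} (subtree B p) := by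
  intro w hw hl _ q hq hqw
  have hpw := mem_subtree.1 hw
  have hex := T.exec _ hpw
  refine G _ hpw (isLeaf_subtree.1 hl) (by simp) q hq.1 ((hS.mem_weakInitials_iff hex).2 ?_)
  obtain ⟨s, t, h⟩ := (hS.mem_weakInitials_iff (by simpa using hex)).1 hqw
  have h1 := hS.indep_equiv hq.2
  have h2 := hS.equiv_append (w := s) h1 (by simpa using h.1)
  exact ⟨p :: s, t, by simpa using h2.symm.trans (by simpa using h)⟩

include hS

namespace OptimalInv

theorem maximal {s : OptimalState P} (I : OptimalInv S s) (hc : s.ctl = .enter)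
    (h : S.enabled s.seq = ∅) {l : List ((P × ℕ) × (P × ℕ))}
    (hl : ∀ r, r ∈ l ↔ S.RevRace s.seq r.1 r.2) {wt : List P → List (List P)}
    (hwt : OptimalRaces S s.seq s.sleep l s.wut wt) :
    OptimalInv S { s with ctl := .ret, wut := wt, log := s.log ++ [s.seq] } := by
  obtain ⟨h1, h2, h3, h4⟩ := optimalRaces_spec hS hwt I.exec (fun r hr => (hl r).1 hr)
    (fun E q hE => ⟨I.tree E ((List.prefix_append _ _).trans hE),
      I.guarded E ((List.prefix_append _ _).trans hE), (I.path E q hE).2⟩)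
  have hself : wt s.seq = s.wut s.seq := h2 _ (fun q hq => prefix_ne_concat hq rfl)
  refine ⟨I.exec, I.sleep_enabled, I.inherited_subset, ?_, ?_, ?_, by simp, by simp, ?_, ?_, ?_, ?_,
    ?_, ?_, ?_⟩
  · exact fun E p hE => ⟨(I.path E p hE).1, (h1 E p hE).first⟩
  · intro E hE
    rcases prefix_eq_or_concat hE with rfl | ⟨q, hq⟩
    · simp only [hself]
      exact I.tree _ hE
    · exact (h1 E q hq).tree
  · intro E hE
    rcases prefix_eq_or_concat hE with rfl | ⟨q, hq⟩
    · simp only [hself]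
      exact I.guarded _ hE
    · exact (h1 E q hq).guarded
  · intro L hL E p hE hp
    rcases List.mem_append.1 hL with hL | hL
    · exact I.logged_path L hL E p hE hp
    · obtain rfl : L = s.seq := by simpa using hL
      exact .inr hp
  · intro E hE p hp w hw hen
    obtain ⟨L, hL, h5⟩ := I.cover E hE p hp w hw hen
    exact ⟨L, List.mem_append_left _ hL, h5⟩
  · intro E hE p x hL e' hr
    rcases List.mem_append.1 hL with hL | hL
    · have hH := I.races E hE p x hL e' hr
      rcases prefix_eq_or_concat hE with rfl | ⟨q, hq⟩
      · exact absurd (List.prefix_append _ _) ((I.enter hc).1 _ hL)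
      · rcases hH with hH | ⟨y, h5, h6, h7⟩
        · exact .inl hH
        · have := (h3 E q hq).1 y h5
          exact .inr ⟨y, this.1, this.2 h6, h7⟩
    · have hL : E ++ p :: x = s.seq := by simpa using hL
      have := h4 (nextEv E p, e') ((hl _).2 (hL ▸ hr))
      rw [← hL] at this
      simp only [pre_nextEv] at this
      exact this
  · intro E q hE y hy hly hne
    -- Insertions at the caller add no leaf below the child on the path, so only old leaves have to
    -- be followed down.
    obtain ⟨h5, h6⟩ := (h3 E q hE).2 y hy hly
    rcases I.down E q hE y h5 h6 hne with ⟨h7, h8⟩ | h7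
    · left
      rcases prefix_eq_or_concat hE with h9 | ⟨r, hr⟩
      · simp only [h9, hself]
        rw [h9] at h7 h8
        exact ⟨h7, h8⟩
      · have := (h3 _ r hr).1 y h7
        exact ⟨this.1, this.2 h8⟩
    · exact .inr h7
  · intro _ w hw _
    obtain rfl := eq_nil_of_maximal hS h hw
    exact ⟨s.seq, by simp, by simpa using HBSystem.Equiv.refl I.exec⟩
  · intro L hL
    rcases List.mem_append.1 hL with hL | hL
    · exact I.log_maximal L hL
    · obtain rfl : L = s.seq := by simpa using hL
      exact ⟨I.exec, h⟩
  · rw [List.pairwise_append]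
    refine ⟨I.log_pairwise, by simp, fun L hL L' hL' he => ?_⟩
    obtain rfl : L' = s.seq := by simpa using hL'
    -- An equivalent logged execution would leave the path through a sleeping thread, which would
    -- then be an initial of the rest of the path.
    obtain ⟨A, w, b, x, h5, rfl, h7⟩ := exists_divergence s.seq L (by
      intro hpre
      have := hpre.eq_of_length he.perm.length_eq
      exact (I.enter hc).1 L hL (this ▸ List.prefix_refl _))
    rcases I.logged_path _ hL A b ⟨w, h5.symm⟩ ⟨x, by simp⟩ with h8 | h8
    · refine I.notMem_initials hS (w := w) (by rw [h5]) h8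
        (hS.mem_initials_of_equiv (w' := x) ?_)
      rw [← h5]
      exact he.symm
    · exact h7 h8

theorem choose {s : OptimalState P} (I : OptimalInv S s) (hc : s.ctl = .enter) {p : P}
    (hp : p ∈ S.enabled s.seq) (hw : s.wut s.seq = [[]]) :
    OptimalInv S { s with ctl := .loop, wut := assign s.wut s.seq [[p], []] } := by
  have hne : ∀ E q, E ++ [q] <+: s.seq → assign s.wut s.seq [[p], []] E = s.wut E := by
    intro E q hE
    refine assign_ne _ _ ?_
    rintro rfl
    exact prefix_ne_concat hE rfl
  refine ⟨I.exec, I.sleep_enabled, I.inherited_subset, ?_, ?_, ?_, by simp, ?_, I.logged_path,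
    I.cover, ?_, ?_, by simp, I.log_maximal, I.log_pairwise⟩
  · intro E q hE
    simp only [hne E q hE]
    exact I.path E q hE
  · intro E hE
    rcases prefix_eq_or_concat hE with rfl | ⟨q, hq⟩
    · simp only [assign_self]
      exact wakeupTree_pair hS hp
    · simp only [hne E q hq]
      exact I.tree E hE
  · intro E hE
    rcases prefix_eq_or_concat hE with rfl | ⟨q, hq⟩
    · intro w _ _ _ q hq
      -- A fresh tree is grown only where the given one consists of its root; there the sleep set is
      -- empty and nothing has to be guarded.
      simp only [(I.enter hc).2 hw] at hq
      exact absurd hq (Set.notMem_empty _)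
    · simp only [hne E q hq]
      exact I.guarded E hE
  · intro _
    left
    exact ⟨p, by simp [assign_self]⟩
  · intro E hE q x hL e' hr
    rcases prefix_eq_or_concat hE with rfl | ⟨r, hq⟩
    · exact absurd (List.prefix_append _ _) ((I.enter hc).1 _ hL)
    · simp only [hne E r hq]
      exact I.races E hE q x hL e' hr
  · intro E q hE y hy hl hy0
    simp only [hne E q hE] at hy hl
    rcases I.down E q hE y hy hl hy0 with h1 | h1
    · rcases prefix_eq_or_concat hE with h2 | ⟨r, hr⟩
      · rw [h2, hw] at h1
        exact absurd (by simpa using h1.1) hy0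
      · simp only [hne _ r hr]
        exact .inl h1
    · exact .inr h1

theorem call {s : OptimalState P} (I : OptimalInv S s) {p : P} {l₁ l₂ : List (List P)}
    (hp : s.wut s.seq = l₁ ++ [p] :: l₂) (hmin : ∀ u ∈ l₁, u.length ≠ 1) :
    OptimalInv S
        { s with
          seq := s.seq ++ [p]
          ctl := .enter
          sleep := assign s.sleep (s.seq ++ [p]) {q ∈ s.sleep s.seq | S.Indep s.seq p [q]}
          wut := assign s.wut (s.seq ++ [p]) (subtree (s.wut s.seq) p) } := by
  have hseq : s.seq <+: s.seq := List.prefix_refl _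
  have T := I.tree _ hseq
  have G := I.guarded _ hseq
  have hmem : [p] ∈ s.wut s.seq := by simp [hp]
  have hexp : S.isExec (s.seq ++ [p]) := T.exec _ hmem
  have hfirst : FirstChild (s.wut s.seq) p := by
    refine ⟨hmem, fun a ha => ?_⟩
    have hn := T.nodup
    rw [hp] at ha hn
    exact hmin _ (mem_of_before_of_nodup hn ha) rfl
  have hpsl : p ∉ s.sleep s.seq := by
    -- A sleeping `p` would start a leaf below it, against the guard.
    intro h
    obtain ⟨y, hy, hl⟩ := WakeupTree.exists_leaf hmem
    refine G _ hy hl (by simp) p h ((hS.mem_weakInitials_iff (T.exec _ hy)).2 ⟨y, [], ?_⟩)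
    simpa using HBSystem.Equiv.refl (T.exec _ hy)
  have hnolog : ∀ L ∈ s.log, ¬ s.seq ++ [p] <+: L := by
    intro L hL hpre
    rcases I.logged_path L hL _ p hseq hpre with h | h
    · exact hpsl h
    · exact prefix_ne_concat h rfl
  have hsl : ∀ {E}, E <+: s.seq → ∀ X, assign s.sleep (s.seq ++ [p]) X E = s.sleep E :=
    fun hE X => assign_ne _ _ (prefix_ne_concat hE)
  have hwt : ∀ {E}, E <+: s.seq → ∀ X, assign s.wut (s.seq ++ [p]) X E = s.wut E :=
    fun hE X => assign_ne _ _ (prefix_ne_concat hE)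
  have hinh : ∀ {E}, E <+: s.seq ++ [p] → ∀ X,
      inherited S (assign s.sleep (s.seq ++ [p]) X) E = inherited S s.sleep E := by
    intro E hE X
    refine inherited_congr fun B hB hne => assign_ne _ _ ?_
    rintro rfl
    exact hne (hB.eq_of_length_le hE.length_le)
  refine ⟨hexp, ?_, ?_, ?_, ?_, ?_, ?_, by simp, ?_, ?_, ?_, ?_, by simp, I.log_maximal,
    I.log_pairwise⟩
  · intro E hE
    rcases prefix_concat_iff'.1 hE with hE | rfl
    · simp only [hsl hE]
      exact I.sleep_enabled E hE
    · simp only [assign_self]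
      rintro q ⟨-, hq⟩
      have := hq.exec
      simpa [HBSystem.enabled] using this
  · intro E hE
    simp only [hinh hE]
    rcases prefix_concat_iff'.1 hE with hE | rfl
    · simp only [hsl hE]
      exact I.inherited_subset E hE
    · simp only [assign_self]
      intro q hq
      exact mem_inherited_concat.1 hq
  · intro E q hE
    rcases concat_prefix_concat hE with hE' | ⟨rfl, rfl⟩
    · have hE'' := (List.prefix_append _ _).trans hE'
      simp only [hsl hE'', hwt hE'']
      exact I.path E q hE'
    · simp only [hsl hseq, hwt hseq]
      exact ⟨hpsl, hfirst⟩
  · intro E hE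
    rcases prefix_concat_iff'.1 hE with hE | rfl
    · simp only [hwt hE]
      exact I.tree E hE
    · simp only [assign_self]
      exact T.subtree hmem
  · intro E hE
    rcases prefix_concat_iff'.1 hE with hE | rfl
    · simp only [hwt hE, hsl hE]
      exact I.guarded E hE
    · simp only [assign_self]
      exact guarded_subtree hS T G
  · intro _
    refine ⟨hnolog, ?_⟩
    simp only [assign_self]
    intro hroot
    have hl : IsLeaf (s.wut s.seq) [p] := by
      refine isLeaf_subtree.1 ?_
      rw [hroot]
      intro q hq
      simp at hq
    ext q
    simp only [Set.mem_ofPred_eq, Set.mem_empty_iff_false, iff_false, not_and]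
    intro hq hqi
    -- If the subtree is only a root, `[p]` is a leaf. A thread that is handed down is independent
    -- of `p`, so the guard of this leaf leaves none.
    exact G _ hmem hl (by simp) q hq (.inr (hS.indep_singleton_symm hqi))
  · intro L hL E q hE hq
    rcases prefix_concat_iff'.1 hE with hE | rfl
    · simp only [hsl hE]
      exact (I.logged_path L hL E q hE hq).imp id (fun h => h.trans (List.prefix_append _ _))
    · exact absurd ((List.prefix_append _ _).trans hq) (hnolog L hL)
  · intro E hE q hq w hw hen
    rcases prefix_concat_iff'.1 hE with hE | rfl
    · simp only [hsl hE] at hq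
      exact I.cover E hE q hq w hw hen
    · simp only [assign_self] at hq
      have h1 := hS.indep_equiv hq.2
      have h2 : S.Equiv (s.seq ++ q :: p :: w) (s.seq ++ [p] ++ q :: w) := by
        have := hS.equiv_append (w := w) h1 (by simpa using hw)
        simpa using this.symm
      -- What starts with `p.q` is equivalent to something that starts with `q.p`, and this is
      -- covered at the caller.
      obtain ⟨L, hL, h3⟩ := I.cover _ hseq q hq.1 (p :: w) h2.1
        (enabled_eq_empty_of_equiv hS h2.symm hen)
      exact ⟨L, hL, h3.trans h2⟩
  · intro E hE q x hL e' hr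
    rcases prefix_concat_iff'.1 hE with hE | rfl
    · simp only [hsl hE, hwt hE]
      exact I.races E hE q x hL e' hr
    · exact absurd (List.prefix_append _ _) (hnolog _ hL)
  · intro E q hE y hy hl hy0
    rcases concat_prefix_concat hE with hE' | ⟨rfl, rfl⟩
    · have hE'' := (List.prefix_append _ _).trans hE'
      simp only [hwt hE''] at hy hl
      simp only [hwt hE', hsl hE']
      exact I.down E q hE' y hy hl hy0
    · simp only [hwt hseq] at hy hl
      simp only [assign_self]
      exact .inl ⟨mem_subtree.2 hy, isLeaf_subtree.2 hl⟩

theorem back {s : OptimalState P} (I : OptimalInv S s) (hc : s.ctl = .ret) {E : List P} {p : P}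
    (h : s.seq = E ++ [p]) :
    OptimalInv S
        { s with
          seq := E
          ctl := .loop
          sleep := assign s.sleep E (insert p (s.sleep E))
          wut := assign s.wut E (removeBranch (s.wut E) p) } := by
  have hEs : E ++ [p] <+: s.seq := by rw [h]
  have hE : E <+: s.seq := (List.prefix_append _ _).trans hEs
  have hpre : ∀ {A}, A <+: E → A <+: s.seq := fun hA => hA.trans hE
  have hinh : ∀ {A}, A <+: E → ∀ X,
      inherited S (assign s.sleep E X) A = inherited S s.sleep A := by
    intro A hA X
    refine inherited_congr fun B hB hne => assign_ne _ _ ?_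
    rintro rfl
    exact hne (hB.eq_of_length_le hA.length_le)
  have hsub : ∀ A, s.sleep A ⊆ assign s.sleep E (insert p (s.sleep E)) A := by
    intro A
    by_cases hA : A = E
    · subst hA
      rw [assign_self]
      exact Set.subset_insert _ _
    · rw [assign_ne _ _ hA]
  refine ⟨hS.exec_left (w := [p]) (h ▸ I.exec), ?_, ?_, ?_, ?_, ?_, by simp, ?_, ?_, ?_, ?_, ?_,
    by simp, I.log_maximal, I.log_pairwise⟩
  · intro A hA
    by_cases hAE : A = E
    · subst hAE
      simp only [assign_self]
      refine Set.insert_subset ?_ (I.sleep_enabled A hE)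
      have := I.exec
      rwa [h] at this
    · simp only [assign_ne _ _ hAE]
      exact I.sleep_enabled A (hpre hA)
  · intro A hA
    simp only [hinh hA]
    exact (I.inherited_subset A (hpre hA)).trans (hsub A)
  · intro A q hA
    have hAE : A ≠ E := by
      rintro rfl
      exact prefix_ne_concat hA rfl
    simp only [assign_ne _ _ hAE]
    exact I.path A q (hpre hA)
  · intro A hA
    by_cases hAE : A = E
    · subst hAE
      simp only [assign_self]
      exact (I.tree A hE).removeBranch p
    · simp only [assign_ne _ _ hAE]
      exact I.tree A (hpre hA)
  · intro A hA
    by_cases hAE : A = E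
    · subst hAE
      simp only [assign_self]
      exact (I.guarded A hE).removeBranch (I.tree A hE) (I.path A p hEs).2
    · simp only [assign_ne _ _ hAE]
      exact I.guarded A (hpre hA)
  · intro _
    right
    exact ⟨p, by simp [assign_self]⟩
  · intro L hL A q hA hq
    rcases I.logged_path L hL A q (hpre hA) hq with h1 | h1
    · exact .inl (hsub A h1)
    · rw [h] at h1
      rcases concat_prefix_concat h1 with h1 | ⟨rfl, rfl⟩
      · exact .inr h1
      · exact .inl (by simp [assign_self])
  · intro A hA q hq w hw hen
    by_cases hAE : A = E
    · subst hAE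
      simp only [assign_self] at hq
      rcases hq with rfl | hq
      · obtain ⟨L, hL, h1⟩ := I.ret hc w (by rw [h]; simpa using hw) (by rw [h]; simpa using hen)
        exact ⟨L, hL, by rw [h] at h1; simpa using h1⟩
      · exact I.cover A hE q hq w hw hen
    · simp only [assign_ne _ _ hAE] at hq
      exact I.cover A (hpre hA) q hq w hw hen
  · intro A hA q x hL e' hr
    have hH := I.races A (hpre hA) q x hL e' hr
    by_cases hAE : A = E
    · subst hAE
      simp only [assign_self]
      refine hH.removeBranch hS ?_
      have := (hS.equiv_of_revRace (I.log_maximal _ hL).1 hr).2.1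
      simpa using this
    · simp only [assign_ne _ _ hAE]
      exact hH
  · intro A q hA y hy hl hy0
    have hAE : A ≠ E := by
      rintro rfl
      exact prefix_ne_concat hA rfl
    simp only [assign_ne _ _ hAE] at hy hl
    rcases I.down A q (hpre hA) y hy hl hy0 with ⟨h1, h2⟩ | ⟨r, z, h1, h2⟩
    · by_cases hAE' : A ++ [q] = E
      · simp only [hAE', assign_self]
        rw [hAE'] at h1 h2
        cases y with
        | nil => exact absurd rfl hy0
        | cons r z =>
          by_cases hrp : r = p
          · exact .inr ⟨r, z, rfl, .inl hrp⟩
          · exact .inl ⟨mem_removeBranch.2 ⟨h1, by simpa using hrp⟩, isLeaf_removeBranch h2⟩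
      · simp only [assign_ne _ _ hAE']
        exact .inl ⟨h1, h2⟩
    · exact .inr ⟨r, z, h1, hsub _ h2⟩

theorem step {N : ℕ} (hN : ∀ L, S.isExec L → L.length ≤ N) {s s' : OptimalState P}
    (h : OptimalStep S s s') (I : OptimalInv S s) : OptimalInv S s' := by
  cases h with
  | maximal hc h l hn hl wt hwt => exact I.maximal hS hc h hl hwt
  | useTree hc h hw =>
    refine ⟨I.exec, I.sleep_enabled, I.inherited_subset, I.path, I.tree, I.guarded, by simp, ?_,
      I.logged_path, I.cover, I.races, I.down, by simp, I.log_maximal, I.log_pairwise⟩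
    intro _
    left
    by_contra hcon
    push Not at hcon
    exact hw ((I.tree _ (List.prefix_refl _)).eq_root hcon)
  | choose hc p hp hw => exact I.choose hS hc hp hw
  | call hc p l₁ l₂ hp hmin => exact I.call hS hp hmin
  | exit hc h =>
    refine ⟨I.exec, I.sleep_enabled, I.inherited_subset, I.path, I.tree, I.guarded, by simp,
      by simp, I.logged_path, I.cover, I.races, I.down, ?_, I.log_maximal, I.log_pairwise⟩
    intro _ w hw hen
    exact I.exists_of_exit hS hN hc h hw hen
  | back hc E p h => exact I.back hS hc h

theorem finished {s : OptimalState P} (I : OptimalInv S s)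
    (h : ∀ s', ¬ OptimalStep S s s') : s.Finished := by
  classical
  have hseq : s.seq <+: s.seq := List.prefix_refl _
  obtain ⟨c, hc⟩ : ∃ c, s.ctl = c := ⟨_, rfl⟩
  cases c with
  | enter =>
    exfalso
    by_cases hen : S.enabled s.seq = ∅
    · let l := ((events s.seq).product (events s.seq)).dedup.filter (fun r => S.RevRace s.seq r.1 r.2)
      have hl : ∀ r, r ∈ l ↔ S.RevRace s.seq r.1 r.2 := by
        intro r
        simp only [l, List.mem_filter, List.mem_dedup, decide_eq_true_eq, and_iff_right_iff_imp]
        intro hr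
        exact List.mem_product.2 ⟨mem_events.2 hr.1.1, mem_events.2 hr.1.2.1⟩
      obtain ⟨wt, hwt⟩ := exists_optimalRaces (S := S) (L := s.seq) (sleep := s.sleep) l s.wut (by
        intro r hr
        obtain ⟨x, h1, -, h3, -⟩ := revRace_split hS I.exec ((hl r).1 hr)
        exact ⟨(I.tree _ ⟨_, h1.symm⟩).root, h3⟩)
      exact h _ (.maximal s hc hen l ((List.nodup_dedup _).filter _) hl wt hwt)
    · have hen' := Set.nonempty_iff_ne_empty.2 hen
      by_cases hw : s.wut s.seq = [[]]
      · obtain ⟨p, hp⟩ := hen'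
        exact h _ (.choose s hc p hp hw)
      · exact h _ (.useTree s hc hen' hw)
  | loop =>
    exfalso
    by_cases hw : ∃ p, [p] ∈ s.wut s.seq
    · obtain ⟨l₁, u, l₂, h1, h2, h3⟩ := exists_first_split (l := s.wut s.seq)
        (Q := fun u => u.length = 1) (by obtain ⟨p, hp⟩ := hw; exact ⟨[p], hp, rfl⟩)
      obtain ⟨p, rfl⟩ := List.length_eq_one_iff.1 h2
      exact h _ (.call s hc p l₁ l₂ h1 h3)
    · push Not at hw
      exact h _ (.exit s hc hw)
  | ret =>
    refine ⟨?_, hc⟩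
    by_contra hne
    rcases List.eq_nil_or_concat s.seq with h1 | ⟨E, p, h1⟩
    · exact hne h1
    · exact h _ (.back s hc E p (by rw [h1, List.concat_eq_append]))

end OptimalInv

theorem optimal_terminates (N : ℕ) (hN : ∀ L, S.isExec L → L.length ≤ N) :
    Terminates (OptimalStep S) OptimalState.init := by
  refine terminates_of_advances S N OptimalState.seq OptimalState.ctl OptimalState.sleep
    (OptimalInv S) ?_ _ (optimalInv_init hS)
  intro s s' I h
  refine ⟨I.step hS hN h, ?_⟩
  have hlen := hN _ I.exec
  have hctl : ∀ c' : Ctl, c'.rank < s.ctl.rank → Advances S N s.seq c' s.sleep s.seq s.ctl s.sleep :=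
    fun c' h => advances_ctl S hlen h
  cases h with
  | maximal hc h => exact hctl _ (by simp [hc, Ctl.rank])
  | useTree hc h => exact hctl _ (by simp [hc, Ctl.rank])
  | choose hc p hp => exact hctl _ (by simp [hc, Ctl.rank])
  | call hc p l₁ l₂ hp hmin =>
    rw [hc]
    exact advances_call S hlen (fun A hA => assign_ne _ _ hA)
  | exit hc h => exact hctl _ (by simp [hc, Ctl.rank])
  | back hc E p h =>
    have hE : E ++ [p] <+: s.seq := by rw [h]
    have hex := I.exec
    rw [h] at hlen hex ⊢
    exact advances_back S (show E.length ≤ N by simp at hlen; omega) (fun A hA => assign_ne _ _ hA)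
      (assign_self _ _ _) (hS.finite_enabled E) hex (I.path E p hE).1

theorem optimal_outcome (N : ℕ) (hN : ∀ L, S.isExec L → L.length ≤ N) {s : OptimalState P}
    (h : Outcome (OptimalStep S) OptimalState.init s) :
    s.Finished ∧ (∀ L ∈ s.log, S.isExec L ∧ S.enabled L = ∅) ∧
      (∀ L, S.isExec L → S.enabled L = ∅ → ∃ L' ∈ s.log, S.Equiv L' L) ∧
      s.log.Pairwise (fun L L' => ¬ S.Equiv L L') := by
  have I : OptimalInv S s := invariant_of_reflTransGen (Inv := OptimalInv S)
    (fun s s' hI h => OptimalInv.step hS hN h hI) (optimalInv_init hS) h.1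
  have hf := I.finished hS h.2
  refine ⟨hf, I.log_maximal, fun L hL hen => ?_, I.log_pairwise⟩
  obtain ⟨L', h1, h2⟩ := I.ret hf.2 L (by rw [hf.1]; simpa using hL) (by
    rw [hf.1]
    simpa using hen)
  rw [hf.1] at h2
  exact ⟨L', h1, by simpa using h2⟩

end OptimalSteps

end RelaxedDPOR

namespace RelaxedDPOR

/-! ### Executions of programs -/

section Executions

variable {T Loc Reg Val Op : Type*} {P : Program T Loc Reg Val Op} {M : MemModel}

theorem run_append (τ w : List (Thread T Loc)) :
    run P M (τ ++ w) = (run P M τ).bind fun c => w.foldlM (step P M) c := by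
  simp [run, List.foldlM_append]

theorem run_concat (τ : List (Thread T Loc)) (r : Thread T Loc) :
    run P M (τ ++ [r]) = (run P M τ).bind fun c => step P M c r := by
  simp [run_append]

theorem isExec_iff {τ : List (Thread T Loc)} : IsExec P M τ ↔ ∃ c, run P M τ = some c :=
  Option.isSome_iff_exists

theorem isExec_prefix {E w : List (Thread T Loc)} (h : IsExec P M (E ++ w)) : IsExec P M E := by
  rw [isExec_iff] at h ⊢
  obtain ⟨c, h⟩ := h
  rw [run_append, Option.bind_eq_some_iff] at h
  obtain ⟨d, h, -⟩ := h
  exact ⟨d, h⟩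

theorem isExec_take {τ : List (Thread T Loc)} (h : IsExec P M τ) (k : ℕ) :
    IsExec P M (τ.take k) := by
  rw [← List.take_append_drop k τ] at h
  exact isExec_prefix h

theorem exists_run_take {τ : List (Thread T Loc)} (h : IsExec P M τ) (k : ℕ) :
    ∃ c, run P M (τ.take k) = some c :=
  isExec_iff.1 (isExec_take h k)

theorem exists_step {τ : List (Thread T Loc)} (h : IsExec P M τ) {k : ℕ} {r : Thread T Loc}
    (hr : τ[k]? = some r) : ∃ c c', run P M (τ.take k) = some c ∧ step P M c r = some c' ∧
      run P M (τ.take (k + 1)) = some c' := by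
  obtain ⟨c', hc'⟩ := exists_run_take h (k + 1)
  have h1 := hc'
  rw [List.take_add_one, hr, Option.toList_some, run_concat, Option.bind_eq_some_iff] at h1
  obtain ⟨c, h1, h2⟩ := h1
  exact ⟨c, c', h1, h2, hc'⟩

/-! #### Steps -/

theorem step_upd_iff {c c' : Conf T Loc Reg Val} {p : T} {b : Option Loc} :
    step P M c (.upd p b) = some c' ↔ ∃ x v B, (c.loc p).buf b = (x, v) :: B ∧
      c' = { loc := assign c.loc p { c.loc p with buf := assign (c.loc p).buf b B }
             mem := assign c.mem x v } := by
  simp only [step]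
  cases h : (c.loc p).buf b with
  | nil => simp
  | cons e B =>
    obtain ⟨x, v⟩ := e
    simp only [Option.some.injEq, List.cons.injEq, Prod.mk.injEq]
    constructor
    · rintro rfl
      exact ⟨x, v, B, ⟨⟨rfl, rfl⟩, rfl⟩, rfl⟩
    · rintro ⟨x', v', B', ⟨⟨rfl, rfl⟩, rfl⟩, rfl⟩
      rfl

theorem step_reg_cases {c c' : Conf T Loc Reg Val} {p : T} (h : step P M c (.reg p) = some c') :
    (∃ x r, P.code p (c.loc p).pc = some (.store x r) ∧ c' = c.setLocal p
        { pc := (c.loc p).pc + 1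
          regs := (c.loc p).regs
          buf := assign (c.loc p).buf (M.buf x)
            ((c.loc p).buf (M.buf x) ++ [(x, (c.loc p).regs r)]) }) ∨
    (∃ x r, P.code p (c.loc p).pc = some (.load r x) ∧ c' = c.setLocal p
        { pc := (c.loc p).pc + 1
          regs := assign (c.loc p).regs r
            ((latest ((c.loc p).buf (M.buf x)) x).getD (c.mem x))
          buf := (c.loc p).buf }) ∨
    (P.code p (c.loc p).pc = some .fence ∧ (∀ b, (c.loc p).buf b = []) ∧
      c' = c.setLocal p { c.loc p with pc := (c.loc p).pc + 1 }) ∨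
    (∃ o, P.code p (c.loc p).pc = some (.other o) ∧ c' = c.setLocal p
        { pc := (P.sem o ((c.loc p).pc, (c.loc p).regs)).1
          regs := (P.sem o ((c.loc p).pc, (c.loc p).regs)).2
          buf := (c.loc p).buf }) := by
  simp only [step] at h
  cases hc : P.code p (c.loc p).pc with
  | none => simp [hc] at h
  | some i =>
    cases i with
    | store x r =>
      simp only [hc, Option.some.injEq] at h
      exact .inl ⟨x, r, rfl, h.symm⟩
    | load r x =>
      simp only [hc, Option.some.injEq] at h
      exact .inr (.inl ⟨x, r, rfl, h.symm⟩)
    | fence =>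
      simp only [hc, Option.ite_none_right_eq_some, Option.some.injEq] at h
      exact .inr (.inr (.inl ⟨rfl, h.1, h.2.symm⟩))
    | other o =>
      simp only [hc, Option.some.injEq] at h
      exact .inr (.inr (.inr ⟨o, rfl, h.symm⟩))

theorem isSome_step_reg {c : Conf T Loc Reg Val} {p : T} :
    (step P M c (.reg p)).isSome ↔ ∃ i, P.code p (c.loc p).pc = some i ∧
      (i = .fence → ∀ b, (c.loc p).buf b = []) := by
  simp only [step]
  cases hc : P.code p (c.loc p).pc with
  | none => simp
  | some i => cases i <;> simp

theorem isSome_step_upd {c : Conf T Loc Reg Val} {p : T} {b : Option Loc} :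
    (step P M c (.upd p b)).isSome ↔ (c.loc p).buf b ≠ [] := by
  simp only [step]
  cases h : (c.loc p).buf b <;> simp

theorem setLocal_loc_self (c : Conf T Loc Reg Val) (p : T) (l : LocalConf Loc Reg Val) :
    (c.setLocal p l).loc p = l := assign_self _ _ _

theorem setLocal_loc_ne (c : Conf T Loc Reg Val) {p q : T} (l : LocalConf Loc Reg Val)
    (h : q ≠ p) : (c.setLocal p l).loc q = c.loc q := assign_ne _ _ h

theorem step_reg_loc_ne {c c' : Conf T Loc Reg Val} {p q : T} (h : step P M c (.reg p) = some c')
    (hq : q ≠ p) : c'.loc q = c.loc q := by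
  rcases step_reg_cases h with ⟨_, _, _, rfl⟩ | ⟨_, _, _, rfl⟩ | ⟨_, _, rfl⟩ | ⟨_, _, rfl⟩ <;>
    exact setLocal_loc_ne _ _ hq

theorem step_upd_loc_ne {c c' : Conf T Loc Reg Val} {p q : T} {b : Option Loc}
    (h : step P M c (.upd p b) = some c') (hq : q ≠ p) : c'.loc q = c.loc q := by
  obtain ⟨x, v, B, _, rfl⟩ := step_upd_iff.1 h
  exact assign_ne _ _ hq

theorem step_upd_loc {c c' : Conf T Loc Reg Val} {p : T} {b : Option Loc}
    (h : step P M c (.upd p b) = some c') (q : T) :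
    (c'.loc q).pc = (c.loc q).pc ∧ (c'.loc q).regs = (c.loc q).regs := by
  by_cases hq : q = p
  · subst hq
    obtain ⟨x, v, B, _, rfl⟩ := step_upd_iff.1 h
    simp [assign_self]
  · rw [step_upd_loc_ne h hq]
    exact ⟨rfl, rfl⟩

theorem step_upd_buf_ne {c c' : Conf T Loc Reg Val} {p : T} {b b' : Option Loc}
    (h : step P M c (.upd p b) = some c') (hb : b' ≠ b) :
    (c'.loc p).buf b' = (c.loc p).buf b' := by
  obtain ⟨x, v, B, _, rfl⟩ := step_upd_iff.1 h
  simp only [assign_self]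
  exact assign_ne _ _ hb

theorem step_reg_buf {c c' : Conf T Loc Reg Val} {p : T} (h : step P M c (.reg p) = some c')
    (b : Option Loc) :
    (∃ x r, P.code p (c.loc p).pc = some (.store x r) ∧ M.buf x = b ∧
      (c'.loc p).buf b = (c.loc p).buf b ++ [(x, (c.loc p).regs r)]) ∨
    ((∀ x r, P.code p (c.loc p).pc = some (.store x r) → M.buf x ≠ b) ∧
      (c'.loc p).buf b = (c.loc p).buf b) := by
  rcases step_reg_cases h with ⟨x, r, hc, rfl⟩ | ⟨_, _, hc, rfl⟩ | ⟨hc, _, rfl⟩ | ⟨_, hc, rfl⟩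
  · by_cases hb : M.buf x = b
    · subst hb
      left
      refine ⟨x, r, hc, rfl, ?_⟩
      rw [setLocal_loc_self]
      exact assign_self _ _ _
    · right
      refine ⟨fun x' r' h' => ?_, ?_⟩
      · rw [hc] at h'
        simp only [Option.some.injEq, Instr.store.injEq] at h'
        rwa [← h'.1]
      · rw [setLocal_loc_self]
        exact assign_ne _ _ (Ne.symm hb)
  all_goals
    right
    refine ⟨fun x' r' h' => ?_, by rw [setLocal_loc_self]⟩
    rw [hc] at h'
    simp at h'

/-- Only the thread itself and its auxiliary thread change a buffer. -/
theorem step_buf_of_ne {c c' : Conf T Loc Reg Val} {r : Thread T Loc} {p : T} {b : Option Loc}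
    (h : step P M c r = some c') (h1 : r ≠ .reg p) (h2 : r ≠ .upd p b) :
    (c'.loc p).buf b = (c.loc p).buf b := by
  cases r with
  | reg q => rw [step_reg_loc_ne h (fun e => h1 (by rw [e]))]
  | upd q b' =>
    by_cases hq : p = q
    · subst hq
      exact step_upd_buf_ne h (fun e => h2 (by rw [e]))
    · rw [step_upd_loc_ne h hq]

theorem step_pc_of_ne {c c' : Conf T Loc Reg Val} {r : Thread T Loc} {p : T}
    (h : step P M c r = some c') (h1 : r ≠ .reg p) :
    (c'.loc p).pc = (c.loc p).pc ∧ (c'.loc p).regs = (c.loc p).regs := by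
  cases r with
  | reg q =>
    rw [step_reg_loc_ne h (fun e => h1 (by rw [e]))]
    exact ⟨rfl, rfl⟩
  | upd q b' => exact step_upd_loc h p

theorem exists_nextAct {c c' : Conf T Loc Reg Val} {r : Thread T Loc}
    (h : step P M c r = some c') : ∃ a, nextAct P c r = some a := by
  cases r with
  | reg p =>
    obtain ⟨i, hi, -⟩ := isSome_step_reg.1 (Option.isSome_iff_exists.2 ⟨c', h⟩)
    exact ⟨.instr i, by simp [nextAct, hi]⟩
  | upd p b =>
    obtain ⟨x, v, B, hB, -⟩ := step_upd_iff.1 h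
    exact ⟨.upd x, by simp [nextAct, hB]⟩

/-! #### Actions depend on the prefix only -/

theorem getElem?_congr {α : Type*} {l l' : List α} {n k : ℕ} (h : l.take n = l'.take n)
    (hk : k < n) : l[k]? = l'[k]? := by
  rw [← List.getElem?_take_of_lt hk, h, List.getElem?_take_of_lt hk]

theorem take_congr {α : Type*} {l l' : List α} {n k : ℕ} (h : l.take n = l'.take n)
    (hk : k ≤ n) : l.take k = l'.take k := by
  have := congrArg (List.take k) h
  simpa [List.take_take, hk] using this

section Locality

variable {τ τ' : List (Thread T Loc)} {n : ℕ} (h : τ.take n = τ'.take n)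

include h

theorem actAt_congr {k : ℕ} (hk : k < n) : actAt P M τ k = actAt P M τ' k := by
  simp only [actAt, take_congr h hk.le, getElem?_congr h hk]

theorem isStore_congr {k : ℕ} (hk : k < n) {p : T} {x : Loc} :
    IsStore P M τ k p x ↔ IsStore P M τ' k p x := by
  simp only [IsStore, actAt_congr h hk, getElem?_congr h hk]

theorem isLoad_congr {k : ℕ} (hk : k < n) {p : T} {x : Loc} :
    IsLoad P M τ k p x ↔ IsLoad P M τ' k p x := by
  simp only [IsLoad, actAt_congr h hk, getElem?_congr h hk]

theorem isFence_congr {k : ℕ} (hk : k < n) {p : T} :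
    IsFence P M τ k p ↔ IsFence P M τ' k p := by
  simp only [IsFence, actAt_congr h hk, getElem?_congr h hk]

theorem isUpd_congr {k : ℕ} (hk : k < n) {p : T} {x : Loc} :
    IsUpd P M τ k p x ↔ IsUpd P M τ' k p x := by
  simp only [IsUpd, actAt_congr h hk, getElem?_congr h hk]

theorem fromMemory_congr {k : ℕ} (hk : k < n) {p : T} {x : Loc} :
    FromMemory P M τ k p x ↔ FromMemory P M τ' k p x := by
  simp only [FromMemory, isLoad_congr h hk, take_congr h hk.le]

theorem fromBuffer_congr {k : ℕ} (hk : k < n) {p : T} {x : Loc} :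
    FromBuffer P M τ k p x ↔ FromBuffer P M τ' k p x := by
  simp only [FromBuffer, isLoad_congr h hk, take_congr h hk.le]

theorem storeUpd_congr {s u : ℕ} (hs : s < n) (hu : u < n) :
    StoreUpd P M τ s u ↔ StoreUpd P M τ' s u := by
  have : ∀ p x, {k | k < s ∧ ∃ y, M.buf y = M.buf x ∧ IsStore P M τ k p y} =
      {k | k < s ∧ ∃ y, M.buf y = M.buf x ∧ IsStore P M τ' k p y} := by
    intro p x
    ext k
    simp only [Set.mem_ofPred_eq]
    refine and_congr_right fun hk => ?_
    simp only [isStore_congr h (hk.trans hs)]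
  simp only [StoreUpd, isStore_congr h hs, isUpd_congr h hu, this, take_congr h hu.le]

theorem nextUpd_congr {u u' : ℕ} (hu' : u' < n) :
    NextUpd P M τ u u' ↔ NextUpd P M τ' u u' := by
  unfold NextUpd
  refine exists_congr fun x => ?_
  constructor
  · rintro ⟨⟨p, h1⟩, ⟨q, h2⟩, h3, h4⟩
    exact ⟨⟨p, (isUpd_congr h (h3.trans hu')).1 h1⟩, ⟨q, (isUpd_congr h hu').1 h2⟩, h3,
      fun k r hk hk' => (isUpd_congr h (hk'.trans hu')).not.1 (h4 k r hk hk')⟩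
  · rintro ⟨⟨p, h1⟩, ⟨q, h2⟩, h3, h4⟩
    exact ⟨⟨p, (isUpd_congr h (h3.trans hu')).2 h1⟩, ⟨q, (isUpd_congr h hu').2 h2⟩, h3,
      fun k r hk hk' => (isUpd_congr h (hk'.trans hu')).not.2 (h4 k r hk hk')⟩

end Locality

/-! #### Counting events -/

theorem occ_take_succ {α : Type*} (l : List α) (k : ℕ) (p : α) :
    (l[k]? = some p ∧ occ (l.take (k + 1)) p = occ (l.take k) p + 1) ∨
      (l[k]? ≠ some p ∧ occ (l.take (k + 1)) p = occ (l.take k) p) := by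
  classical
  rw [List.take_add_one]
  cases h : l[k]? with
  | none => exact .inr ⟨by simp, by simp⟩
  | some q =>
    by_cases hq : q = p
    · subst hq
      exact .inl ⟨rfl, by simp [occ]⟩
    · exact .inr ⟨by simpa using hq, by simp [occ, hq]⟩

theorem occ_take_mono {α : Type*} (l : List α) (p : α) : Monotone fun k => occ (l.take k) p := by
  refine monotone_nat_of_le_succ fun k => ?_
  rcases occ_take_succ l k p with ⟨-, h⟩ | ⟨-, h⟩ <;> omega

theorem occ_take_lt {α : Type*} {l : List α} {p : α} {k n : ℕ} (hk : l[k]? = some p)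
    (hkn : k < n) : occ (l.take k) p < occ (l.take n) p := by
  have h1 := occ_take_mono l p (Nat.succ_le_of_lt hkn)
  rcases occ_take_succ l k p with ⟨-, h⟩ | ⟨h, -⟩
  · simp only [Nat.succ_eq_add_one] at h1
    omega
  · exact absurd hk h

theorem occ_take_inj {α : Type*} {l : List α} {p : α} {k n : ℕ} (hk : l[k]? = some p)
    (hn : l[n]? = some p) (h : occ (l.take k) p = occ (l.take n) p) : k = n := by
  rcases Nat.lt_trichotomy k n with h1 | h1 | h1
  · have := occ_take_lt hk h1
    omega
  · exact h1
  · have := occ_take_lt hn h1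
    omega

/-- The count grows by steps of at most one, so it takes every intermediate value just before an
occurrence of `p`. -/
theorem exists_of_lt_occ {α : Type*} {l : List α} {p : α} {n j : ℕ} (h : j < occ (l.take n) p) :
    ∃ k < n, l[k]? = some p ∧ occ (l.take k) p = j := by
  induction n with
  | zero => simp [occ] at h
  | succ n ih =>
    rcases occ_take_succ l n p with ⟨h1, h2⟩ | ⟨h1, h2⟩
    · rcases Nat.lt_or_ge j (occ (l.take n) p) with h3 | h3
      · obtain ⟨k, hk, h4⟩ := ih h3
        exact ⟨k, by omega, h4⟩
      · exact ⟨n, by omega, h1, by omega⟩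
    · obtain ⟨k, hk, h4⟩ := ih (by omega)
      exact ⟨k, by omega, h4⟩

/-- The number of stores of `p` into its buffer `b` before position `s`. -/
noncomputable def storeCount (P : Program T Loc Reg Val Op) (M : MemModel)
    (τ : List (Thread T Loc)) (s : ℕ) (p : T) (b : Option Loc) : ℕ :=
  {k | k < s ∧ ∃ y, M.buf y = b ∧ IsStore P M τ k p y}.ncard

theorem storeCount_congr {τ τ' : List (Thread T Loc)} {n s : ℕ} (h : τ.take n = τ'.take n)
    (hs : s ≤ n) (p : T) (b : Option Loc) :
    storeCount P M τ s p b = storeCount P M τ' s p b := by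
  unfold storeCount
  congr 1
  ext k
  simp only [Set.mem_ofPred_eq]
  refine and_congr_right fun hk => ?_
  simp only [isStore_congr h (hk.trans_le hs)]

theorem storeCount_zero (τ : List (Thread T Loc)) (p : T) (b : Option Loc) :
    storeCount P M τ 0 p b = 0 := by
  simp [storeCount]

theorem storeCount_succ (τ : List (Thread T Loc)) (s : ℕ) (p : T) (b : Option Loc) :
    ((∃ y, M.buf y = b ∧ IsStore P M τ s p y) ∧
      storeCount P M τ (s + 1) p b = storeCount P M τ s p b + 1) ∨
    ((¬ ∃ y, M.buf y = b ∧ IsStore P M τ s p y) ∧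
      storeCount P M τ (s + 1) p b = storeCount P M τ s p b) := by
  have hfin : {k | k < s ∧ ∃ y, M.buf y = b ∧ IsStore P M τ k p y}.Finite :=
    (Set.finite_lt_nat s).subset fun k hk => hk.1
  by_cases h : ∃ y, M.buf y = b ∧ IsStore P M τ s p y
  · refine .inl ⟨h, ?_⟩
    unfold storeCount
    rw [← Set.ncard_insert_of_notMem (a := s) (by simp) hfin]
    congr 1
    ext k
    simp only [Set.mem_ofPred_eq, Set.mem_insert_iff, Nat.lt_succ_iff_lt_or_eq]
    constructor
    · rintro ⟨h1 | rfl, h2⟩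
      · exact .inr ⟨h1, h2⟩
      · exact .inl rfl
    · rintro (rfl | ⟨h1, h2⟩)
      · exact ⟨.inr rfl, h⟩
      · exact ⟨.inl h1, h2⟩
  · refine .inr ⟨h, ?_⟩
    unfold storeCount
    congr 1
    ext k
    simp only [Set.mem_ofPred_eq, Nat.lt_succ_iff_lt_or_eq]
    constructor
    · rintro ⟨h1 | rfl, h2⟩
      · exact ⟨h1, h2⟩
      · exact absurd h2 h
    · rintro ⟨h1, h2⟩
      exact ⟨.inl h1, h2⟩

theorem storeCount_mono (τ : List (Thread T Loc)) (p : T) (b : Option Loc) :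
    Monotone fun s => storeCount P M τ s p b := by
  refine monotone_nat_of_le_succ fun k => ?_
  rcases storeCount_succ (P := P) (M := M) τ k p b with ⟨-, h⟩ | ⟨-, h⟩ <;> omega

theorem storeCount_lt {τ : List (Thread T Loc)} {s n : ℕ} {p : T} {x : Loc}
    (h : IsStore P M τ s p x) (hs : s < n) :
    storeCount P M τ s p (M.buf x) < storeCount P M τ n p (M.buf x) := by
  have h1 := storeCount_mono (P := P) (M := M) τ p (M.buf x) (Nat.succ_le_of_lt hs)
  rcases storeCount_succ (P := P) (M := M) τ s p (M.buf x) with ⟨-, h2⟩ | ⟨h2, -⟩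
  · simp only [Nat.succ_eq_add_one] at h1
    omega
  · exact absurd ⟨x, rfl, h⟩ h2

/-- The count increases strictly at each store into the buffer, so it identifies the store. -/
theorem storeCount_inj {τ : List (Thread T Loc)} {s t : ℕ} {p : T} {x y : Loc}
    (h : IsStore P M τ s p x) (h' : IsStore P M τ t p y) (hb : M.buf x = M.buf y)
    (he : storeCount P M τ s p (M.buf x) = storeCount P M τ t p (M.buf x)) : s = t := by
  rcases Nat.lt_trichotomy s t with h1 | h1 | h1
  · have := storeCount_lt h h1
    omega
  · exact h1
  · have := storeCount_lt h' h1
    rw [← hb] at this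
    omega

theorem IsStore.lt_length {τ : List (Thread T Loc)} {k : ℕ} {p : T} {x : Loc}
    (h : IsStore P M τ k p x) : k < τ.length := (List.getElem?_eq_some_iff.1 h.1).1

theorem IsStore.unique {τ : List (Thread T Loc)} {k : ℕ} {p q : T} {x y : Loc}
    (h : IsStore P M τ k p x) (h' : IsStore P M τ k q y) : p = q ∧ x = y := by
  obtain ⟨h1, r, h2⟩ := h
  obtain ⟨h3, r', h4⟩ := h'
  rw [h1] at h3
  rw [h2] at h4
  simp only [Option.some.injEq, Thread.reg.injEq, Act.instr.injEq, Instr.store.injEq] at h3 h4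
  exact ⟨h3, h4.1⟩

theorem IsLoad.unique {τ : List (Thread T Loc)} {k : ℕ} {p q : T} {x y : Loc}
    (h : IsLoad P M τ k p x) (h' : IsLoad P M τ k q y) : p = q ∧ x = y := by
  obtain ⟨h1, r, h2⟩ := h
  obtain ⟨h3, r', h4⟩ := h'
  rw [h1] at h3
  rw [h2] at h4
  simp only [Option.some.injEq, Thread.reg.injEq, Act.instr.injEq, Instr.load.injEq] at h3 h4
  exact ⟨h3, h4.2⟩

theorem IsUpd.unique {τ : List (Thread T Loc)} {k : ℕ} {p q : T} {x y : Loc}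
    (h : IsUpd P M τ k p x) (h' : IsUpd P M τ k q y) : p = q ∧ x = y := by
  obtain ⟨h1, h2⟩ := h
  obtain ⟨h3, h4⟩ := h'
  rw [h1] at h3
  rw [h2] at h4
  simp only [Option.some.injEq, Thread.upd.injEq, Act.upd.injEq] at h3 h4
  exact ⟨h3.1, h4⟩

theorem IsLoad.not_isStore {τ : List (Thread T Loc)} {k : ℕ} {p q : T} {x y : Loc}
    (h : IsLoad P M τ k p x) : ¬ IsStore P M τ k q y := by
  rintro ⟨h1, r, h2⟩
  obtain ⟨h3, r', h4⟩ := h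
  rw [h2] at h4
  simp at h4

theorem IsLoad.not_isUpd {τ : List (Thread T Loc)} {k : ℕ} {p q : T} {x y : Loc}
    (h : IsLoad P M τ k p x) : ¬ IsUpd P M τ k q y := by
  rintro ⟨h1, h2⟩
  obtain ⟨h3, r', h4⟩ := h
  rw [h2] at h4
  simp at h4

/-- The action at a position, from the configuration before it. -/
theorem actAt_eq {τ : List (Thread T Loc)} {k : ℕ} {r : Thread T Loc} {c : Conf T Loc Reg Val}
    (hc : run P M (τ.take k) = some c) (hr : τ[k]? = some r) : actAt P M τ k = nextAct P c r := by
  simp [actAt, hc, hr]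

theorem isStore_iff {τ : List (Thread T Loc)} {k : ℕ} {p : T} {x : Loc} {c : Conf T Loc Reg Val}
    (hc : run P M (τ.take k) = some c) :
    IsStore P M τ k p x ↔ τ[k]? = some (.reg p) ∧ ∃ r, P.code p (c.loc p).pc = some (.store x r) := by
  unfold IsStore
  refine and_congr_right fun hr => ?_
  rw [actAt_eq hc hr]
  simp [nextAct]

theorem isLoad_iff {τ : List (Thread T Loc)} {k : ℕ} {p : T} {x : Loc} {c : Conf T Loc Reg Val}
    (hc : run P M (τ.take k) = some c) :
    IsLoad P M τ k p x ↔ τ[k]? = some (.reg p) ∧ ∃ r, P.code p (c.loc p).pc = some (.load r x) := by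
  unfold IsLoad
  refine and_congr_right fun hr => ?_
  rw [actAt_eq hc hr]
  simp [nextAct]

theorem isFence_iff {τ : List (Thread T Loc)} {k : ℕ} {p : T} {c : Conf T Loc Reg Val}
    (hc : run P M (τ.take k) = some c) :
    IsFence P M τ k p ↔ τ[k]? = some (.reg p) ∧ P.code p (c.loc p).pc = some .fence := by
  unfold IsFence
  refine and_congr_right fun hr => ?_
  rw [actAt_eq hc hr]
  simp [nextAct]

theorem isUpd_iff {τ : List (Thread T Loc)} {k : ℕ} {p : T} {x : Loc} {c : Conf T Loc Reg Val}
    (hc : run P M (τ.take k) = some c) :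
    IsUpd P M τ k p x ↔ τ[k]? = some (.upd p (M.buf x)) ∧
      ∃ v B, (c.loc p).buf (M.buf x) = (x, v) :: B := by
  unfold IsUpd
  refine and_congr_right fun hr => ?_
  rw [actAt_eq hc hr]
  simp only [nextAct, Option.map_eq_some_iff, Act.upd.injEq, Prod.exists]
  constructor
  · rintro ⟨y, v, h1, rfl⟩
    obtain ⟨B, hB⟩ := List.head?_eq_some_iff.1 h1
    exact ⟨v, B, hB⟩
  · rintro ⟨v, B, h⟩
    exact ⟨x, v, by simp [h], rfl⟩

/-! #### The contents of the buffers -/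

/-- The entries of a buffer stem from the stores that have not been updated, in their order. -/
theorem buffer_spec {τ : List (Thread T Loc)} {c : Conf T Loc Reg Val} (h : run P M τ = some c)
    (p : T) (b : Option Loc) :
    storeCount P M τ τ.length p b = occ τ (.upd p b) + ((c.loc p).buf b).length ∧
    ∀ i e, ((c.loc p).buf b)[i]? = some e → ∃ s < τ.length, IsStore P M τ s p e.1 ∧
      M.buf e.1 = b ∧ storeCount P M τ s p b = occ τ (.upd p b) + i := by
  induction τ using List.reverseRecOn generalizing c with
  | nil =>
    have : c = initConf P := by
      simpa [run] using h.symm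
    subst this
    simp [initConf, storeCount_zero, occ]
  | append_singleton τ r ih =>
    rw [run_concat, Option.bind_eq_some_iff] at h
    obtain ⟨d, hd, hs⟩ := h
    obtain ⟨h1, h2⟩ := ih hd
    have htake : (τ ++ [r]).take τ.length = τ.take τ.length := by simp
    have hrun : run P M ((τ ++ [r]).take τ.length) = some d := by simpa using hd
    have hget : (τ ++ [r])[τ.length]? = some r := by simp
    have hcount : ∀ s ≤ τ.length, storeCount P M (τ ++ [r]) s p b = storeCount P M τ s p b :=
      fun s hs => storeCount_congr htake hs p b
    have hlift : ∀ s < τ.length, ∀ x, IsStore P M τ s p x → IsStore P M (τ ++ [r]) s p x :=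
      fun s hs x hx => (isStore_congr htake hs).2 hx
    have hlen : (τ ++ [r]).length = τ.length + 1 := by simp
    have hsucc := storeCount_succ (P := P) (M := M) (τ ++ [r]) τ.length p b
    rw [hcount _ le_rfl] at hsucc
    -- The steps that leave the buffer and both counts alone are treated together.
    have hold : (c.loc p).buf b = (d.loc p).buf b → occ (τ ++ [r]) (.upd p b) = occ τ (.upd p b) →
        (¬ ∃ y, M.buf y = b ∧ IsStore P M (τ ++ [r]) τ.length p y) →
        storeCount P M (τ ++ [r]) (τ ++ [r]).length p b =
          occ (τ ++ [r]) (.upd p b) + ((c.loc p).buf b).length ∧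
        ∀ i e, ((c.loc p).buf b)[i]? = some e → ∃ s < (τ ++ [r]).length,
          IsStore P M (τ ++ [r]) s p e.1 ∧ M.buf e.1 = b ∧
          storeCount P M (τ ++ [r]) s p b = occ (τ ++ [r]) (.upd p b) + i := by
      intro e1 e2 e3
      rw [e1, e2, hlen]
      rcases hsucc with ⟨e4, -⟩ | ⟨-, e4⟩
      · exact absurd e4 e3
      · refine ⟨by omega, fun i e he => ?_⟩
        obtain ⟨s, hs', h3, h4, h5⟩ := h2 i e he
        exact ⟨s, by omega, hlift s hs' _ h3, h4, by rw [hcount s hs'.le, h5]⟩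
    by_cases hr1 : r = .reg p
    · subst hr1
      have hocc : occ (τ ++ [.reg p]) (.upd p b) = occ τ (Thread.upd p b) := by
        simp [occ]
      rcases step_reg_buf hs b with ⟨x, a, h3, h4, h5⟩ | ⟨h3, h4⟩
      · have hst : IsStore P M (τ ++ [.reg p]) τ.length p x := (isStore_iff hrun).2 ⟨hget, a, h3⟩
        rcases hsucc with ⟨-, e4⟩ | ⟨e4, -⟩
        · rw [h5, hocc, hlen, e4, h1]
          refine ⟨by simp [add_assoc], fun i e he => ?_⟩
          rcases Nat.lt_or_ge i ((d.loc p).buf b).length with hi | hi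
          · rw [List.getElem?_append_left hi] at he
            obtain ⟨s, hs', h6, h7, h8⟩ := h2 i e he
            exact ⟨s, by omega, hlift s hs' _ h6, h7, by rw [hcount s hs'.le, h8]⟩
          · rw [List.getElem?_append_right hi] at he
            have hi' : i = ((d.loc p).buf b).length := by
              by_contra hne
              rw [List.getElem?_eq_none (by simp; omega)] at he
              simp at he
            subst hi'
            simp only [Nat.sub_self, List.getElem?_cons_zero, Option.some.injEq] at he
            subst he
            exact ⟨τ.length, by omega, hst, h4, by rw [hcount _ le_rfl, h1]⟩
        · exact absurd ⟨x, h4, hst⟩ e4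
      · refine hold h4 hocc ?_
        rintro ⟨y, hy, hst⟩
        obtain ⟨-, a, h5⟩ := (isStore_iff hrun).1 hst
        exact h3 y a h5 hy
    · have hnost : ¬ ∃ y, M.buf y = b ∧ IsStore P M (τ ++ [r]) τ.length p y := by
        rintro ⟨y, -, hst⟩
        have := hst.1
        rw [hget] at this
        exact hr1 (by simpa using this)
      by_cases hr2 : r = .upd p b
      · subst hr2
        have hocc : occ (τ ++ [.upd p b]) (.upd p b) = occ τ (Thread.upd p b) + 1 := by
          simp [occ]
        obtain ⟨x, v, B, hB, rfl⟩ := step_upd_iff.1 hs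
        simp only [assign_self]
        rw [hB] at h1 h2
        rcases hsucc with ⟨e4, -⟩ | ⟨-, e4⟩
        · exact absurd e4 hnost
        · rw [hlen, e4, h1, hocc]
          refine ⟨by simp; omega, fun i e he => ?_⟩
          -- Dequeuing shifts the entries by one place and raises the number of updates by one, so
          -- their sum is unchanged.
          obtain ⟨s, hs', h3, h4, h5⟩ := h2 (i + 1) e (by simpa using he)
          exact ⟨s, by omega, hlift s hs' _ h3, h4, by rw [hcount s hs'.le, h5]; omega⟩
      · refine hold (step_buf_of_ne hs hr1 hr2) ?_ hnost
        classical
        simp [occ, hr2]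

end Executions

end RelaxedDPOR

namespace RelaxedDPOR

section Relations

variable {T Loc Reg Val Op : Type*} {P : Program T Loc Reg Val Op} {M : MemModel}
  {τ : List (Thread T Loc)}

/-! ### The relations between events -/

theorem exists_last_lt {Q : ℕ → Prop} {k : ℕ} (h : ∃ u < k, Q u) :
    ∃ u < k, Q u ∧ ∀ u', u < u' → u' < k → ¬ Q u' := by
  induction k with
  | zero => obtain ⟨u, hu, -⟩ := h; omega
  | succ k ih =>
    by_cases hk : Q k
    · exact ⟨k, by omega, hk, fun u' h1 h2 => by omega⟩
    · obtain ⟨u, hu, hq⟩ := h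
      have hne : u ≠ k := fun e => hk (e ▸ hq)
      obtain ⟨v, h1, h2, h3⟩ := ih ⟨u, by omega, hq⟩
      refine ⟨v, by omega, h2, fun u' h4 h5 => ?_⟩
      rcases Nat.lt_succ_iff_lt_or_eq.1 h5 with h6 | rfl
      · exact h3 u' h4 h6
      · exact hk

theorem exists_first_gt {Q : ℕ → Prop} {u v : ℕ} (huv : u < v) (hv : Q v) :
    ∃ w, u < w ∧ w ≤ v ∧ Q w ∧ ∀ k, u < k → k < w → ¬ Q k := by
  classical
  have hex : ∃ w, u < w ∧ Q w := ⟨v, huv, hv⟩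
  obtain ⟨h1, h2⟩ := Nat.find_spec hex
  exact ⟨Nat.find hex, h1, Nat.find_min' hex ⟨huv, hv⟩, h2, fun k hk hk' hq =>
    Nat.find_min hex hk' ⟨hk, hq⟩⟩

theorem lt_length_of_getElem? {α : Type*} {l : List α} {k : ℕ} {a : α} (h : l[k]? = some a) :
    k < l.length := (List.getElem?_eq_some_iff.1 h).1

theorem buffer_spec_take {k : ℕ} (hk : k ≤ τ.length)
    {c : Conf T Loc Reg Val} (hc : run P M (τ.take k) = some c) (p : T) (b : Option Loc) :
    storeCount P M τ k p b = occ (τ.take k) (.upd p b) + ((c.loc p).buf b).length ∧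
    ∀ i e, ((c.loc p).buf b)[i]? = some e → ∃ s < k, IsStore P M τ s p e.1 ∧
      M.buf e.1 = b ∧ storeCount P M τ s p b = occ (τ.take k) (.upd p b) + i := by
  have hlen : (τ.take k).length = k := by simp [hk]
  have htake : (τ.take k).take k = τ.take k := by simp [List.take_take]
  obtain ⟨h1, h2⟩ := buffer_spec hc p b
  rw [hlen] at h1 h2
  refine ⟨by rw [← storeCount_congr htake le_rfl, h1], fun i e he => ?_⟩
  obtain ⟨s, hs, h3, h4, h5⟩ := h2 i e he
  exact ⟨s, hs, (isStore_congr htake hs).1 h3, h4, by rw [← storeCount_congr htake hs.le, h5]⟩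

theorem StoreUpd.left_unique {s s' u : ℕ} (h : StoreUpd P M τ s u) (h' : StoreUpd P M τ s' u) :
    s = s' := by
  obtain ⟨p, x, h1, h2, h3⟩ := h
  obtain ⟨q, y, h4, h5, h6⟩ := h'
  obtain ⟨rfl, rfl⟩ := h2.unique h5
  exact storeCount_inj h1 h4 rfl (h3.trans h6.symm)

theorem StoreUpd.right_unique {s u u' : ℕ} (h : StoreUpd P M τ s u) (h' : StoreUpd P M τ s u') :
    u = u' := by
  obtain ⟨p, x, h1, h2, h3⟩ := h
  obtain ⟨q, y, h4, h5, h6⟩ := h'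
  obtain ⟨rfl, rfl⟩ := h1.unique h4
  exact occ_take_inj h2.1 h5.1 (h3.symm.trans h6)

theorem StoreUpd.isUpd {s u : ℕ} {p : T} {x : Loc} (h : StoreUpd P M τ s u)
    (hs : IsStore P M τ s p x) : IsUpd P M τ u p x := by
  obtain ⟨q, y, h1, h2, -⟩ := h
  obtain ⟨rfl, rfl⟩ := hs.unique h1
  exact h2

theorem StoreUpd.isStore {s u : ℕ} {p : T} {x : Loc} (h : StoreUpd P M τ s u)
    (hs : IsUpd P M τ u p x) : IsStore P M τ s p x := by
  obtain ⟨q, y, h1, h2, -⟩ := h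
  obtain ⟨rfl, rfl⟩ := hs.unique h2
  exact h1

/-- The entry at index `0` of the buffer stems from the store preceded by exactly as many stores as
there have been updates. -/
theorem exists_storeUpd_of_isUpd (h : IsExec P M τ) {u : ℕ} {p : T} {x : Loc}
    (hu : IsUpd P M τ u p x) : ∃ s < u, StoreUpd P M τ s u := by
  obtain ⟨c, hc⟩ := exists_run_take h u
  obtain ⟨h1, v, B, hB⟩ := (isUpd_iff hc).1 hu
  obtain ⟨s, hs, h2, h3, h4⟩ := (buffer_spec_take (lt_length_of_getElem? h1).le hc p
    (M.buf x)).2 0 (x, v) (by simp [hB])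
  exact ⟨s, hs, p, x, h2, hu, h4⟩

theorem exists_isUpd_of_getElem? (h : IsExec P M τ) {u : ℕ} {p : T} {b : Option Loc}
    (hu : τ[u]? = some (.upd p b)) : ∃ x, M.buf x = b ∧ IsUpd P M τ u p x := by
  obtain ⟨c, c', hc, hs, -⟩ := exists_step h hu
  obtain ⟨x, v, B, hB, -⟩ := step_upd_iff.1 hs
  obtain ⟨s, _, _, rfl, _⟩ := (buffer_spec_take (lt_length_of_getElem? hu).le hc p
    b).2 0 (x, v) (by simp [hB])
  exact ⟨x, rfl, (isUpd_iff hc).2 ⟨hu, v, B, hB⟩⟩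

theorem StoreUpd.lt (h : IsExec P M τ) {s u : ℕ} (hsu : StoreUpd P M τ s u) : s < u := by
  obtain ⟨p, x, -, h2, -⟩ := id hsu
  obtain ⟨s', h3, h4⟩ := exists_storeUpd_of_isUpd h h2
  rwa [hsu.left_unique h4]

/-- Converts the pairing of stores with updates into an inequality of counts; in this form FIFO
order amounts to monotonicity. -/
theorem exists_storeUpd_iff (h : IsExec P M τ) {s k : ℕ} {p : T} {x : Loc}
    (hs : IsStore P M τ s p x) : (∃ u < k, StoreUpd P M τ s u) ↔
      storeCount P M τ s p (M.buf x) < occ (τ.take k) (.upd p (M.buf x)) := by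
  constructor
  · rintro ⟨u, hu, q, y, h1, h2, h3⟩
    obtain ⟨rfl, rfl⟩ := hs.unique h1
    have h4 := occ_take_lt h2.1 hu
    exact lt_of_eq_of_lt h3 h4
  · intro hlt
    obtain ⟨u, hu, h1, h2⟩ := exists_of_lt_occ hlt
    obtain ⟨y, hy, h3⟩ := exists_isUpd_of_getElem? h h1
    obtain ⟨s', -, h4⟩ := exists_storeUpd_of_isUpd h h3
    have hs' := h4.isStore h3
    obtain ⟨q, z, h5, h6, h7⟩ := id h4
    obtain ⟨rfl, rfl⟩ := hs'.unique h5
    have : s' = s := storeCount_inj hs' hs hy (by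
      refine h7.trans ?_
      rw [hy, h2])
    exact ⟨u, hu, this ▸ h4⟩

/-- Buffers are FIFO. -/
theorem exists_storeUpd_of_lt (h : IsExec P M τ) {s s' u' : ℕ} {p : T} {x y : Loc}
    (hs : IsStore P M τ s p x) (hs' : IsStore P M τ s' p y) (hb : M.buf x = M.buf y)
    (hlt : s < s') (hu : StoreUpd P M τ s' u') : ∃ u < u', StoreUpd P M τ s u := by
  refine (exists_storeUpd_iff h hs).2 ?_
  obtain ⟨q, z, h1, h2, h3⟩ := hu
  obtain ⟨rfl, rfl⟩ := hs'.unique h1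
  rw [hb]
  refine lt_of_lt_of_eq ?_ h3
  rw [← hb]
  exact storeCount_lt hs hlt

theorem latest_eq_none_iff {B : List (Loc × Val)} {x : Loc} :
    latest B x = none ↔ ∀ e ∈ B, e.1 ≠ x := by
  classical
  simp [latest]

/-- Expresses the contents of the buffer by events. The definitions of loads from memory and from
the buffer thereby become independent of configurations and can be transported between executions.
-/
theorem latest_take_eq_none_iff (h : IsExec P M τ) {k : ℕ} (hk : k ≤ τ.length)
    {c : Conf T Loc Reg Val} (hc : run P M (τ.take k) = some c) (p : T) (x : Loc) :
    latest ((c.loc p).buf (M.buf x)) x = none ↔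
      ∀ s < k, IsStore P M τ s p x → ∃ u < k, StoreUpd P M τ s u := by
  obtain ⟨h1, h2⟩ := buffer_spec_take hk hc p (M.buf x)
  rw [latest_eq_none_iff]
  constructor
  · intro hl s hs hst
    rw [exists_storeUpd_iff h hst]
    by_contra hge
    have hlt := storeCount_lt hst hs
    have hi : storeCount P M τ s p (M.buf x) - occ (τ.take k) (.upd p (M.buf x)) <
        ((c.loc p).buf (M.buf x)).length := by omega
    obtain ⟨s', -, h3, h4, h5⟩ := h2 _ _ (List.getElem?_eq_getElem hi)
    obtain rfl : s' = s := storeCount_inj h3 hst h4 (by rw [h4, h5]; omega)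
    exact hl _ (List.getElem_mem hi) (h3.unique hst).2
  · intro hl e he hx
    obtain ⟨i, hi⟩ := List.mem_iff_getElem?.1 he
    obtain ⟨s, hs, h3, h4, h5⟩ := h2 i e hi
    rw [hx] at h3
    have := (exists_storeUpd_iff h h3).1 (hl s hs h3)
    omega

theorem fromMemory_iff (h : IsExec P M τ) {k : ℕ} {p : T} {x : Loc} :
    FromMemory P M τ k p x ↔ IsLoad P M τ k p x ∧
      ∀ s < k, IsStore P M τ s p x → ∃ u < k, StoreUpd P M τ s u := by
  refine and_congr_right fun hl => ?_
  have hk := (lt_length_of_getElem? hl.1).le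
  constructor
  · rintro ⟨c, hc, h1⟩
    exact (latest_take_eq_none_iff h hk hc p x).1 h1
  · intro h1
    obtain ⟨c, hc⟩ := exists_run_take h k
    exact ⟨c, hc, (latest_take_eq_none_iff h hk hc p x).2 h1⟩

theorem fromBuffer_iff_not (h : IsExec P M τ) {k : ℕ} {p : T} {x : Loc} :
    FromBuffer P M τ k p x ↔ IsLoad P M τ k p x ∧ ¬ FromMemory P M τ k p x := by
  obtain ⟨c, hc⟩ := exists_run_take h k
  constructor
  · rintro ⟨h1, d, hd, h2⟩
    refine ⟨h1, ?_⟩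
    rintro ⟨-, e, he, h3⟩
    rw [hd] at he
    cases he
    exact h2 h3
  · rintro ⟨h1, h2⟩
    exact ⟨h1, c, hc, fun h3 => h2 ⟨h1, c, hc, h3⟩⟩

theorem fromBuffer_iff (h : IsExec P M τ) {k : ℕ} {p : T} {x : Loc} :
    FromBuffer P M τ k p x ↔ IsLoad P M τ k p x ∧
      ∃ s < k, IsStore P M τ s p x ∧ ∀ u < k, ¬ StoreUpd P M τ s u := by
  rw [fromBuffer_iff_not h, fromMemory_iff h]
  refine and_congr_right fun hl => ?_
  simp [hl]

/-- The newest store of a thread to a location is pending whenever some store to it is. -/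
theorem not_storeUpd_last (h : IsExec P M τ) {k s s' : ℕ} {p : T} {x : Loc}
    (hs : IsStore P M τ s p x) (hs' : IsStore P M τ s' p x)
    (hlast : ∀ t, s < t → t < k → ¬ IsStore P M τ t p x) (hk' : s' < k)
    (hn : ∀ u < k, ¬ StoreUpd P M τ s' u) : ∀ u < k, ¬ StoreUpd P M τ s u := by
  intro u hu hsu
  rcases Nat.lt_trichotomy s s' with h1 | rfl | h1
  · exact hlast s' h1 hk' hs'
  · exact hn u hu hsu
  · obtain ⟨u', h2, h3⟩ := exists_storeUpd_of_lt h hs' hs rfl h1 hsu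
    exact hn u' (h2.trans hu) h3

theorem ReadsFrom.lt (h : IsExec P M τ) {k s : ℕ} (hr : ReadsFrom P M τ k s) : s < k := by
  obtain ⟨p, x, ⟨-, -, h1, -⟩ | ⟨-, u, q, -, h1, -, h2⟩⟩ := hr
  · exact h1
  · exact (h2.lt h).trans h1

theorem ReadsFrom.isLoad {k s : ℕ} (hr : ReadsFrom P M τ k s) : ∃ p x, IsLoad P M τ k p x ∧
    ∃ q, IsStore P M τ s q x := by
  obtain ⟨p, x, ⟨h1, h2, -⟩ | ⟨h1, u, q, h2, -, -, h3⟩⟩ := hr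
  · exact ⟨p, x, h1.1, p, h2⟩
  · exact ⟨p, x, h1.1, q, h3.isStore h2⟩

theorem ReadsFrom.unique (h : IsExec P M τ) {k s s' : ℕ} (hr : ReadsFrom P M τ k s)
    (hr' : ReadsFrom P M τ k s') : s = s' := by
  obtain ⟨p, x, hr⟩ := hr
  obtain ⟨q, y, hr'⟩ := hr'
  obtain ⟨rfl, rfl⟩ : p = q ∧ x = y := by
    have h1 : IsLoad P M τ k p x := hr.elim (fun h => h.1.1) (fun h => h.1.1)
    have h2 : IsLoad P M τ k q y := hr'.elim (fun h => h.1.1) (fun h => h.1.1)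
    exact h1.unique h2
  rcases hr with ⟨h1, h2, h3, h4⟩ | ⟨h1, u, q, h2, h3, h4, h5⟩ <;>
    rcases hr' with ⟨h1', h2', h3', h4'⟩ | ⟨h1', u', q', h2', h3', h4', h5'⟩
  · rcases Nat.lt_trichotomy s s' with h6 | h6 | h6
    · exact absurd h2' (h4 s' h6 h3')
    · exact h6
    · exact absurd h2 (h4' s h6 h3)
  · exact absurd h1' ((fromBuffer_iff_not h).1 h1).2
  · exact absurd h1 ((fromBuffer_iff_not h).1 h1').2
  · rcases Nat.lt_trichotomy u u' with h6 | rfl | h6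
    · exact absurd h2' (h4 u' q' h6 h3')
    · exact h5.left_unique h5'
    · exact absurd h2 (h4' u q h6 h3)

theorem readsFrom_of_isUpd (h : IsExec P M τ) {k u : ℕ} {p q : T} {x : Loc}
    (hm : FromMemory P M τ k p x) (hu : IsUpd P M τ u q x) (huk : u < k) :
    ∃ s u' q', ReadsFrom P M τ k s ∧ StoreUpd P M τ s u' ∧ IsUpd P M τ u' q' x ∧ u' < k ∧
      ∀ v q, u' < v → v < k → ¬ IsUpd P M τ v q x := by
  obtain ⟨v, h1, ⟨r, h2⟩, h3⟩ := exists_last_lt (Q := fun u => ∃ q, IsUpd P M τ u q x)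
    ⟨u, huk, q, hu⟩
  obtain ⟨s, -, h4⟩ := exists_storeUpd_of_isUpd h h2
  have h3' : ∀ w q, v < w → w < k → ¬ IsUpd P M τ w q x := fun w q hw hw' hq => h3 w hw hw' ⟨q, hq⟩
  exact ⟨s, v, r, ⟨p, x, .inr ⟨hm, v, r, h2, h1, h3', h4⟩⟩, h4, h2, h1, h3'⟩

theorem exists_readsFrom_of_isStore (h : IsExec P M τ) {k s : ℕ} {p : T} {x : Loc}
    (hl : IsLoad P M τ k p x) (hs : IsStore P M τ s p x) (hsk : s < k) :
    ∃ s', ReadsFrom P M τ k s' := by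
  by_cases hm : FromMemory P M τ k p x
  · obtain ⟨u, h1, h2⟩ := ((fromMemory_iff h).1 hm).2 s hsk hs
    obtain ⟨s', -, -, h3, -⟩ := readsFrom_of_isUpd h hm (h2.isUpd hs) h1
    exact ⟨s', h3⟩
  · obtain ⟨s', h1, h2, h3⟩ := exists_last_lt (Q := fun s => IsStore P M τ s p x) ⟨s, hsk, hs⟩
    exact ⟨s', p, x, .inl ⟨(fromBuffer_iff_not h).2 ⟨hl, hm⟩, h2, h1, h3⟩⟩

theorem NextUpd.lt {u u' : ℕ} (h : NextUpd P M τ u u') : u < u' := by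
  obtain ⟨x, -, -, h, -⟩ := h
  exact h

theorem exists_nextUpd {u v : ℕ} {p q : T} {x : Loc} (hu : IsUpd P M τ u p x)
    (hv : IsUpd P M τ v q x) (huv : u < v) :
    ∃ w ≤ v, (∃ r, IsUpd P M τ w r x) ∧ NextUpd P M τ u w := by
  obtain ⟨w, h1, h2, h3, h4⟩ := exists_first_gt (Q := fun u => ∃ q, IsUpd P M τ u q x) huv ⟨q, hv⟩
  exact ⟨w, h2, h3, x, ⟨p, hu⟩, h3, h1, fun k r hk hk' h5 => h4 k hk hk' ⟨r, h5⟩⟩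

theorem NextUpd.right_unique {u v w : ℕ} (h : NextUpd P M τ u v) (h' : NextUpd P M τ u w) :
    v = w := by
  obtain ⟨x, ⟨p, h1⟩, ⟨q, h2⟩, h3, h4⟩ := h
  obtain ⟨y, ⟨p', h1'⟩, ⟨q', h2'⟩, h3', h4'⟩ := h'
  obtain ⟨-, rfl⟩ := h1.unique h1'
  rcases Nat.lt_trichotomy v w with h6 | h6 | h6
  · exact absurd h2 (h4' v q h3 h6)
  · exact h6
  · exact absurd h2' (h4 w q' h3' h6)

theorem NextUpd.isUpd {u v : ℕ} {p : T} {x : Loc} (h : NextUpd P M τ u v)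
    (hu : IsUpd P M τ u p x) : ∃ q, IsUpd P M τ v q x := by
  obtain ⟨y, ⟨q, h1⟩, h2, -⟩ := h
  obtain ⟨-, rfl⟩ := hu.unique h1
  exact h2

/-- The value read and its overwriting update are described by `ReadsFrom` and `NextUpd` alone: a
load without source reads the initial value, and the first update to a location is the one that is
the successor of none. So two executions that agree on these relations agree on `Overwrites`. -/
theorem overwrites_iff (h : IsExec P M τ) {k u : ℕ} : Overwrites P M τ k u ↔
    (∃ s u', ReadsFrom P M τ k s ∧ StoreUpd P M τ s u' ∧ NextUpd P M τ u' u) ∨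
    ∃ p x q, IsLoad P M τ k p x ∧ (∀ s, ¬ ReadsFrom P M τ k s) ∧ IsUpd P M τ u q x ∧
      ∀ u', ¬ NextUpd P M τ u' u := by
  refine or_congr_right ?_
  constructor
  · rintro ⟨p, x, h1, h2, ⟨q, h3⟩, h4⟩
    refine ⟨p, x, q, h1.1, ?_, h3, ?_⟩
    · rintro s ⟨p', x', ⟨h5, -⟩ | ⟨h5, v, r, h6, h7, -⟩⟩
      · obtain ⟨rfl, rfl⟩ := h1.1.unique h5.1
        exact ((fromBuffer_iff_not h).1 h5).2 h1
      · obtain ⟨rfl, rfl⟩ := h1.1.unique h5.1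
        exact h2 v r h7 h6
    · rintro u' ⟨y, ⟨r, h5⟩, ⟨r', h6⟩, h7, -⟩
      obtain ⟨-, rfl⟩ := h3.unique h6
      exact h4 u' r h7 h5
  · rintro ⟨p, x, q, h1, h2, h3, h4⟩
    have hm : FromMemory P M τ k p x := by
      by_contra hm
      obtain ⟨-, s, h5, h6, -⟩ := (fromBuffer_iff h).1 ((fromBuffer_iff_not h).2 ⟨h1, hm⟩)
      obtain ⟨s', h7⟩ := exists_readsFrom_of_isStore h h1 h6 h5
      exact h2 s' h7
    refine ⟨p, x, hm, ?_, ⟨q, h3⟩, ?_⟩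
    · intro u' r h5 h6
      obtain ⟨s, -, -, h7, -⟩ := readsFrom_of_isUpd h hm h6 h5
      exact h2 s h7
    · intro u' r h5 h6
      obtain ⟨v, h7, ⟨r', h8⟩, h9⟩ := exists_last_lt (Q := fun u => ∃ q, IsUpd P M τ u q x)
        ⟨u', h5, r, h6⟩
      exact h4 v ⟨x, ⟨r', h8⟩, ⟨q, h3⟩, h7, fun w r hw hw' h10 => h9 w hw hw' ⟨r, h10⟩⟩

/-- At a fence the buffers are empty, so the updates before it are as many as the stores of the
thread before it. This replaces the position of the fence relative to another thread by a count
within its own thread. -/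
theorem updFence_iff (h : IsExec P M τ) {u f : ℕ} : UpdFence P M τ u f ↔
    ∃ p b, IsFence P M τ f p ∧ τ[u]? = some (.upd p b) ∧
      occ (τ.take u) (.upd p b) + 1 = storeCount P M τ f p b := by
  have hcount : ∀ p b, IsFence P M τ f p →
      storeCount P M τ f p b = occ (τ.take f) (.upd p b) := by
    intro p b hf
    obtain ⟨c, c', hc, hs, -⟩ := exists_step h hf.1
    have hcode := ((isFence_iff hc).1 hf).2
    obtain ⟨i, hi, hb⟩ := isSome_step_reg.1 (Option.isSome_iff_exists.2 ⟨c', hs⟩)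
    rw [hcode] at hi
    have := (buffer_spec_take (lt_length_of_getElem? hf.1).le hc p b).1
    rwa [hb (by simpa using hi.symm) b, List.length_nil, Nat.add_zero] at this
  unfold UpdFence
  refine exists_congr fun p => exists_congr fun b => and_congr_right fun hf => and_congr_right
    fun hu => ?_
  rw [hcount p b hf]
  constructor
  · rintro ⟨h1, h2⟩
    have h3 := occ_take_lt hu h1
    by_contra hne
    obtain ⟨v, h4, h5, h6⟩ := exists_of_lt_occ (l := τ) (p := Thread.upd p b) (n := f)
      (j := occ (τ.take u) (.upd p b) + 1) (by omega)
    refine h2 v ?_ h4 h5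
    by_contra hvu
    have := occ_take_mono τ (Thread.upd p b) (Nat.le_of_not_lt hvu)
    simp only at this
    omega
  · intro h1
    constructor
    · by_contra hfu
      have := occ_take_mono τ (Thread.upd p b) (Nat.le_of_not_lt hfu)
      simp only at this
      omega
    · intro v h2 h3 h4
      have h5 := occ_take_lt hu h2
      have h6 := occ_take_lt h4 h3
      omega

theorem PO.lt {k k' : ℕ} (h : PO τ k k') : k < k' := by
  obtain ⟨p, -, -, h⟩ := h
  by_contra hc
  have := occ_take_mono τ p (Nat.le_of_not_lt hc)
  simp only at this
  omega

/-- A load that reads the value of an update of another thread reads it from memory. -/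
theorem SrcCT.fromMemory {u k : ℕ} (he : SrcCT P M τ u k) :
    ∃ p q x, FromMemory P M τ k p x ∧ IsUpd P M τ u q x ∧ q ≠ p ∧ u < k ∧
      ∀ v r, u < v → v < k → ¬ IsUpd P M τ v r x := by
  obtain ⟨s, p, q, x, h1, h2, h3, h4, h5⟩ := he
  obtain ⟨p', x', ⟨h6, h7, -⟩ | ⟨h6, u', q', h7, h8, h9, h10⟩⟩ := h1
  · obtain ⟨rfl, rfl⟩ := h3.unique h6.1
    exact absurd ((h2.isUpd h7).unique h4).1.symm h5
  · obtain ⟨rfl, rfl⟩ := h3.unique h6.1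
    obtain rfl := h2.right_unique h10
    exact ⟨p, q, x, h6, h4, h5, h8, h9⟩

theorem srcCT_of_fromMemory (h : IsExec P M τ) {u k : ℕ} {p q : T} {x : Loc}
    (hm : FromMemory P M τ k p x) (hu : IsUpd P M τ u q x) (hqp : q ≠ p) (huk : u < k)
    (hn : ∀ v r, u < v → v < k → ¬ IsUpd P M τ v r x) : SrcCT P M τ u k := by
  obtain ⟨s, -, hs⟩ := exists_storeUpd_of_isUpd h hu
  exact ⟨s, p, q, x, ⟨p, x, .inr ⟨hm, u, q, hu, huk, hn, hs⟩⟩, hs, hm.1, hu, hqp⟩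

/-- For a load served by forwarding, the update of its store comes after the load and before the
overwriting one. Consequently such an edge never joins adjacent events, and edges between adjacent
events come from loads that access memory. -/
theorem Overwrites.cases (h : IsExec P M τ) {k u : ℕ} (he : Overwrites P M τ k u) :
    k < u ∧ ((∃ p q x, FromMemory P M τ k p x ∧ IsUpd P M τ u q x) ∨
      ∃ u', k < u' ∧ u' < u) := by
  rcases he with ⟨s, u', h1, h2, h3⟩ | ⟨p, x, h1, h2, ⟨q, h3⟩, h4⟩
  · obtain ⟨p, x, ⟨h5, h6, h7, h8⟩ | ⟨h5, v, q, h6, h7, h8, h9⟩⟩ := h1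
    · obtain ⟨h9, s', h10, h11, h12⟩ := (fromBuffer_iff h).1 h5
      have h13 := not_storeUpd_last h h6 h11 h8 h10 h12
      have h14 : k ≤ u' := by
        by_contra hlt
        exact h13 u' (by omega) h2
      have h15 : k ≠ u' := by
        rintro rfl
        exact h9.not_isUpd (h2.isUpd h6)
      have := h3.lt
      exact ⟨by omega, .inr ⟨u', by omega, this⟩⟩
    · obtain rfl := h2.right_unique h9
      obtain ⟨r, h10⟩ := h3.isUpd h6
      have h11 : k ≤ u := by
        by_contra hlt
        exact h8 u r h3.lt (by omega) h10
      have h12 : k ≠ u := by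
        rintro rfl
        exact h5.1.not_isUpd h10
      exact ⟨by omega, .inl ⟨p, r, x, h5, h10⟩⟩
  · have h11 : k ≤ u := by
      by_contra hlt
      exact h2 u q (by omega) h3
    have h12 : k ≠ u := by
      rintro rfl
      exact h1.1.not_isUpd h3
    exact ⟨by omega, .inl ⟨p, q, x, h1, h3⟩⟩

theorem overwrites_of_fromMemory (h : IsExec P M τ) {k u : ℕ} {p q : T} {x : Loc}
    (hm : FromMemory P M τ k p x) (hu : IsUpd P M τ u q x) (hku : k < u)
    (hn : ∀ v r, k < v → v < u → ¬ IsUpd P M τ v r x) : Overwrites P M τ k u := by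
  by_cases hex : ∃ v < k, ∃ r, IsUpd P M τ v r x
  · obtain ⟨v, hv, r, hr⟩ := hex
    obtain ⟨s, u', q', h1, h2, h3, h4, h5⟩ := readsFrom_of_isUpd h hm hr hv
    refine .inl ⟨s, u', h1, h2, x, ⟨q', h3⟩, ⟨q, hu⟩, by omega, fun w r hw hw' h6 => ?_⟩
    rcases Nat.lt_trichotomy w k with h7 | rfl | h7
    · exact h5 w r hw h7 h6
    · exact hm.1.not_isUpd h6
    · exact hn w r h7 hw' h6
  · push Not at hex
    refine .inr ⟨p, x, hm, fun v r hv => hex v hv r, ⟨q, hu⟩, fun w r hw h6 => ?_⟩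
    rcases Nat.lt_trichotomy w k with h7 | rfl | h7
    · exact hex w h7 r h6
    · exact hm.1.not_isUpd h6
    · exact hn w r h7 hw h6

theorem ChronEdge.lt (h : IsExec P M τ) {k k' : ℕ} (he : ChronEdge P M τ k k') :
    k < k' ∧ k' < τ.length := by
  rcases he with he | he | he | he | he | he
  · obtain ⟨p, -, h1, -⟩ := id he
    exact ⟨he.lt, lt_length_of_getElem? h1⟩
  · obtain ⟨p, x, -, h1, -⟩ := id he
    exact ⟨he.lt h, lt_length_of_getElem? h1.1⟩
  · obtain ⟨x, -, ⟨q, h1⟩, -⟩ := id he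
    exact ⟨he.lt, lt_length_of_getElem? h1.1⟩
  · obtain ⟨p, q, x, h1, -, -, h2, -⟩ := he.fromMemory
    exact ⟨h2, lt_length_of_getElem? h1.1.1⟩
  · refine ⟨(Overwrites.cases h he).1, ?_⟩
    rcases he with ⟨s, u', h1, h2, x, -, ⟨q, h3⟩, -⟩ | ⟨p, x, -, -, ⟨q, h3⟩, -⟩ <;>
      exact lt_length_of_getElem? h3.1
  · obtain ⟨p, b, h1, -, h2, -⟩ := he
    exact ⟨h2, lt_length_of_getElem? h1.1⟩

end Relations

end RelaxedDPOR

namespace RelaxedDPOR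

section Similarity

variable {T Loc Reg Val Op : Type*} {P : Program T Loc Reg Val Op} {M : MemModel}
  {τ τ' : List (Thread T Loc)}

/-! ### Executions with corresponding events -/

/-- The positions `k` and `k'` carry events of the same name. -/
def Match {α : Type*} (τ τ' : List α) (k k' : ℕ) : Prop :=
  ∃ r, τ[k]? = some r ∧ τ'[k']? = some r ∧ occ (τ.take k) r = occ (τ'.take k') r

theorem Match.symm {α : Type*} {τ τ' : List α} {k k' : ℕ} (h : Match τ τ' k k') :
    Match τ' τ k' k := by
  obtain ⟨r, h1, h2, h3⟩ := h
  exact ⟨r, h2, h1, h3.symm⟩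

theorem Match.unique {α : Type*} {τ τ' : List α} {k k' l' : ℕ} (h : Match τ τ' k k')
    (h' : Match τ τ' k l') : k' = l' := by
  obtain ⟨r, h1, h2, h3⟩ := h
  obtain ⟨r', h4, h5, h6⟩ := h'
  obtain rfl : r = r' := by simpa [h1] using h4
  exact occ_take_inj h2 h5 (h3.symm.trans h6)

theorem Match.getElem? {α : Type*} {τ τ' : List α} {k k' : ℕ} {r : α} (h : Match τ τ' k k')
    (hr : τ[k]? = some r) : τ'[k']? = some r ∧ occ (τ.take k) r = occ (τ'.take k') r := by
  obtain ⟨r', h1, h2, h3⟩ := h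
  obtain rfl : r = r' := by simpa [hr] using h1
  exact ⟨h2, h3⟩

theorem occ_take_lt_iff {α : Type*} {l : List α} {p : α} {k n : ℕ} (hk : l[k]? = some p) :
    occ (l.take k) p < occ (l.take n) p ↔ k < n := by
  refine ⟨fun h => ?_, occ_take_lt hk⟩
  by_contra hc
  have := occ_take_mono l p (Nat.le_of_not_lt hc)
  simp only at this
  omega

theorem Match.lt_iff {α : Type*} {τ τ' : List α} {k k' l l' : ℕ} {r : α} (h : Match τ τ' k k')
    (h' : Match τ τ' l l') (hk : τ[k]? = some r) (hl : τ[l]? = some r) : k < l ↔ k' < l' := by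
  obtain ⟨h1, h2⟩ := h.getElem? hk
  obtain ⟨h3, h4⟩ := h'.getElem? hl
  rw [← occ_take_lt_iff hk, ← occ_take_lt_iff h1, h2, h4]

theorem exists_match {α : Type*} {τ τ' : List α} (hp : τ.Perm τ') {k : ℕ} (hk : k < τ.length) :
    ∃ k', Match τ τ' k k' := by
  have hr : τ[k]? = some τ[k] := List.getElem?_eq_getElem hk
  have h1 := occ_take_lt hr hk
  rw [List.take_length, perm_iff_occ.1 hp, ← List.take_length (l := τ')] at h1
  obtain ⟨k', -, h2, h3⟩ := exists_of_lt_occ h1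
  exact ⟨k', τ[k], hr, h2, h3.symm⟩

theorem PO.of_match {k k' l l' : ℕ} (hp : PO τ k l) (hk : Match τ τ' k k') (hl : Match τ τ' l l') :
    PO τ' k' l' := by
  obtain ⟨r, h1, h2, h3⟩ := hp
  obtain ⟨h4, h5⟩ := hk.getElem? h1
  obtain ⟨h6, h7⟩ := hl.getElem? h2
  exact ⟨r, h4, h6, by omega⟩

/-- Stores are sent to stores with the same index in their thread, which is an injection. -/
theorem storeCount_le {k k' : ℕ} {p : T} {b : Option Loc}
    (h : ∀ l < k, ∀ y, M.buf y = b → IsStore P M τ l p y → ∃ l' < k', IsStore P M τ' l' p y ∧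
      occ (τ.take l) (.reg p) = occ (τ'.take l') (.reg p)) :
    storeCount P M τ k p b ≤ storeCount P M τ' k' p b := by
  have h' : ∀ l, l ∈ {l | l < k ∧ ∃ y, M.buf y = b ∧ IsStore P M τ l p y} → ∃ l',
      (l' ∈ {l | l < k' ∧ ∃ y, M.buf y = b ∧ IsStore P M τ' l p y}) ∧
      occ (τ.take l) (.reg p) = occ (τ'.take l') (Thread.reg (Loc := Loc) p) := by
    rintro l ⟨hl, y, hy, hst⟩
    obtain ⟨l', h1, h2, h3⟩ := h l hl y hy hst
    exact ⟨l', ⟨h1, y, hy, h2⟩, h3⟩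
  choose! f hf hf' using h'
  refine Set.ncard_le_ncard_of_injOn f hf ?_ ((Set.finite_lt_nat k').subset fun l hl => hl.1)
  intro a ha b hb hab
  obtain ⟨-, y, -, h1⟩ := id ha
  obtain ⟨-, z, -, h2⟩ := id hb
  exact occ_take_inj h1.1 h2.1 ((hf' a ha).trans (hab ▸ (hf' b hb).symm))

/-- The events of two executions correspond to each other, and their regular threads execute the
same instructions. -/
structure SameActs (P : Program T Loc Reg Val Op) (M : MemModel) (τ τ' : List (Thread T Loc)) :
    Prop where
  exec_left : IsExec P M τ
  exec_right : IsExec P M τ'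
  perm : τ.Perm τ'
  act : ∀ k k' p, Match τ τ' k k' → τ[k]? = some (.reg p) → actAt P M τ k = actAt P M τ' k'

namespace SameActs

theorem symm (h : SameActs P M τ τ') : SameActs P M τ' τ :=
  ⟨h.exec_right, h.exec_left, h.perm.symm, fun k k' p hm hk =>
    (h.act k' k p hm.symm (hm.getElem? hk).1).symm⟩

variable (h : SameActs P M τ τ')

include h

theorem isStore {k k' : ℕ} (hm : Match τ τ' k k') {p : T} {x : Loc} (hk : IsStore P M τ k p x) :
    IsStore P M τ' k' p x := by
  obtain ⟨h1, r, h2⟩ := hk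
  exact ⟨(hm.getElem? h1).1, r, by rw [← h.act k k' p hm h1, h2]⟩

theorem isLoad {k k' : ℕ} (hm : Match τ τ' k k') {p : T} {x : Loc} (hk : IsLoad P M τ k p x) :
    IsLoad P M τ' k' p x := by
  obtain ⟨h1, r, h2⟩ := hk
  exact ⟨(hm.getElem? h1).1, r, by rw [← h.act k k' p hm h1, h2]⟩

theorem isFence {k k' : ℕ} (hm : Match τ τ' k k') {p : T} (hk : IsFence P M τ k p) :
    IsFence P M τ' k' p := by
  obtain ⟨h1, h2⟩ := hk
  exact ⟨(hm.getElem? h1).1, by rw [← h.act k k' p hm h1, h2]⟩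

theorem storeCount_le {k k' : ℕ} (hm : Match τ τ' k k') {p : T} (hk : τ[k]? = some (.reg p))
    (b : Option Loc) : storeCount P M τ k p b ≤ storeCount P M τ' k' p b := by
  refine RelaxedDPOR.storeCount_le fun l hl y hy hst => ?_
  obtain ⟨l', hml⟩ := exists_match h.perm hst.lt_length
  exact ⟨l', (hml.lt_iff hm hst.1 hk).1 hl, h.isStore hml hst, (hml.getElem? hst.1).2⟩

theorem storeCount_eq {k k' : ℕ} (hm : Match τ τ' k k') {p : T} (hk : τ[k]? = some (.reg p))
    (b : Option Loc) : storeCount P M τ k p b = storeCount P M τ' k' p b :=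
  le_antisymm (h.storeCount_le hm hk b) (h.symm.storeCount_le hm.symm (hm.getElem? hk).1 b)

/-- The location of an update is that of its store. By FIFO order this store is determined by the
index of the update, and the counts of stores agree since the regular threads execute the same
instructions. -/
theorem isUpd {k k' : ℕ} (hm : Match τ τ' k k') {p : T} {x : Loc} (hk : IsUpd P M τ k p x) :
    IsUpd P M τ' k' p x := by
  obtain ⟨s, -, hs⟩ := exists_storeUpd_of_isUpd h.exec_left hk
  have hst := hs.isStore hk
  obtain ⟨q, z, h1, h2, h3⟩ := id hs
  obtain ⟨rfl, rfl⟩ := hst.unique h1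
  obtain ⟨h4, h5⟩ := hm.getElem? hk.1
  obtain ⟨y, hy, h6⟩ := exists_isUpd_of_getElem? h.exec_right h4
  obtain ⟨t, -, ht⟩ := exists_storeUpd_of_isUpd h.exec_right h6
  have htt := ht.isStore h6
  obtain ⟨q, z, h7, h8, h9⟩ := id ht
  obtain ⟨rfl, rfl⟩ := htt.unique h7
  obtain ⟨s', hms⟩ := exists_match h.perm hst.lt_length
  have h10 := h.isStore hms hst
  have h11 := h.storeCount_eq hms hst.1 (M.buf x)
  obtain rfl : s' = t := by
    refine storeCount_inj h10 htt hy.symm ?_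
    rw [← h11]
    refine h3.trans (h5.trans ?_)
    rw [← hy]
    exact h9.symm
  obtain ⟨-, rfl⟩ := h10.unique htt
  exact h6

theorem actAt_eq {k k' : ℕ} (hm : Match τ τ' k k') : actAt P M τ k = actAt P M τ' k' := by
  obtain ⟨r, hr, -⟩ := id hm
  cases r with
  | reg p => exact h.act k k' p hm hr
  | upd p b =>
    obtain ⟨x, -, hu⟩ := exists_isUpd_of_getElem? h.exec_left hr
    rw [hu.2, (h.isUpd hm hu).2]

theorem storeUpd {s s' u u' : ℕ} (hs : Match τ τ' s s') (hu : Match τ τ' u u')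
    (hsu : StoreUpd P M τ s u) : StoreUpd P M τ' s' u' := by
  obtain ⟨p, x, h1, h2, h3⟩ := hsu
  refine ⟨p, x, h.isStore hs h1, h.isUpd hu h2, ?_⟩
  exact (h.storeCount_eq hs h1.1 (M.buf x)).symm.trans (h3.trans (hu.getElem? h2.1).2)

theorem updFence {u u' f f' : ℕ} (hu : Match τ τ' u u') (hf : Match τ τ' f f')
    (huf : UpdFence P M τ u f) : UpdFence P M τ' u' f' := by
  rw [updFence_iff h.exec_left] at huf
  rw [updFence_iff h.exec_right]
  obtain ⟨p, b, h1, h2, h3⟩ := huf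
  obtain ⟨h4, h5⟩ := hu.getElem? h2
  exact ⟨p, b, h.isFence hf h1, h4, by rw [← h5, h3, h.storeCount_eq hf h1.1 b]⟩

theorem isEventAt {k k' : ℕ} (hm : Match τ τ' k k') {e : Event T Loc Reg Op}
    (he : IsEventAt P M τ k e) : IsEventAt P M τ' k' e := by
  obtain ⟨h1, h2, h3⟩ := he
  obtain ⟨h4, h5⟩ := hm.getElem? h1
  exact ⟨h4, by rw [← h.actAt_eq hm, h2], by rw [h3, h5]⟩

end SameActs

/-- The order of the updates to each location and the sources of the loads also agree. -/
structure Similar (P : Program T Loc Reg Val Op) (M : MemModel) (τ τ' : List (Thread T Loc)) :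
    Prop extends SameActs P M τ τ' where
  nextUpd_iff : ∀ u v u' v', Match τ τ' u u' → Match τ τ' v v' →
    (NextUpd P M τ u v ↔ NextUpd P M τ' u' v')
  readsFrom_iff : ∀ k s k' s', Match τ τ' k k' → Match τ τ' s s' →
    (ReadsFrom P M τ k s ↔ ReadsFrom P M τ' k' s')

namespace Similar

theorem symm (h : Similar P M τ τ') : Similar P M τ' τ :=
  ⟨h.toSameActs.symm, fun u v u' v' hu hv => (h.nextUpd_iff u' v' u v hu.symm hv.symm).symm,
    fun k s k' s' hk hs => (h.readsFrom_iff k' s' k s hk.symm hs.symm).symm⟩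

variable (h : Similar P M τ τ')

include h

theorem overwrites {k k' u u' : ℕ} (hk : Match τ τ' k k') (hu : Match τ τ' u u')
    (ho : Overwrites P M τ k u) : Overwrites P M τ' k' u' := by
  rw [overwrites_iff h.exec_left] at ho
  rw [overwrites_iff h.exec_right]
  rcases ho with ⟨s, v, h1, h2, h3⟩ | ⟨p, x, q, h1, h2, h3, h4⟩
  · obtain ⟨p, x, hs, hv, -⟩ := id h2
    obtain ⟨s', hms⟩ := exists_match h.perm hs.lt_length
    obtain ⟨v', hmv⟩ := exists_match h.perm (lt_length_of_getElem? hv.1)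
    exact .inl ⟨s', v', (h.readsFrom_iff _ _ _ _ hk hms).1 h1, h.storeUpd hms hmv h2,
      (h.nextUpd_iff _ _ _ _ hmv hu).1 h3⟩
  · refine .inr ⟨p, x, q, h.isLoad hk h1, fun s' h5 => ?_, h.isUpd hu h3, fun v' h5 => ?_⟩
    · obtain ⟨_, _, _, q', hs'⟩ := h5.isLoad
      obtain ⟨s, hms⟩ := exists_match h.perm.symm hs'.lt_length
      exact h2 s ((h.readsFrom_iff _ _ _ _ hk hms.symm).2 h5)
    · obtain ⟨_, ⟨_, hv'⟩, -⟩ := id h5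
      obtain ⟨v, hmv⟩ := exists_match h.perm.symm (lt_length_of_getElem? hv'.1)
      exact h4 v ((h.nextUpd_iff _ _ _ _ hmv.symm hu).2 h5)

theorem srcCT {k k' u u' : ℕ} (hu : Match τ τ' u u') (hk : Match τ τ' k k')
    (ho : SrcCT P M τ u k) : SrcCT P M τ' u' k' := by
  obtain ⟨s, p, q, x, h1, h2, h3, h4, h5⟩ := ho
  obtain ⟨s', hms⟩ := exists_match h.perm (h2.isStore h4).lt_length
  exact ⟨s', p, q, x, (h.readsFrom_iff _ _ _ _ hk hms).1 h1, h.storeUpd hms hu h2,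
    h.isLoad hk h3, h.isUpd hu h4, h5⟩

theorem chronEdge {k k' l l' : ℕ} (hk : Match τ τ' k k') (hl : Match τ τ' l l')
    (he : ChronEdge P M τ k l) : ChronEdge P M τ' k' l' := by
  rcases he with he | he | he | he | he | he
  · exact .inl (he.of_match hk hl)
  · exact .inr (.inl (h.storeUpd hk hl he))
  · exact .inr (.inr (.inl ((h.nextUpd_iff _ _ _ _ hk hl).1 he)))
  · exact .inr (.inr (.inr (.inl (h.srcCT hk hl he))))
  · exact .inr (.inr (.inr (.inr (.inl (h.overwrites hk hl he)))))
  · exact .inr (.inr (.inr (.inr (.inr (h.updFence hk hl he)))))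

theorem ssEdge {k k' l l' : ℕ} (hk : Match τ τ' k k') (hl : Match τ τ' l l')
    (he : SSEdge P M τ k l) : SSEdge P M τ' k' l' := by
  have hpos : ∀ {s u}, StoreUpd P M τ s u → ∃ u', Match τ τ' u u' := by
    rintro s u ⟨p, x, -, hu, -⟩
    exact exists_match h.perm (lt_length_of_getElem? hu.1)
  rcases he with he | ⟨u, v, h1, h2, h3⟩ | he | ⟨u, h1, h2⟩
  · exact .inl (he.of_match hk hl)
  · obtain ⟨u', hu⟩ := hpos h1
    obtain ⟨v', hv⟩ := hpos h2
    exact .inr (.inl ⟨u', v', h.storeUpd hk hu h1, h.storeUpd hl hv h2,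
      (h.nextUpd_iff _ _ _ _ hu hv).1 h3⟩)
  · exact .inr (.inr (.inl ((h.readsFrom_iff _ _ _ _ hl hk).1 he)))
  · obtain ⟨u', hu⟩ := hpos h2
    exact .inr (.inr (.inr ⟨u', h.overwrites hk hu h1, h.storeUpd hl hu h2⟩))

theorem exists_isEventAt {k : ℕ} {e : Event T Loc Reg Op} (he : IsEventAt P M τ k e) :
    ∃ k', Match τ τ' k k' ∧ IsEventAt P M τ' k' e := by
  obtain ⟨k', hm⟩ := exists_match h.perm (lt_length_of_getElem? he.1)
  exact ⟨k', hm, h.isEventAt hm he⟩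

theorem chronTrace_le : (chronTrace P M τ).verts ⊆ (chronTrace P M τ').verts ∧
    (chronTrace P M τ).edges ⊆ (chronTrace P M τ').edges := by
  constructor
  · rintro e ⟨k, hk⟩
    obtain ⟨k', -, h1⟩ := h.exists_isEventAt hk
    exact ⟨k', h1⟩
  · rintro ⟨d, e⟩ ⟨k, l, hk, hl, he⟩
    obtain ⟨k', hmk, h1⟩ := h.exists_isEventAt hk
    obtain ⟨l', hml, h2⟩ := h.exists_isEventAt hl
    exact ⟨k', l', h1, h2, h.chronEdge hmk hml he⟩

theorem ssTrace_le : (ssTrace P M τ).verts ⊆ (ssTrace P M τ').verts ∧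
    (ssTrace P M τ).edges ⊆ (ssTrace P M τ').edges := by
  constructor
  · rintro e ⟨⟨k, hk⟩, hn⟩
    obtain ⟨k', -, h1⟩ := h.exists_isEventAt hk
    exact ⟨⟨k', h1⟩, hn⟩
  · rintro ⟨d, e⟩ ⟨hd, hn, k, l, hk, hl, he⟩
    obtain ⟨k', hmk, h1⟩ := h.exists_isEventAt hk
    obtain ⟨l', hml, h2⟩ := h.exists_isEventAt hl
    exact ⟨hd, hn, k', l', h1, h2, h.ssEdge hmk hml he⟩

theorem chronTrace_eq : chronTrace P M τ = chronTrace P M τ' := by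
  ext1
  · exact h.chronTrace_le.1.antisymm h.symm.chronTrace_le.1
  · exact h.chronTrace_le.2.antisymm h.symm.chronTrace_le.2

theorem ssTrace_eq : ssTrace P M τ = ssTrace P M τ' := by
  ext1
  · exact h.ssTrace_le.1.antisymm h.symm.ssTrace_le.1
  · exact h.ssTrace_le.2.antisymm h.symm.ssTrace_le.2

theorem chronHB_iff (a b : Thread T Loc × ℕ) : chronHB P M τ a b ↔ chronHB P M τ' a b := by
  rw [chronHB, chronHB, h.chronTrace_eq]

theorem equiv : (chronSystem P M).Equiv τ τ' :=
  ⟨h.exec_left, h.exec_right, dom_eq_iff.2 h.perm, h.chronHB_iff⟩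

end Similar

end Similarity

end RelaxedDPOR

namespace RelaxedDPOR

section Commutation

variable {T Loc Reg Val Op : Type*} {P : Program T Loc Reg Val Op} {M : MemModel}

/-! ### Independent steps commute -/

theorem assign_comm {α β : Type*} (f : α → β) {a a' : α} (b b' : β) (h : a ≠ a') :
    assign (assign f a b) a' b' = assign (assign f a' b') a b := by
  classical
  simp only [assign]
  exact Function.update_comm h b b' f

theorem assign_assign {α β : Type*} (f : α → β) (a : α) (b b' : β) :
    assign (assign f a b) a b' = assign f a b' := by
  classical
  simp [assign]

/-- The regular thread to which `r` belongs. -/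
def Thread.owner : Thread T Loc → T
  | .reg p => p
  | .upd p _ => p

/-- The thread `r` is about to load `x` from memory. -/
def LoadsMem (P : Program T Loc Reg Val Op) (M : MemModel) (c : Conf T Loc Reg Val)
    (r : Thread T Loc) (x : Loc) : Prop :=
  ∃ p a, r = .reg p ∧ P.code p (c.loc p).pc = some (.load a x) ∧
    latest ((c.loc p).buf (M.buf x)) x = none

/-- The next steps of two threads access the same location of the memory, one of them writing. -/
def Conflict (P : Program T Loc Reg Val Op) (M : MemModel) (c : Conf T Loc Reg Val)
    (p q : Thread T Loc) : Prop :=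
  ∃ x, (nextAct P c p = some (.upd x) ∧ nextAct P c q = some (.upd x)) ∨
    (LoadsMem P M c p x ∧ nextAct P c q = some (.upd x)) ∨
    (LoadsMem P M c q x ∧ nextAct P c p = some (.upd x))

theorem Conflict.symm {c : Conf T Loc Reg Val} {p q : Thread T Loc} (h : Conflict P M c p q) :
    Conflict P M c q p := by
  obtain ⟨x, h | h | h⟩ := h
  · exact ⟨x, .inl h.symm⟩
  · exact ⟨x, .inr (.inr h)⟩
  · exact ⟨x, .inr (.inl h)⟩

/-- The footprint of a step: it depends on the local configuration of its owner and on the memory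
cells that it loads, and it changes only that local configuration and, for an update, one cell. -/
theorem step_local {c c' : Conf T Loc Reg Val} {r : Thread T Loc} (h : step P M c r = some c') :
    ∃ (l : LocalConf Loc Reg Val) (f : (Loc → Val) → Loc → Val),
      c' = ⟨assign c.loc r.owner l, f c.mem⟩ ∧
      (f = id ∨ ∃ x v, nextAct P c r = some (.upd x) ∧ f = fun m => assign m x v) ∧
      (∀ d : Conf T Loc Reg Val, d.loc r.owner = c.loc r.owner →
        (∀ x, LoadsMem P M c r x → d.mem x = c.mem x) →
        step P M d r = some ⟨assign d.loc r.owner l, f d.mem⟩) := by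
  cases r with
  | reg p =>
    simp only [Thread.owner]
    rcases step_reg_cases h with ⟨x, r, hc, rfl⟩ | ⟨x, r, hc, rfl⟩ | ⟨hc, hb, rfl⟩ | ⟨o, hc, rfl⟩
    · refine ⟨_, id, rfl, .inl rfl, fun d hd _ => ?_⟩
      simp only [step, hd, hc]
      rfl
    · refine ⟨_, id, rfl, .inl rfl, fun d hd hm => ?_⟩
      have : (latest ((c.loc p).buf (M.buf x)) x).getD (d.mem x) =
          (latest ((c.loc p).buf (M.buf x)) x).getD (c.mem x) := by
        cases hl : latest ((c.loc p).buf (M.buf x)) x with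
        | none => simpa using hm x ⟨p, r, rfl, hc, hl⟩
        | some v => rfl
      simp only [step, hd, hc, this]
      rfl
    · refine ⟨_, id, rfl, .inl rfl, fun d hd _ => ?_⟩
      simp only [step, hd, hc, hb, implies_true, if_true]
      rfl
    · refine ⟨_, id, rfl, .inl rfl, fun d hd _ => ?_⟩
      simp only [step, hd, hc]
      rfl
  | upd p b =>
    obtain ⟨x, v, B, hB, rfl⟩ := step_upd_iff.1 h
    refine ⟨_, fun m => assign m x v, rfl, .inr ⟨x, v, by simp [nextAct, hB], rfl⟩,
      fun d hd _ => ?_⟩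
    simp only [Thread.owner] at hd
    simp only [step, hd, hB, Thread.owner]

theorem latest_cons_of_ne {B : List (Loc × Val)} {x y : Loc} {v : Val} (h : x ≠ y) :
    latest ((x, v) :: B) y = latest B y := by
  classical
  simp [latest, h]

/-- A load obtains the same value before and after the oldest entry moves from the buffer to memory.
-/
theorem latest_cons_self {B : List (Loc × Val)} {x : Loc} {v w : Val} :
    (latest ((x, v) :: B) x).getD w = (latest B x).getD v := by
  classical
  simp only [latest, decide_true, List.filter_cons_of_pos, List.getLast?_cons]
  cases (B.filter fun e => e.1 = x).getLast? <;> rfl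

/-- A store appends at one end of a buffer while the update removes at the other; a load is handled
by `latest_cons_self`; a fence is impossible next to a nonempty buffer. The hypothesis `hw` says
that entries sit in the buffer of their location, so that a load looks into the buffer that is
updated. -/
theorem step_comm_own {c c₁ c₂ : Conf T Loc Reg Val} {p : T} {b : Option Loc}
    (hw : ∀ e ∈ (c.loc p).buf b, M.buf e.1 = b)
    (h1 : step P M c (.reg p) = some c₁) (h2 : step P M c (.upd p b) = some c₂) :
    ∃ d, step P M c₁ (.upd p b) = some d ∧ step P M c₂ (.reg p) = some d := by
  obtain ⟨x, v, B, hB, rfl⟩ := step_upd_iff.1 h2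
  rcases step_reg_cases h1 with ⟨y, r, hc, rfl⟩ | ⟨y, r, hc, rfl⟩ | ⟨hc, hb, rfl⟩ | ⟨o, hc, rfl⟩
  · by_cases hyb : M.buf y = b
    · subst hyb
      refine ⟨_, step_upd_iff.2 ⟨x, v, B ++ [(y, (c.loc p).regs r)], ?_, rfl⟩, ?_⟩
      · simp [setLocal_loc_self, assign_self, hB]
      · simp only [step, assign_self, hc, Conf.setLocal, assign_assign]
    · refine ⟨_, step_upd_iff.2 ⟨x, v, B, ?_, rfl⟩, ?_⟩
      · rw [setLocal_loc_self]
        simp only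
        rw [assign_ne _ _ (Ne.symm hyb), hB]
      · simp only [step, assign_self, hc, Conf.setLocal, assign_assign, assign_ne _ _ hyb]
        rw [assign_comm _ _ _ hyb]
  · refine ⟨_, step_upd_iff.2 ⟨x, v, B, ?_, rfl⟩, ?_⟩
    · simp [setLocal_loc_self, hB]
    · have : (latest (assign (c.loc p).buf b B (M.buf y)) y).getD (assign c.mem x v y) =
          (latest ((c.loc p).buf (M.buf y)) y).getD (c.mem y) := by
        by_cases hxy : y = x
        · subst hxy
          by_cases hyb : M.buf y = b
          · subst hyb
            rw [assign_self, assign_self, hB, latest_cons_self]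
          · exact absurd (hw (y, v) (by simp [hB])) hyb
        · rw [assign_ne _ _ hxy]
          by_cases hyb : M.buf y = b
          · subst hyb
            rw [assign_self, hB, latest_cons_of_ne (Ne.symm hxy)]
          · rw [assign_ne _ _ hyb]
      simp only [step, assign_self, hc, Conf.setLocal, assign_assign, this]
  · rw [hb b] at hB
    simp at hB
  · refine ⟨_, step_upd_iff.2 ⟨x, v, B, ?_, rfl⟩, ?_⟩
    · simp [setLocal_loc_self, hB]
    · simp only [step, assign_self, hc, Conf.setLocal, assign_assign]

/-- Threads with different owners interact only through memory, and `Conflict` excludes exactly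
that; steps with the same owner act on different ends or different buffers. -/
theorem step_comm {c c₁ c₂ : Conf T Loc Reg Val} {p q : Thread T Loc}
    (hw : ∀ a b, ∀ e ∈ (c.loc a).buf b, M.buf e.1 = b) (h1 : step P M c p = some c₁)
    (h2 : step P M c q = some c₂) (hpq : p ≠ q) (hn : ¬ Conflict P M c p q) :
    ∃ d, step P M c₁ q = some d ∧ step P M c₂ p = some d := by
  by_cases ho : p.owner = q.owner
  · cases p with
    | reg a =>
      cases q with
      | reg a' =>
        simp only [Thread.owner] at ho
        exact absurd (by rw [ho]) hpq
      | upd a' b' =>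
        obtain rfl : a = a' := ho
        exact step_comm_own (hw a b') h1 h2
    | upd a b =>
      cases q with
      | reg a' =>
        obtain rfl : a = a' := ho
        obtain ⟨d, h3, h4⟩ := step_comm_own (hw a b) h2 h1
        exact ⟨d, h4, h3⟩
      | upd a' b' =>
        obtain rfl : a = a' := ho
        have hb : b ≠ b' := fun h => hpq (by rw [h])
        obtain ⟨x, v, B, hB, rfl⟩ := step_upd_iff.1 h1
        obtain ⟨x', v', B', hB', rfl⟩ := step_upd_iff.1 h2
        have hx : x ≠ x' := by
          rintro rfl
          exact hn ⟨x, .inl ⟨by simp [nextAct, hB], by simp [nextAct, hB']⟩⟩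
        refine ⟨_, step_upd_iff.2 ⟨x', v', B', ?_, rfl⟩, ?_⟩
        · simp only [assign_self]
          rw [assign_ne _ _ hb.symm, hB']
        · simp only [step, assign_self, assign_ne _ _ hb, hB, assign_assign]
          rw [assign_comm _ _ _ hb, assign_comm c.mem _ _ hx]
  · obtain ⟨l, f, rfl, hf, h3⟩ := step_local h1
    obtain ⟨l', f', rfl, hf', h4⟩ := step_local h2
    have hm : ∀ x, LoadsMem P M c q x → f c.mem x = c.mem x := by
      intro x hx
      rcases hf with rfl | ⟨y, v, hy, rfl⟩
      · rfl
      · exact assign_ne _ _ (by rintro rfl; exact hn ⟨x, .inr (.inr ⟨hx, hy⟩)⟩)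
    have hm' : ∀ x, LoadsMem P M c p x → f' c.mem x = c.mem x := by
      intro x hx
      rcases hf' with rfl | ⟨y, v, hy, rfl⟩
      · rfl
      · exact assign_ne _ _ (by rintro rfl; exact hn ⟨x, .inr (.inl ⟨hx, hy⟩)⟩)
    refine ⟨_, h4 _ (assign_ne _ _ (Ne.symm ho)) hm, ?_⟩
    rw [h3 _ (assign_ne _ _ ho) hm', assign_comm _ _ _ ho]
    congr 2
    rcases hf with rfl | ⟨y, v, hy, rfl⟩
    · rfl
    · rcases hf' with rfl | ⟨y', v', hy', rfl⟩
      · rfl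
      · exact assign_comm _ _ _ (by rintro rfl; exact hn ⟨_, .inl ⟨hy, hy'⟩⟩)

theorem nextAct_step {c c₁ c₂ : Conf T Loc Reg Val} {p q : Thread T Loc}
    (h1 : step P M c p = some c₁) (h2 : step P M c q = some c₂) (hpq : p ≠ q) :
    nextAct P c₁ q = nextAct P c q := by
  cases q with
  | reg a => simp [nextAct, (step_pc_of_ne h1 hpq).1]
  | upd a b =>
    by_cases hp : p = .reg a
    · subst hp
      obtain ⟨x, v, B, hB, -⟩ := step_upd_iff.1 h2
      rcases step_reg_buf h1 b with ⟨y, r, -, -, h3⟩ | ⟨-, h3⟩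
      · simp [nextAct, h3, hB]
      · simp [nextAct, h3]
    · simp [nextAct, step_buf_of_ne h1 hp hpq]

/-- A step of one thread does not disable another one. -/
theorem isSome_step_step {c c₁ c₂ : Conf T Loc Reg Val} {p q : Thread T Loc}
    (h1 : step P M c p = some c₁) (h2 : step P M c q = some c₂) (hpq : p ≠ q) :
    (step P M c₁ q).isSome := by
  have hs : (step P M c q).isSome := by simp [h2]
  cases q with
  | reg a =>
    rw [isSome_step_reg] at hs ⊢
    obtain ⟨i, hi, hf⟩ := hs
    rw [(step_pc_of_ne h1 hpq).1]
    refine ⟨i, hi, fun hi' b => ?_⟩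
    by_cases hp : p = .upd a b
    · subst hp
      obtain ⟨x, v, B, hB, -⟩ := step_upd_iff.1 h1
      rw [hf hi' b] at hB
      simp at hB
    · rw [step_buf_of_ne h1 hpq hp, hf hi' b]
  | upd a b =>
    rw [isSome_step_upd] at hs ⊢
    by_cases hp : p = .reg a
    · subst hp
      rcases step_reg_buf h1 b with ⟨y, r, -, -, h3⟩ | ⟨-, h3⟩
      · simp [h3]
      · rwa [h3]
    · rwa [step_buf_of_ne h1 hp hpq]

/-- How a thread can be enabled by a step of another one. -/
theorem step_enabled_cases {c c₁ c₂ : Conf T Loc Reg Val} {p q : Thread T Loc}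
    (h1 : step P M c p = some c₁) (h2 : step P M c₁ q = some c₂) (hpq : p ≠ q)
    (hn : ¬ (step P M c q).isSome) :
    (∃ a b, p = .reg a ∧ q = .upd a b ∧ (c.loc a).buf b = []) ∨
    ∃ a b, p = .upd a b ∧ q = .reg a ∧ (c.loc a).buf b ≠ [] ∧
      P.code a (c.loc a).pc = some .fence := by
  have hs : (step P M c₁ q).isSome := by simp [h2]
  cases q with
  | reg a =>
    right
    rw [isSome_step_reg] at hs hn
    obtain ⟨i, hi, hf⟩ := hs
    rw [(step_pc_of_ne h1 hpq).1] at hi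
    have hi' : i = .fence ∧ ∃ b, (c.loc a).buf b ≠ [] := by
      by_contra hc
      refine hn ⟨i, hi, fun h b => ?_⟩
      by_contra hb
      exact hc ⟨h, b, hb⟩
    obtain ⟨rfl, b, hb⟩ := hi'
    by_cases hp : p = .upd a b
    · exact ⟨a, b, hp, rfl, hb, hi⟩
    · rw [← step_buf_of_ne h1 hpq hp, hf rfl b] at hb
      exact absurd rfl hb
  | upd a b =>
    left
    rw [isSome_step_upd] at hs hn
    push Not at hn
    by_cases hp : p = .reg a
    · exact ⟨a, b, hp, rfl, hn⟩
    · rw [step_buf_of_ne h1 hp hpq] at hs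
      exact absurd hn hs

theorem run_buf_of_notMem {c c' : Conf T Loc Reg Val} {w : List (Thread T Loc)} {a : T}
    {b : Option Loc} (h : w.foldlM (step P M) c = some c') (h1 : .reg a ∉ w) (h2 : .upd a b ∉ w) :
    (c'.loc a).buf b = (c.loc a).buf b ∧ (c'.loc a).pc = (c.loc a).pc := by
  induction w generalizing c with
  | nil =>
    obtain rfl : c = c' := by simpa using h
    exact ⟨rfl, rfl⟩
  | cons r w ih =>
    rw [List.foldlM_cons, Option.bind_eq_bind, Option.bind_eq_some_iff] at h
    obtain ⟨d, hd, h⟩ := h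
    simp only [List.mem_cons, not_or] at h1 h2
    obtain ⟨h3, h4⟩ := ih h h1.2 h2.2
    rw [h3, h4]
    exact ⟨step_buf_of_ne hd (Ne.symm h1.1) (Ne.symm h2.1), (step_pc_of_ne hd (Ne.symm h1.1)).1⟩

end Commutation

end RelaxedDPOR

namespace RelaxedDPOR

section Exchange

variable {T Loc Reg Val Op : Type*} {P : Program T Loc Reg Val Op} {M : MemModel}

/-! ### Exchange of consecutive independent events -/

theorem match_exchange_cases {α : Type*} {A B : List α} {p q : α} (hpq : p ≠ q) {k k' : ℕ}
    (h : Match (A ++ p :: q :: B) (A ++ q :: p :: B) k k') :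
    (k < A.length ∧ k' = k) ∨ (k = A.length ∧ k' = A.length + 1) ∨
      (k = A.length + 1 ∧ k' = A.length) ∨ (A.length + 1 < k ∧ k' = k) := by
  classical
  have key : ∀ l', Match (A ++ p :: q :: B) (A ++ q :: p :: B) k l' → k' = l' := fun l' h' =>
    h.unique h'
  have hk : k < (A ++ p :: q :: B).length := by
    obtain ⟨r, hr, -⟩ := h
    exact lt_length_of_getElem? hr
  have e1 : ∀ (x y : α), (A ++ x :: y :: B).take (A.length + 1) = A ++ [x] := by
    intro x y
    rw [show A ++ x :: y :: B = (A ++ [x]) ++ y :: B by simp]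
    exact List.take_left' (by simp)
  have e2 : ∀ (x y : α), (A ++ x :: y :: B)[A.length + 1]? = some y := by
    intro x y
    rw [show A ++ x :: y :: B = (A ++ [x]) ++ y :: B by simp,
      List.getElem?_append_right (by simp)]
    simp
  rcases Nat.lt_trichotomy k A.length with h1 | rfl | h1
  · refine .inl ⟨h1, key k ?_⟩
    refine ⟨A[k], by rw [List.getElem?_append_left h1]; simp,
      by rw [List.getElem?_append_left h1]; simp, ?_⟩
    rw [List.take_append_of_le_length h1.le, List.take_append_of_le_length h1.le]
  · refine .inr (.inl ⟨rfl, key _ ⟨p, by simp, e2 q p, ?_⟩⟩)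
    rw [e1]
    simp [occ, Ne.symm hpq]
  · rcases Nat.lt_or_ge (A.length + 1) k with h2 | h2
    · refine .inr (.inr (.inr ⟨h2, key k ?_⟩))
      obtain ⟨j, rfl⟩ := Nat.exists_eq_add_of_le (show A.length + 2 ≤ k by omega)
      have e3 : ∀ (x y : α), (A ++ x :: y :: B)[A.length + 2 + j]? = B[j]? := by
        intro x y
        rw [List.getElem?_append_right (by omega),
          show A.length + 2 + j - A.length = j + 2 by omega]
        simp
      have e4 : ∀ (x y : α), (A ++ x :: y :: B).take (A.length + 2 + j) =
          A ++ x :: y :: B.take j := by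
        intro x y
        rw [List.take_append, show A.length + 2 + j - A.length = j + 2 by omega,
          List.take_of_length_le (by omega)]
        simp
      have hj : j < B.length := by simp at hk; omega
      refine ⟨B[j], by rw [e3]; simp, by rw [e3]; simp, ?_⟩
      rw [e4, e4]
      exact perm_iff_occ.1 ((List.Perm.swap q p _).append_left A) _
    · obtain rfl : k = A.length + 1 := by omega
      refine .inr (.inr (.inl ⟨rfl, key _ ⟨q, e2 p q, by simp, ?_⟩⟩))
      rw [e1]
      simp [occ, hpq]

section Transport

variable {τ τ' : List (Thread T Loc)} {n : ℕ} (h : SameActs P M τ τ')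
  (hcase : ∀ k k', Match τ τ' k k' → (k < n ∧ k' = k) ∨ (k = n ∧ k' = n + 1) ∨
    (k = n + 1 ∧ k' = n) ∨ (n + 1 < k ∧ k' = k))
  (hupd : ∀ x p q, IsUpd P M τ n p x → ¬ IsUpd P M τ (n + 1) q x)

include h hcase hupd

/-- Only the relative order of the two exchanged events changes, and they are not updates to the
same location. -/
theorem nextUpd_of_exchange {u v u' v' : ℕ} (hu : Match τ τ' u u') (hv : Match τ τ' v v')
    (huv : NextUpd P M τ u v) : NextUpd P M τ' u' v' := by
  obtain ⟨x, ⟨p, h1⟩, ⟨q, h2⟩, h3, h4⟩ := huv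
  refine ⟨x, ⟨p, h.isUpd hu h1⟩, ⟨q, h.isUpd hv h2⟩, ?_, ?_⟩
  · have hne : ¬ (u = n ∧ v = n + 1) := by
      rintro ⟨rfl, rfl⟩
      exact hupd x p q h1 h2
    have := hcase _ _ hu
    have := hcase _ _ hv
    omega
  · intro w' r h5 h6 h7
    obtain ⟨w, hw⟩ := exists_match h.perm.symm (lt_length_of_getElem? h7.1)
    have h8 := h.symm.isUpd hw h7
    refine h4 w r ?_ ?_ h8
    · have hne : ¬ (w = n ∧ u = n + 1) := by
        rintro ⟨rfl, rfl⟩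
        exact hupd x r p h8 h1
      have := hcase _ _ hu
      have := hcase _ _ hw.symm
      omega
    · have hne : ¬ (v = n ∧ w = n + 1) := by
        rintro ⟨rfl, rfl⟩
        exact hupd x q r h2 h8
      have := hcase _ _ hv
      have := hcase _ _ hw.symm
      omega

/-- Sources are preserved, although the way in which the value arrives may change: when a load is
exchanged with the update of the store it reads from, it changes between buffer forwarding and
memory. -/
theorem readsFrom_of_exchange
    (hmem : ∀ p x q, FromMemory P M τ n p x → ¬ IsUpd P M τ (n + 1) q x)
    (hmem' : ∀ p x q, FromMemory P M τ' n p x → ¬ IsUpd P M τ' (n + 1) q x)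
    {k s k' s' : ℕ} (hk : Match τ τ' k k') (hs : Match τ τ' s s')
    (hr : ReadsFrom P M τ k s) : ReadsFrom P M τ' k' s' := by
  obtain ⟨a, x, ⟨h1, h2, h3, h4⟩ | ⟨h1, u, q, h2, h3, h4, h5⟩⟩ := hr
  · have hl' := h.isLoad hk h1.1
    have hlt := (hs.lt_iff hk h2.1 h1.1.1).1 h3
    have hst' := h.isStore hs h2
    by_cases hm : FromMemory P M τ' k' a x
    -- The load was forwarded before the exchange and reads memory after it. This forces the load
    -- and the update of its source to be the exchanged pair, so the update immediately precedes the
    -- load now.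
    · obtain ⟨u', h5, h6⟩ := ((fromMemory_iff h.exec_right).1 hm).2 s' hlt hst'
      have hu' := h6.isUpd hst'
      obtain ⟨u, hu⟩ := exists_match h.perm.symm (lt_length_of_getElem? hu'.1)
      have hsu := h.symm.storeUpd hs.symm hu h6
      obtain ⟨hl, t, h7, h8, h9⟩ := (fromBuffer_iff h.exec_left).1 h1
      have h10 := not_storeUpd_last h.exec_left h2 h8 h4 h7 h9
      have h11 : ¬ u < k := fun hlt => h10 u hlt hsu
      have h12 : u ≠ k := by
        rintro rfl
        exact hl.not_isUpd (hsu.isUpd h2)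
      have c1 := hcase _ _ hk
      have c2 := hcase _ _ hu.symm
      exact ⟨a, x, .inr ⟨hm, u', a, hu', h5, fun v r h13 h14 => by omega, h6⟩⟩
    · refine ⟨a, x, .inl ⟨(fromBuffer_iff_not h.exec_right).2 ⟨hl', hm⟩, hst', hlt,
        fun t' h5 h6 h7 => ?_⟩⟩
      obtain ⟨t, ht⟩ := exists_match h.perm.symm h7.lt_length
      have h8 := h.symm.isStore ht h7
      exact h4 t ((hs.lt_iff ht.symm h2.1 h8.1).2 h5) ((ht.symm.lt_iff hk h8.1 h1.1.1).2 h6) h8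
  · have hl' := h.isLoad hk h1.1
    have hst := h5.isStore h2
    obtain ⟨u', hu⟩ := exists_match h.perm (lt_length_of_getElem? h2.1)
    have hu' := h.isUpd hu h2
    have hsu' := h.storeUpd hs hu h5
    by_cases hm : FromMemory P M τ' k' a x
    · refine ⟨a, x, .inr ⟨hm, u', q, hu', ?_, ?_, hsu'⟩⟩
      · have c1 := hcase _ _ hk
        have c2 := hcase _ _ hu
        by_contra hlt
        have h6 : k' = n ∧ u' = n + 1 := by omega
        rw [h6.1] at hm
        rw [h6.2] at hu'
        exact hmem' a x q hm hu'
      · intro v' r h6 h7 h8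
        obtain ⟨v, hv⟩ := exists_match h.perm.symm (lt_length_of_getElem? h8.1)
        have h9 := h.symm.isUpd hv h8
        have c1 := hcase _ _ hk
        have c2 := hcase _ _ hu
        have c3 := hcase _ _ hv.symm
        refine h4 v r ?_ ?_ h9
        · have hne : ¬ (v = n ∧ u = n + 1) := by
            rintro ⟨rfl, rfl⟩
            exact hupd x r q h9 h2
          omega
        · have hne : ¬ (k = n ∧ v = n + 1) := by
            rintro ⟨rfl, rfl⟩
            exact hmem a x r h1 h9
          have hne' : v ≠ k := by
            rintro rfl
            exact h1.1.not_isUpd h9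
          omega
    -- Conversely, the load now finds a pending store of its own thread whose update immediately
    -- preceded the load before. That update was the latest to the location, so its store is the old
    -- source; FIFO order shows that it is also the newest store.
    · have hb := (fromBuffer_iff_not h.exec_right).2 ⟨hl', hm⟩
      obtain ⟨-, t', h6, h7, h8⟩ := (fromBuffer_iff h.exec_right).1 hb
      obtain ⟨t, ht⟩ := exists_match h.perm.symm h7.lt_length
      have h9 := h.symm.isStore ht h7
      have h10 := (ht.symm.lt_iff hk h9.1 h1.1.1).2 h6
      have hall := ((fromMemory_iff h.exec_left).1 h1).2
      obtain ⟨w, h11, h12⟩ := hall t h10 h9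
      have h13 := h12.isUpd h9
      obtain ⟨w', hw⟩ := exists_match h.perm (lt_length_of_getElem? h13.1)
      have h14 := h.storeUpd ht.symm hw h12
      have h15 : ¬ w' < k' := fun hlt => h8 w' hlt h14
      have h16 : w' ≠ k' := by
        rintro rfl
        exact hl'.not_isUpd (h14.isUpd h7)
      have c1 := hcase _ _ hk
      have c2 := hcase _ _ hw
      have h17 : ¬ u < w := fun hlt => h4 w a hlt h11 h13
      obtain rfl : u = w := by omega
      obtain rfl := h5.left_unique h12
      obtain rfl := hs.unique ht.symm
      refine ⟨a, x, .inl ⟨hb, h7, h6, fun r' h18 h19 h20 => ?_⟩⟩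
      obtain ⟨r, hr⟩ := exists_match h.perm.symm h20.lt_length
      have h21 := h.symm.isStore hr h20
      have h22 := (ht.symm.lt_iff hr.symm h9.1 h21.1).2 h18
      obtain ⟨w₂, h23, h24⟩ := hall r ((hr.symm.lt_iff hk h21.1 h1.1.1).2 h19) h21
      obtain ⟨w₃, h25, h26⟩ := exists_storeUpd_of_lt h.exec_left h9 h21 rfl h22 h24
      obtain rfl := h26.right_unique h12
      omega

end Transport

theorem conf_buf_wf {τ : List (Thread T Loc)} {c : Conf T Loc Reg Val}
    (h : run P M τ = some c) (a : T) (b : Option Loc) : ∀ e ∈ (c.loc a).buf b, M.buf e.1 = b := by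
  intro e he
  obtain ⟨i, hi⟩ := List.mem_iff_getElem?.1 he
  obtain ⟨s, -, -, h1, -⟩ := (buffer_spec h a b).2 i e hi
  exact h1

theorem isUpd_of_nextAct {τ : List (Thread T Loc)} (h : IsExec P M τ) {k : ℕ} {r : Thread T Loc}
    {c : Conf T Loc Reg Val} (hc : run P M (τ.take k) = some c) (hr : τ[k]? = some r) {x : Loc}
    (ha : nextAct P c r = some (.upd x)) : ∃ a, IsUpd P M τ k a x := by
  cases r with
  | reg a => simp [nextAct] at ha
  | upd a b =>
    obtain ⟨y, -, hy⟩ := exists_isUpd_of_getElem? h hr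
    have := hy.2
    rw [actAt_eq hc hr, ha] at this
    obtain rfl : x = y := by simpa using this
    exact ⟨a, hy⟩

theorem nextAct_of_isUpd {τ : List (Thread T Loc)} {k : ℕ} {r : Thread T Loc}
    {c : Conf T Loc Reg Val} (hc : run P M (τ.take k) = some c) (hr : τ[k]? = some r) {x : Loc}
    {a : T} (hu : IsUpd P M τ k a x) : nextAct P c r = some (.upd x) := by
  rw [← actAt_eq hc hr, hu.2]

theorem fromMemory_iff_loadsMem {τ : List (Thread T Loc)} {k : ℕ} {r : Thread T Loc}
    {c : Conf T Loc Reg Val} (hc : run P M (τ.take k) = some c) (hr : τ[k]? = some r) {x : Loc} :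
    (∃ a, FromMemory P M τ k a x) ↔ LoadsMem P M c r x := by
  constructor
  · rintro ⟨a, h1, d, hd, h2⟩
    rw [hc] at hd
    cases hd
    obtain ⟨h3, g, h4⟩ := (isLoad_iff hc).1 h1
    rw [hr] at h3
    exact ⟨a, g, by simpa using h3, h4, h2⟩
  · rintro ⟨a, g, rfl, h1, h2⟩
    exact ⟨a, (isLoad_iff hc).2 ⟨hr, g, h1⟩, c, hc, h2⟩

/-- Two consecutive events that are not connected by an edge of the chronological trace are
independent. -/
theorem independent_of_not_chronEdge {A : List (Thread T Loc)} {p q : Thread T Loc}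
    (h : IsExec P M (A ++ [p, q])) (hpq : p ≠ q)
    (hn : ¬ ChronEdge P M (A ++ [p, q]) A.length (A.length + 1)) {c c₁ : Conf T Loc Reg Val}
    (hc : run P M A = some c) (hc1 : step P M c p = some c₁) :
    (∃ c₂, step P M c q = some c₂) ∧ ¬ Conflict P M c p q := by
  have hn1 : run P M ((A ++ [p, q]).take A.length) = some c := by simpa using hc
  have hn2 : run P M ((A ++ [p, q]).take (A.length + 1)) = some c₁ := by
    rw [List.take_append, Nat.add_sub_cancel_left, List.take_of_length_le (by omega)]
    simp only [List.take_succ_cons, List.take_zero]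
    rw [run_concat, hc]
    exact hc1
  have hg1 : (A ++ [p, q])[A.length]? = some p := by simp
  have hg2 : (A ++ [p, q])[A.length + 1]? = some q := by
    rw [List.getElem?_append_right (by omega)]
    simp
  have hs2 : ∃ d, step P M c₁ q = some d := by
    obtain ⟨d, hd⟩ := isExec_iff.1 h
    rw [show A ++ [p, q] = A ++ [p] ++ [q] by simp, run_concat, run_concat, hc] at hd
    simp only [Option.bind_some, hc1] at hd
    exact ⟨d, hd⟩
  obtain ⟨d, hd⟩ := hs2
  have hlt : A.length < A.length + 1 := by omega
  have hbetween : ∀ v, A.length < v → v < A.length + 1 → False := fun v h1 h2 => by omega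
  -- If `q` became enabled by `p`, then `q` is the update of the store `p` or a fence waiting for
  -- the update `p`; either way there is an edge.
  have hsome : ∃ c₂, step P M c q = some c₂ := by
    by_contra hcon
    rcases step_enabled_cases hc1 hd hpq (by
      rwa [Option.isSome_iff_exists]) with ⟨a, b, rfl, rfl, h1⟩ | ⟨a, b, rfl, rfl, h1, h2⟩
    · obtain ⟨x, rfl, hx⟩ := exists_isUpd_of_getElem? h hg2
      obtain ⟨s, h2, h3⟩ := exists_storeUpd_of_isUpd h hx
      have hst := h3.isStore hx
      rcases Nat.lt_succ_iff_lt_or_eq.1 h2 with h4 | rfl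
      · have h5 := (buffer_spec_take (by simp) hn1 a (M.buf x)).1
        rw [h1] at h5
        have h6 := storeCount_lt hst h4
        obtain ⟨a', y, h7, h8, h9⟩ := h3
        obtain ⟨rfl, rfl⟩ := hst.unique h7
        rcases occ_take_succ (A ++ [Thread.reg a, .upd a (M.buf x)]) A.length
          (Thread.upd a (M.buf x)) with ⟨h10, -⟩ | ⟨-, h10⟩
        · rw [hg1] at h10
          simp at h10
        · have h11 : storeCount P M (A ++ [Thread.reg a, .upd a (M.buf x)]) s a (M.buf x) =
              occ ((A ++ [Thread.reg a, .upd a (M.buf x)]).take (A.length + 1)) (.upd a (M.buf x)) := h9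
          simp only [List.length_nil] at h5
          omega
      · exact hn (.inr (.inl h3))
    · refine hn (.inr (.inr (.inr (.inr (.inr ⟨a, b, ?_, hg1, hlt, fun v h3 h4 => by omega⟩)))))
      refine (isFence_iff hn2).2 ⟨hg2, ?_⟩
      rw [(step_pc_of_ne hc1 hpq).1]
      exact h2
  refine ⟨hsome, ?_⟩
  obtain ⟨c₂, hc2⟩ := hsome
  have hq := nextAct_step hc1 hc2 hpq
  rintro ⟨x, ⟨h1, h2⟩ | ⟨h1, h2⟩ | ⟨h1, h2⟩⟩
  · obtain ⟨a, h3⟩ := isUpd_of_nextAct h hn1 hg1 h1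
    obtain ⟨a', h4⟩ := isUpd_of_nextAct h hn2 hg2 (hq.trans h2)
    exact hn (.inr (.inr (.inl ⟨x, ⟨a, h3⟩, ⟨a', h4⟩, hlt, fun v r h5 h6 => by omega⟩)))
  · obtain ⟨a, h3⟩ := (fromMemory_iff_loadsMem hn1 hg1).2 h1
    obtain ⟨a', h4⟩ := isUpd_of_nextAct h hn2 hg2 (hq.trans h2)
    exact hn (.inr (.inr (.inr (.inr (.inl (overwrites_of_fromMemory h h3 h4 hlt
      fun v r h5 h6 => by omega))))))
  · obtain ⟨a, h3⟩ := isUpd_of_nextAct h hn1 hg1 h2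
    obtain ⟨a', g, rfl, h4, h5⟩ := h1
    -- A load from memory has no pending store of its own thread to the location, so the update
    -- belongs to another thread.
    have hne : a ≠ a' := by
      rintro rfl
      obtain ⟨-, v, B, hB⟩ := (isUpd_iff hn1).1 h3
      exact latest_eq_none_iff.1 h5 (x, v) (by simp [hB]) rfl
    have hp : p = .upd a (M.buf x) := by
      have := h3.1
      rw [hg1] at this
      simpa using this
    have hm : FromMemory P M (A ++ [p, .reg a']) (A.length + 1) a' x := by
      refine ⟨(isLoad_iff hn2).2 ⟨hg2, g, ?_⟩, c₁, hn2, ?_⟩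
      · rw [(step_pc_of_ne hc1 hpq).1]
        exact h4
      · subst hp
        rw [step_upd_loc_ne hc1 (Ne.symm hne)]
        exact h5
    exact hn (.inr (.inr (.inr (.inl (srcCT_of_fromMemory h hm h3 hne hlt
      fun v r h6 h7 => by omega)))))

theorem no_conflict_at {A B : List (Thread T Loc)} {p q : Thread T Loc}
    (hpq : p ≠ q) {c c₁ c₂ : Conf T Loc Reg Val}
    (hc : run P M A = some c) (hc1 : step P M c p = some c₁) (hc2 : step P M c q = some c₂)
    (hn : ¬ Conflict P M c p q) :
    (∀ x a a', IsUpd P M (A ++ p :: q :: B) A.length a x →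
      ¬ IsUpd P M (A ++ p :: q :: B) (A.length + 1) a' x) ∧
    ∀ a x a', FromMemory P M (A ++ p :: q :: B) A.length a x →
      ¬ IsUpd P M (A ++ p :: q :: B) (A.length + 1) a' x := by
  have hn1 : run P M ((A ++ p :: q :: B).take A.length) = some c := by simpa using hc
  have hn2 : run P M ((A ++ p :: q :: B).take (A.length + 1)) = some c₁ := by
    rw [show A ++ p :: q :: B = (A ++ [p]) ++ q :: B by simp, List.take_left' (by simp),
      run_concat, hc]
    exact hc1
  have hg1 : (A ++ p :: q :: B)[A.length]? = some p := by simp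
  have hg2 : (A ++ p :: q :: B)[A.length + 1]? = some q := by
    rw [List.getElem?_append_right (by omega)]
    simp
  have hq := nextAct_step hc1 hc2 hpq
  constructor
  · intro x a a' h1 h2
    exact hn ⟨x, .inl ⟨nextAct_of_isUpd hn1 hg1 h1, hq ▸ nextAct_of_isUpd hn2 hg2 h2⟩⟩
  · intro a x a' h1 h2
    exact hn ⟨x, .inr (.inl ⟨(fromMemory_iff_loadsMem hn1 hg1).1 ⟨a, h1⟩,
      hq ▸ nextAct_of_isUpd hn2 hg2 h2⟩)⟩

theorem similar_exchange {A B : List (Thread T Loc)} {p q : Thread T Loc}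
    (h : IsExec P M (A ++ p :: q :: B)) (hpq : p ≠ q)
    (hn : ¬ ChronEdge P M (A ++ [p, q]) A.length (A.length + 1)) :
    Similar P M (A ++ p :: q :: B) (A ++ q :: p :: B) := by
  obtain ⟨c, c₁, hc, hc1, -⟩ := exists_step h (k := A.length) (r := p) (by simp)
  rw [List.take_left] at hc
  obtain ⟨⟨c₂, hc2⟩, hnc⟩ := independent_of_not_chronEdge
    (isExec_prefix (w := B) (by simpa using h)) hpq hn hc hc1
  obtain ⟨d, hd1, hd2⟩ := step_comm (conf_buf_wf hc) hc1 hc2 hpq hnc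
  have hrun : ∀ w, run P M (A ++ p :: q :: w) = run P M (A ++ q :: p :: w) := by
    intro w
    simp [run_append, hc, hc1, hc2, hd1, hd2]
  have h' : IsExec P M (A ++ q :: p :: B) := by
    unfold IsExec
    rw [← hrun]
    exact h
  have hcase := fun k k' => match_exchange_cases (A := A) (B := B) hpq (k := k) (k' := k')
  have htake : (A ++ p :: q :: B).take A.length = (A ++ q :: p :: B).take A.length := by simp
  have e1 : ∀ (x y : Thread T Loc), run P M ((A ++ x :: y :: B).take (A.length + 1)) =
      (run P M A).bind fun c => step P M c x := by
    intro x y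
    rw [show A ++ x :: y :: B = (A ++ [x]) ++ y :: B by simp, List.take_left' (by simp),
      run_concat]
  have e2 : ∀ (x y : Thread T Loc), (A ++ x :: y :: B)[A.length + 1]? = some y := by
    intro x y
    rw [List.getElem?_append_right (by omega)]
    simp
  have same : SameActs P M (A ++ p :: q :: B) (A ++ q :: p :: B) := by
    refine ⟨h, h', (List.Perm.swap q p B).append_left A, fun k k' a hm hk => ?_⟩
    rcases hcase k k' hm with ⟨h1, rfl⟩ | ⟨rfl, rfl⟩ | ⟨rfl, rfl⟩ | ⟨h1, rfl⟩
    · exact actAt_congr htake h1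
    · rw [actAt_eq (c := c) (r := p) (by simpa using hc) (by simp),
        actAt_eq (c := c₂) (r := p) (by rw [e1, hc]; exact hc2) (e2 q p)]
      exact (nextAct_step hc2 hc1 hpq.symm).symm
    · rw [actAt_eq (c := c₁) (r := q) (by rw [e1, hc]; exact hc1) (e2 p q),
        actAt_eq (c := c) (r := q) (by simpa using hc) (by simp)]
      exact nextAct_step hc1 hc2 hpq
    · obtain ⟨j, rfl⟩ := Nat.exists_eq_add_of_le (show A.length + 2 ≤ k' by omega)
      have e4 : ∀ (x y : Thread T Loc), (A ++ x :: y :: B).take (A.length + 2 + j) =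
          A ++ x :: y :: B.take j := by
        intro x y
        rw [List.take_append, show A.length + 2 + j - A.length = j + 2 by omega,
          List.take_of_length_le (by omega)]
        simp
      simp only [actAt, e4, hrun, hk, (hm.getElem? hk).1]
  obtain ⟨h1, h2⟩ := no_conflict_at (B := B) hpq hc hc1 hc2 hnc
  obtain ⟨h3, h4⟩ := no_conflict_at (B := B) hpq.symm hc hc2 hc1 (fun hcon => hnc hcon.symm)
  have hcase' := fun k k' => match_exchange_cases (A := A) (B := B) hpq.symm (k := k) (k' := k')
  refine ⟨same, fun u v u' v' hu hv => ⟨fun huv => nextUpd_of_exchange same hcase h1 hu hv huv,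
    fun huv => nextUpd_of_exchange same.symm hcase' h3 hu.symm hv.symm huv⟩,
    fun k s k' s' hk hs => ⟨fun hr => readsFrom_of_exchange same hcase h1 h2 h4 hk hs hr,
    fun hr => readsFrom_of_exchange same.symm hcase' h3 h4 h2 hk.symm hs.symm hr⟩⟩

end Exchange

end RelaxedDPOR

namespace RelaxedDPOR

section Happens

variable {T Loc Reg Val Op : Type*} {P : Program T Loc Reg Val Op} {M : MemModel}
  {τ τ' : List (Thread T Loc)}

/-! ### Happens-before in terms of positions -/

/-- The event at position `k` has the name `a`. -/
def NamedAt {α : Type*} (l : List α) (k : ℕ) (a : α × ℕ) : Prop :=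
  l[k]? = some a.1 ∧ a.2 = occ (l.take k) a.1 + 1

theorem NamedAt.unique {α : Type*} {l : List α} {k k' : ℕ} {a : α × ℕ} (h : NamedAt l k a)
    (h' : NamedAt l k' a) : k = k' :=
  occ_take_inj h.1 h'.1 (by have := h.2; have := h'.2; omega)

theorem namedAt_iff {α : Type*} {l : List α} {k : ℕ} {a : α × ℕ} :
    NamedAt l k a ↔ (events l)[k]? = some a := by
  rw [List.getElem?_eq_some_iff]
  constructor
  · rintro ⟨h1, h2⟩
    have hk := lt_length_of_getElem? h1
    refine ⟨by simpa using hk, ?_⟩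
    rw [getElem_events l k hk]
    rw [List.getElem?_eq_getElem hk, Option.some.injEq] at h1
    simp only [eventAt, List.get_eq_getElem, h1, ← h2]
  · rintro ⟨hk, h⟩
    have hk' : k < l.length := by simpa using hk
    rw [getElem_events l k hk'] at h
    subst h
    exact ⟨by simp [eventAt], rfl⟩

theorem mem_events_iff_namedAt {α : Type*} {l : List α} {a : α × ℕ} :
    a ∈ events l ↔ ∃ k, NamedAt l k a := by
  simp only [namedAt_iff, List.mem_iff_getElem?]

theorem namedAt_append {α : Type*} {l w : List α} {k : ℕ} (hk : k < l.length) {a : α × ℕ} :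
    NamedAt (l ++ w) k a ↔ NamedAt l k a := by
  rw [NamedAt, NamedAt, List.getElem?_append_left hk, List.take_append_of_le_length hk.le]

theorem namedAt_length {α : Type*} (A B : List α) (p : α) :
    NamedAt (A ++ p :: B) A.length (nextEv A p) := by
  constructor
  · simp
  · simp [nextEv]

theorem NamedAt.lt_length {α : Type*} {l : List α} {k : ℕ} {a : α × ℕ} (h : NamedAt l k a) :
    k < l.length := lt_length_of_getElem? h.1

theorem IsEventAt.namedAt {k : ℕ} {e : Event T Loc Reg Op} (h : IsEventAt P M τ k e) :
    NamedAt τ k (e.thread, e.idx) := ⟨h.1, h.2.2⟩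

theorem IsEventAt.unique {k k' : ℕ} {e e' : Event T Loc Reg Op} (h : IsEventAt P M τ k e)
    (h' : IsEventAt P M τ k' e') (he : (e.thread, e.idx) = (e'.thread, e'.idx)) :
    e = e' ∧ k = k' := by
  have h1 := h.namedAt
  rw [he] at h1
  obtain rfl := h1.unique h'.namedAt
  refine ⟨?_, rfl⟩
  obtain ⟨t, a, i⟩ := e
  obtain ⟨t', a', i'⟩ := e'
  simp only [Prod.mk.injEq] at he
  have h2 := h.2.1
  rw [h'.2.1] at h2
  simp only [Option.some.injEq] at h2
  rw [he.1, he.2, h2]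

theorem exists_isEventAt (h : IsExec P M τ) {k : ℕ} (hk : k < τ.length) :
    ∃ e, IsEventAt P M τ k e := by
  have hr := List.getElem?_eq_getElem hk
  obtain ⟨c, c', hc, hs, -⟩ := exists_step h hr
  obtain ⟨a, ha⟩ := exists_nextAct hs
  exact ⟨⟨τ[k], a, occ (τ.take k) τ[k] + 1⟩, hr, by rw [actAt_eq hc hr, ha], rfl⟩

theorem NamedAt.exists_isEventAt (h : IsExec P M τ) {k : ℕ} {a : Thread T Loc × ℕ}
    (ha : NamedAt τ k a) :
    ∃ e, IsEventAt P M τ k e ∧ (e.thread, e.idx) = a := by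
  obtain ⟨e, he⟩ := RelaxedDPOR.exists_isEventAt h ha.lt_length
  refine ⟨e, he, ?_⟩
  have h1 := he.1
  rw [ha.1, Option.some.injEq] at h1
  have h2 := he.2.2
  rw [← h1, ← ha.2] at h2
  rw [← h1, h2]

theorem ChronEdge.transGen_lt (h : IsExec P M τ) {k k' : ℕ}
    (hk : Relation.TransGen (ChronEdge P M τ) k k') : k < k' ∧ k' < τ.length := by
  induction hk with
  | single he => exact he.lt h
  | tail _ he ih => exact ⟨ih.1.trans (he.lt h).1, (he.lt h).2⟩

theorem exists_pos_of_transGen {e e' : Event T Loc Reg Op}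
    (h : Relation.TransGen (fun d d' => (d, d') ∈ (chronTrace P M τ).edges) e e') :
    ∃ k k', IsEventAt P M τ k e ∧ IsEventAt P M τ k' e' ∧
      Relation.TransGen (ChronEdge P M τ) k k' := by
  induction h with
  | single h =>
    obtain ⟨k, k', h1, h2, h3⟩ := h
    exact ⟨k, k', h1, h2, .single h3⟩
  | tail _ h ih =>
    obtain ⟨k, l, h1, h2, h3⟩ := ih
    obtain ⟨l', k', h4, h5, h6⟩ := h
    obtain ⟨-, rfl⟩ := h2.unique h4 rfl
    exact ⟨k, k', h1, h5, h3.tail h6⟩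

theorem transGen_of_pos (h : IsExec P M τ) {k k' : ℕ}
    (hk : Relation.TransGen (ChronEdge P M τ) k k') {e e' : Event T Loc Reg Op}
    (he : IsEventAt P M τ k e) (he' : IsEventAt P M τ k' e') :
    Relation.TransGen (fun d d' => (d, d') ∈ (chronTrace P M τ).edges) e e' := by
  induction hk generalizing e' with
  | single h1 => exact .single ⟨k, _, he, he', h1⟩
  | @tail l m h1 h2 ih =>
    obtain ⟨d, hd⟩ := exists_isEventAt h (ChronEdge.transGen_lt h h1).2
    exact (ih hd).tail ⟨_, _, hd, he', h2⟩

/-- Events of an execution correspond to positions, so the closure can be taken over positions,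
where edges point forward. -/
theorem chronHB_iff_pos (h : IsExec P M τ) {a b : Thread T Loc × ℕ} :
    chronHB P M τ a b ↔
      ∃ k k', NamedAt τ k a ∧ NamedAt τ k' b ∧ Relation.TransGen (ChronEdge P M τ) k k' := by
  constructor
  · rintro ⟨e, e', rfl, rfl, h1⟩
    obtain ⟨k, k', h2, h3, h4⟩ := exists_pos_of_transGen h1
    exact ⟨k, k', h2.namedAt, h3.namedAt, h4⟩
  · rintro ⟨k, k', h1, h2, h3⟩
    obtain ⟨e, he, h4⟩ := h1.exists_isEventAt h
    obtain ⟨e', he', h5⟩ := h2.exists_isEventAt h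
    exact ⟨e, e', h4, h5, transGen_of_pos h h3 he he'⟩

theorem ChronEdge.hb (h : IsExec P M τ) {k k' : ℕ} {a b : Thread T Loc × ℕ}
    (he : ChronEdge P M τ k k') (ha : NamedAt τ k a) (hb : NamedAt τ k' b) : chronHB P M τ a b :=
  (chronHB_iff_pos h).2 ⟨k, k', ha, hb, .single he⟩

theorem chronHB_trans {a b c : Thread T Loc × ℕ} (h : chronHB P M τ a b)
    (h' : chronHB P M τ b c) : chronHB P M τ a c := by
  obtain ⟨e, d, h1, h2, h3⟩ := h
  obtain ⟨d', e', h4, h5, h6⟩ := h'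
  obtain ⟨_, _, _, h7, -⟩ := exists_pos_of_transGen h3
  obtain ⟨_, _, h8, _, -⟩ := exists_pos_of_transGen h6
  obtain ⟨rfl, -⟩ := h7.unique h8 (h2.trans h4.symm)
  exact ⟨e, e', h1, h5, h3.trans h6⟩

theorem readsFrom_congr {n : ℕ} (h : IsExec P M τ) (ht : τ.take n = τ'.take n) {k s : ℕ}
    (hk : k < n) (hr : ReadsFrom P M τ k s) : ReadsFrom P M τ' k s := by
  have hs := (hr.lt h).trans hk
  obtain ⟨p, x, ⟨h1, h2, h3, h4⟩ | ⟨h1, u, q, h2, h3, h4, h5⟩⟩ := hr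
  · exact ⟨p, x, .inl ⟨(fromBuffer_congr ht hk).1 h1, (isStore_congr ht hs).1 h2, h3,
      fun t h5 h6 => (isStore_congr ht (h6.trans hk)).not.1 (h4 t h5 h6)⟩⟩
  · exact ⟨p, x, .inr ⟨(fromMemory_congr ht hk).1 h1, u, q, (isUpd_congr ht (h3.trans hk)).1 h2, h3,
      fun v r h6 h7 => (isUpd_congr ht (h7.trans hk)).not.1 (h4 v r h6 h7),
      (storeUpd_congr ht hs (h3.trans hk)).1 h5⟩⟩

/-- Every event mentioned in the definition of an edge lies before its target, so an edge depends
only on the part of the execution up to the target. -/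
theorem chronEdge_congr {n : ℕ} (h : IsExec P M τ) (ht : τ.take n = τ'.take n) {k k' : ℕ}
    (hk' : k' < n) (he : ChronEdge P M τ k k') : ChronEdge P M τ' k k' := by
  have hk : k < n := (he.lt h).1.trans hk'
  rcases he with he | he | he | he | he | he
  · left
    unfold PO at he ⊢
    rwa [← getElem?_congr ht hk, ← getElem?_congr ht hk', ← take_congr ht hk.le,
      ← take_congr ht hk'.le]
  · exact .inr (.inl ((storeUpd_congr ht hk hk').1 he))
  · exact .inr (.inr (.inl ((nextUpd_congr ht hk').1 he)))
  · obtain ⟨s, p, q, x, h1, h2, h3, h4, h5⟩ := he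
    exact .inr (.inr (.inr (.inl ⟨s, p, q, x, readsFrom_congr h ht hk' h1,
      (storeUpd_congr ht ((h2.lt h).trans hk) hk).1 h2, (isLoad_congr ht hk').1 h3,
      (isUpd_congr ht hk).1 h4, h5⟩)))
  · refine .inr (.inr (.inr (.inr (.inl ?_))))
    rcases he with ⟨s, u', h1, h2, h3⟩ | ⟨p, x, h1, h2, ⟨q, h3⟩, h4⟩
    · have hu' := h3.lt.trans hk'
      exact .inl ⟨s, u', readsFrom_congr h ht hk h1,
        (storeUpd_congr ht ((h2.lt h).trans hu') hu').1 h2, (nextUpd_congr ht hk').1 h3⟩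
    · exact .inr ⟨p, x, (fromMemory_congr ht hk).1 h1,
        fun v r h5 => (isUpd_congr ht (h5.trans hk)).not.1 (h2 v r h5),
        ⟨q, (isUpd_congr ht hk').1 h3⟩,
        fun v r h5 => (isUpd_congr ht (h5.trans hk')).not.1 (h4 v r h5)⟩
  · obtain ⟨p, b, h1, h2, h3, h4⟩ := he
    refine .inr (.inr (.inr (.inr (.inr ⟨p, b, (isFence_congr ht hk').1 h1, ?_, h3, ?_⟩))))
    · rwa [← getElem?_congr ht hk]
    · intro v h5 h6
      rw [← getElem?_congr ht (h6.trans hk')]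
      exact h4 v h5 h6

theorem transGen_congr {n : ℕ} (h : IsExec P M τ) (ht : τ.take n = τ'.take n) {k k' : ℕ}
    (hk' : k' < n) (hk : Relation.TransGen (ChronEdge P M τ) k k') :
    Relation.TransGen (ChronEdge P M τ') k k' := by
  induction hk with
  | single he => exact .single (chronEdge_congr h ht hk' he)
  | tail _ he ih => exact (ih ((he.lt h).1.trans hk')).tail (chronEdge_congr h ht hk' he)

theorem chronHB_append {E w : List (Thread T Loc)} {a b : Thread T Loc × ℕ}
    (h : IsExec P M (E ++ w)) (ha : a ∈ events E) (hb : b ∈ events E) :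
    chronHB P M (E ++ w) a b ↔ chronHB P M E a b := by
  have hE := isExec_prefix h
  have ht : (E ++ w).take E.length = E.take E.length := by simp
  rw [chronHB_iff_pos h, chronHB_iff_pos hE]
  obtain ⟨k, hk⟩ := mem_events_iff_namedAt.1 ha
  obtain ⟨l, hl⟩ := mem_events_iff_namedAt.1 hb
  constructor
  · rintro ⟨k', l', h1, h2, h3⟩
    obtain rfl := h1.unique ((namedAt_append hk.lt_length).2 hk)
    obtain rfl := h2.unique ((namedAt_append hl.lt_length).2 hl)
    exact ⟨_, _, hk, hl, transGen_congr h ht hl.lt_length h3⟩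
  · rintro ⟨k', l', h1, h2, h3⟩
    exact ⟨k', l', (namedAt_append h1.lt_length).2 h1, (namedAt_append h2.lt_length).2 h2,
      transGen_congr hE ht.symm h2.lt_length h3⟩

theorem chronHB_mem {a b : Thread T Loc × ℕ} (h : chronHB P M τ a b) :
    a ∈ events τ ∧ b ∈ events τ := by
  obtain ⟨e, e', rfl, rfl, h1⟩ := h
  obtain ⟨k, k', h2, h3, -⟩ := exists_pos_of_transGen h1
  exact ⟨mem_events_iff_namedAt.2 ⟨k, h2.namedAt⟩, mem_events_iff_namedAt.2 ⟨k', h3.namedAt⟩⟩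

theorem chronHB_lt (h : IsExec P M τ) {a b : Thread T Loc × ℕ} (hab : chronHB P M τ a b)
    {k l : ℕ} (ha : NamedAt τ k a) (hb : NamedAt τ l b) : k < l := by
  obtain ⟨k', l', h1, h2, h3⟩ := (chronHB_iff_pos h).1 hab
  obtain rfl := h1.unique ha
  obtain rfl := h2.unique hb
  exact (ChronEdge.transGen_lt h h3).1

theorem chronHB_order (h : IsExec P M τ) :
    (events τ).Pairwise (fun a b => ¬ chronHB P M τ b a) := by
  rw [List.pairwise_iff_getElem]
  intro i j hi hj hij hb
  have := chronHB_lt h hb (namedAt_iff.2 (List.getElem?_eq_getElem hj))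
    (namedAt_iff.2 (List.getElem?_eq_getElem hi))
  omega

theorem chronHB_thread (h : IsExec P M τ) {p : Thread T Loc} {i j : ℕ}
    (hi : (p, i) ∈ events τ) (hj : (p, j) ∈ events τ) (hij : i < j) :
    chronHB P M τ (p, i) (p, j) := by
  induction j with
  | zero => omega
  | succ j ih =>
    have hmem : (p, j) ∈ events τ := by
      rw [mem_events] at hi hj ⊢
      obtain ⟨h1, -⟩ := hi
      obtain ⟨-, h2⟩ := hj
      simp only at h1 h2
      exact ⟨by simp only; omega, by simp only; omega⟩
    obtain ⟨k, hk⟩ := mem_events_iff_namedAt.1 hmem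
    obtain ⟨l, hl⟩ := mem_events_iff_namedAt.1 hj
    have hedge : chronHB P M τ (p, j) (p, j + 1) := by
      refine ChronEdge.hb h (.inl ⟨p, hk.1, hl.1, ?_⟩) hk hl
      have h1 := hk.2
      have h2 := hl.2
      simp only at h1 h2
      omega
    rcases Nat.lt_succ_iff_lt_or_eq.1 hij with h1 | rfl
    · exact chronHB_trans (ih hmem h1) hedge
    · exact hedge

theorem loadsMem_step {c c' : Conf T Loc Reg Val} {p r : Thread T Loc} {x : Loc}
    (h : LoadsMem P M c r x) (hs : step P M c p = some c') (hpr : p ≠ r) : LoadsMem P M c' r x := by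
  obtain ⟨a, g, rfl, h1, h2⟩ := h
  refine ⟨a, g, rfl, by rw [(step_pc_of_ne hs hpr).1]; exact h1, ?_⟩
  by_cases hp : p = .upd a (M.buf x)
  · subst hp
    obtain ⟨y, v, B, hB, rfl⟩ := step_upd_iff.1 hs
    rw [hB, latest_eq_none_iff] at h2
    simp only [assign_self]
    exact latest_eq_none_iff.2 fun e he => h2 e (List.mem_cons_of_mem _ he)
  · rwa [step_buf_of_ne hs hpr hp]

/-- An edge between consecutive events cannot be removed by inserting an event between them,
provided that the second event does not need the first one. -/
theorem chronEdge_insert {E : List (Thread T Loc)} {x p r : Thread T Loc}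
    (h : IsExec P M (E ++ [x, p, r])) (h' : IsExec P M (E ++ [r])) (hxp : x ≠ p) (hxr : x ≠ r)
    (hpr : p ≠ r) (h1 : IsExec P M (E ++ [x, r]))
    (he : ChronEdge P M (E ++ [x, r]) E.length (E.length + 1)) :
    ChronEdge P M (E ++ [x, p, r]) E.length (E.length + 1) ∨
      ChronEdge P M (E ++ [x, p, r]) E.length (E.length + 2) := by
  obtain ⟨c, c₁, hc, hc1, hc1'⟩ := exists_step h (k := E.length) (r := x) (by simp)
  obtain ⟨d₁, c₂, hd1, hc2, hc2'⟩ := exists_step h (k := E.length + 1) (r := p) (by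
    rw [List.getElem?_append_right (by omega)]
    simp)
  rw [hc1'] at hd1
  cases hd1
  have g1 : (E ++ [x, p, r])[E.length]? = some x := by simp
  have g3 : (E ++ [x, p, r])[E.length + 2]? = some r := by
    rw [List.getElem?_append_right (by omega)]
    simp
  obtain ⟨d₂, c₃, hd2, hc3, -⟩ := exists_step h g3
  rw [hc2'] at hd2
  cases hd2
  have f1 : (E ++ [x, r])[E.length]? = some x := by simp
  have f2 : (E ++ [x, r])[E.length + 1]? = some r := by
    rw [List.getElem?_append_right (by omega)]
    simp
  have ht : (E ++ [x, r]).take (E.length + 1) = (E ++ [x, p, r]).take (E.length + 1) := by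
    simp [List.take_append]
  have hrun1 : run P M ((E ++ [x, r]).take (E.length + 1)) = some c₁ := by rw [ht, hc1']
  obtain ⟨d₁, c₄, hd1, hc4, -⟩ := exists_step h1 f2
  rw [hrun1] at hd1
  cases hd1
  have hact : nextAct P c₂ r = nextAct P c₁ r := nextAct_step hc2 hc4 hpr
  have hcE : run P M E = some c := by simpa using hc
  have hc' : ∃ c₅, step P M c r = some c₅ := by
    obtain ⟨c₅, h2⟩ := isExec_iff.1 h'
    rw [run_concat, hcE] at h2
    exact ⟨c₅, h2⟩
  obtain ⟨c₅, hc5⟩ := hc'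
  have hn : E.length < E.length + 1 := by omega
  have hupd : ∀ a y, IsUpd P M (E ++ [x, r]) (E.length + 1) a y →
      ∃ a', IsUpd P M (E ++ [x, p, r]) (E.length + 2) a' y := fun a y hu =>
    isUpd_of_nextAct h hc2' g3 (hact.trans (nextAct_of_isUpd hrun1 f2 hu))
  rcases he with he | he | he | he | he | he
  · obtain ⟨q, h2, h3, -⟩ := he
    rw [f1] at h2
    rw [f2] at h3
    exact absurd (Option.some.inj (h2.trans h3.symm)) hxr
  -- The update `r` is enabled before `x`, so its buffer is nonempty then, and the entry it moves is
  -- older than the store `x`.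
  · exfalso
    obtain ⟨a, y, h2, h3, h4⟩ := he
    have hr : r = .upd a (M.buf y) := by
      have := h3.1
      rw [f2] at this
      simpa using this
    subst hr
    have h5 := isSome_step_upd.1 (Option.isSome_iff_exists.2 ⟨c₅, hc5⟩)
    have h6 := (buffer_spec_take (τ := E ++ [x, .upd a (M.buf y)]) (k := E.length) (by simp)
      (by simpa using hcE) a (M.buf y)).1
    have h7 := List.length_pos_of_ne_nil h5
    have h8 : storeCount P M (E ++ [x, .upd a (M.buf y)]) E.length a (M.buf y) =
      occ ((E ++ [x, .upd a (M.buf y)]).take (E.length + 1)) (.upd a (M.buf y)) := h4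
    rcases occ_take_succ (E ++ [x, Thread.upd a (M.buf y)]) E.length
      (Thread.upd a (M.buf y)) with ⟨h9, -⟩ | ⟨-, h9⟩
    · rw [f1] at h9
      exact hxr (by simpa using h9)
    · omega
  · obtain ⟨y, ⟨a, h2⟩, ⟨b, h3⟩, -⟩ := he
    have h4 := (isUpd_congr ht hn).1 h2
    obtain ⟨b', h5⟩ := hupd b y h3
    by_cases h6 : ∃ b, IsUpd P M (E ++ [x, p, r]) (E.length + 1) b y
    · exact .inl (.inr (.inr (.inl ⟨y, ⟨a, h4⟩, h6, hn, fun v q h7 h8 => by omega⟩)))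
    · refine .inr (.inr (.inr (.inl ⟨y, ⟨a, h4⟩, ⟨b', h5⟩, by omega, fun v q h7 h8 h9 => ?_⟩)))
      obtain rfl : v = E.length + 1 := by omega
      exact h6 ⟨q, h9⟩
  · obtain ⟨a, q, y, h2, h3, h4, -, -⟩ := he.fromMemory
    have h5 := (isUpd_congr ht hn).1 h3
    by_cases h6 : ∃ b, IsUpd P M (E ++ [x, p, r]) (E.length + 1) b y
    · exact .inl (.inr (.inr (.inl ⟨y, ⟨q, h5⟩, h6, hn, fun v q h7 h8 => by omega⟩)))
    · obtain ⟨a', h7⟩ := (fromMemory_iff_loadsMem hc2' g3).2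
        (loadsMem_step ((fromMemory_iff_loadsMem hrun1 f2).1 ⟨a, h2⟩) hc2 hpr)
      obtain rfl : a = a' := by
        have h8 := h2.1.1
        have h9 := h7.1.1
        rw [f2] at h8
        rw [g3] at h9
        simpa using h8.symm.trans h9
      refine .inr (.inr (.inr (.inr (.inl (srcCT_of_fromMemory h h7 h5 h4 (by omega)
        fun v q h8 h9 h10 => ?_)))))
      obtain rfl : v = E.length + 1 := by omega
      exact h6 ⟨q, h10⟩
  · rcases (Overwrites.cases h1 he).2 with ⟨a, q, y, h2, h3⟩ | ⟨u', h2, h3⟩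
    · have h4 := (fromMemory_congr ht hn).1 h2
      obtain ⟨b', h5⟩ := hupd q y h3
      by_cases h6 : ∃ b, IsUpd P M (E ++ [x, p, r]) (E.length + 1) b y
      · obtain ⟨b, h6⟩ := h6
        exact .inl (.inr (.inr (.inr (.inr (.inl (overwrites_of_fromMemory h h4 h6 hn
          fun v q h7 h8 => by omega))))))
      · refine .inr (.inr (.inr (.inr (.inr (.inl (overwrites_of_fromMemory h h4 h5 (by omega)
          fun v q h7 h8 h9 => ?_))))))
        obtain rfl : v = E.length + 1 := by omega
        exact h6 ⟨q, h9⟩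
    · omega
  -- The fence is enabled before `x`, so its buffers are empty then and `x` has nothing to move.
  · exfalso
    obtain ⟨a, b, h2, h3, -⟩ := he
    have hx : x = .upd a b := by
      rw [f1] at h3
      simpa using h3
    obtain ⟨h4, h5⟩ := (isFence_iff hrun1).1 h2
    have hr : r = .reg a := by
      rw [f2] at h4
      simpa using h4
    subst hx hr
    rw [(step_pc_of_ne hc1 hxr).1] at h5
    obtain ⟨i, h6, h7⟩ := isSome_step_reg.1 (Option.isSome_iff_exists.2 ⟨c₅, hc5⟩)
    have h8 := isSome_step_upd.1 (Option.isSome_iff_exists.2 ⟨c₁, hc1⟩)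
    rw [h5] at h6
    exact h8 (h7 (by simpa using h6.symm) b)

end Happens

end RelaxedDPOR

namespace RelaxedDPOR

/-! ### The chronological happens-before relation satisfies the axioms -/

section ChronSystem

variable {T Loc Reg Val Op : Type*} {P : Program T Loc Reg Val Op} {M : MemModel}
  {τ τ' : List (Thread T Loc)}

theorem namedAt_length_succ {α : Type*} (A B : List α) (p q : α) :
    NamedAt (A ++ p :: q :: B) (A.length + 1) (nextEv (A ++ [p]) q) := by
  have := namedAt_length (A ++ [p]) B q
  simpa using this

theorem isExec_concat_iff {c : Conf T Loc Reg Val} (hc : run P M τ = some c) (r : Thread T Loc) :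
    IsExec P M (τ ++ [r]) ↔ (step P M c r).isSome := by
  rw [IsExec, run_concat, hc, Option.bind_some]

theorem isExec_swap {E : List (Thread T Loc)} {p q : Thread T Loc} (hpq : p ≠ q)
    (hp : IsExec P M (E ++ [p])) (hq : IsExec P M (E ++ [q])) : IsExec P M (E ++ [p, q]) := by
  obtain ⟨c, hc⟩ := isExec_iff.1 (isExec_prefix hp)
  obtain ⟨c₁, h1⟩ := Option.isSome_iff_exists.1 ((isExec_concat_iff hc p).1 hp)
  obtain ⟨c₂, h2⟩ := Option.isSome_iff_exists.1 ((isExec_concat_iff hc q).1 hq)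
  have hc1 : run P M (E ++ [p]) = some c₁ := by rw [run_concat, hc]; exact h1
  have := (isExec_concat_iff hc1 q).2 (isSome_step_step h1 h2 hpq)
  simpa using this

theorem not_chronEdge_of_not_chronHB {A B : List (Thread T Loc)} {p q : Thread T Loc}
    (h : IsExec P M (A ++ p :: q :: B)) (hpq : p ≠ q)
    (hn : ¬ chronHB P M (A ++ [p, q]) (nextEv A p) (nextEv A q)) :
    ¬ ChronEdge P M (A ++ [p, q]) A.length (A.length + 1) := by
  intro he
  have h1 := namedAt_length_succ A [] p q
  rw [nextEv_append_singleton_of_ne hpq.symm] at h1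
  exact hn (he.hb (isExec_prefix (w := B) (by simpa using h)) (namedAt_length A [q] p) h1)

/-- The only enablings are that a store fills an empty buffer and that an update empties the last
buffer before a fence. While neither of the two threads runs, the state of the buffer, and with it
the obstacle, remains. -/
theorem not_isExec_of_notMem {E X : List (Thread T Loc)} {q r : Thread T Loc} (hqr : q ≠ r)
    (hr : ¬ IsExec P M (E ++ [r])) (h : IsExec P M (E ++ [q, r])) (hq : q ∉ X) (hrX : r ∉ X) :
    ¬ IsExec P M (E ++ X ++ [r]) := by
  intro hX
  obtain ⟨c, hc⟩ := isExec_iff.1 (isExec_prefix h)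
  have hEq : IsExec P M (E ++ [q]) := isExec_prefix (w := [r]) (by simpa using h)
  obtain ⟨c₁, h1⟩ := Option.isSome_iff_exists.1 ((isExec_concat_iff hc q).1 hEq)
  have hc1 : run P M (E ++ [q]) = some c₁ := by rw [run_concat, hc]; exact h1
  obtain ⟨c₂, h2⟩ := Option.isSome_iff_exists.1 ((isExec_concat_iff hc1 r).1 (by simpa using h))
  obtain ⟨d, hd⟩ := isExec_iff.1 (isExec_prefix hX)
  rw [isExec_concat_iff hd] at hX
  rw [isExec_concat_iff hc] at hr
  rw [run_append, hc, Option.bind_some] at hd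
  rcases step_enabled_cases h1 h2 hqr hr with ⟨a, b, rfl, rfl, h3⟩ | ⟨a, b, rfl, rfl, h3, h4⟩
  · rw [isSome_step_upd, (run_buf_of_notMem hd hq hrX).1] at hX
    exact hX h3
  · obtain ⟨h5, h6⟩ := run_buf_of_notMem hd hrX hq
    obtain ⟨i, h7, h8⟩ := isSome_step_reg.1 hX
    rw [h6, h4] at h7
    obtain rfl := Option.some.inj h7
    exact h3 (h5 ▸ h8 rfl b)

/-- After `E.x.r` a chain of edges from `x` to `r` is a single edge, as the two events are adjacent;
`chronEdge_insert` turns it into an edge from `x` in `E.x.p.r`. -/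
theorem chronSystem_indep_remove {E : List (Thread T Loc)} {x p r : Thread T Loc} (hpr : p ≠ r)
    (h : (chronSystem P M).Indep E x [p, r]) (hr : IsExec P M (E ++ [r])) :
    (chronSystem P M).Indep E x [r] := by
  obtain ⟨h1, h2⟩ := h
  replace h1 : IsExec P M (E ++ [x, p, r]) := h1
  replace h2 : ∀ e ∈ domAfter (E ++ [x]) [p, r],
    ¬ chronHB P M (E ++ [x, p, r]) (nextEv E x) e := h2
  have hne : ∀ q ∈ [p, r], x ≠ q := by
    rintro q hq rfl
    have hmem := nextEv_mem_eventsFrom (E := E ++ [x]) hq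
    refine h2 _ (mem_domAfter.2 hmem) (chronHB_thread h1 ?_ ?_ ?_)
    · rw [show E ++ [x, p, r] = E ++ [x] ++ [p, r] by simp, events_append, events_concat]
      simp [nextEv]
    · rw [show E ++ [x, p, r] = E ++ [x] ++ [p, r] by simp, events_append]
      exact List.mem_append_right _ hmem
    · simp
  have hxp := hne p (by simp)
  have hxr := hne r (by simp)
  have hx : IsExec P M (E ++ [x]) := isExec_prefix (w := [p, r]) (by simpa using h1)
  have hxr' := isExec_swap hxr hx hr
  refine ⟨hxr', fun e he hhb => ?_⟩
  rw [mem_domAfter] at he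
  obtain rfl : e = nextEv (E ++ [x]) r := by simpa using he
  obtain ⟨k, k', h3, h4, h5⟩ := (chronHB_iff_pos hxr').1 hhb
  obtain rfl := h3.unique (namedAt_length E [r] x)
  obtain rfl := h4.unique (namedAt_length_succ E [] x r)
  have h6 : ChronEdge P M (E ++ [x, r]) E.length (E.length + 1) := by
    rcases Relation.TransGen.tail'_iff.1 h5 with ⟨m, h6, h7⟩
    rcases Relation.reflTransGen_iff_eq_or_transGen.1 h6 with rfl | h8
    · exact h7
    · have := ChronEdge.transGen_lt hxr' h8
      have := (h7.lt hxr').1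
      omega
  rcases chronEdge_insert h1 hr hxp hxr hpr hxr' h6 with h7 | h7
  · refine h2 (nextEv (E ++ [x]) p) ?_ (h7.hb h1 (namedAt_length E [p, r] x)
      (namedAt_length_succ E [r] x p))
    exact mem_domAfter.2 (nextEv_mem_eventsFrom (by simp))
  · have h8 := namedAt_length (E ++ [x, p]) [] r
    rw [show E ++ [x, p] ++ [r] = E ++ [x, p, r] by simp,
      show (E ++ [x, p]).length = E.length + 2 by simp,
      show E ++ [x, p] = E ++ [x] ++ [p] by simp, nextEv_append_singleton_of_ne hpr.symm] at h8
    refine h2 (nextEv (E ++ [x]) r) ?_ (h7.hb h1 (namedAt_length E [p, r] x) h8)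
    exact mem_domAfter.2 (nextEv_mem_eventsFrom (by simp))

/-- There may be infinitely many locations, hence auxiliary threads. An enabled one has a nonempty
buffer, whose oldest entry stems from one of the finitely many stores of `E`. -/
theorem finite_enabled [Finite T] (E : List (Thread T Loc)) :
    {r | IsExec P M (E ++ [r])}.Finite := by
  by_cases hE : IsExec P M E
  · obtain ⟨c, hc⟩ := isExec_iff.1 hE
    refine ((Set.finite_range Thread.reg).union (Set.Finite.biUnion (Set.finite_Iio E.length)
      (t := fun s => {r | ∃ a x, IsStore P M E s a x ∧ r = .upd a (M.buf x)})
      fun s _ => ?_)).subset ?_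
    · refine Set.Subsingleton.finite ?_
      rintro _ ⟨a, x, h1, rfl⟩ _ ⟨a', x', h2, rfl⟩
      obtain ⟨rfl, rfl⟩ := h1.unique h2
      rfl
    · intro r hr
      rw [Set.mem_ofPred_eq, isExec_concat_iff hc] at hr
      cases r with
      | reg a => exact .inl ⟨a, rfl⟩
      | upd a b =>
        right
        rw [isSome_step_upd] at hr
        obtain ⟨e, B, hB⟩ := List.exists_cons_of_ne_nil hr
        obtain ⟨s, hs, h1, h2, -⟩ := (buffer_spec hc a b).2 0 e (by simp [hB])
        simp only [Set.mem_iUnion]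
        exact ⟨s, hs, a, e.1, h1, by rw [h2]⟩
  · convert Set.finite_empty
    exact Set.eq_empty_of_forall_notMem fun r hr => hE (isExec_prefix hr)

theorem chronSystem_valid [Finite T] : (chronSystem P M).Valid where
  exec_nil := isExec_iff.2 ⟨initConf P, rfl⟩
  exec_prefix _ _ h := isExec_prefix h
  hb_mem _ _ _ _ h := chronHB_mem h
  hb_trans _ _ _ _ h h' := chronHB_trans h h'
  hb_irrefl E a hE h := by
    obtain ⟨k, hk⟩ := mem_events_iff_namedAt.1 (chronHB_mem h).1
    exact lt_irrefl _ (chronHB_lt hE h hk hk)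
  hb_order _ h := chronHB_order h
  hb_thread _ _ _ _ h hi hj hij := chronHB_thread h hi hj hij
  hb_prefix _ _ _ _ h ha hb := chronHB_append h ha hb
  swap A p q B h hpq hn := by
    have := similar_exchange h hpq (not_chronEdge_of_not_chronHB h hpq hn)
    exact ⟨this.exec_right, this.chronHB_iff⟩
  not_disable _ _ _ hpq hp hq := isExec_swap hpq hp hq
  enable _ _ _ _ hqr hr h hq hrX := not_isExec_of_notMem hqr hr h hq hrX
  remove _ _ _ _ hpr h hr := chronSystem_indep_remove hpr h hr
  finite_enabled E := finite_enabled E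

end ChronSystem

end RelaxedDPOR

namespace RelaxedDPOR

section ShashaSnir

variable {T Loc Reg Val Op : Type*} {P : Program T Loc Reg Val Op} {M : MemModel}
  {τ τ' : List (Thread T Loc)}

/-! ### Maximal executions -/

theorem isMaximal_iff :
    IsMaximal P M τ ↔ (chronSystem P M).isExec τ ∧ (chronSystem P M).enabled τ = ∅ := by
  rw [Set.eq_empty_iff_forall_notMem]
  rfl

theorem IsMaximal.isCompleted (h : IsMaximal P M τ) : IsCompleted P M τ := by
  refine ⟨h.1, fun s p x hs => ?_⟩
  obtain ⟨c, hc⟩ := isExec_iff.1 h.1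
  have hb : (c.loc p).buf (M.buf x) = [] := by
    by_contra hne
    exact h.2 (.upd p (M.buf x)) ((isExec_concat_iff hc _).2 (isSome_step_upd.2 hne))
  have h1 := (buffer_spec hc p (M.buf x)).1
  rw [hb, List.length_nil, Nat.add_zero] at h1
  have h2 := storeCount_lt hs hs.lt_length
  obtain ⟨u, -, hu⟩ := (exists_storeUpd_iff h.1 hs (k := τ.length)).2 (by
    rwa [List.take_length, ← h1])
  exact ⟨u, hu⟩

/-- An entry left in a buffer at the end would stem from a store without update. -/
theorem IsCompleted.storeCount_eq (h : IsCompleted P M τ) (p : T) (b : Option Loc) :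
    storeCount P M τ τ.length p b = occ τ (.upd p b) := by
  obtain ⟨c, hc⟩ := isExec_iff.1 h.1
  obtain ⟨h1, h2⟩ := buffer_spec hc p b
  cases hb : (c.loc p).buf b with
  | nil => rw [h1, hb, List.length_nil, Nat.add_zero]
  | cons e B =>
    obtain ⟨s, -, h3, rfl, h4⟩ := h2 0 e (by simp [hb])
    obtain ⟨u, hu⟩ := h.2 s p e.1 h3
    have h5 := (exists_storeUpd_iff h.1 h3).1
      ⟨u, lt_length_of_getElem? (hu.isUpd h3).1, hu⟩
    rw [List.take_length] at h5
    omega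

/-! ### The Shasha-Snir trace determines the chronological trace -/

theorem PO.right_unique {k l l' : ℕ} (h : PO τ k l) (h' : PO τ k l') : l = l' := by
  obtain ⟨p, h1, h2, h3⟩ := h
  obtain ⟨q, h4, h5, h6⟩ := h'
  obtain rfl : p = q := by simpa [h1] using h4
  exact occ_take_inj h2 h5 (h3.trans h6.symm)

theorem PO.left_unique {k k' l : ℕ} (h : PO τ k l) (h' : PO τ k' l) : k = k' := by
  obtain ⟨p, h1, h2, h3⟩ := h
  obtain ⟨q, h4, h5, h6⟩ := h'
  obtain rfl : p = q := by simpa [h2] using h5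
  exact occ_take_inj h1 h4 (by omega)

theorem StoreOrder.right_unique {s t t' : ℕ} (h : StoreOrder P M τ s t)
    (h' : StoreOrder P M τ s t') : t = t' := by
  obtain ⟨u, v, h1, h2, h3⟩ := h
  obtain ⟨u', v', h4, h5, h6⟩ := h'
  obtain rfl := h1.right_unique h4
  obtain rfl := h3.right_unique h6
  exact h2.left_unique h5

theorem Overwrites.isLoad {k u : ℕ} (h : Overwrites P M τ k u) : ∃ p x, IsLoad P M τ k p x := by
  obtain ⟨s, u', h1, -⟩ | ⟨p, x, h1, -⟩ := h
  · obtain ⟨p, x, h2, -⟩ := h1.isLoad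
    exact ⟨p, x, h2⟩
  · exact ⟨p, x, h1.1⟩

/-- The edges of a Shasha-Snir trace carry no labels; the kind of their endpoints excludes some of
the possibilities. -/
theorem SSEdge.of_isStore {s k : ℕ} {p : T} {x : Loc} (h : SSEdge P M τ s k)
    (hs : IsStore P M τ s p x) : PO τ s k ∨ StoreOrder P M τ s k ∨ ReadsFrom P M τ k s := by
  obtain h | h | h | ⟨u, h, -⟩ := h
  · exact .inl h
  · exact .inr (.inl h)
  · exact .inr (.inr h)
  · obtain ⟨q, y, h⟩ := h.isLoad
    exact absurd hs h.not_isStore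

theorem exists_act_eq_instr (h : IsExec P M τ) {k : ℕ} {p : T} (hk : τ[k]? = some (.reg p)) :
    ∃ i, IsEventAt P M τ k ⟨.reg p, .instr i, occ (τ.take k) (.reg p) + 1⟩ := by
  obtain ⟨c, c', hc, hs, -⟩ := exists_step h hk
  obtain ⟨i, hi, -⟩ := isSome_step_reg.1 (Option.isSome_iff_exists.2 ⟨c', hs⟩)
  exact ⟨i, hk, by simp [actAt_eq hc hk, nextAct, hi], rfl⟩

theorem exists_match_of_ssTrace_eq (h : IsExec P M τ) (he : ssTrace P M τ = ssTrace P M τ')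
    {k : ℕ} {p : T} (hk : τ[k]? = some (.reg p)) :
    ∃ k', Match τ τ' k k' ∧ actAt P M τ k = actAt P M τ' k' := by
  obtain ⟨i, hi⟩ := exists_act_eq_instr h hk
  have hmem : (⟨.reg p, .instr i, occ (τ.take k) (.reg p) + 1⟩ : Event T Loc Reg Op) ∈
      (ssTrace P M τ).verts := ⟨⟨k, hi⟩, by simp⟩
  rw [he] at hmem
  obtain ⟨⟨k', h1, h2, h3⟩, -⟩ := hmem
  exact ⟨k', ⟨.reg p, hk, h1, by simpa using h3⟩, hi.2.1.trans h2.symm⟩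

/-- Events of regular threads are vertices of the trace. Updates are not, but in a completed
execution they are as many as the stores into the buffer. -/
theorem occ_le_of_ssTrace_eq (h : IsCompleted P M τ) (h' : IsCompleted P M τ')
    (he : ssTrace P M τ = ssTrace P M τ') (r : Thread T Loc) : occ τ r ≤ occ τ' r := by
  cases r with
  | reg p =>
    by_contra hlt
    rw [not_le, ← List.take_length (l := τ)] at hlt
    obtain ⟨k, -, h1, h2⟩ := exists_of_lt_occ hlt
    obtain ⟨k', hm, -⟩ := exists_match_of_ssTrace_eq h.1 he h1
    obtain ⟨h3, h4⟩ := hm.getElem? h1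
    have h5 := occ_take_lt h3 (lt_length_of_getElem? h3)
    rw [List.take_length] at h5
    omega
  | upd p b =>
    rw [← h.storeCount_eq, ← h'.storeCount_eq]
    refine storeCount_le fun l _ y _ hl => ?_
    obtain ⟨l', hm, ha⟩ := exists_match_of_ssTrace_eq h.1 he hl.1
    obtain ⟨h3, h4⟩ := hm.getElem? hl.1
    obtain ⟨r, hr⟩ := hl.2
    exact ⟨l', lt_length_of_getElem? h3, ⟨h3, r, ha ▸ hr⟩, h4⟩

theorem sameActs_of_ssTrace_eq (h : IsCompleted P M τ) (h' : IsCompleted P M τ')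
    (he : ssTrace P M τ = ssTrace P M τ') : SameActs P M τ τ' := by
  refine ⟨h.1, h'.1, perm_iff_occ.2 fun r => (occ_le_of_ssTrace_eq h h' he r).antisymm
    (occ_le_of_ssTrace_eq h' h he.symm r), fun k k' p hm hk => ?_⟩
  obtain ⟨l, hm', ha⟩ := exists_match_of_ssTrace_eq h.1 he hk
  obtain rfl := hm.unique hm'
  exact ha

namespace SameActs

variable (h : SameActs P M τ τ') (he : ssTrace P M τ = ssTrace P M τ')

include h he

theorem ssEdge {k k' l l' : ℕ} {p q : T} (hk : Match τ τ' k k') (hl : Match τ τ' l l')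
    (hp : τ[k]? = some (.reg p)) (hq : τ[l]? = some (.reg q)) (hkl : SSEdge P M τ k l) :
    SSEdge P M τ' k' l' := by
  obtain ⟨i, hi⟩ := exists_act_eq_instr h.exec_left hp
  obtain ⟨j, hj⟩ := exists_act_eq_instr h.exec_left hq
  have hmem : ((⟨.reg p, .instr i, occ (τ.take k) (.reg p) + 1⟩,
      ⟨.reg q, .instr j, occ (τ.take l) (.reg q) + 1⟩) :
        Event T Loc Reg Op × Event T Loc Reg Op) ∈ (ssTrace P M τ).edges :=
    ⟨by simp, by simp, k, l, hi, hj, hkl⟩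
  rw [he] at hmem
  obtain ⟨-, -, m, n, h1, h2, h3⟩ := hmem
  obtain rfl := (h1.unique (h.isEventAt hk hi) rfl).2
  obtain rfl := (h2.unique (h.isEventAt hl hj) rfl).2
  exact h3

/-- The edge from `s` to `t` might come from program order in the other execution. Then both stores
belong to one thread and location, so by FIFO order `s` has a successor in store order there, and
the edge to this successor exists in the first execution too. It starts at `s` and ends at a store,
so it comes from program order or store order, and under either its end is `t` by uniqueness of
successors. -/
theorem storeOrder {s s' t t' : ℕ} (hs : Match τ τ' s s') (ht : Match τ τ' t t')
    (hst : StoreOrder P M τ s t) : StoreOrder P M τ' s' t' := by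
  obtain ⟨u, v, ⟨p, x, h1, h2, h3⟩, ⟨q, y, h4, h5, h6⟩, h7⟩ := id hst
  obtain ⟨u', hu⟩ := exists_match h.perm (lt_length_of_getElem? h2.1)
  obtain ⟨v', hv⟩ := exists_match h.perm (lt_length_of_getElem? h5.1)
  have hsu := h.storeUpd hs hu ⟨p, x, h1, h2, h3⟩
  have htv := h.storeUpd ht hv ⟨q, y, h4, h5, h6⟩
  obtain rfl : x = y := by
    obtain ⟨q', h8⟩ := h7.isUpd h2
    exact (h8.unique h5).2
  have hs' := h.isStore hs h1
  have ht' := h.isStore ht h4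
  rcases (h.ssEdge he hs ht h1.1 h4.1 (.inr (.inl hst))).of_isStore hs' with h8 | h8 | h8
  · have hpq : p = q := by
      obtain ⟨r, h9, h10, -⟩ := h8
      rw [hs'.1] at h9
      rw [ht'.1, ← h9] at h10
      simpa using h10.symm
    subst hpq
    obtain ⟨u₂, h9, h10⟩ := exists_storeUpd_of_lt h.exec_right hs' ht' rfl h8.lt htv
    obtain rfl := h10.right_unique hsu
    obtain ⟨w', -, ⟨r, h11⟩, h12⟩ := exists_nextUpd (hsu.isUpd hs') (htv.isUpd ht') h9
    obtain ⟨z', -, h13⟩ := exists_storeUpd_of_isUpd h.exec_right h11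
    have hz' := h13.isStore h11
    obtain ⟨z, hz⟩ := exists_match h.perm.symm hz'.lt_length
    have hso : StoreOrder P M τ' s' z' := ⟨_, w', hsu, h13, h12⟩
    have hz1 := h.symm.isStore hz hz'
    have hzt : z = t := by
      rcases (h.symm.ssEdge he.symm hs.symm hz hs'.1 hz'.1 (.inr (.inl hso))).of_isStore h1
        with h14 | h14 | h14
      · exact h14.right_unique (h8.of_match hs.symm ht.symm)
      · exact h14.right_unique hst
      · obtain ⟨a, b, h15, -⟩ := h14.isLoad
        exact absurd hz1 h15.not_isStore
    subst hzt
    obtain rfl := hz.symm.unique ht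
    exact hso
  · exact h8
  · obtain ⟨a, b, h9, -⟩ := h8.isLoad
    exact absurd ht' h9.not_isStore

/-- The only ambiguity is again program order. If the store immediately precedes the load in its own
thread, the load has some source in the other execution; the edge from that source, seen in the
first execution, comes from program order or from reading, and under either it starts at `s`. -/
theorem readsFrom {k k' s s' : ℕ} (hk : Match τ τ' k k') (hs : Match τ τ' s s')
    (hr : ReadsFrom P M τ k s) : ReadsFrom P M τ' k' s' := by
  obtain ⟨p, x, hl, q, hst⟩ := hr.isLoad
  have hl' := h.isLoad hk hl
  have hst' := h.isStore hs hst
  rcases (h.ssEdge he hs hk hst.1 hl.1 (.inr (.inr (.inl hr)))).of_isStore hst' with h1 | h1 | h1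
  · have hpq : p = q := by
      obtain ⟨r, h2, h3, -⟩ := h1
      rw [hst'.1] at h2
      rw [hl'.1, ← h2] at h3
      simpa using h3
    subst hpq
    obtain ⟨z', hz'⟩ := exists_readsFrom_of_isStore h.exec_right hl' hst' h1.lt
    obtain ⟨_, y, -, r, hz1⟩ := hz'.isLoad
    obtain ⟨z, hz⟩ := exists_match h.perm.symm hz1.lt_length
    have hz2 := h.symm.isStore hz hz1
    have hzs : z = s := by
      rcases (h.symm.ssEdge he.symm hz hk.symm hz1.1 hl'.1
        (.inr (.inr (.inl hz')))).of_isStore hz2 with h2 | h2 | h2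
      · exact h2.left_unique (h1.of_match hs.symm hk.symm)
      · obtain ⟨_, _, -, ⟨a, b, h3, -⟩, -⟩ := h2
        exact absurd h3 hl.not_isStore
      · exact h2.unique h.exec_left hr
    subst hzs
    obtain rfl := hz.symm.unique hs
    exact hz'
  · obtain ⟨_, _, -, ⟨a, b, h3, -⟩, -⟩ := h1
    exact absurd h3 hl'.not_isStore
  · exact h1

theorem nextUpd {u v u' v' : ℕ} (hu : Match τ τ' u u') (hv : Match τ τ' v v')
    (huv : NextUpd P M τ u v) : NextUpd P M τ' u' v' := by
  obtain ⟨x, ⟨p, h1⟩, ⟨q, h2⟩, -⟩ := id huv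
  obtain ⟨s, -, h3⟩ := exists_storeUpd_of_isUpd h.exec_left h1
  obtain ⟨t, -, h4⟩ := exists_storeUpd_of_isUpd h.exec_left h2
  obtain ⟨s', hs⟩ := exists_match h.perm (h3.isStore h1).lt_length
  obtain ⟨t', ht⟩ := exists_match h.perm (h4.isStore h2).lt_length
  obtain ⟨w, z, h5, h6, h7⟩ := h.storeOrder he hs ht ⟨u, v, h3, h4, huv⟩
  obtain rfl := h5.right_unique (h.storeUpd hs hu h3)
  obtain rfl := h6.right_unique (h.storeUpd ht hv h4)
  exact h7

theorem similar : Similar P M τ τ' :=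
  ⟨h, fun _ _ _ _ hu hv => ⟨h.nextUpd he hu hv, h.symm.nextUpd he.symm hu.symm hv.symm⟩,
    fun _ _ _ _ hk hs => ⟨h.readsFrom he hk hs, h.symm.readsFrom he.symm hk.symm hs.symm⟩⟩

end SameActs

/-- Each exchange of independent neighbours yields a similar execution, and similarity preserves
both kinds of trace. -/
theorem ssTrace_eq_of_swaps (h : Relation.ReflTransGen (chronSystem P M).Swap τ τ') :
    ssTrace P M τ = ssTrace P M τ' := by
  induction h with
  | refl => rfl
  | tail _ h ih =>
    obtain ⟨A, p, q, B, rfl, rfl, hpq, he, hn⟩ := h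
    exact ih.trans (similar_exchange he hpq (not_chronEdge_of_not_chronHB he hpq hn)).ssTrace_eq

/-- Completed executions have the same Shasha-Snir trace if and only if they have the same
happens-before relation. -/
theorem ssTrace_eq_iff_equiv [Finite T] (h : IsCompleted P M τ) (h' : IsCompleted P M τ') :
    ssTrace P M τ = ssTrace P M τ' ↔ (chronSystem P M).Equiv τ τ' := by
  refine ⟨fun he => ((sameActs_of_ssTrace_eq h h' he).similar he).equiv, fun he => ?_⟩
  have := chronSystem_valid.swaps_of_equiv (w := []) he (by
    rw [List.append_nil]
    exact h.1)
  simp only [List.append_nil] at this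
  exact ssTrace_eq_of_swaps this

end ShashaSnir

end RelaxedDPOR

theorem theorem2 {T Loc Reg Val Op : Type*} [Finite T]
    (P : RelaxedDPOR.Program T Loc Reg Val Op) (M : RelaxedDPOR.MemModel)
    (hbound : ∃ N : ℕ, ∀ τ, RelaxedDPOR.IsExec P M τ → τ.length ≤ N) :
    (RelaxedDPOR.Terminates (RelaxedDPOR.SourceStep (RelaxedDPOR.chronSystem P M))
        RelaxedDPOR.SourceState.init ∧
      ∀ s, RelaxedDPOR.Outcome (RelaxedDPOR.SourceStep (RelaxedDPOR.chronSystem P M))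
          RelaxedDPOR.SourceState.init s →
        s.Finished ∧
        (∀ τ ∈ s.log, RelaxedDPOR.IsMaximal P M τ ∧ RelaxedDPOR.IsCompleted P M τ) ∧
        ∀ τ, RelaxedDPOR.IsMaximal P M τ →
          ∃ τ' ∈ s.log, RelaxedDPOR.ssTrace P M τ' = RelaxedDPOR.ssTrace P M τ) ∧
    (RelaxedDPOR.Terminates (RelaxedDPOR.OptimalStep (RelaxedDPOR.chronSystem P M))
        RelaxedDPOR.OptimalState.init ∧
      ∀ s, RelaxedDPOR.Outcome (RelaxedDPOR.OptimalStep (RelaxedDPOR.chronSystem P M))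
          RelaxedDPOR.OptimalState.init s →
        s.Finished ∧
        (∀ τ ∈ s.log, RelaxedDPOR.IsMaximal P M τ ∧ RelaxedDPOR.IsCompleted P M τ) ∧
        ∀ τ, RelaxedDPOR.IsMaximal P M τ →
          ∃! i : Fin s.log.length,
            RelaxedDPOR.ssTrace P M (s.log.get i) = RelaxedDPOR.ssTrace P M τ) := by
  obtain ⟨N, hN⟩ := hbound
  have hS : (RelaxedDPOR.chronSystem P M).Valid := RelaxedDPOR.chronSystem_valid
  refine ⟨⟨RelaxedDPOR.source_terminates hS N hN, fun s hs => ?_⟩,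
    RelaxedDPOR.optimal_terminates hS N hN, fun s hs => ?_⟩
  · obtain ⟨h1, h2, h3⟩ := RelaxedDPOR.source_outcome hS hs
    have hmax : ∀ τ ∈ s.log, RelaxedDPOR.IsMaximal P M τ :=
      fun τ hτ => RelaxedDPOR.isMaximal_iff.2 (h2 τ hτ)
    refine ⟨h1, fun τ hτ => ⟨hmax τ hτ, (hmax τ hτ).isCompleted⟩, fun τ hτ => ?_⟩
    obtain ⟨h4, h5⟩ := RelaxedDPOR.isMaximal_iff.1 hτ
    obtain ⟨τ', h6, h7⟩ := h3 τ h4 h5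
    exact ⟨τ', h6, (RelaxedDPOR.ssTrace_eq_iff_equiv (hmax τ' h6).isCompleted
      hτ.isCompleted).2 h7⟩
  · obtain ⟨h1, h2, h3, h4⟩ := RelaxedDPOR.optimal_outcome hS N hN hs
    have hmax : ∀ τ ∈ s.log, RelaxedDPOR.IsMaximal P M τ :=
      fun τ hτ => RelaxedDPOR.isMaximal_iff.2 (h2 τ hτ)
    refine ⟨h1, fun τ hτ => ⟨hmax τ hτ, (hmax τ hτ).isCompleted⟩, fun τ hτ => ?_⟩
    obtain ⟨h5, h6⟩ := RelaxedDPOR.isMaximal_iff.1 hτ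
    obtain ⟨τ', h7, h8⟩ := h3 τ h5 h6
    obtain ⟨i, rfl⟩ := List.get_of_mem h7
    refine ⟨i, (RelaxedDPOR.ssTrace_eq_iff_equiv (hmax _ h7).isCompleted hτ.isCompleted).2 h8,
      fun j hj => ?_⟩
    -- Two positions of the log with the same Shasha-Snir trace carry equivalent executions, whereas
    -- the log is pairwise inequivalent.
    have hij : (RelaxedDPOR.chronSystem P M).Equiv (s.log.get j) (s.log.get i) :=
      ((RelaxedDPOR.ssTrace_eq_iff_equiv (hmax _ (List.get_mem _ _)).isCompleted
        hτ.isCompleted).1 hj).trans h8.symm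
    rcases lt_trichotomy j i with hlt | rfl | hlt
    · exact absurd hij (List.pairwise_iff_get.1 h4 j i hlt)
    · rfl
    · exact absurd hij.symm (List.pairwise_iff_get.1 h4 i j hlt)
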